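/- **Setting.** Let $k$ be a commutative ring, $A$ a $k$-algebra and $(U,A,\Delta,\varepsilon,s,t)$ a left bialgebroid over $A$, with $A$-actions $$a\triangleright u=s(a)u,\quad u\triangleleft a=t(a)u,\quad u\blacktriangleleft a=u\,s(a),\quad a\blacktriangleright u=u\,t(a).$$ Write $U^{\otimes_A n}$ for the tensor power formed with $\triangleright,\triangleleft$, with elements $(u^1|\dots|u^n)$, and $U^{\otimes_{A^{op}}n}$ for the one formed with $\blacktriangleright,\triangleleft$, with elements $(u^1,\dots,u^n)$; both are $A$ for $n=0$. In particular $\Delta u=u_{(1)}\otimes u_{(2)}\in U_\triangleleft\otimes_A{}_\triangleright U$. Assume that $U$ is a left and a right Hopf algebroid: the maps $${}_\blacktriangleright U\otimes_{A^{op}}U_\triangleleft\to U_\triangleleft\otimes_A{}_\triangleright U,\ u\otimes v\mapsto u_{(1)}\otimes u_{(2)}v,\qquad U_\blacktriangleleft\otimes_A{}_\triangleright U\to U_\triangleleft\otimes_A{}_\triangleright U,\ u\otimes v\mapsto u_{(1)}v\otimes u_{(2)}$$ are bijective. Let $u_+\otimes u_-$ be the preimage of $u\otimes1$ under the first, and $u_{[+]}\otimes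 u_{[-]}$ the preimage of $1\otimes u$ under the second. Let $M$ be a left $U$-module, with $am=s(a)m$ and $ma=t(a)m$. A contraaction is a $k$-linear map $\gamma:\mathrm{Hom}_{A^{op}}(U_\triangleleft,M)\to M$ with $\gamma(f(a\triangleright-))=\gamma(f)a$, with $\gamma\big(u\mapsto\gamma(g(u\otimes-))\big)=\gamma(g\circ\Delta)$ for all $g\in\mathrm{Hom}_{A^{op}}(U_\triangleleft\otimes_A{}_\triangleright U_\triangleleft,M)$, and with $\gamma(m\,\varepsilon(-))=m$ for all $m\in M$. Assume that $M$ with $\gamma$ is a stable anti Yetter–Drinfel'd (aYD) contramodule: $\gamma(m\,\varepsilon(-\blacktriangleleft a))=am$; $u\,\gamma(f)=\gamma\big(u_{+(2)}f(u_-\,-\,u_{+(1)})\big)$; and $\gamma(u\mapsto um)=m$, for all $a\in A$, $u\in U$, $m\in M$, $f\in\mathrm{Hom}_{A^{op}}(U_\triangleleft,M)$. Put $$C^n(U,M)=\mathrm{Hom}_{A^{op}}(U^{\otimes_{A^{op}}n},M),\qquad C_n(U,M)=\mathrm{Hom}_A(U^{\otimes_An},M),\qquad D_n(U,M)=\mathrm{Hom}_{A^{op}}(U^{\otimes_An},M),$$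 where linearity refers to $\triangleleft$ on the first factor, to $\triangleright$ on the first factor, and to $\triangleleft$ on the last factor, respectively. **Theorem.** (1) The following maps are well defined and make $C^\bullet(U,M)$ a cocyclic $k$-module, for $f\in C^n(U,M)$: $$(\delta_if)(u^1,\dots,u^{n+1})=\begin{cases}u^1f(u^2,\dots,u^{n+1})&i=0\\ f(u^1,\dots,u^iu^{i+1},\dots,u^{n+1})&1\le i\le n\\ f(u^1,\dots,u^{n-1},\varepsilon(u^{n+1})\blacktriangleright u^n)&i=n+1,\end{cases}$$ (for $n=0$, $(\delta_1f)(u)=f(\varepsilon(u))$ and $(\delta_0f)(u)=uf(1)$), $$(\sigma_jf)(u^1,\dots,u^{n-1})=f(u^1,\dots,u^j,1,u^{j+1},\dots,u^{n-1})\quad(0\le j\le n-1),$$ $$(\tau f)(u^1,\dots,u^n)=\gamma\big((u^1_{(2)}\cdots u^{n-1}_{(2)}u^n)_+\,f((u^1_{(2)}\cdots u^{n-1}_{(2)}u^n)_-\,-,\,u^1_{(1)},\dots,u^{n-1}_{(1)})\big)\ (n\ge1),\qquad \tau=\mathrm{id}\ (n=0).$$ (2) For every $n$ the map $$\xi:C^n(U,M)\to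 C_n(U,M),\quad(\xi g)(u^1|\dots|u^n)=u^1_+\,g(u^1_-u^2_+,\dots,u^{n-1}_-u^n_+,u^n_-)$$ (the identity on values at $1\in A$ if $n=0$) is a well-defined isomorphism of $k$-modules. (3) The cyclic dual of $C^\bullet(U,M)$ transported along $\xi$, that is, $d_0=\xi\sigma_{n-1}\tau\xi^{-1}$ and $d_i=\xi\sigma_{i-1}\xi^{-1}$ for $1\le i\le n$, $s_j=\xi\delta_j\xi^{-1}$ for $0\le j\le n$, and $t=\xi\tau^{-1}\xi^{-1}$ in degree $n$, is a cyclic $k$-module $(C_\bullet(U,M),d_\bullet,s_\bullet,t)$, and is given explicitly, for $f\in C_n(U,M)$, by $$(d_if)(u^1|\dots|u^{n-1})=\begin{cases}\gamma\big(-_{[+]}f(-_{[-]}|u^1|\dots|u^{n-1})\big)&i=0\\ f(u^1|\dots|\Delta u^i|\dots|u^{n-1})&1\le i\le n-1\\ f(u^1|\dots|u^{n-1}|1)&i=n\end{cases}\qquad(n\ge1),$$ $$(s_jf)(u^1|\dots|u^{n+1})=f(u^1|\dots|\varepsilon(u^{j+1})|\dots|u^{n+1})\quad(0\le j\le n),$$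 $$(tf)(u^1|\dots|u^n)=\gamma\Big(v\mapsto(vu^1)_{[+]}\,f\big((vu^1)_{[-]}\cdot(u^2|\dots|u^n|1)\big)\Big)\ (n\ge1),\qquad t=\mathrm{id}\ (n=0),$$ where $u\cdot(v^1|\dots|v^n)=(u_{(1)}v^1|\dots|u_{(n)}v^n)$ is the diagonal action, and where in $s_j$ the element $\varepsilon(u^{j+1})\in A$ is absorbed in the tensor product. (4) The maps, for $f\in D_n(U,M)$, $n\ge1$, $$(b_if)(u^1|\dots|u^{n-1})=\begin{cases}f(1|u^1|\dots|u^{n-1})&i=0\\ f(u^1|\dots|\Delta u^i|\dots|u^{n-1})&1\le i\le n-1\\ \gamma\big(f(u^1|\dots|u^{n-1}|-)\big)&i=n\end{cases}$$ are well defined, $b=\sum_{i=0}^n(-1)^ib_i$ satisfies $b^2=0$, and the chain complexes $\big(C_\bullet(U,M),\sum_{i=0}^n(-1)^id_i\big)$ and $(D_\bullet(U,M),b)$ are isomorphic. (5) If $U_\triangleleft$ is flat over $A$ and $M$ is injective as a right $A$-module, then $(D_\bullet(U,M),b)$ computes $\mathrm{Coext}^U_\bullet(A,M)$. Here $A$ is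 a right $U$-comodule by $a\mapsto1\otimes t(a)$; a right $U$-comodule is called injective if it is a direct summand of a free one $X\otimes_AU$, with $X$ a right $A$-module; for a right $U$-comodule $P$ with coaction $\rho_P$, $$\mathrm{Cohom}_U(P,M)=\mathrm{Hom}_{A^{op}}(P,M)\big/\big\{g\circ\rho_P-\big(x\mapsto\gamma(g(x\otimes-))\big)\ :\ g\in\mathrm{Hom}_{A^{op}}(P\otimes_A{}_\triangleright U_\triangleleft,M)\big\};$$ and $\mathrm{Coext}^U_\bullet(A,M)$ is the homology of $\mathrm{Cohom}_U(I^\bullet,M)$ for a resolution $0\to A\to I^0\to I^1\to\cdots$ (an exact sequence of right $U$-comodules) by injective right $U$-comodules. That is: such resolutions exist, and for each of them and every $n\ge0$ there is an isomorphism of $k$-modules $H_n(D_\bullet(U,M),b)\cong H_n(\mathrm{Cohom}_U(I^\bullet,M))$. -/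

import Mathlib

open scoped TensorProduct

universe v u

namespace CoextCyclic

/-! ## Balanced tensor products over a noncommutative ring

`ρ` and `l` are families of `k`-linear operators on `M` and `N`, indexed by `A`.  If `ρ` is a right
`A`-action and `l` a left `A`-action, `BalTensor ρ l` is `M ⊗_A N`. -/

section Balanced

variable {k : Type v} [CommRing k] {A : Type*}
  {M : Type*} [AddCommGroup M] [Module k M] {N : Type*} [AddCommGroup N] [Module k N]
  {M' : Type*} [AddCommGroup M'] [Module k M'] {N' : Type*} [AddCommGroup N'] [Module k N']
  {P : Type*} [AddCommGroup P] [Module k P]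

/-- The balancing relations `m a ⊗ n - m ⊗ a n`. -/
def balRel (ρ : A → Module.End k M) (l : A → Module.End k N) : Submodule k (M ⊗[k] N) :=
  Submodule.span k {z | ∃ a m n, z = ρ a m ⊗ₜ[k] n - m ⊗ₜ[k] l a n}

/-- The tensor product of `M` and `N`, balanced over `A`. -/
abbrev BalTensor (ρ : A → Module.End k M) (l : A → Module.End k N) : Type _ :=
  (M ⊗[k] N) ⧸ balRel ρ l

/-- Pure tensors in the balanced tensor product. -/
def btmul (ρ : A → Module.End k M) (l : A → Module.End k N) :
    M →ₗ[k] N →ₗ[k] BalTensor ρ l :=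
  (TensorProduct.mk k M N).compr₂ (balRel ρ l).mkQ

variable {ρ : A → Module.End k M} {l : A → Module.End k N}
  {ρ' : A → Module.End k M'} {l' : A → Module.End k N'}

theorem btmul_bal (a : A) (m : M) (n : N) :
    btmul ρ l (ρ a m) n = btmul ρ l m (l a n) := by
  refine (Submodule.Quotient.eq _).2 (Submodule.subset_span ⟨a, m, n, rfl⟩)

/-- A balanced bilinear map factors through the balanced tensor product. -/
def BalTensor.lift (f : M →ₗ[k] N →ₗ[k] P) (hf : ∀ a m n, f (ρ a m) n = f m (l a n)) :
    BalTensor ρ l →ₗ[k] P :=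
  (balRel ρ l).liftQ (TensorProduct.lift f) (by
    refine Submodule.span_le.2 ?_
    rintro _ ⟨a, m, n, rfl⟩
    simp [hf])

@[simp] theorem BalTensor.lift_btmul (f : M →ₗ[k] N →ₗ[k] P)
    (hf : ∀ a m n, f (ρ a m) n = f m (l a n)) (m : M) (n : N) :
    BalTensor.lift f hf (btmul ρ l m n) = f m n := by
  change TensorProduct.lift f (m ⊗ₜ[k] n) = f m n
  simp

theorem BalTensor.ext {f g : BalTensor ρ l →ₗ[k] P}
    (h : ∀ m n, f (btmul ρ l m n) = g (btmul ρ l m n)) : f = g := by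
  apply Submodule.linearMap_qext
  apply TensorProduct.ext'
  exact h

theorem id_intertwines (ρ : A → Module.End k M) (a : A) (m : M) :
    (LinearMap.id : M →ₗ[k] M) (ρ a m) = ρ a ((LinearMap.id : M →ₗ[k] M) m) := rfl

/-- The map `f ⊗ g` between balanced tensor products. -/
def BalTensor.map (f : M →ₗ[k] M') (g : N →ₗ[k] N') (hf : ∀ a m, f (ρ a m) = ρ' a (f m))
    (hg : ∀ a n, g (l a n) = l' a (g n)) : BalTensor ρ l →ₗ[k] BalTensor ρ' l' :=
  BalTensor.lift ((btmul ρ' l').compl₁₂ f g) (by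
    intro a m n
    simp only [LinearMap.compl₁₂_apply, hf, hg, btmul_bal])

@[simp] theorem BalTensor.map_btmul (f : M →ₗ[k] M') (g : N →ₗ[k] N')
    (hf : ∀ a m, f (ρ a m) = ρ' a (f m)) (hg : ∀ a n, g (l a n) = l' a (g n)) (m : M) (n : N) :
    BalTensor.map f g hf hg (btmul ρ l m n) = btmul ρ' l' (f m) (g n) := by
  simp [BalTensor.map]

end Balanced

/-! ## Rings with source and target, and the four `A`-actions -/

/-- A `k`-algebra `U` with commuting source `s : A → U` (a ring map) and target `t : A → U`
(an anti-ring map, i.e. a ring map on `Aᵐᵒᵖ`). -/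
structure AeRing (k : Type v) [CommRing k] (A U : Type u) [Ring A] [Algebra k A]
    [Ring U] [Algebra k U] where
  s : A →ₐ[k] U
  t : Aᵐᵒᵖ →ₐ[k] U
  comm : ∀ (a : A) (b : Aᵐᵒᵖ), s a * t b = t b * s a

section Main

variable {k : Type v} [CommRing k] {A U : Type u} [Ring A] [Algebra k A] [Ring U] [Algebra k U]

namespace AeRing

variable (S : AeRing k A U)

/-- `a ▷ u = s(a) u`. -/
abbrev sL (a : A) : Module.End k U := LinearMap.mulLeft k (S.s a)
/-- `u ◁ a = t(a) u`. -/
abbrev tL (a : A) : Module.End k U := LinearMap.mulLeft k (S.t (MulOpposite.op a))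
/-- `u ◀ a = u s(a)`. -/
abbrev sR (a : A) : Module.End k U := LinearMap.mulRight k (S.s a)
/-- `a ▶ u = u t(a)`. -/
abbrev tR (a : A) : Module.End k U := LinearMap.mulRight k (S.t (MulOpposite.op a))

theorem sL_tL (a b : A) (u : U) : S.sL a (S.tL b u) = S.tL b (S.sL a u) := by
  simp [← mul_assoc, S.comm]

theorem tL_sL (a b : A) (u : U) : S.tL a (S.sL b u) = S.sL b (S.tL a u) :=
  (S.sL_tL b a u).symm

theorem mulRight_tL (v : U) (b : A) (u : U) :
    LinearMap.mulRight k v (S.tL b u) = S.tL b (LinearMap.mulRight k v u) := by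
  simp [mul_assoc]

theorem mulRight_sL (v : U) (b : A) (u : U) :
    LinearMap.mulRight k v (S.sL b u) = S.sL b (LinearMap.mulRight k v u) := by
  simp [mul_assoc]

theorem tL_tR (a b : A) (u : U) : S.tL a (S.tR b u) = S.tR b (S.tL a u) := by
  simp [mul_assoc]

/-- `U_◁ ⊗_A ▷U`. -/
abbrev UU : Type u := BalTensor S.tL S.sL
/-- `▶U ⊗_{Aᵒᵖ} U_◁`. -/
abbrev UUl : Type u := BalTensor S.tR S.tL
/-- `U_◀ ⊗_A ▷U`. -/
abbrev UUr : Type u := BalTensor S.sR S.sL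

/-- The left `A`-action on `U_◁ ⊗_A ▷U`, through `▷` on the first factor. -/
def lUU (a : A) : Module.End k S.UU :=
  BalTensor.map (ρ' := S.tL) (l' := S.sL) (S.sL a) LinearMap.id (S.sL_tL a) (id_intertwines S.sL)

/-- The right `A`-action on `U_◁ ⊗_A ▷U`, through `◁` on the second factor. -/
def rUU (a : A) : Module.End k S.UU :=
  BalTensor.map (ρ' := S.tL) (l' := S.sL) LinearMap.id (S.tL a) (id_intertwines S.tL) (S.tL_sL a)

/-- `u' ↦ u' ⊗ v`, as a map `U → U_◁ ⊗_A ▷U`. -/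
def tmulR (v : U) : U →ₗ[k] S.UU := (btmul S.tL S.sL).flip v

theorem tmulR_sL (v : U) (a : A) (u : U) :
    S.tmulR v (S.sL a u) = S.lUU a (S.tmulR v u) := by
  simp [tmulR, lUU]

end AeRing

/-- A left bialgebroid `(U, A, Δ, ε, s, t)`.  Sweedler components of `Δ u = u₍₁₎ ⊗ u₍₂₎` are
given by finite families `p`, `q` with `∑ p j ⊗ q j = Δ u`. -/
structure LeftBialgebroid (k : Type v) [CommRing k] (A U : Type u) [Ring A] [Algebra k A]
    [Ring U] [Algebra k U] extends AeRing k A U where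
  /-- the coproduct, with values in `U_◁ ⊗_A ▷U` -/
  Δ : U →ₗ[k] toAeRing.UU
  /-- the counit -/
  ε : U →ₗ[k] A
  comul_bimod : ∀ (a b : A) (u : U),
    Δ (s a * t (MulOpposite.op b) * u) = toAeRing.lUU a (toAeRing.rUU b (Δ u))
  counit_bimod : ∀ (a b : A) (u : U), ε (s a * t (MulOpposite.op b) * u) = a * ε u * b
  coassoc : ∀ (u : U) (m : ℕ) (p q : Fin m → U),
    ∑ j, btmul toAeRing.tL toAeRing.sL (p j) (q j) = Δ u →
    ∑ j, BalTensor.map (ρ := toAeRing.tL) (l := toAeRing.sL)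
        (ρ' := toAeRing.tL) (l' := toAeRing.lUU) LinearMap.id (toAeRing.tmulR (q j))
        (id_intertwines toAeRing.tL) (toAeRing.tmulR_sL (q j)) (Δ (p j)) =
      ∑ j, btmul toAeRing.tL toAeRing.lUU (p j) (Δ (q j))
  counit_left : ∀ (u : U) (m : ℕ) (p q : Fin m → U),
    ∑ j, btmul toAeRing.tL toAeRing.sL (p j) (q j) = Δ u → ∑ j, s (ε (p j)) * q j = u
  counit_right : ∀ (u : U) (m : ℕ) (p q : Fin m → U),
    ∑ j, btmul toAeRing.tL toAeRing.sL (p j) (q j) = Δ u →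
      ∑ j, t (MulOpposite.op (ε (q j))) * p j = u
  /-- `Δ` takes values in the Sweedler-Takeuchi product -/
  takeuchi : ∀ (a : A) (u : U),
    BalTensor.map (ρ' := toAeRing.tL) (l' := toAeRing.sL) (toAeRing.tR a) LinearMap.id
        (toAeRing.mulRight_tL _) (id_intertwines toAeRing.sL) (Δ u) =
      BalTensor.map (ρ' := toAeRing.tL) (l' := toAeRing.sL) LinearMap.id (toAeRing.sR a)
        (id_intertwines toAeRing.tL) (toAeRing.mulRight_sL _) (Δ u)
  comul_one : Δ 1 = btmul toAeRing.tL toAeRing.sL 1 1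
  /-- `Δ` is multiplicative for the factorwise product of the Sweedler-Takeuchi product -/
  comul_mul : ∀ (u u' : U) (z z' : U ⊗[k] U),
    (balRel toAeRing.tL toAeRing.sL).mkQ z = Δ u →
    (balRel toAeRing.tL toAeRing.sL).mkQ z' = Δ u' →
    Δ (u * u') = (balRel toAeRing.tL toAeRing.sL).mkQ (z * z')
  counit_one : ε 1 = 1
  counit_mul_s : ∀ u u' : U, ε (u * u') = ε (u * s (ε u'))
  counit_mul_t : ∀ u u' : U, ε (u * u') = ε (u * t (MulOpposite.op (ε u')))

/-! ## Hom spaces -/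

section Hom

variable (S : AeRing k A U) {P : Type*} [AddCommGroup P] [Module k P]
  (M : Type*) [AddCommGroup M] [Module k M] [Module U M] [IsScalarTower k U M]

/-- `Hom_{Aᵒᵖ}(P, M)`, for `P` with right `A`-action `r` and `M` a left `U`-module, a right
`A`-module through `m a = t(a) m`. -/
def HomRight (r : A → Module.End k P) : Submodule k (P →ₗ[k] M) where
  carrier := {f | ∀ a p, f (r a p) = S.t (MulOpposite.op a) • f p}
  add_mem' := by
    intro f g hf hg a p
    simp only [LinearMap.add_apply, smul_add]
    rw [hf a p, hg a p]
  zero_mem' := by intro a p; simp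
  smul_mem' := by
    intro c f hf a p
    simp only [LinearMap.smul_apply]
    rw [hf a p, smul_comm c]

/-- `Hom_A(P, M)`, for `P` with left `A`-action `l` and `M` a left `U`-module, a left
`A`-module through `a m = s(a) m`. -/
def HomLeft (l : A → Module.End k P) : Submodule k (P →ₗ[k] M) where
  carrier := {f | ∀ a p, f (l a p) = S.s a • f p}
  add_mem' := by
    intro f g hf hg a p
    simp only [LinearMap.add_apply, smul_add]
    rw [hf a p, hg a p]
  zero_mem' := by intro a p; simp
  smul_mem' := by
    intro c f hf a p
    simp only [LinearMap.smul_apply]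
    rw [hf a p, smul_comm c]

end Hom

/-! ## Tensor powers of `U` -/

/-- A `k`-module with a family of operators indexed by `A`. -/
structure OpMod (k : Type v) [CommRing k] (A : Type u) where
  carrier : Type u
  [grp : AddCommGroup carrier]
  [mod : Module k carrier]
  act : A → Module.End k carrier

attribute [instance] OpMod.grp OpMod.mod

namespace AeRing

variable (S : AeRing k A U)

/-- The tensor power `U^{⊗_A n}` with respect to `▷U_◁`, with its left `A`-action through `▷` on the
first factor; it is built as `U ⊗_A (U ⊗_A (⋯ ⊗_A (U ⊗_A A)))`, and is `A` for `n = 0`. -/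
def tens : ℕ → OpMod k A
  | 0 => { carrier := A, act := fun a => LinearMap.mulLeft k a }
  | n + 1 =>
    { carrier := BalTensor S.tL (tens n).act
      act := fun a => BalTensor.map (ρ' := S.tL) (l' := (tens n).act) (S.sL a) LinearMap.id
        (S.sL_tL a) (id_intertwines (tens n).act) }

/-- The tensor power `U^{⊗_{Aᵒᵖ} n}` with respect to `▶U_◁`, with its right `A`-action through `◁` on
the first factor; it is built as `U ⊗ (U ⊗ (⋯ ⊗ (U ⊗ A)))` over `Aᵒᵖ`, and is `A` for `n = 0`. -/
def tensOp : ℕ → OpMod k A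
  | 0 => { carrier := A, act := fun a => LinearMap.mulRight k a }
  | n + 1 =>
    { carrier := BalTensor S.tR (tensOp n).act
      act := fun a => BalTensor.map (ρ' := S.tR) (l' := (tensOp n).act) (S.tL a) LinearMap.id
        (S.tL_tR a) (id_intertwines (tensOp n).act) }

/-- `u, x ↦ (u | x)`. -/
def cons (n : ℕ) : U →ₗ[k] (S.tens n).carrier →ₗ[k] (S.tens (n + 1)).carrier :=
  btmul S.tL (S.tens n).act

/-- `u, x ↦ (u, x)`. -/
def consOp (n : ℕ) : U →ₗ[k] (S.tensOp n).carrier →ₗ[k] (S.tensOp (n + 1)).carrier :=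
  btmul S.tR (S.tensOp n).act

/-- `(u¹ | ⋯ | uⁿ | a)` in `U^{⊗_A n} ⊗_A A = U^{⊗_A n}`. -/
def pureA : (n : ℕ) → (Fin n → U) → A → (S.tens n).carrier
  | 0, _, a => a
  | n + 1, w, a => S.cons n (w 0) (pureA n (Fin.tail w) a)

/-- `(u¹ | ⋯ | uⁿ)`. -/
def pure (n : ℕ) (w : Fin n → U) : (S.tens n).carrier := S.pureA n w 1

/-- `(u¹, …, uⁿ, a)` in `U^{⊗ n} ⊗ A = U^{⊗ n}`, tensor products over `Aᵒᵖ`. -/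
def pureOpA : (n : ℕ) → (Fin n → U) → A → (S.tensOp n).carrier
  | 0, _, a => a
  | n + 1, w, a => S.consOp n (w 0) (pureOpA n (Fin.tail w) a)

/-- `(u¹, …, uⁿ)`. -/
def pureOp (n : ℕ) (w : Fin n → U) : (S.tensOp n).carrier := S.pureOpA n w 1

/-- The right `A`-action on `U^{⊗_A n}` through `◁` on the last factor, together with the fact that
it commutes with the left action. -/
def tensRAux : (n : ℕ) → (a : A) →
    {φ : Module.End k (S.tens n).carrier // ∀ b x, φ ((S.tens n).act b x) = (S.tens n).act b (φ x)}
  | 0, a => ⟨(LinearMap.mulRight k a : Module.End k A), fun b x => mul_assoc b x a⟩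
  | n + 1, a =>
    ⟨BalTensor.map (ρ := S.tL) (l := (S.tens n).act) (ρ' := S.tL) (l' := (S.tens n).act)
        LinearMap.id (tensRAux n a).1 (id_intertwines S.tL) (tensRAux n a).2, by
      intro b x
      let φ : Module.End k (BalTensor S.tL (S.tens n).act) :=
        BalTensor.map (ρ := S.tL) (l := (S.tens n).act) (ρ' := S.tL) (l' := (S.tens n).act)
          LinearMap.id (tensRAux n a).1 (id_intertwines S.tL) (tensRAux n a).2
      let ψ : Module.End k (BalTensor S.tL (S.tens n).act) := (S.tens (n + 1)).act b
      have h : φ ∘ₗ ψ = ψ ∘ₗ φ := by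
        apply BalTensor.ext
        intro m y
        simp [φ, ψ, tens]
      exact LinearMap.congr_fun h x⟩

/-- The right `A`-action on `U^{⊗_A n}` through `◁` on the last factor. -/
def tensR (n : ℕ) (a : A) : Module.End k (S.tens n).carrier := (S.tensRAux n a).1

end AeRing

namespace LeftBialgebroid

variable (B : LeftBialgebroid k A U)

theorem comul_s_mul (a : A) (u : U) : B.Δ (B.s a * u) = B.lUU a (B.Δ u) := by
  have h := B.comul_bimod a 1 u
  have h1 : B.rUU 1 = LinearMap.id := by
    apply BalTensor.ext
    intro m n
    simp [AeRing.rUU]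
  simpa [h1] using h

theorem comul_t_mul (a : A) (u : U) : B.Δ (B.t (MulOpposite.op a) * u) = B.rUU a (B.Δ u) := by
  have h := B.comul_bimod 1 a u
  have h1 : B.lUU 1 = LinearMap.id := by
    apply BalTensor.ext
    intro m n
    simp [AeRing.lUU]
  simpa [h1] using h

/-- Multiplication from the right by `v` on the second factor of `U_◁ ⊗_A ▷U`. -/
def mulSnd (v : U) : Module.End k B.UU :=
  BalTensor.map (ρ' := B.tL) (l' := B.sL) LinearMap.id (LinearMap.mulRight k v)
    (id_intertwines B.tL) (B.mulRight_sL v)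

/-- Multiplication from the right by `v` on the first factor of `U_◁ ⊗_A ▷U`. -/
def mulFst (v : U) : Module.End k B.UU :=
  BalTensor.map (ρ' := B.tL) (l' := B.sL) (LinearMap.mulRight k v) LinearMap.id
    (B.mulRight_tL v) (id_intertwines B.sL)

@[simp] theorem mulSnd_btmul (v p q : U) :
    B.mulSnd v (btmul B.tL B.sL p q) = btmul B.tL B.sL p (q * v) :=
  BalTensor.map_btmul _ _ _ _ _ _

@[simp] theorem mulFst_btmul (v p q : U) :
    B.mulFst v (btmul B.tL B.sL p q) = btmul B.tL B.sL (p * v) q :=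
  BalTensor.map_btmul _ _ _ _ _ _

theorem lUU_btmul (a : A) (p q : U) :
    B.lUU a (btmul B.tL B.sL p q) = btmul B.tL B.sL (B.s a * p) q :=
  BalTensor.map_btmul _ _ _ _ _ _

theorem mkQ_tmul (p q : U) :
    (balRel B.tL B.sL).mkQ (p ⊗ₜ[k] q) = btmul B.tL B.sL p q := rfl

theorem mkQ_mul_snd (z : U ⊗[k] U) (v : U) :
    (balRel B.tL B.sL).mkQ (z * (1 ⊗ₜ[k] v)) = B.mulSnd v ((balRel B.tL B.sL).mkQ z) := by
  induction z using TensorProduct.induction_on with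
  | zero => simp
  | tmul x y =>
    rw [Algebra.TensorProduct.tmul_mul_tmul, mkQ_tmul, mkQ_tmul, mulSnd_btmul, mul_one]
  | add x y hx hy => rw [add_mul, map_add, hx, hy, map_add, map_add]

theorem mkQ_mul_fst (z : U ⊗[k] U) (v : U) :
    (balRel B.tL B.sL).mkQ (z * (v ⊗ₜ[k] 1)) = B.mulFst v ((balRel B.tL B.sL).mkQ z) := by
  induction z using TensorProduct.induction_on with
  | zero => simp
  | tmul x y =>
    rw [Algebra.TensorProduct.tmul_mul_tmul, mkQ_tmul, mkQ_tmul, mulFst_btmul, mul_one]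
  | add x y hx hy => rw [add_mul, map_add, hx, hy, map_add, map_add]

theorem comul_mul_t (a : A) (u : U) :
    B.Δ (u * B.t (MulOpposite.op a)) = B.mulSnd (B.t (MulOpposite.op a)) (B.Δ u) := by
  obtain ⟨z, hz⟩ := (balRel B.tL B.sL).mkQ_surjective (B.Δ u)
  have h : B.Δ (B.t (MulOpposite.op a)) =
      (balRel B.tL B.sL).mkQ (1 ⊗ₜ[k] B.t (MulOpposite.op a)) := by
    have h := B.comul_t_mul a 1
    rw [mul_one, B.comul_one] at h
    rw [h]
    simp only [AeRing.rUU, BalTensor.map_btmul]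
    simp [btmul]
  rw [B.comul_mul _ _ z _ hz h.symm, mkQ_mul_snd, hz]

theorem comul_mul_s (a : A) (u : U) :
    B.Δ (u * B.s a) = B.mulFst (B.s a) (B.Δ u) := by
  obtain ⟨z, hz⟩ := (balRel B.tL B.sL).mkQ_surjective (B.Δ u)
  have h : B.Δ (B.s a) = (balRel B.tL B.sL).mkQ (B.s a ⊗ₜ[k] 1) := by
    have h := B.comul_s_mul a 1
    rw [mul_one, B.comul_one] at h
    rw [h]
    simp only [AeRing.lUU, BalTensor.map_btmul]
    simp [btmul]
  rw [B.comul_mul _ _ z _ hz h.symm, mkQ_mul_fst, hz]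

/-- The Hopf-Galois map `u ⊗ v ↦ u₍₁₎ ⊗ u₍₂₎ v`, `▶U ⊗_{Aᵒᵖ} U_◁ → U_◁ ⊗_A ▷U`. -/
def galoisL : B.UUl →ₗ[k] B.UU :=
  BalTensor.lift
    (LinearMap.mk₂ k (fun u v => B.mulSnd v (B.Δ u))
      (fun u u' v => by simp)
      (fun c u v => by simp)
      (fun u v v' => by
        have h : B.mulSnd (v + v') = B.mulSnd v + B.mulSnd v' := by
          apply BalTensor.ext
          intro m n
          simp [mul_add]
        simp [h])
      (fun c u v => by
        have h : B.mulSnd (c • v) = c • B.mulSnd v := by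
          apply BalTensor.ext
          intro m n
          simp
        simp [h]))
    (by
      intro a u v
      have h : B.mulSnd v ∘ₗ B.mulSnd (B.t (MulOpposite.op a)) =
          B.mulSnd (B.t (MulOpposite.op a) * v) := by
        apply BalTensor.ext
        intro m n
        simp [mul_assoc]
      simpa [B.comul_mul_t] using LinearMap.congr_fun h (B.Δ u))

/-- The Hopf-Galois map `u ⊗ v ↦ u₍₁₎ v ⊗ u₍₂₎`, `U_◀ ⊗_A ▷U → U_◁ ⊗_A ▷U`. -/
def galoisR : B.UUr →ₗ[k] B.UU :=
  BalTensor.lift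
    (LinearMap.mk₂ k (fun v u => B.mulFst u (B.Δ v))
      (fun u u' v => by simp)
      (fun c u v => by simp)
      (fun u v v' => by
        have h : B.mulFst (v + v') = B.mulFst v + B.mulFst v' := by
          apply BalTensor.ext
          intro m n
          simp [mul_add]
        simp [h])
      (fun c u v => by
        have h : B.mulFst (c • v) = c • B.mulFst v := by
          apply BalTensor.ext
          intro m n
          simp
        simp [h]))
    (by
      intro a u v
      have h : B.mulFst v ∘ₗ B.mulFst (B.s a) = B.mulFst (B.s a * v) := by
        apply BalTensor.ext
        intro m n
        simp [mul_assoc]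
      simpa [B.comul_mul_s] using LinearMap.congr_fun h (B.Δ u))

/-- `(U, A)` is a left Hopf algebroid. -/
def IsLeftHopf : Prop := Function.Bijective B.galoisL

/-- `(U, A)` is a right Hopf algebroid. -/
def IsRightHopf : Prop := Function.Bijective B.galoisR

variable {B} in
/-- The translation map `u ↦ u₊ ⊗ u₋`, with `galoisL (u₊ ⊗ u₋) = u ⊗ 1`. -/
noncomputable def IsLeftHopf.transl (hl : B.IsLeftHopf) (u : U) : B.UUl :=
  (LinearEquiv.ofBijective B.galoisL hl).symm (btmul B.tL B.sL u 1)

variable {B} in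
/-- The translation map `u ↦ u₍₊₎ ⊗ u₍₋₎` (square brackets in print), with
`galoisR (u₍₊₎ ⊗ u₍₋₎) = 1 ⊗ u`. -/
noncomputable def IsRightHopf.transl (hr : B.IsRightHopf) (u : U) : B.UUr :=
  (LinearEquiv.ofBijective B.galoisR hr).symm (btmul B.tL B.sL 1 u)

/-! ### The diagonal action -/

/-- The data of a left `U`-action on `X` whose restriction along `s` is the given left `A`-action. -/
abbrev CompatAct (X : OpMod k A) : Type _ :=
  {D : U →ₗ[k] Module.End k X.carrier //
    (∀ a u x, D (B.s a * u) x = X.act a (D u x)) ∧ (∀ a u x, D (u * B.s a) x = D u (X.act a x))}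

/-- `p ⊗ q ↦ (v ⊗ x ↦ p v ⊗ q x)`. -/
def diagPre (X : OpMod k A) (D : B.CompatAct X) :
    B.UU →ₗ[k] (U ⊗[k] X.carrier →ₗ[k] BalTensor B.tL X.act) :=
  BalTensor.lift
    (LinearMap.mk₂ k
      (fun p q => TensorProduct.lift
        ((btmul B.tL X.act).compl₁₂ (LinearMap.mulLeft k p) (D.1 q)))
      (fun p p' q => by
        apply TensorProduct.ext'
        intro v x
        simp [add_mul])
      (fun c p q => by
        apply TensorProduct.ext'
        intro v x
        simp)
      (fun p q q' => by
        apply TensorProduct.ext'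
        intro v x
        simp)
      (fun c p q => by
        apply TensorProduct.ext'
        intro v x
        simp))
    (by
      intro a p q
      apply TensorProduct.ext'
      intro v x
      have h := btmul_bal (ρ := B.tL) (l := X.act) a (p * v) (D.1 q x)
      simp only [LinearMap.mulLeft_apply] at h
      simp [D.2.1, h])

theorem diagPre_btmul (X : OpMod k A) (D : B.CompatAct X) (p q v : U) (x : X.carrier) :
    B.diagPre X D (btmul B.tL B.sL p q) (v ⊗ₜ[k] x) = btmul B.tL X.act (p * v) (D.1 q x) := by
  simp [diagPre]

theorem diagPre_bal (X : OpMod k A) (D : B.CompatAct X) (u : U) (a : A) (v : U) (x : X.carrier) :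
    B.diagPre X D (B.Δ u) (B.tL a v ⊗ₜ[k] x) = B.diagPre X D (B.Δ u) (v ⊗ₜ[k] X.act a x) := by
  have h1 : ∀ w : B.UU, B.diagPre X D w (B.tL a v ⊗ₜ[k] x) =
      B.diagPre X D (BalTensor.map (ρ' := B.tL) (l' := B.sL) (B.tR a) LinearMap.id
        (B.mulRight_tL _) (id_intertwines B.sL) w) (v ⊗ₜ[k] x) := by
    intro w
    obtain ⟨z, rfl⟩ := (balRel B.tL B.sL).mkQ_surjective w
    induction z using TensorProduct.induction_on with
    | zero => simp only [map_zero, LinearMap.zero_apply]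
    | tmul p q =>
      change B.diagPre X D (btmul B.tL B.sL p q) _ =
        B.diagPre X D (BalTensor.map _ _ _ _ (btmul B.tL B.sL p q)) _
      rw [BalTensor.map_btmul, diagPre_btmul, diagPre_btmul]
      simp [mul_assoc]
    | add z z' hz hz' => simp only [map_add, LinearMap.add_apply, hz, hz']
  have h2 : ∀ w : B.UU, B.diagPre X D w (v ⊗ₜ[k] X.act a x) =
      B.diagPre X D (BalTensor.map (ρ' := B.tL) (l' := B.sL) LinearMap.id (B.sR a)
        (id_intertwines B.tL) (B.mulRight_sL _) w) (v ⊗ₜ[k] x) := by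
    intro w
    obtain ⟨z, rfl⟩ := (balRel B.tL B.sL).mkQ_surjective w
    induction z using TensorProduct.induction_on with
    | zero => simp only [map_zero, LinearMap.zero_apply]
    | tmul p q =>
      change B.diagPre X D (btmul B.tL B.sL p q) _ =
        B.diagPre X D (BalTensor.map _ _ _ _ (btmul B.tL B.sL p q)) _
      rw [BalTensor.map_btmul, diagPre_btmul, diagPre_btmul]
      simp [D.2.2]
    | add z z' hz hz' => simp only [map_add, LinearMap.add_apply, hz, hz']
  rw [h1, h2, B.takeuchi]

/-- The diagonal action `u (v ⊗ x) = u₍₁₎ v ⊗ u₍₂₎ x` on `U ⊗_A X`. -/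
def diagStep (X : OpMod k A) (D : B.CompatAct X) :
    U →ₗ[k] Module.End k (BalTensor B.tL X.act) where
  toFun u := (balRel B.tL X.act).liftQ (B.diagPre X D (B.Δ u)) (by
    refine Submodule.span_le.2 ?_
    rintro _ ⟨a, v, x, rfl⟩
    simp only [SetLike.mem_coe, LinearMap.mem_ker, map_sub, sub_eq_zero]
    exact B.diagPre_bal X D u a v x)
  map_add' u u' := by
    apply BalTensor.ext
    intro v x
    exact congrArg (fun f => f (v ⊗ₜ[k] x)) (by simp only [map_add] :
      B.diagPre X D (B.Δ (u + u')) = B.diagPre X D (B.Δ u) + B.diagPre X D (B.Δ u'))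
  map_smul' c u := by
    apply BalTensor.ext
    intro v x
    exact congrArg (fun f => f (v ⊗ₜ[k] x)) (by simp only [map_smul] :
      B.diagPre X D (B.Δ (c • u)) = c • B.diagPre X D (B.Δ u))

theorem diagStep_btmul (X : OpMod k A) (D : B.CompatAct X) (u v : U) (x : X.carrier) :
    B.diagStep X D u (btmul B.tL X.act v x) = B.diagPre X D (B.Δ u) (v ⊗ₜ[k] x) := rfl

/-- The left `U`-action on `U^{⊗_A n}`, together with its compatibility with the left `A`-action:
for `n = 0` it is `u a = ε(u s(a))`, for larger `n` it is the diagonal action. -/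
def diagAux : (n : ℕ) → B.CompatAct (B.tens n)
  | 0 =>
    ⟨(LinearMap.mk₂ k (fun (u : U) (a : A) => (B.ε (u * B.s a) : A))
        (fun u u' a => by simp [add_mul])
        (fun c u a => by simp)
        (fun u a a' => by simp [mul_add])
        (fun c u a => by simp) : U →ₗ[k] A →ₗ[k] A),
      fun b u x => by
        have h := B.counit_bimod b 1 (u * B.s x)
        rw [MulOpposite.op_one, map_one, mul_one, mul_one, ← mul_assoc] at h
        exact h,
      fun b u x => congrArg B.ε
        ((mul_assoc u (B.s b) (B.s x)).trans (congrArg (u * ·) (map_mul B.s b x).symm))⟩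
  | n + 1 =>
    ⟨B.diagStep (B.tens n) (diagAux n),
      fun a u x => by
        let φ : Module.End k (BalTensor B.tL (B.tens n).act) := (B.tens (n + 1)).act a
        have hφ : ∀ v y, φ (btmul B.tL (B.tens n).act v y) =
            btmul B.tL (B.tens n).act (B.s a * v) y := by
          intro v y
          simp [φ, AeRing.tens]
        have h : B.diagStep (B.tens n) (diagAux n) (B.s a * u) =
            φ ∘ₗ B.diagStep (B.tens n) (diagAux n) u := by
          apply BalTensor.ext
          intro v y
          rw [LinearMap.comp_apply, diagStep_btmul, diagStep_btmul, comul_s_mul]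
          generalize B.Δ u = w
          obtain ⟨z, rfl⟩ := (balRel B.tL B.sL).mkQ_surjective w
          induction z using TensorProduct.induction_on with
          | zero => simp only [map_zero, LinearMap.zero_apply]
          | tmul p q =>
            change B.diagPre _ _ (B.lUU a (btmul B.tL B.sL p q)) _ =
              φ (B.diagPre _ _ (btmul B.tL B.sL p q) _)
            rw [lUU_btmul, diagPre_btmul, diagPre_btmul, hφ]
            simp [mul_assoc]
          | add z z' hz hz' => simp only [map_add, LinearMap.add_apply, hz, hz']
        exact LinearMap.congr_fun h x,
      fun a u x => by
        let φ : Module.End k (BalTensor B.tL (B.tens n).act) := (B.tens (n + 1)).act a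
        have hφ : ∀ v y, φ (btmul B.tL (B.tens n).act v y) =
            btmul B.tL (B.tens n).act (B.s a * v) y := by
          intro v y
          simp [φ, AeRing.tens]
        have h : B.diagStep (B.tens n) (diagAux n) (u * B.s a) =
            B.diagStep (B.tens n) (diagAux n) u ∘ₗ φ := by
          apply BalTensor.ext
          intro v y
          rw [LinearMap.comp_apply, hφ, diagStep_btmul, diagStep_btmul, comul_mul_s]
          generalize B.Δ u = w
          obtain ⟨z, rfl⟩ := (balRel B.tL B.sL).mkQ_surjective w
          induction z using TensorProduct.induction_on with
          | zero => simp only [map_zero, LinearMap.zero_apply]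
          | tmul p q =>
            change B.diagPre _ _ (B.mulFst (B.s a) (btmul B.tL B.sL p q)) _ =
              B.diagPre _ _ (btmul B.tL B.sL p q) _
            rw [mulFst_btmul, diagPre_btmul, diagPre_btmul]
            simp [mul_assoc]
          | add z z' hz hz' => simp only [map_add, LinearMap.add_apply, hz, hz']
        exact LinearMap.congr_fun h x⟩

/-- The diagonal left `U`-action on `U^{⊗_A n}`. -/
def diag (n : ℕ) : U →ₗ[k] Module.End k (B.tens n).carrier := (B.diagAux n).1

theorem diag_s_mul (n : ℕ) (a : A) (u : U) (x : (B.tens n).carrier) :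
    B.diag n (B.s a * u) x = (B.tens n).act a (B.diag n u x) := (B.diagAux n).2.1 a u x

/-! ### Evaluating Sweedler components -/

section Eval

variable {B} {M : Type u} [AddCommGroup M] [Module k M] [Module U M] [IsScalarTower k U M]

/-- For `F ∈ Hom_{Aᵒᵖ}(U_◁, M)`, the map `x ⊗ y ↦ x F(y)` on `▶U ⊗_{Aᵒᵖ} U_◁`. -/
def evalL (F : HomRight B.toAeRing M B.tL) : B.UUl →ₗ[k] M :=
  BalTensor.lift
    (LinearMap.mk₂ k (fun x y => x • F.1 y)
      (fun x x' y => add_smul x x' _) (fun c x y => smul_assoc c x _)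
      (fun x y y' => by simp) (fun c x y => by rw [map_smul, smul_comm]))
    (by
      intro a x y
      have h := F.2 a y
      simp only [LinearMap.mk₂_apply, LinearMap.mulRight_apply, mul_smul]
      rw [h])

/-- For `F ∈ Hom_A(▷U, M)`, the map `x ⊗ y ↦ x F(y)` on `U_◀ ⊗_A ▷U`. -/
def evalR (F : HomLeft B.toAeRing M B.sL) : B.UUr →ₗ[k] M :=
  BalTensor.lift
    (LinearMap.mk₂ k (fun x y => x • F.1 y)
      (fun x x' y => add_smul x x' _) (fun c x y => smul_assoc c x _)
      (fun x y y' => by simp) (fun c x y => by rw [map_smul, smul_comm]))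
    (by
      intro a x y
      have h := F.2 a y
      simp only [LinearMap.mk₂_apply, LinearMap.mulRight_apply, mul_smul]
      rw [h])

/-- `x ↦ f(x v p)`. -/
def sliceMul (f : HomRight B.toAeRing M B.tL) (v p : U) : HomRight B.toAeRing M B.tL :=
  ⟨f.1 ∘ₗ LinearMap.mulRight k (v * p), fun a x => by
    have h := f.2 a (x * (v * p))
    simpa [mul_assoc] using h⟩

/-- `x ↦ f(x v, z)`. -/
def sliceBar {n : ℕ} (f : HomRight B.toAeRing M (B.tensOp (n + 1)).act) (v : U)
    (z : (B.tensOp n).carrier) : HomRight B.toAeRing M B.tL :=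
  ⟨f.1 ∘ₗ (B.consOp n).flip z ∘ₗ LinearMap.mulRight k v, fun a x => by
    refine Eq.trans (congrArg f.1 ?_) (f.2 a (B.consOp n (x * v) z))
    refine Eq.trans ?_ (BalTensor.map_btmul (ρ' := B.tR) (l' := (B.tensOp n).act)
      (B.tL a) LinearMap.id (B.tL_tR a) (id_intertwines (B.tensOp n).act) (x * v) z).symm
    simp only [LinearMap.comp_apply, LinearMap.mulRight_apply, LinearMap.mulLeft_apply, mul_assoc]
    rfl⟩

/-- `y ↦ f(y | x)`. -/
def sliceCons {n : ℕ} (f : HomLeft B.toAeRing M (B.tens (n + 1)).act)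
    (x : (B.tens n).carrier) : HomLeft B.toAeRing M B.sL :=
  ⟨f.1 ∘ₗ (B.cons n).flip x, fun a y => by
    refine Eq.trans (congrArg f.1 ?_) (f.2 a (B.cons n y x))
    exact (BalTensor.map_btmul (ρ' := B.tL) (l' := (B.tens n).act)
      (B.sL a) LinearMap.id (B.sL_tL a) (id_intertwines (B.tens n).act) y x).symm⟩

/-- `y ↦ f(y x)`, for the diagonal action. -/
def sliceDiag {n : ℕ} (f : HomLeft B.toAeRing M (B.tens n).act)
    (x : (B.tens n).carrier) : HomLeft B.toAeRing M B.sL :=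
  ⟨f.1 ∘ₗ (B.diag n).flip x, fun a y => by
    refine Eq.trans (congrArg f.1 ?_) (f.2 a (B.diag n y x))
    exact B.diag_s_mul n a y x⟩

/-- The left `U`-action `(u f)(x) = u₍₊₎ f(u₍₋₎ x)` (square brackets in print, right Hopf structure)
on `Hom_A(U^{⊗_A n}, M)`. -/
noncomputable def rightHopfAct (hr : B.IsRightHopf) {n : ℕ} (u : U)
    (f : HomLeft B.toAeRing M (B.tens n).act) (x : (B.tens n).carrier) : M :=
  evalR (sliceDiag f x) (hr.transl u)

end Eval

end LeftBialgebroid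

/-! ## Contramodules -/

section Contra

variable (B : LeftBialgebroid k A U) (M : Type u) [AddCommGroup M] [Module k M] [Module U M]
  [IsScalarTower k U M]

/-- `GammaRel γ F m` says that the function `F : U → M` lies in `Hom_{Aᵒᵖ}(U_◁, M)` and that
`γ(F) = m`. -/
def GammaRel {B : LeftBialgebroid k A U} {M : Type u} [AddCommGroup M] [Module k M] [Module U M]
    [IsScalarTower k U M] (γ : HomRight B.toAeRing M B.tL →ₗ[k] M) (F : U → M) (m : M) : Prop :=
  ∃ f : HomRight B.toAeRing M B.tL, (∀ u, f.1 u = F u) ∧ γ f = m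

/-- A right `U`-contramodule structure on the right `A`-module `M`; the right `A`-action of `M` is
the one induced by the left `U`-action, `m a = t(a) m`. -/
structure Contraaction where
  γ : HomRight B.toAeRing M B.tL →ₗ[k] M
  /-- right `A`-linearity, `γ(f(a ▷ -)) = γ(f) a` -/
  map_act : ∀ (f : HomRight B.toAeRing M B.tL) (a : A),
    GammaRel γ (fun u => f.1 (B.s a * u)) (B.t (MulOpposite.op a) • γ f)
  /-- contraassociativity; `h u = γ(g(u ⊗ -))` -/
  assoc : ∀ g : HomRight B.toAeRing M B.rUU, ∃ h : HomRight B.toAeRing M B.tL,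
    (∀ u, GammaRel γ (fun v => g.1 (btmul B.tL B.sL u v)) (h.1 u)) ∧
      GammaRel γ (fun u => g.1 (B.Δ u)) (γ h)
  /-- contraunitality -/
  unit : ∀ m : M, GammaRel γ (fun u => B.t (MulOpposite.op (B.ε u)) • m) m

end Contra

section AYD

variable {B : LeftBialgebroid k A U} {M : Type u} [AddCommGroup M] [Module k M] [Module U M]
  [IsScalarTower k U M]

/-- Anti Yetter-Drinfel'd contramodules: a left `U`-module and right `U`-contramodule with
coinciding underlying `A`-bimodules, such that action and contraaction are compatible. -/
structure IsAYD (hl : B.IsLeftHopf) (c : Contraaction B M) : Prop where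
  /-- the left `A`-action `a m = γ(m ε(- ◀ a))` coming from the contraaction is the one coming from
  the `U`-action -/
  left_act : ∀ (a : A) (m : M),
    GammaRel c.γ (fun u => B.t (MulOpposite.op (B.ε (u * B.s a))) • m) (B.s a • m)
  /-- `u γ(f) = γ(u₊₍₂₎ f(u₋ - u₊₍₁₎))`, with `u₊₍₁₎ ⊗ u₊₍₂₎ ⊗ u₋` written as
  `u₍₁₎ ⊗ u₍₂₎₊ ⊗ u₍₂₎₋`, which makes the argument of `γ` right `A`-linear for every choice of
  components `p j ⊗ q j` of `u₍₁₎ ⊗ u₍₂₎` -/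
  compat : ∀ (u : U) (f : HomRight B.toAeRing M B.tL) (m : ℕ) (p q : Fin m → U),
    ∑ j, btmul B.tL B.sL (p j) (q j) = B.Δ u →
    GammaRel c.γ
      (fun v => ∑ j, LeftBialgebroid.evalL (LeftBialgebroid.sliceMul f v (p j)) (hl.transl (q j)))
      (u • c.γ f)

/-- Stability, `γ(u ↦ u m) = m`. -/
def IsStable (c : Contraaction B M) : Prop := ∀ m : M, GammaRel c.γ (fun u => u • m) m

end AYD

/-! ## Cocyclic and cyclic modules -/

section Cyclic

variable {X : ℕ → Type u} [∀ n, AddCommGroup (X n)] [∀ n, Module k (X n)]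
  {Y : ℕ → Type u} [∀ n, AddCommGroup (Y n)] [∀ n, Module k (Y n)]

/-- A cocyclic `k`-module with cofaces `δ`, codegeneracies `σ` and cocyclic operator `τ`. -/
structure IsCocyclicModule (δ : ∀ n, Fin (n + 2) → X n →ₗ[k] X (n + 1))
    (σ : ∀ n, Fin (n + 1) → X (n + 1) →ₗ[k] X n) (τ : ∀ n, X n →ₗ[k] X n) : Prop where
  δ_δ : ∀ n (i j : Fin (n + 2)), i ≤ j →
    δ (n + 1) j.succ ∘ₗ δ n i = δ (n + 1) i.castSucc ∘ₗ δ n j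
  σ_σ : ∀ n (i j : Fin (n + 1)), i ≤ j →
    σ n j ∘ₗ σ (n + 1) i.castSucc = σ n i ∘ₗ σ (n + 1) j.succ
  σ_δ_lt : ∀ n (i : Fin (n + 2)) (j : Fin (n + 1)), i ≤ j.castSucc →
    σ (n + 1) j.succ ∘ₗ δ (n + 1) i.castSucc = δ n i ∘ₗ σ n j
  σ_δ_self : ∀ n (i : Fin (n + 1)), σ n i ∘ₗ δ n i.castSucc = LinearMap.id
  σ_δ_succ : ∀ n (i : Fin (n + 1)), σ n i ∘ₗ δ n i.succ = LinearMap.id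
  σ_δ_gt : ∀ n (i : Fin (n + 2)) (j : Fin (n + 1)), j.castSucc < i →
    σ (n + 1) j.castSucc ∘ₗ δ (n + 1) i.succ = δ n i ∘ₗ σ n j
  τ_δ : ∀ n (i : Fin (n + 1)), τ (n + 1) ∘ₗ δ n i.succ = δ n i.castSucc ∘ₗ τ n
  τ_δ_zero : ∀ n, τ (n + 1) ∘ₗ δ n 0 = δ n (Fin.last (n + 1))
  τ_σ : ∀ n (i : Fin n), τ n ∘ₗ σ n i.succ = σ n i.castSucc ∘ₗ τ (n + 1)
  τ_σ_zero : ∀ n, τ n ∘ₗ σ n 0 = σ n (Fin.last n) ∘ₗ τ (n + 1) ∘ₗ τ (n + 1)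
  τ_pow : ∀ n, (τ n : Module.End k (X n)) ^ (n + 1) = 1

/-- A cyclic `k`-module with faces `d`, degeneracies `s` and cyclic operator `t`. -/
structure IsCyclicModule (d : ∀ n, Fin (n + 2) → X (n + 1) →ₗ[k] X n)
    (s : ∀ n, Fin (n + 1) → X n →ₗ[k] X (n + 1)) (t : ∀ n, X n →ₗ[k] X n) : Prop where
  d_d : ∀ n (i j : Fin (n + 2)), i ≤ j →
    d n i ∘ₗ d (n + 1) j.succ = d n j ∘ₗ d (n + 1) i.castSucc
  s_s : ∀ n (i j : Fin (n + 1)), i ≤ j →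
    s (n + 1) i.castSucc ∘ₗ s n j = s (n + 1) j.succ ∘ₗ s n i
  d_s_lt : ∀ n (i : Fin (n + 2)) (j : Fin (n + 1)), i ≤ j.castSucc →
    d (n + 1) i.castSucc ∘ₗ s (n + 1) j.succ = s n j ∘ₗ d n i
  d_s_self : ∀ n (i : Fin (n + 1)), d n i.castSucc ∘ₗ s n i = LinearMap.id
  d_s_succ : ∀ n (i : Fin (n + 1)), d n i.succ ∘ₗ s n i = LinearMap.id
  d_s_gt : ∀ n (i : Fin (n + 2)) (j : Fin (n + 1)), j.castSucc < i →
    d (n + 1) i.succ ∘ₗ s (n + 1) j.castSucc = s n j ∘ₗ d n i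
  d_t : ∀ n (i : Fin (n + 1)), d n i.succ ∘ₗ t (n + 1) = t n ∘ₗ d n i.castSucc
  d_t_zero : ∀ n, d n 0 ∘ₗ t (n + 1) = d n (Fin.last (n + 1))
  s_t : ∀ n (i : Fin n), s n i.succ ∘ₗ t n = t (n + 1) ∘ₗ s n i.castSucc
  s_t_zero : ∀ n, s n 0 ∘ₗ t n = t (n + 1) ∘ₗ t (n + 1) ∘ₗ s n (Fin.last n)
  t_pow : ∀ n, (t n : Module.End k (X n)) ^ (n + 1) = 1

/-- `(Y, d, s, t)` is the cyclic dual of `(X, δ, σ, τ)`, transported along the isomorphisms `ξ`: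
up to `ξ`, one has `d₀ = σ_{n-1} τ`, `d_i = σ_{i-1}` for `1 ≤ i ≤ n`, `s_j = δ_j` for `0 ≤ j ≤ n`,
and `t = τ⁻¹`. -/
structure IsCyclicDualVia (ξ : ∀ n, X n ≃ₗ[k] Y n)
    (δ : ∀ n, Fin (n + 2) → X n →ₗ[k] X (n + 1))
    (σ : ∀ n, Fin (n + 1) → X (n + 1) →ₗ[k] X n) (τ : ∀ n, X n →ₗ[k] X n)
    (d : ∀ n, Fin (n + 2) → Y (n + 1) →ₗ[k] Y n)
    (s : ∀ n, Fin (n + 1) → Y n →ₗ[k] Y (n + 1)) (t : ∀ n, Y n →ₗ[k] Y n) : Prop where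
  d_zero : ∀ n x, d n 0 (ξ (n + 1) x) = ξ n (σ n (Fin.last n) (τ (n + 1) x))
  d_succ : ∀ n (i : Fin (n + 1)) x, d n i.succ (ξ (n + 1) x) = ξ n (σ n i x)
  s_eq : ∀ n (j : Fin (n + 1)) x, s n j (ξ n x) = ξ (n + 1) (δ n j.castSucc x)
  t_eq : ∀ n x, t n (ξ n (τ n x)) = ξ n x
  t_eq' : ∀ n x, ξ n (τ n ((ξ n).symm (t n (ξ n x)))) = ξ n x

/-- The alternating sum of the faces. -/
def altSum (d : ∀ n, Fin (n + 2) → X (n + 1) →ₗ[k] X n) (n : ℕ) : X (n + 1) →ₗ[k] X n :=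
  ∑ i : Fin (n + 2), (-1 : ℤ) ^ (i : ℕ) • d n i

/-- The cycles in degree `n` of a sequence of maps `⋯ → X 2 → X 1 → X 0`. -/
def cycles (d : ∀ n, X (n + 1) →ₗ[k] X n) : (n : ℕ) → Submodule k (X n)
  | 0 => ⊤
  | n + 1 => LinearMap.ker (d n)

/-- The homology in degree `n` of a chain complex `⋯ → X 2 → X 1 → X 0`. -/
abbrev Homology (d : ∀ n, X (n + 1) →ₗ[k] X n) (n : ℕ) : Type u :=
  cycles d n ⧸ (LinearMap.range (d n)).comap (cycles d n).subtype

end Cyclic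

/-! ## Comodules, cohomomorphisms and `Coext` -/

/-- `U_◁` is flat: `U_◁ ⊗_A -` preserves injective maps of left `A`-modules. -/
def AeRing.TargetFlat (S : AeRing k A U) : Prop :=
  ∀ (X Y : Type u) [AddCommGroup X] [Module k X] [AddCommGroup Y] [Module k Y]
    (lX : A →ₐ[k] Module.End k X) (lY : A →ₐ[k] Module.End k Y) (φ : X →ₗ[k] Y)
    (hφ : ∀ a x, φ (lX a x) = lY a (φ x)), Function.Injective φ →
    Function.Injective (BalTensor.map (ρ := S.tL) (l := fun a => lX a) (ρ' := S.tL)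
      (l' := fun a => lY a) LinearMap.id φ (id_intertwines S.tL) hφ)

/-- A right `U`-comodule: a right `A`-module `P` with a right `A`-linear, coassociative and counital
coaction `P → P ⊗_A ▷U`. -/
structure RComod (B : LeftBialgebroid k A U) where
  carrier : Type u
  [grp : AddCommGroup carrier]
  [mod : Module k carrier]
  act : Aᵐᵒᵖ →ₐ[k] Module.End k carrier
  coact : carrier →ₗ[k] BalTensor (fun a : A => act (MulOpposite.op a)) B.sL
  coact_act : ∀ (a : A) (x : carrier), coact (act (MulOpposite.op a) x) =
    BalTensor.map (ρ' := fun a : A => act (MulOpposite.op a)) (l' := B.sL) LinearMap.id (B.tL a)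
      (id_intertwines fun a : A => act (MulOpposite.op a)) (B.tL_sL a) (coact x)
  coassoc : ∀ (x : carrier) (m : ℕ) (p : Fin m → carrier) (q : Fin m → U),
    ∑ j, btmul (fun a : A => act (MulOpposite.op a)) B.sL (p j) (q j) = coact x →
    ∑ j, BalTensor.map (ρ' := fun a : A => act (MulOpposite.op a)) (l' := B.lUU)
        LinearMap.id (B.tmulR (q j))
        (id_intertwines fun a : A => act (MulOpposite.op a)) (B.tmulR_sL (q j)) (coact (p j)) =
      ∑ j, btmul (fun a : A => act (MulOpposite.op a)) B.lUU (p j) (B.Δ (q j))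
  counit : ∀ (x : carrier) (m : ℕ) (p : Fin m → carrier) (q : Fin m → U),
    ∑ j, btmul (fun a : A => act (MulOpposite.op a)) B.sL (p j) (q j) = coact x →
    ∑ j, act (MulOpposite.op (B.ε (q j))) (p j) = x

attribute [instance] RComod.grp RComod.mod

namespace RComod

variable {B : LeftBialgebroid k A U}

/-- The right `A`-action on a comodule. -/
abbrev r (P : RComod B) (a : A) : Module.End k P.carrier := P.act (MulOpposite.op a)

/-- The right `A`-action on `P ⊗_A U`, through `◁` on `U`. -/
def rPU (P : RComod B) (a : A) : Module.End k (BalTensor P.r B.sL) :=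
  BalTensor.map (ρ' := P.r) (l' := B.sL) LinearMap.id (B.tL a) (id_intertwines P.r) (B.tL_sL a)

/-- Morphisms of right `U`-comodules. -/
structure Hom (P Q : RComod B) where
  map : P.carrier →ₗ[k] Q.carrier
  map_act : ∀ a x, map (P.r a x) = Q.r a (map x)
  map_coact : ∀ x, Q.coact (map x) =
    BalTensor.map (ρ := P.r) (l := B.sL) (ρ' := Q.r) (l' := B.sL) map LinearMap.id map_act
      (id_intertwines B.sL) (P.coact x)

/-- `F` is isomorphic to a free comodule `X ⊗_A U`, with right `A`-action through `◁` on `U` and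
coaction `X ⊗ Δ`. -/
def IsFree (F : RComod B) : Prop :=
  ∃ (X : Type u) (_ : AddCommGroup X) (_ : Module k X) (rX : Aᵐᵒᵖ →ₐ[k] Module.End k X)
    (e : F.carrier ≃ₗ[k] BalTensor (fun a : A => rX (MulOpposite.op a)) B.sL),
    (∀ (a : A) (y : F.carrier), e (F.r a y) =
      BalTensor.map (ρ' := fun a : A => rX (MulOpposite.op a)) (l' := B.sL) LinearMap.id (B.tL a)
        (id_intertwines fun a : A => rX (MulOpposite.op a)) (B.tL_sL a) (e y)) ∧
    ∀ (y : F.carrier) (m : ℕ) (p : Fin m → F.carrier) (q : Fin m → U),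
      ∑ j, btmul F.r B.sL (p j) (q j) = F.coact y →
      ∑ j, BalTensor.map (ρ' := fun a : A => rX (MulOpposite.op a)) (l' := B.lUU)
          LinearMap.id (B.tmulR (q j))
          (id_intertwines fun a : A => rX (MulOpposite.op a)) (B.tmulR_sL (q j)) (e (p j)) =
        BalTensor.map (ρ' := fun a : A => rX (MulOpposite.op a)) (l' := B.lUU)
          LinearMap.id B.Δ
          (id_intertwines fun a : A => rX (MulOpposite.op a)) B.comul_s_mul (e y)

/-- A comodule is injective if it is a direct summand of a free one. -/
def IsInjective (I : RComod B) : Prop :=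
  ∃ F : RComod B, F.IsFree ∧ ∃ (i : Hom I F) (π : Hom F I), ∀ x, π.map (i.map x) = x

section Cohom

variable {M : Type u} [AddCommGroup M] [Module k M] [Module U M] [IsScalarTower k U M]

/-- The submodule of `Hom_{Aᵒᵖ}(P, M)` generated by all `g ∘ ρ_P - γ(g(- ⊗ ·))` with
`g ∈ Hom_{Aᵒᵖ}(P ⊗_A ▷U, M)`. -/
def cohomRel (c : Contraaction B M) (P : RComod B) : Submodule k (HomRight B.toAeRing M P.r) :=
  Submodule.span k {h | ∃ g : HomRight B.toAeRing M P.rPU, ∀ x,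
    GammaRel c.γ (fun v => g.1 (btmul P.r B.sL x v)) (g.1 (P.coact x) - h.1 x)}

/-- The space of cohomomorphisms `Cohom_U(P, M)`. -/
abbrev Cohom (c : Contraaction B M) (P : RComod B) : Type u :=
  HomRight B.toAeRing M P.r ⧸ cohomRel c P

/-- Precomposition `Hom_{Aᵒᵖ}(Q, M) → Hom_{Aᵒᵖ}(P, M)`. -/
def homPre {P Q : RComod B} (φ : Hom P Q) :
    HomRight B.toAeRing M Q.r →ₗ[k] HomRight B.toAeRing M P.r where
  toFun f := ⟨f.1 ∘ₗ φ.map, fun a x => by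
    rw [LinearMap.comp_apply, φ.map_act]
    exact f.2 a _⟩
  map_add' _ _ := rfl
  map_smul' _ _ := rfl

/-- Functoriality of `Cohom_U(-, M)`. -/
def cohomMap (c : Contraaction B M) {P Q : RComod B} (φ : Hom P Q) :
    Cohom c Q →ₗ[k] Cohom c P :=
  Submodule.mapQ _ _ (homPre φ) (by
    refine Submodule.span_le.2 ?_
    rintro h ⟨g, hg⟩
    refine Submodule.subset_span ?_
    let Φ : BalTensor P.r B.sL →ₗ[k] BalTensor Q.r B.sL :=
      BalTensor.map (ρ := P.r) (l := B.sL) (ρ' := Q.r) (l' := B.sL) φ.map LinearMap.id φ.map_act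
        (id_intertwines B.sL)
    have hΦ : ∀ x v, Φ (btmul P.r B.sL x v) = btmul Q.r B.sL (φ.map x) v := by
      intro x v
      simp [Φ]
    refine ⟨⟨g.1 ∘ₗ Φ, ?_⟩, ?_⟩
    · intro a x
      have h1 : Φ ∘ₗ P.rPU a = Q.rPU a ∘ₗ Φ := by
        apply BalTensor.ext
        intro m n
        simp [rPU, Φ]
      have h2 := LinearMap.congr_fun h1 x
      simp only [LinearMap.comp_apply] at h2 ⊢
      rw [h2]
      exact g.2 a _
    · intro x
      have h3 := hg (φ.map x)
      rw [φ.map_coact] at h3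
      obtain ⟨f, hf, hf'⟩ := h3
      refine ⟨f, fun v => ?_, hf'⟩
      exact (hf v).trans (congrArg g.1 (hΦ x v)).symm)

end Cohom

end RComod

/-- A resolution `0 → A → I⁰ → I¹ → ⋯` of the right `U`-comodule `A`, with coaction
`a ↦ 1 ⊗ t(a)`, by injective right `U`-comodules. -/
structure InjResolution (B : LeftBialgebroid k A U) where
  I : ℕ → RComod B
  d : ∀ n, RComod.Hom (I n) (I (n + 1))
  aug : A →ₗ[k] (I 0).carrier
  aug_act : ∀ a b : A, aug (a * b) = (I 0).r b (aug a)
  aug_coact : ∀ a : A, (I 0).coact (aug a) =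
    btmul (I 0).r B.sL (aug 1) (B.t (MulOpposite.op a))
  injective : ∀ n, (I n).IsInjective
  aug_injective : Function.Injective aug
  exact_zero : Function.Exact aug (d 0).map
  exact_succ : ∀ n, Function.Exact (d n).map (d (n + 1)).map

/-- `Coext^U_n(A, M)`, computed from the resolution `R`: the homology of `Cohom_U(I^•, M)`. -/
abbrev InjResolution.Coext {B : LeftBialgebroid k A U} (R : InjResolution B)
    {M : Type u} [AddCommGroup M] [Module k M] [Module U M] [IsScalarTower k U M]
    (c : Contraaction B M) (n : ℕ) : Type u :=
  Homology (k := k) (X := fun i => RComod.Cohom c (R.I i)) (fun i => RComod.cohomMap c (R.d i)) n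

/-- `M` is injective as a right `A`-module, `m a = t(a) m`. -/
def IsRightInjective (S : AeRing k A U) (M : Type u) [AddCommGroup M] [Module U M] : Prop :=
  letI : Module Aᵐᵒᵖ M := Module.compHom M S.t.toRingHom
  Module.Injective Aᵐᵒᵖ M

/-! ## The complexes and their structure maps -/

section Complexes

variable (B : LeftBialgebroid k A U) (M : Type u) [AddCommGroup M] [Module k M] [Module U M]
  [IsScalarTower k U M]

/-- `Cⁿ(U, M) = Hom_{Aᵒᵖ}(U^{⊗_{Aᵒᵖ} n}, M)`. -/
abbrev BarCochain (n : ℕ) : Type u := HomRight B.toAeRing M (B.tensOp n).act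

/-- `C_n(U, M) = Hom_A(U^{⊗_A n}, M)`. -/
abbrev CobarChain (n : ℕ) : Type u := HomLeft B.toAeRing M (B.tens n).act

/-- `D_n(U, M) = Hom_{Aᵒᵖ}(U^{⊗_A n}, M)`. -/
abbrev DChain (n : ℕ) : Type u := HomRight B.toAeRing M (B.tensR n)

variable {B M}

/-- The cofaces, codegeneracies and cocyclic operator on `C^•(U, M)`. -/
structure BarFormulas (hl : B.IsLeftHopf) (c : Contraaction B M)
    (δ : ∀ n, Fin (n + 2) → BarCochain B M n →ₗ[k] BarCochain B M (n + 1))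
    (σ : ∀ n, Fin (n + 1) → BarCochain B M (n + 1) →ₗ[k] BarCochain B M n)
    (τ : ∀ n, BarCochain B M n →ₗ[k] BarCochain B M n) : Prop where
  /-- `(δ₀ f)(u¹, …) = u¹ f(u², …)` -/
  δ_zero : ∀ n f (w : Fin (n + 1) → U),
    (δ n 0 f).1 (B.pureOp (n + 1) w) = w 0 • f.1 (B.pureOp n (Fin.tail w))
  /-- `(δ_i f)(u¹, …) = f(…, uⁱ uⁱ⁺¹, …)` for `1 ≤ i ≤ n` -/
  δ_mid : ∀ n f (i : Fin n) (w : Fin (n + 1) → U),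
    (δ n i.castSucc.succ f).1 (B.pureOp (n + 1) w) =
      f.1 (B.pureOp n (Fin.contractNth i.castSucc (· * ·) w))
  /-- `(δ_{n+1} f)(u¹, …) = f(u¹, …, ε(uⁿ⁺¹) ▶ uⁿ)` -/
  δ_last : ∀ n f (w : Fin (n + 1) → U),
    (δ n (Fin.last (n + 1)) f).1 (B.pureOp (n + 1) w) =
      f.1 (B.pureOpA n (Fin.init w) (B.ε (w (Fin.last n))))
  /-- `(σ_j f)(u¹, …) = f(u¹, …, uʲ, 1, uʲ⁺¹, …)` -/
  σ_eq : ∀ n f (j : Fin (n + 1)) (w : Fin n → U),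
    (σ n j f).1 (B.pureOp n w) = f.1 (B.pureOp (n + 1) (Fin.insertNth (α := fun _ => U) j 1 w))
  τ_zero : τ 0 = LinearMap.id
  /-- `(τ f)(u¹, …, uⁿ) = γ((u¹₍₂₎ ⋯ uⁿ⁻¹₍₂₎ uⁿ)₊ f((u¹₍₂₎ ⋯ uⁿ⁻¹₍₂₎ uⁿ)₋ -, u¹₍₁₎, …, uⁿ⁻¹₍₁₎))` -/
  τ_succ : ∀ n f (w : Fin (n + 1) → U) (m : ℕ) (p q : Fin n → Fin m → U),
    (∀ i, ∑ j, btmul B.tL B.sL (p i j) (q i j) = B.Δ (w i.castSucc)) →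
    GammaRel c.γ
      (fun v => ∑ j : Fin n → Fin m,
        LeftBialgebroid.evalL
          (LeftBialgebroid.sliceBar f v (B.pureOp n fun i => p i (j i)))
          (hl.transl ((List.ofFn fun i => q i (j i)).prod * w (Fin.last n))))
      ((τ (n + 1) f).1 (B.pureOp (n + 1) w))

/-- `(ξ g)(u¹ | ⋯ | uⁿ) = u¹₊ g(u¹₋ u²₊, …, uⁿ⁻¹₋ uⁿ₊, uⁿ₋)`. -/
structure XiFormula (hl : B.IsLeftHopf)
    (ξ : ∀ n, BarCochain B M n ≃ₗ[k] CobarChain B M n) : Prop where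
  ξ_zero : ∀ g (w : Fin 0 → U), (ξ 0 g).1 (B.pure 0 w) = g.1 (B.pureOp 0 w)
  ξ_succ : ∀ n g (w : Fin (n + 1) → U) (m : ℕ) (p q : Fin (n + 1) → Fin m → U),
    (∀ i, ∑ j, btmul B.tR B.tL (p i j) (q i j) = hl.transl (w i)) →
    (ξ (n + 1) g).1 (B.pure (n + 1) w) =
      ∑ j : Fin (n + 1) → Fin m, p 0 (j 0) •
        g.1 (B.pureOp (n + 1) (Fin.snoc (α := fun _ => U)
          (fun i : Fin n => q i.castSucc (j i.castSucc) * p i.succ (j i.succ))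
          (q (Fin.last n) (j (Fin.last n)))))

/-- `(u¹ | ⋯ | p | q | ⋯ | uⁿ)`, with `uⁱ` replaced by the two entries `p`, `q`. -/
def splitAt {n : ℕ} (i : Fin n) (p q : U) (w : Fin n → U) : Fin (n + 1) → U :=
  Fin.insertNth (α := fun _ => U) i.succ q (Function.update w i p)

/-- The faces, degeneracies and cyclic operator on `C_•(U, M)`. -/
structure CobarFormulas (hr : B.IsRightHopf) (c : Contraaction B M)
    (d : ∀ n, Fin (n + 2) → CobarChain B M (n + 1) →ₗ[k] CobarChain B M n)
    (s : ∀ n, Fin (n + 1) → CobarChain B M n →ₗ[k] CobarChain B M (n + 1))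
    (t : ∀ n, CobarChain B M n →ₗ[k] CobarChain B M n) : Prop where
  /-- `(d₀ f)(u¹ | ⋯) = γ(-₍₊₎ f(-₍₋₎ | u¹ | ⋯))`, right Hopf structure -/
  d_zero : ∀ n f (w : Fin n → U),
    GammaRel c.γ
      (fun v => LeftBialgebroid.evalR (LeftBialgebroid.sliceCons f (B.pure n w)) (hr.transl v))
      ((d n 0 f).1 (B.pure n w))
  /-- `(d_i f)(u¹ | ⋯) = f(u¹ | ⋯ | Δ uⁱ | ⋯)` for the inner faces -/
  d_mid : ∀ n f (i : Fin n) (w : Fin n → U) (m : ℕ) (p q : Fin m → U),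
    ∑ j, btmul B.tL B.sL (p j) (q j) = B.Δ (w i) →
    (d n i.castSucc.succ f).1 (B.pure n w) =
      ∑ j, f.1 (B.pure (n + 1) (splitAt i (p j) (q j) w))
  /-- the last face is `f(u¹ | ⋯ | 1)` -/
  d_last : ∀ n f (w : Fin n → U),
    (d n (Fin.last (n + 1)) f).1 (B.pure n w) =
      f.1 (B.pure (n + 1) (Fin.snoc (α := fun _ => U) w 1))
  /-- `(s_j f)(u¹ | ⋯) = f(u¹ | ⋯ | ε(uʲ⁺¹) | ⋯)` for `j < n`, where `ε(uʲ⁺¹) ∈ A` acts on the next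
  entry -/
  s_lt : ∀ n f (j : Fin n) (w : Fin (n + 1) → U),
    (s n j.castSucc f).1 (B.pure (n + 1) w) =
      f.1 (B.pure n (Fin.contractNth j.castSucc (fun x y => B.s (B.ε x) * y) w))
  /-- the same for `j = n` -/
  s_last : ∀ n f (w : Fin (n + 1) → U),
    (s n (Fin.last n) f).1 (B.pure (n + 1) w) =
      f.1 (B.pureA n (Fin.init w) (B.ε (w (Fin.last n))))
  t_zero : t 0 = LinearMap.id
  /-- `(t f)(u¹ | ⋯ | uⁿ) = γ(((- u¹) f)(u² | ⋯ | uⁿ | 1))`, with the `U`-action on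
  `Hom_A(U^{⊗_A n}, M)` coming from the right Hopf structure -/
  t_succ : ∀ n f (w : Fin (n + 1) → U),
    GammaRel c.γ
      (fun v => LeftBialgebroid.rightHopfAct hr (v * w 0) f
        (B.pure (n + 1) (Fin.snoc (α := fun _ => U) (Fin.tail w) 1)))
      ((t (n + 1) f).1 (B.pure (n + 1) w))

/-- The faces on `D_•(U, M)`. -/
structure DFormulas (c : Contraaction B M)
    (b : ∀ n, Fin (n + 2) → DChain B M (n + 1) →ₗ[k] DChain B M n) : Prop where
  b_zero : ∀ n f (w : Fin n → U),
    (b n 0 f).1 (B.pure n w) = f.1 (B.pure (n + 1) (Fin.cons (α := fun _ => U) 1 w))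
  b_mid : ∀ n f (i : Fin n) (w : Fin n → U) (m : ℕ) (p q : Fin m → U),
    ∑ j, btmul B.tL B.sL (p j) (q j) = B.Δ (w i) →
    (b n i.castSucc.succ f).1 (B.pure n w) =
      ∑ j, f.1 (B.pure (n + 1) (splitAt i (p j) (q j) w))
  b_last : ∀ n f (w : Fin n → U),
    GammaRel c.γ (fun v => f.1 (B.pure (n + 1) (Fin.snoc (α := fun _ => U) w v)))
      ((b n (Fin.last (n + 1)) f).1 (B.pure n w))

end Complexes

end Main
end CoextCyclic
open CoextCyclic

namespace CoextCyclic

set_option linter.unusedSectionVars false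

/-! ### Sums over components of elements of balanced tensor products -/

section Calculus

variable {k : Type v} [CommRing k] {A : Type*}
  {M : Type*} [AddCommGroup M] [Module k M] {N : Type*} [AddCommGroup N] [Module k N]
  {M' : Type*} [AddCommGroup M'] [Module k M'] {N' : Type*} [AddCommGroup N'] [Module k N']
  {P : Type*} [AddCommGroup P] [Module k P] {Q : Type*} [AddCommGroup Q] [Module k Q]
  {ρ : A → Module.End k M} {l : A → Module.End k N}
  {ρ' : A → Module.End k M'} {l' : A → Module.End k N'}

/-! The three families of Hom spaces are coordinate descriptions of one homogeneous object, `DiagHom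
B M n`, that is, Hom_U(U^{⊗_A (n+1)}, M) for the diagonal action. There the cofaces are composition
with ε in one entry, the codegeneracies are composition with Δ in one entry, and the inverse of the
cocyclic operator is the rotation (Tφ)(u | x) = γ(v ↦ φ(x | vu)), called `DiagHom.rot`. The
identities without T are the coassociativity and counit laws. Each hypothesis on M has its own role.
The agreement of the two left A-actions makes Tφ balanced over A and handles the last coface. The
aYD compatibility makes Tφ U-linear. Contraassociativity handles the last codegeneracy and,
iterated, gives (Tʲφ)(x | y) = γ(v ↦ φ(y | v·x)) for x of length j (`DiagHom.rot_pow_aux`). For j =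
n+1 the right side is γ(v ↦ vφ(x)), which is φ(x) by stability, so T^{n+1} = 1. All this is
collected in `DiagHom.isRotational`; `IsRotational.cocyclic` and `IsRotational.cyclic` turn it into
a cocyclic module and its cyclic dual.

The coordinates come from the two Hopf structures. The right one gives (x | u) = u₍₊₎·(u₍₋₎x | 1)
(square brackets in print), so restriction to (x | 1) identifies the homogeneous object with C_n
(`cobarEquiv`). The left one gives (u | x) = u₊·(1 | u₋x), so restriction to (1 | x) identifies it
with D_n (`dEquiv`). Iterating the second formula, θ(u¹, u², …) = u¹·(1 | u²·(1 | ⋯)) is an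
isomorphism from the tensor power over Aᵒᵖ to the one over A (`theta_bijective`), and this gives Cⁿ
(`barEquiv`). The map ξ is the change of coordinates from Cⁿ to C_n. Explicit formulas are found by
evaluation on pure tensors, and cyclic identities are transported. For D the rotation T is applied
before restricting to (1 | x): this turns the zeroth face into insertion of 1 and moves γ to the
last entry.

For Coext, consider the double complex Hom_{Aᵒᵖ}(I^p ⊗_A U^{⊗_A q}, M). For fixed p it is exact in
positive degrees, because the coaction of an injective comodule has a colinear retraction
(`RComod.Retraction.exact_biD`), and its zeroth homology is Cohom_U(I^p, M)
(`RComod.mem_cohomRel_iff`). For fixed q, the map x ⊗ p ↦ p₍₀₎ ⊗ p₍₁₎x identifies U^{⊗_A q} ⊗_A I^p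
with I^p ⊗_A U^{⊗_A q} (`RComod.swap`). Flatness of U_◁ and injectivity of M therefore make the
complex in the direction of p exact, with augmentation to D_q (`InjResolution.isRowExact`). A zigzag
argument shows that both edges have the same homology (`IsRowExact.nonempty_homology_equiv`). A
resolution exists without flatness: each cosyzygy embeds in a free comodule by its own coaction. -/

theorem BalTensor.exists_rep (z : BalTensor ρ l) :
    ∃ (n : ℕ) (p : Fin n → M) (q : Fin n → N), ∑ j, btmul ρ l (p j) (q j) = z := by
  obtain ⟨z, rfl⟩ := (balRel ρ l).mkQ_surjective z
  induction z using TensorProduct.induction_on with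
  | zero => exact ⟨0, Fin.elim0, Fin.elim0, by simp⟩
  | tmul x y => exact ⟨1, fun _ => x, fun _ => y, by simp [btmul]⟩
  | add z z' hz hz' =>
    obtain ⟨n, p, q, h⟩ := hz
    obtain ⟨n', p', q', h'⟩ := hz'
    exact ⟨n + n', Fin.append p p', Fin.append q q', by
      rw [Fin.sum_univ_add, map_add, ← h, ← h']; simp⟩

/-- A balanced `k`-bilinear function of two variables. -/
structure IsBal (k : Type*) [CommRing k] {A M N P : Type*} [AddCommGroup M] [Module k M]
    [AddCommGroup N] [Module k N] [AddCommGroup P] [Module k P]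
    (ρ : A → Module.End k M) (l : A → Module.End k N) (F : M → N → P) : Prop where
  add_l : ∀ m m' n, F (m + m') n = F m n + F m' n
  smul_l : ∀ (c : k) m n, F (c • m) n = c • F m n
  add_r : ∀ m n n', F m (n + n') = F m n + F m n'
  smul_r : ∀ (c : k) m n, F m (c • n) = c • F m n
  bal : ∀ a m n, F (ρ a m) n = F m (l a n)

/-- The linear map on the balanced tensor product induced by a balanced function. -/
def IsBal.lift {F : M → N → P} (h : IsBal k ρ l F) : BalTensor ρ l →ₗ[k] P :=
  BalTensor.lift (LinearMap.mk₂ k F h.add_l h.smul_l h.add_r h.smul_r) (by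
    intro a m n; exact h.bal a m n)

@[simp] theorem IsBal.lift_btmul {F : M → N → P} (h : IsBal k ρ l F) (m : M) (n : N) :
    h.lift (btmul ρ l m n) = F m n := by
  exact BalTensor.lift_btmul _ _ _ _

/-- `∑ F(m, n)` over chosen components `∑ m ⊗ n` of `z`. -/
noncomputable def bsum (z : BalTensor ρ l) (F : M → N → P) : P :=
  ∑ j, F (z.exists_rep.choose_spec.choose j) (z.exists_rep.choose_spec.choose_spec.choose j)

theorem bsum_btmul_eq (z : BalTensor ρ l) : bsum z (fun m n => btmul ρ l m n) = z :=
  z.exists_rep.choose_spec.choose_spec.choose_spec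

/-- For a fixed target, one choice of components serves all `F`, so axioms stated for explicit
finite families can be fed with the components that `bsum` uses. -/
theorem bsum_exists (z : BalTensor ρ l) : ∃ (n : ℕ) (p : Fin n → M) (q : Fin n → N),
    ∑ j, btmul ρ l (p j) (q j) = z ∧ ∀ F : M → N → P, bsum z F = ∑ j, F (p j) (q j) :=
  ⟨_, _, _, bsum_btmul_eq z, fun _ => rfl⟩

theorem map_bsum {P' G : Type*} [AddCommGroup P'] [FunLike G P P'] [AddMonoidHomClass G P P']
    (f : G) (z : BalTensor ρ l) (F : M → N → P) :
    f (bsum z F) = bsum z (fun m n => f (F m n)) := map_sum _ _ _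

theorem bsum_add_fun (z : BalTensor ρ l) (F G : M → N → P) :
    bsum z (fun m n => F m n + G m n) = bsum z F + bsum z G := Finset.sum_add_distrib

theorem bsum_smul_fun {R : Type*} [Monoid R] [DistribMulAction R P] (c : R) (z : BalTensor ρ l)
    (F : M → N → P) : bsum z (fun m n => c • F m n) = c • bsum z F := Finset.smul_sum.symm

/-- Both sides are finite double sums over fixed components, so no balancing of `F` is needed. The
same is true of the additivity of `bsum` in the function; additivity in the tensor does need
balancing. -/
theorem bsum_comm (z : BalTensor ρ l) (w : BalTensor ρ' l') (F : M → N → M' → N' → P) :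
    bsum z (fun m n => bsum w (F m n)) = bsum w (fun a b => bsum z (fun m n => F m n a b)) :=
  Finset.sum_comm

theorem IsBal.bsum_eq {F : M → N → P} (h : IsBal k ρ l F) (z : BalTensor ρ l) :
    bsum z F = h.lift z := by
  conv_rhs => rw [← bsum_btmul_eq z, map_bsum]
  simp

/-- Independence of the chosen components: a balanced function factors through the tensor product.
This is the bridge between `bsum` and statements quantified over all Sweedler components. -/
theorem IsBal.of_rep {F : M → N → P} (h : IsBal k ρ l F) {z : BalTensor ρ l} {ι : Type*}
    (s : Finset ι) (p : ι → M) (q : ι → N) (hz : ∑ j ∈ s, btmul ρ l (p j) (q j) = z) :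
    ∑ j ∈ s, F (p j) (q j) = bsum z F := by
  rw [h.bsum_eq, ← hz]; simp

theorem IsBal.bsum_btmul {F : M → N → P} (h : IsBal k ρ l F) (m : M) (n : N) :
    bsum (btmul ρ l m n) F = F m n := by
  rw [h.bsum_eq, h.lift_btmul]

theorem IsBal.bsum_add {F : M → N → P} (h : IsBal k ρ l F) (z w : BalTensor ρ l) :
    bsum (z + w) F = bsum z F + bsum w F := by
  simp [h.bsum_eq]

theorem IsBal.bsum_smul {F : M → N → P} (h : IsBal k ρ l F) (c : k) (z : BalTensor ρ l) :
    bsum (c • z) F = c • bsum z F := by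
  simp [h.bsum_eq]

theorem IsBal.bsum_bsum {F : M → N → P} (h : IsBal k ρ l F) (w : BalTensor ρ' l')
    (Z : M' → N' → BalTensor ρ l) :
    bsum (bsum w Z) F = bsum w (fun a b => bsum (Z a b) F) := by
  simp only [h.bsum_eq, map_bsum]

theorem IsBal.bsum_map {F : M' → N' → P} (h : IsBal k ρ' l' F) (f : M →ₗ[k] M') (g : N →ₗ[k] N')
    (hf : ∀ a m, f (ρ a m) = ρ' a (f m)) (hg : ∀ a n, g (l a n) = l' a (g n))
    (z : BalTensor ρ l) :
    bsum (BalTensor.map f g hf hg z) F = bsum z (fun m n => F (f m) (g n)) := by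
  rw [h.bsum_eq]
  conv_lhs => rw [← bsum_btmul_eq z]
  rw [map_bsum, map_bsum]
  simp

theorem map_eq_bsum (f : M →ₗ[k] M') (g : N →ₗ[k] N')
    (hf : ∀ a m, f (ρ a m) = ρ' a (f m)) (hg : ∀ a n, g (l a n) = l' a (g n))
    (z : BalTensor ρ l) :
    BalTensor.map f g hf hg z = bsum z (fun m n => btmul ρ' l' (f m) (g n)) := by
  conv_lhs => rw [← bsum_btmul_eq z]
  rw [map_bsum]
  simp

theorem lift_eq_bsum (f : M →ₗ[k] N →ₗ[k] P) (hf : ∀ a m n, f (ρ a m) n = f m (l a n))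
    (z : BalTensor ρ l) : BalTensor.lift f hf z = bsum z (fun m n => f m n) := by
  conv_lhs => rw [← bsum_btmul_eq z]
  rw [map_bsum]
  simp

theorem linear_eq_bsum (f : BalTensor ρ l →ₗ[k] P) (z : BalTensor ρ l) :
    f z = bsum z (fun m n => f (btmul ρ l m n)) := by
  rw [← map_bsum, bsum_btmul_eq]

theorem IsBal.of_linear (f : BalTensor ρ l →ₗ[k] P) :
    IsBal k ρ l (fun m n => f (btmul ρ l m n)) where
  add_l _ _ _ := by simp
  smul_l _ _ _ := by simp
  add_r _ _ _ := by simp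
  smul_r _ _ _ := by simp
  bal _ _ _ := by rw [btmul_bal]

theorem IsBal.comp {F : M → N → P} (h : IsBal k ρ l F) (f : P →ₗ[k] Q) :
    IsBal k ρ l (fun m n => f (F m n)) where
  add_l _ _ _ := by rw [h.add_l, map_add]
  smul_l _ _ _ := by rw [h.smul_l, map_smul]
  add_r _ _ _ := by rw [h.add_r, map_add]
  smul_r _ _ _ := by rw [h.smul_r, map_smul]
  bal _ _ _ := by rw [h.bal]

/-- A sum of balanced functions is balanced. -/
theorem IsBal.bsum {F : M' → N' → M → N → P} (h : ∀ a b, IsBal k ρ l (F a b))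
    (z : BalTensor ρ' l') : IsBal k ρ l (fun m n => bsum z (fun a b => F a b m n)) where
  add_l _ _ _ := by simp only [(h _ _).add_l, bsum_add_fun]
  smul_l _ _ _ := by simp only [(h _ _).smul_l, bsum_smul_fun]
  add_r _ _ _ := by simp only [(h _ _).add_r, bsum_add_fun]
  smul_r _ _ _ := by simp only [(h _ _).smul_r, bsum_smul_fun]
  bal _ _ _ := by simp only [(h _ _).bal]

end Calculus

/-! ### Sweedler calculus for the coproduct -/

section Sweedler

variable {k : Type v} [CommRing k] {A U : Type u} [Ring A] [Algebra k A] [Ring U] [Algebra k U]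
  {P : Type*} [AddCommGroup P] [Module k P]

namespace LeftBialgebroid

variable (B : LeftBialgebroid k A U)

/-- `∑ F(u₍₁₎, u₍₂₎)`. -/
noncomputable abbrev sw (u : U) (F : U → U → P) : P := bsum (B.Δ u) F

/-- A function of three variables that is balanced on `U_◁ ⊗_A ▷U_◁ ⊗_A ▷U`. -/
structure IsBal3 (F : U → U → U → P) : Prop where
  add₁ : ∀ x x' y z, F (x + x') y z = F x y z + F x' y z
  smul₁ : ∀ (c : k) x y z, F (c • x) y z = c • F x y z
  add₂ : ∀ x y y' z, F x (y + y') z = F x y z + F x y' z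
  smul₂ : ∀ (c : k) x y z, F x (c • y) z = c • F x y z
  add₃ : ∀ x y z z', F x y (z + z') = F x y z + F x y z'
  smul₃ : ∀ (c : k) x y z, F x y (c • z) = c • F x y z
  bal₁ : ∀ a x y z, F (B.t (MulOpposite.op a) * x) y z = F x (B.s a * y) z
  bal₂ : ∀ a x y z, F x (B.t (MulOpposite.op a) * y) z = F x y (B.s a * z)

variable {B}

namespace IsBal3

variable {F : U → U → U → P}

theorem isBal_right (h : B.IsBal3 F) (x : U) : IsBal k B.tL B.sL (fun y z => F x y z) where
  add_l _ _ _ := h.add₂ ..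
  smul_l _ _ _ := h.smul₂ ..
  add_r _ _ _ := h.add₃ ..
  smul_r _ _ _ := h.smul₃ ..
  bal _ _ _ := h.bal₂ ..

theorem isBal_lUU (h : B.IsBal3 F) :
    IsBal k B.tL B.lUU (fun (x : U) (w : B.UU) => bsum w (fun y z => F x y z)) where
  add_l _ _ _ := by simp only [h.add₁, bsum_add_fun]
  smul_l _ _ _ := by simp only [h.smul₁, bsum_smul_fun]
  add_r _ _ _ := (h.isBal_right _).bsum_add _ _
  smul_r _ _ _ := (h.isBal_right _).bsum_smul _ _
  bal a x w := by
    simp only [LinearMap.mulLeft_apply, h.bal₁, AeRing.lUU]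
    rw [(h.isBal_right x).bsum_map]
    simp

/-- Coassociativity. -/
theorem coassoc (h : B.IsBal3 F) (u : U) :
    B.sw u (fun p q => B.sw p (fun a b => F a b q)) =
      B.sw u (fun p q => B.sw q (fun c d => F p c d)) := by
  obtain ⟨m, p, q, hpq, hs⟩ := bsum_exists (P := P) (B.Δ u)
  -- The axiom is an equation in U ⊗_A (U ⊗_A U); it is evaluated under the functional that `F`
  -- induces there.
  have := congrArg h.isBal_lUU.lift (B.coassoc u m p q hpq)
  rw [map_sum, map_sum] at this
  simp only [sw, hs]
  refine Eq.trans ?_ (this.trans ?_)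
  · refine Finset.sum_congr rfl fun j _ => ?_
    rw [← h.isBal_lUU.bsum_eq, h.isBal_lUU.bsum_map]
    simp only [AeRing.tmulR, LinearMap.flip_apply, LinearMap.id_apply]
    simp only [(h.isBal_right _).bsum_btmul]
  · refine Finset.sum_congr rfl fun j _ => ?_
    rw [h.isBal_lUU.lift_btmul]

end IsBal3

variable {F : U → U → P}

theorem sw_mul (h : IsBal k B.tL B.sL F) (u u' : U) :
    B.sw (u * u') F = B.sw u (fun p q => B.sw u' (fun p' q' => F (p * p') (q * q'))) := by
  obtain ⟨m, p, q, hpq, hs⟩ := bsum_exists (P := P) (B.Δ u)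
  obtain ⟨m', p', q', hpq', hs'⟩ := bsum_exists (P := P) (B.Δ u')
  have := B.comul_mul u u' (∑ j, p j ⊗ₜ q j) (∑ j, p' j ⊗ₜ q' j)
    (by rw [← hpq, map_sum]; rfl) (by rw [← hpq', map_sum]; rfl)
  simp only [sw, hs, hs', this, h.bsum_eq, Finset.sum_mul_sum, map_sum,
    Algebra.TensorProduct.tmul_mul_tmul, mkQ_tmul, h.lift_btmul]

theorem sw_one (h : IsBal k B.tL B.sL F) : B.sw 1 F = F 1 1 := by
  rw [sw, B.comul_one, h.bsum_btmul]

theorem sw_add (h : IsBal k B.tL B.sL F) (u u' : U) : B.sw (u + u') F = B.sw u F + B.sw u' F := by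
  rw [sw, map_add, h.bsum_add]

theorem sw_smul (h : IsBal k B.tL B.sL F) (c : k) (u : U) : B.sw (c • u) F = c • B.sw u F := by
  rw [sw, map_smul, h.bsum_smul]

theorem sw_s_mul (h : IsBal k B.tL B.sL F) (a : A) (u : U) : B.sw (B.s a * u) F = B.sw u (fun p q => F (B.s a * p) q) := by
  rw [sw, B.comul_s_mul, AeRing.lUU, h.bsum_map]; simp

theorem sw_t_mul (h : IsBal k B.tL B.sL F) (a : A) (u : U) : B.sw (B.t (MulOpposite.op a) * u) F =
    B.sw u (fun p q => F p (B.t (MulOpposite.op a) * q)) := by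
  rw [sw, B.comul_t_mul, AeRing.rUU, h.bsum_map]; simp

theorem sw_mul_s (h : IsBal k B.tL B.sL F) (a : A) (u : U) : B.sw (u * B.s a) F = B.sw u (fun p q => F (p * B.s a) q) := by
  rw [sw, B.comul_mul_s, mulFst, h.bsum_map]; simp

theorem sw_takeuchi (h : IsBal k B.tL B.sL F) (a : A) (u : U) : B.sw u (fun p q => F (p * B.t (MulOpposite.op a)) q) =
    B.sw u (fun p q => F p (q * B.s a)) := by
  have := congrArg h.lift (B.takeuchi a u)
  rw [← h.bsum_eq, ← h.bsum_eq, h.bsum_map, h.bsum_map] at this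
  simpa using this

variable (B)

theorem sw_counit_left (u : U) : B.sw u (fun p q => B.s (B.ε p) * q) = u := by
  obtain ⟨m, p, q, hpq, hs⟩ := bsum_exists (P := U) (B.Δ u)
  rw [sw, hs]; exact B.counit_left u m p q hpq

theorem sw_counit_right (u : U) : B.sw u (fun p q => B.t (MulOpposite.op (B.ε q)) * p) = u := by
  obtain ⟨m, p, q, hpq, hs⟩ := bsum_exists (P := U) (B.Δ u)
  rw [sw, hs]; exact B.counit_right u m p q hpq

theorem counit_s_mul (a : A) (u : U) : B.ε (B.s a * u) = a * B.ε u := by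
  simpa using B.counit_bimod a 1 u

theorem counit_t_mul (a : A) (u : U) : B.ε (B.t (MulOpposite.op a) * u) = B.ε u * a := by
  simpa using B.counit_bimod 1 a u

theorem counit_s (a : A) : B.ε (B.s a) = a := by
  simpa [B.counit_one] using B.counit_s_mul a 1

theorem counit_t (a : A) : B.ε (B.t (MulOpposite.op a)) = a := by
  simpa [B.counit_one] using B.counit_t_mul a 1

theorem counit_mul_t_eq (a : A) (u : U) : B.ε (u * B.t (MulOpposite.op a)) = B.ε (u * B.s a) := by
  rw [B.counit_mul_s, B.counit_t]

end LeftBialgebroid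
end Sweedler

/-! ### Tensor powers seen from the last entry, and the diagonal action -/

section Tens

variable {k : Type v} [CommRing k] {A U : Type u} [Ring A] [Algebra k A] [Ring U] [Algebra k U]
  {P : Type*} [AddCommGroup P] [Module k P]

namespace AeRing

variable (S : AeRing k A U)

theorem tens_hom_ext {n : ℕ} {f g : (S.tens (n + 1)).carrier →ₗ[k] P}
    (h : ∀ u x, f (S.cons n u x) = g (S.cons n u x)) : f = g :=
  BalTensor.ext h

theorem tens_induct {n : ℕ} {p : (S.tens (n + 1)).carrier → Prop}
    (hc : ∀ u x, p (S.cons n u x)) (h0 : p 0) (ha : ∀ x y, p x → p y → p (x + y)) (z) : p z := by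
  obtain ⟨z, rfl⟩ := (balRel S.tL (S.tens n).act).mkQ_surjective z
  induction z using TensorProduct.induction_on with
  | zero => rw [map_zero]; exact h0
  | tmul x y => exact hc x y
  | add x y hx hy => rw [map_add]; exact ha _ _ hx hy

theorem tensOp_hom_ext {n : ℕ} {f g : (S.tensOp (n + 1)).carrier →ₗ[k] P}
    (h : ∀ u x, f (S.consOp n u x) = g (S.consOp n u x)) : f = g :=
  BalTensor.ext h

theorem tens_isBal {n : ℕ} (f : (S.tens (n + 1)).carrier →ₗ[k] P) :
    IsBal k S.tL (S.tens n).act (fun u x => f (S.cons n u x)) :=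
  IsBal.of_linear (ρ := S.tL) (l := (S.tens n).act) f

theorem cons_bal (n : ℕ) (a : A) (u : U) (x : (S.tens n).carrier) :
    S.cons n (S.t (MulOpposite.op a) * u) x = S.cons n u ((S.tens n).act a x) :=
  btmul_bal (ρ := S.tL) (l := (S.tens n).act) a u x

theorem consOp_bal (n : ℕ) (a : A) (u : U) (x : (S.tensOp n).carrier) :
    S.consOp n (u * S.t (MulOpposite.op a)) x = S.consOp n u ((S.tensOp n).act a x) :=
  btmul_bal (ρ := S.tR) (l := (S.tensOp n).act) a u x

theorem act_cons (n : ℕ) (a : A) (u : U) (x : (S.tens n).carrier) :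
    (S.tens (n + 1)).act a (S.cons n u x) = S.cons n (S.s a * u) x :=
  BalTensor.map_btmul (ρ' := S.tL) (l' := (S.tens n).act) _ _ (S.sL_tL a)
    (id_intertwines (S.tens n).act) u x

theorem act_consOp (n : ℕ) (a : A) (u : U) (x : (S.tensOp n).carrier) :
    (S.tensOp (n + 1)).act a (S.consOp n u x) = S.consOp n (S.t (MulOpposite.op a) * u) x :=
  BalTensor.map_btmul (ρ' := S.tR) (l' := (S.tensOp n).act) _ _ (S.tL_tR a)
    (id_intertwines (S.tensOp n).act) u x

/-- The identification of `A` with the zeroth tensor power. -/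
def ofBase : A ≃ₗ[k] (S.tens 0).carrier := LinearEquiv.refl k A

/-- The identification of `A` with the zeroth tensor power over `Aᵒᵖ`. -/
def ofBaseOp : A ≃ₗ[k] (S.tensOp 0).carrier := LinearEquiv.refl k A

theorem act_zero (a b : A) : (S.tens 0).act a (S.ofBase b) = S.ofBase (a * b) := rfl

theorem tensR_cons (n : ℕ) (a : A) (u : U) (x : (S.tens n).carrier) :
    S.tensR (n + 1) a (S.cons n u x) = S.cons n u (S.tensR n a x) :=
  BalTensor.map_btmul (ρ := S.tL) (l := (S.tens n).act) (ρ' := S.tL) (l' := (S.tens n).act) _ _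
    (id_intertwines S.tL) (S.tensRAux n a).2 u x

theorem tensR_zero (a b : A) : S.tensR 0 a (S.ofBase b) = S.ofBase (b * a) := rfl

/-- The linear map on `U^{⊗_A (n+1)}` given by a balanced function. -/
def tensLift {n : ℕ} {F : U → (S.tens n).carrier → P} (h : IsBal k S.tL (S.tens n).act F) :
    (S.tens (n + 1)).carrier →ₗ[k] P := h.lift

@[simp] theorem tensLift_cons {n : ℕ} {F : U → (S.tens n).carrier → P}
    (h : IsBal k S.tL (S.tens n).act F) (u : U) (x : (S.tens n).carrier) :
    S.tensLift h (S.cons n u x) = F u x := h.lift_btmul u x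

/-- The linear map on `U^{⊗_{Aᵒᵖ} (n+1)}` given by a balanced function. -/
def tensOpLift {n : ℕ} {F : U → (S.tensOp n).carrier → P}
    (h : IsBal k S.tR (S.tensOp n).act F) : (S.tensOp (n + 1)).carrier →ₗ[k] P := h.lift

@[simp] theorem tensOpLift_consOp {n : ℕ} {F : U → (S.tensOp n).carrier → P}
    (h : IsBal k S.tR (S.tensOp n).act F) (u : U) (x : (S.tensOp n).carrier) :
    S.tensOpLift h (S.consOp n u x) = F u x := h.lift_btmul u x

/-- Left `A`-linear families of maps `U^{⊗_A n} → U^{⊗_A m}`. -/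
abbrev LinFam (V : Type*) [AddCommGroup V] [Module k V] (n m : ℕ) : Type _ :=
  {f : V →ₗ[k] (S.tens n).carrier →ₗ[k] (S.tens m).carrier //
    ∀ v a x, f v ((S.tens n).act a x) = (S.tens m).act a (f v x)}

/-- The map `(u | x) ↦ (u | f x)`. -/
def consMap {n m : ℕ} (f : (S.tens n).carrier →ₗ[k] (S.tens m).carrier)
    (hf : ∀ a x, f ((S.tens n).act a x) = (S.tens m).act a (f x)) :
    (S.tens (n + 1)).carrier →ₗ[k] (S.tens (m + 1)).carrier :=
  S.tensLift (F := fun v x => S.cons m v (f x))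
    { add_l := fun _ _ _ => by simp
      smul_l := fun _ _ _ => by simp
      add_r := fun _ _ _ => by simp
      smul_r := fun _ _ _ => by simp
      bal := fun a v x => by rw [hf, LinearMap.mulLeft_apply, cons_bal] }

@[simp] theorem consMap_cons {n m : ℕ} (f : (S.tens n).carrier →ₗ[k] (S.tens m).carrier)
    (hf : ∀ a x, f ((S.tens n).act a x) = (S.tens m).act a (f x)) (u : U) (x) :
    S.consMap f hf (S.cons n u x) = S.cons m u (f x) := by
  simp [consMap]

theorem consMap_act {n m : ℕ} (f : (S.tens n).carrier →ₗ[k] (S.tens m).carrier)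
    (hf : ∀ a x, f ((S.tens n).act a x) = (S.tens m).act a (f x)) (a : A) (z) :
    S.consMap f hf ((S.tens (n + 1)).act a z) = (S.tens (m + 1)).act a (S.consMap f hf z) := by
  induction z using S.tens_induct with
  | hc v x => rw [act_cons, consMap_cons, consMap_cons, act_cons]
  | h0 => simp
  | ha x y hx hy => simp only [map_add, hx, hy]

/-- The map `(u | x) ↦ (u | f v x)`, for a family of maps `f v`. -/
def consFam {V : Type*} [AddCommGroup V] [Module k V] {n m : ℕ} (f : S.LinFam (k := k) V n m) :
    S.LinFam (k := k) V (n + 1) (m + 1) :=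
  ⟨{ toFun := fun v => S.consMap (f.1 v) (f.2 v)
     map_add' := fun v w => S.tens_hom_ext fun u x => by simp
     map_smul' := fun c v => S.tens_hom_ext fun u x => by simp },
    fun v a x => S.consMap_act _ (f.2 v) a x⟩

/-- `(u, x) ↦ (x | u)`, for `n = 0`. -/
def snocBase : S.LinFam (k := k) U 0 1 :=
  ⟨LinearMap.mk₂ k (fun u x => S.cons 0 (S.s (S.ofBase.symm x) * u) (S.ofBase 1))
    (fun a b u => by simp [mul_add]) (fun c a u => by simp)
    (fun a u u' => by simp [add_mul]) (fun c a u => by simp), by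
      intro u a x
      obtain ⟨x, rfl⟩ := S.ofBase.surjective x
      rw [act_zero]
      simp [act_cons, mul_assoc]⟩

/-- `(u, x) ↦ (x | u)`, and its linearity for the left `A`-action. -/
def snocAux : (n : ℕ) → S.LinFam (k := k) U n (n + 1)
  | 0 => S.snocBase
  | n + 1 => S.consFam (snocAux n)

/-- `(x, u) ↦ (x | u)`. -/
def snoc (n : ℕ) : (S.tens n).carrier →ₗ[k] U →ₗ[k] (S.tens (n + 1)).carrier :=
  (S.snocAux n).1.flip

theorem snoc_act (n : ℕ) (a : A) (x : (S.tens n).carrier) (u : U) :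
    S.snoc n ((S.tens n).act a x) u = (S.tens (n + 1)).act a (S.snoc n x u) := (S.snocAux n).2 u a x

theorem snoc_zero (a : A) (u : U) :
    S.snoc 0 (S.ofBase a) u = S.cons 0 (S.s a * u) (S.ofBase 1) := by
  simp [snoc, snocAux, snocBase]

theorem snoc_cons (n : ℕ) (v : U) (x : (S.tens n).carrier) (u : U) :
    S.snoc (n + 1) (S.cons n v x) u = S.cons (n + 1) v (S.snoc n x u) := by
  exact S.consMap_cons ((S.snocAux n).1 u) ((S.snocAux n).2 u) v x

theorem snoc_tensR (n : ℕ) (a : A) (x : (S.tens n).carrier) (u : U) :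
    S.snoc n (S.tensR n a x) u = S.snoc n x (S.s a * u) := by
  induction n with
  | zero =>
    obtain ⟨x, rfl⟩ := S.ofBase.surjective x
    rw [tensR_zero, snoc_zero, snoc_zero, map_mul S.s, mul_assoc]
  | succ n ih =>
    induction x using S.tens_induct with
    | hc v x => rw [tensR_cons, snoc_cons, snoc_cons, ih]
    | h0 => simp
    | ha x y hx hy => simp only [map_add, LinearMap.add_apply, hx, hy]

theorem tensR_snoc (n : ℕ) (a : A) (x : (S.tens n).carrier) (u : U) :
    S.tensR (n + 1) a (S.snoc n x u) = S.snoc n x (S.t (MulOpposite.op a) * u) := by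
  induction n with
  | zero =>
    obtain ⟨x, rfl⟩ := S.ofBase.surjective x
    rw [snoc_zero, snoc_zero, tensR_cons, ← mul_assoc, S.comm, mul_assoc, cons_bal, tensR_zero,
      act_zero, one_mul, mul_one]
  | succ n ih =>
    induction x using S.tens_induct with
    | hc v x => rw [snoc_cons, snoc_cons, tensR_cons, ih]
    | h0 => simp
    | ha x y hx hy => simp only [map_add, LinearMap.add_apply, hx, hy]

/-- In degree one, (u | a) = (1 | t(a)u), so appending to elements of `A` already gives everything.
In higher degree the first entry is frozen and the induction hypothesis is applied to the rest. -/
theorem snoc_hom_ext {n : ℕ} {P : Type u} [AddCommGroup P] [Module k P]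
    {f g : (S.tens (n + 1)).carrier →ₗ[k] P}
    (h : ∀ x u, f (S.snoc n x u) = g (S.snoc n x u)) : f = g := by
  induction n with
  | zero =>
    refine S.tens_hom_ext fun u a => ?_
    obtain ⟨a, rfl⟩ := S.ofBase.surjective a
    have h1 : S.cons 0 u (S.ofBase a) = S.snoc 0 (S.ofBase 1) (S.t (MulOpposite.op a) * u) := by
      rw [snoc_zero, map_one, one_mul, cons_bal, act_zero, mul_one]
    rw [h1, h]
  | succ n ih =>
    refine S.tens_hom_ext fun u z => ?_
    have := ih (f := f ∘ₗ S.cons (n + 1) u) (g := g ∘ₗ S.cons (n + 1) u) fun x v => by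
      simp only [LinearMap.comp_apply, ← snoc_cons, h]
    exact LinearMap.congr_fun this z

/-- Functions balanced on `U^{⊗_A n} ⊗_A U` are functions on `U^{⊗_A (n+1)}`. -/
theorem exists_snoc_lift (n : ℕ) : ∀ {P : Type u} [AddCommGroup P] [Module k P]
    (f : (S.tens n).carrier →ₗ[k] U →ₗ[k] P), (∀ a x u, f (S.tensR n a x) u = f x (S.s a * u)) →
    ∃ F : (S.tens (n + 1)).carrier →ₗ[k] P, ∀ x u, F (S.snoc n x u) = f x u := by
  induction n with
  | zero =>
    intro P _ _ f hf
    -- Here (u | a) is read as the element 1 ∈ A followed by t(a)u.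
    refine ⟨S.tensLift (n := 0)
      (F := fun u a => f (S.ofBase 1) (S.t (MulOpposite.op (S.ofBase.symm a)) * u))
      { add_l := fun _ _ _ => by simp [mul_add]
        smul_l := fun _ _ _ => by simp
        add_r := fun _ _ _ => by simp [add_mul]
        smul_r := fun _ _ _ => by simp
        bal := fun a u b => by
          obtain ⟨b, rfl⟩ := S.ofBase.surjective b
          rw [act_zero]
          simp [mul_assoc] }, fun x u => ?_⟩
    obtain ⟨x, rfl⟩ := S.ofBase.surjective x
    rw [snoc_zero, tensLift_cons, LinearEquiv.symm_apply_apply, MulOpposite.op_one, map_one S.t,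
      one_mul, ← hf, tensR_zero, one_mul]
  | succ n ih =>
    intro P _ _ f hf
    -- The first entry is kept as a free variable by taking values in `U →ₗ[k] P`; this is why the
    -- target is quantified inside the induction.
    obtain ⟨F, hF⟩ := ih (P := U →ₗ[k] P) (LinearMap.mk₂ k
      (fun x u => (f.flip u) ∘ₗ (S.cons n).flip x)
      (fun _ _ _ => by ext; simp) (fun _ _ _ => by ext; simp)
      (fun _ _ _ => by ext; simp) (fun _ _ _ => by ext; simp)) (fun a x u => by
        ext v
        have := hf a (S.cons n v x) u
        rw [tensR_cons] at this
        simpa using this)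
    have hF' : ∀ x u v, F (S.snoc n x u) v = f (S.cons n v x) u := fun x u v => by
      rw [hF]; rfl
    refine ⟨S.tensLift (n := n + 1) (F := fun u z => F z u)
      { add_l := fun _ _ _ => by simp
        smul_l := fun _ _ _ => by simp
        add_r := fun _ _ _ => by simp
        smul_r := fun _ _ _ => by simp
        bal := fun a u z => by
          have : (F.flip (S.t (MulOpposite.op a) * u)) = F.flip u ∘ₗ (S.tens (n + 1)).act a :=
            S.snoc_hom_ext fun x v => by
              simp only [LinearMap.flip_apply, LinearMap.comp_apply, ← snoc_act, hF', cons_bal]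
          exact LinearMap.congr_fun this z }, fun x u => ?_⟩
    induction x using S.tens_induct with
    | hc v x => rw [snoc_cons, tensLift_cons, hF']
    | h0 => simp
    | ha x y hx hy => simp only [map_add, LinearMap.add_apply, hx, hy]

end AeRing

namespace LeftBialgebroid

variable (B : LeftBialgebroid k A U)

theorem diagPre_eq {X : OpMod k A} (D : B.CompatAct X) (w : B.UU) (v : U) (x : X.carrier) :
    B.diagPre X D w (v ⊗ₜ[k] x) = bsum w (fun p q => btmul B.tL X.act (p * v) (D.1 q x)) := by
  have h : (B.diagPre X D).flip (v ⊗ₜ[k] x) w = _ := linear_eq_bsum _ w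
  rw [LinearMap.flip_apply] at h
  rw [h]
  simp only [LinearMap.flip_apply, diagPre_btmul]

theorem diag_cons (n : ℕ) (u v : U) (x : (B.tens n).carrier) :
    B.diag (n + 1) u (B.cons n v x) = B.sw u (fun p q => B.cons n (p * v) (B.diag n q x)) :=
  B.diagPre_eq (B.diagAux n) (B.Δ u) v x

theorem diag_zero (u : U) (a : A) : B.diag 0 u (B.ofBase a) = B.ofBase (B.ε (u * B.s a)) := rfl

theorem diag_isBal (n : ℕ) (v : U) (x : (B.tens n).carrier) :
    IsBal k B.tL B.sL (fun p q => B.cons n (p * v) (B.diag n q x)) where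
  add_l _ _ _ := by simp [add_mul]
  smul_l _ _ _ := by simp
  add_r _ _ _ := by simp
  smul_r _ _ _ := by simp
  bal a p q := by simp [mul_assoc, AeRing.cons_bal, diag_s_mul]

theorem diag_isBal' (n : ℕ) {F : U → (B.tens n).carrier → P} (v : U) (x : (B.tens n).carrier)
    (h : IsBal k B.tL (B.tens n).act F) :
    IsBal k B.tL B.sL (fun p q => F (p * v) (B.diag n q x)) where
  add_l _ _ _ := by simp [add_mul, h.add_l]
  smul_l _ _ _ := by simp [h.smul_l]
  add_r _ _ _ := by simp [h.add_r]
  smul_r _ _ _ := by simp [h.smul_r]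
  bal a p q := by
    have := h.bal a (p * v) (B.diag n q x)
    simpa [mul_assoc, diag_s_mul] using this

theorem diag_one (n : ℕ) (x : (B.tens n).carrier) : B.diag n 1 x = x := by
  induction n with
  | zero =>
    obtain ⟨x, rfl⟩ := B.ofBase.surjective x
    rw [diag_zero, one_mul, counit_s]
  | succ n ih =>
    induction x using B.tens_induct with
    | hc v x => rw [diag_cons, sw_one (B.diag_isBal n v x), one_mul, ih]
    | h0 => simp
    | ha x y hx hy => simp only [map_add, hx, hy]

/-- In degree zero this is ε(uu') = ε(u s(ε(u'))); in higher degree it is multiplicativity of Δ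
followed by an exchange of sums. -/
theorem diag_mul (n : ℕ) (u u' : U) (x : (B.tens n).carrier) :
    B.diag n (u * u') x = B.diag n u (B.diag n u' x) := by
  induction n generalizing u u' with
  | zero =>
    obtain ⟨x, rfl⟩ := B.ofBase.surjective x
    rw [diag_zero, diag_zero, diag_zero, mul_assoc, counit_mul_s]
  | succ n ih =>
    induction x using B.tens_induct with
    | hc v x =>
      rw [diag_cons, sw_mul (B.diag_isBal n v x), diag_cons, map_bsum]
      simp only [diag_cons, mul_assoc, ih]
      exact bsum_comm _ _ _
    | h0 => simp
    | ha x y hx hy => simp only [map_add, hx, hy]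

theorem diag_s (n : ℕ) (a : A) (x : (B.tens n).carrier) :
    B.diag n (B.s a) x = (B.tens n).act a x := by
  have := B.diag_s_mul n a 1 x
  rwa [mul_one, diag_one] at this

/-- Since Δ(t(a)) = 1 ⊗ t(a), the element t(a) travels through all factors to the last one. Together
with `diag_s` this makes every U-linear map on a tensor power linear for both outer A-actions. -/
theorem diag_t (n : ℕ) (a : A) (x : (B.tens n).carrier) :
    B.diag n (B.t (MulOpposite.op a)) x = B.tensR n a x := by
  induction n with
  | zero =>
    obtain ⟨x, rfl⟩ := B.ofBase.surjective x
    rw [diag_zero, counit_t_mul, counit_s, AeRing.tensR_zero]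
  | succ n ih =>
    induction x using B.tens_induct with
    | hc v x =>
      have h := sw_t_mul (B.diag_isBal n v x) a 1
      rw [mul_one] at h
      rw [diag_cons, h, sw_one, AeRing.tensR_cons, one_mul, mul_one, ih]
      have h1 := B.diag_isBal n v x
      exact { add_l := fun _ _ _ => h1.add_l .., smul_l := fun _ _ _ => h1.smul_l ..
              add_r := fun _ _ _ => by simp [mul_add]
              smul_r := fun _ _ _ => by simp
              bal := fun b m n' => by
                have := h1.bal b m (B.t (MulOpposite.op a) * n')
                simp only [LinearMap.mulLeft_apply, ← mul_assoc, B.comm] at this ⊢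
                exact this }
    | h0 => simp
    | ha x y hx hy => simp only [map_add, hx, hy]

theorem isBal3_diag_cons (n : ℕ) (g : (B.tens (n + 2)).carrier →ₗ[k] P) (v w : U)
    (x : (B.tens n).carrier) :
    B.IsBal3 (fun p q r => g (B.cons (n + 1) (p * v) (B.cons n (q * w) (B.diag n r x)))) where
  add₁ _ _ _ _ := by simp [add_mul]
  smul₁ _ _ _ _ := by simp
  add₂ _ _ _ _ := by simp [add_mul]
  smul₂ _ _ _ _ := by simp
  add₃ _ _ _ _ := by simp
  smul₃ _ _ _ _ := by simp
  bal₁ _ _ _ _ := by simp [mul_assoc, AeRing.cons_bal, AeRing.act_cons]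
  bal₂ _ _ _ _ := by simp [mul_assoc, AeRing.cons_bal, diag_s_mul]

theorem isBal_snoc (n : ℕ) (g : (B.tens (n + 1)).carrier →ₗ[k] P) (x : (B.tens n).carrier) (v : U) :
    IsBal k B.tL B.sL (fun p q => g (B.snoc n (B.diag n p x) (q * v))) where
  add_l _ _ _ := by simp
  smul_l _ _ _ := by simp
  add_r _ _ _ := by simp [add_mul]
  smul_r _ _ _ := by simp
  bal a p q := by
    simp [mul_assoc, diag_mul, diag_t, AeRing.snoc_tensR]

/-- The diagonal action is built by splitting off the first entry; coassociativity allows the last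
entry to be split off instead. In the base case both sides reduce to u s(x) v by the two counit
laws. -/
theorem diag_snoc (n : ℕ) (u : U) (x : (B.tens n).carrier) (v : U) :
    B.diag (n + 1) u (B.snoc n x v) = B.sw u (fun p q => B.snoc n (B.diag n p x) (q * v)) := by
  induction n generalizing u with
  | zero =>
    obtain ⟨x, rfl⟩ := B.ofBase.surjective x
    rw [AeRing.snoc_zero, diag_cons]
    have h1 : ∀ q : U, B.diag 0 q (B.ofBase 1) = B.ofBase (B.ε q * 1) := fun q => by
      rw [diag_zero]; simp
    -- The terminal factor `A` contributes ε(q), which balancing moves to the left as t(ε(q))p, the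
    -- shape of the right counit law.
    have h2 : ∀ p q : U, B.cons 0 (p * (B.s x * v)) (B.diag 0 q (B.ofBase 1)) =
        B.cons 0 ((B.t (MulOpposite.op (B.ε q)) * p) * (B.s x * v)) (B.ofBase 1) := by
      intro p q
      rw [h1, mul_assoc, AeRing.cons_bal, AeRing.act_zero]
    have h3 : ∀ p q : U, B.snoc 0 (B.diag 0 p (B.ofBase x)) (q * v) =
        B.cons 0 ((B.s (B.ε (p * B.s x)) * q) * v) (B.ofBase 1) := by
      intro p q
      rw [diag_zero, AeRing.snoc_zero, mul_assoc]
    have hb : IsBal k B.tL B.sL (fun p q : U => B.s (B.ε p) * q) :=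
      { add_l := fun _ _ _ => by simp [add_mul]
        smul_l := fun _ _ _ => by simp
        add_r := fun _ _ _ => by simp [mul_add]
        smul_r := fun _ _ _ => by simp
        bal := fun a p q => by simp [counit_t_mul, mul_assoc] }
    simp only [h2, h3]
    have e1 := map_bsum ((B.cons 0).flip (B.ofBase 1) ∘ₗ LinearMap.mulRight k (B.s x * v)) (B.Δ u)
      (fun p q => B.t (MulOpposite.op (B.ε q)) * p)
    have e2 := map_bsum ((B.cons 0).flip (B.ofBase 1) ∘ₗ LinearMap.mulRight k v) (B.Δ u)
      (fun p q => B.s (B.ε (p * B.s x)) * q)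
    simp only [LinearMap.comp_apply, LinearMap.flip_apply, LinearMap.mulRight_apply] at e1 e2
    rw [sw, sw, ← e1, ← e2]
    have h4 := B.sw_counit_right u
    have h5 := B.sw_counit_left (u * B.s x)
    rw [sw_mul_s hb] at h5
    simp only [sw] at h4 h5
    rw [h4, h5, mul_assoc]
  | succ n ih =>
    induction x using B.tens_induct with
    | hc w x =>
      simp only [AeRing.snoc_cons, diag_cons, ih]
      have h : B.IsBal3 (fun p q r => B.cons (n + 1) (p * w) (B.snoc n (B.diag n q x) (r * v))) :=
        { add₁ := fun _ _ _ _ => by simp [add_mul]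
          smul₁ := fun _ _ _ _ => by simp
          add₂ := fun _ _ _ _ => by simp
          smul₂ := fun _ _ _ _ => by simp
          add₃ := fun _ _ _ _ => by simp [add_mul]
          smul₃ := fun _ _ _ _ => by simp
          bal₁ := fun _ _ _ _ => by
            simp [mul_assoc, AeRing.cons_bal, diag_s_mul, AeRing.snoc_act]
          bal₂ := fun _ _ _ _ => by
            simp [mul_assoc, diag_mul, diag_t, AeRing.snoc_tensR] }
      have h6 : ∀ p q, B.snoc (n + 1) (B.sw p fun a b => B.cons n (a * w) (B.diag n b x)) (q * v) =
          B.sw p (fun a b => B.cons (n + 1) (a * w) (B.snoc n (B.diag n b x) (q * v))) := by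
        intro p q
        have := map_bsum ((B.snoc (n + 1)).flip (q * v)) (B.Δ p)
          (fun a b => B.cons n (a * w) (B.diag n b x))
        simpa only [LinearMap.flip_apply, AeRing.snoc_cons] using this
      simp only [h6]
      simp only [map_bsum]
      exact h.coassoc u |>.symm
    | h0 => simp [bsum]
    | ha x y hx hy => simp only [map_add, LinearMap.add_apply, hx, hy, ← bsum_add_fun]

end LeftBialgebroid
end Tens

/-! ### The operators ε and Δ on single entries -/

section Cosimplicial

variable {k : Type v} [CommRing k] {A U : Type u} [Ring A] [Algebra k A] [Ring U] [Algebra k U]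
  {P : Type*} [AddCommGroup P] [Module k P]

namespace LeftBialgebroid

variable (B : LeftBialgebroid k A U)

/-- Left `A`-linear maps `U^{⊗_A n} → U^{⊗_A m}`. -/
abbrev LMap (n m : ℕ) : Type _ :=
  {f : (B.tens n).carrier →ₗ[k] (B.tens m).carrier //
    ∀ a x, f ((B.tens n).act a x) = (B.tens m).act a (f x)}

/-- The map `(u | x) ↦ (u | f x)`. -/
def LMap.cons {B : LeftBialgebroid k A U} {n m : ℕ} (f : B.LMap n m) : B.LMap (n + 1) (m + 1) :=
  ⟨B.consMap f.1 f.2, B.consMap_act f.1 f.2⟩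

/-- `(u | x) ↦ ε(u) x`. -/
def epsZero (n : ℕ) : B.LMap (n + 1) n :=
  ⟨B.tensLift (F := fun u x => B.diag n (B.s (B.ε u)) x)
    { add_l := fun _ _ _ => by simp
      smul_l := fun _ _ _ => by simp
      add_r := fun _ _ _ => by simp
      smul_r := fun _ _ _ => by simp
      bal := fun a u x => by
        rw [LinearMap.mulLeft_apply, counit_t_mul, map_mul, diag_mul, B.diag_s n a] },
    fun a z => by
      induction z using B.tens_induct with
      | hc v x =>
        rw [AeRing.act_cons, AeRing.tensLift_cons, AeRing.tensLift_cons, counit_s_mul, map_mul,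
          diag_s_mul]
      | h0 => simp
      | ha x y hx hy => simp only [map_add, hx, hy]⟩

/-- `(u¹ | ⋯) ↦ (⋯ | ε(uʲ⁺¹) | ⋯)`. -/
def eps : (n j : ℕ) → B.LMap (n + 1) n
  | n, 0 => B.epsZero n
  | 0, _ + 1 => B.epsZero 0
  | n + 1, j + 1 => (eps n j).cons

theorem isBal_consCons (n : ℕ) (g : (B.tens (n + 2)).carrier →ₗ[k] P) (x : (B.tens n).carrier) :
    IsBal k B.tL B.sL (fun p q => g (B.cons (n + 1) p (B.cons n q x))) where
  add_l _ _ _ := by simp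
  smul_l _ _ _ := by simp
  add_r _ _ _ := by simp
  smul_r _ _ _ := by simp
  bal _ _ _ := by simp [AeRing.cons_bal, AeRing.act_cons]

/-- `(u | x) ↦ (Δ u | x)`. -/
noncomputable def dlZero (n : ℕ) : B.LMap (n + 1) (n + 2) :=
  ⟨B.tensLift (F := fun u x => B.sw u (fun p q => B.cons (n + 1) p (B.cons n q x)))
    { add_l := fun _ _ x => sw_add (B.isBal_consCons n LinearMap.id x) _ _
      smul_l := fun _ _ x => sw_smul (B.isBal_consCons n LinearMap.id x) _ _
      add_r := fun _ _ _ => by simp [bsum_add_fun]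
      smul_r := fun _ _ _ => by simp [bsum_smul_fun]
      bal := fun a u x => by
        refine (sw_t_mul (B.isBal_consCons n LinearMap.id x) a u).trans ?_
        simp only [LinearMap.id_apply, AeRing.cons_bal] },
    fun a z => by
      induction z using B.tens_induct with
      | hc v x =>
        rw [AeRing.act_cons, AeRing.tensLift_cons, AeRing.tensLift_cons, map_bsum]
        refine (sw_s_mul (B.isBal_consCons n LinearMap.id x) a v).trans ?_
        simp only [LinearMap.id_apply, AeRing.act_cons]
      | h0 => simp
      | ha x y hx hy => simp only [map_add, hx, hy]⟩

/-- `(u¹ | ⋯) ↦ (⋯ | Δ uʲ⁺¹ | ⋯)`. -/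
noncomputable def dl : (n j : ℕ) → B.LMap (n + 1) (n + 2)
  | n, 0 => B.dlZero n
  | 0, _ + 1 => B.dlZero 0
  | n + 1, j + 1 => (dl n j).cons

theorem eps_zero_cons (n : ℕ) (u : U) (x : (B.tens n).carrier) :
    (B.eps n 0).1 (B.cons n u x) = B.diag n (B.s (B.ε u)) x := by
  have h : ((B.epsZero n).1) (B.cons n u x) = B.diag n (B.s (B.ε u)) x := by
    simp only [epsZero, AeRing.tensLift_cons]
  cases n <;> exact h

theorem eps_succ_cons (n j : ℕ) (u : U) (x : (B.tens (n + 1)).carrier) :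
    (B.eps (n + 1) (j + 1)).1 (B.cons (n + 1) u x) = B.cons n u ((B.eps n j).1 x) :=
  B.consMap_cons _ (B.eps n j).2 _ _

theorem dl_zero_cons (n : ℕ) (u : U) (x : (B.tens n).carrier) :
    (B.dl n 0).1 (B.cons n u x) = B.sw u (fun p q => B.cons (n + 1) p (B.cons n q x)) := by
  have h : ((B.dlZero n).1) (B.cons n u x) =
      B.sw u (fun p q => B.cons (n + 1) p (B.cons n q x)) := by
    simp only [dlZero, AeRing.tensLift_cons]
  cases n <;> exact h

theorem dl_succ_cons (n j : ℕ) (u : U) (x : (B.tens (n + 1)).carrier) :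
    (B.dl (n + 1) (j + 1)).1 (B.cons (n + 1) u x) = B.cons (n + 2) u ((B.dl n j).1 x) :=
  B.consMap_cons _ (B.dl n j).2 _ _

theorem LMap.diag_s {B : LeftBialgebroid k A U} {n m : ℕ} (f : B.LMap n m) (a : A) (x) :
    f.1 (B.diag n (B.s a) x) = B.diag m (B.s a) (f.1 x) := by
  rw [B.diag_s, B.diag_s, f.2]

/-! ### The cosimplicial identities -/

/-- This and the following identities are proved by peeling off first entries: positive indices pass
to the tail, and when an index is zero the first entries alone decide. Left A-linearity of the
operators lets ε of the first entry slide past the other operator. -/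
theorem eps_eps (n i j : ℕ) (h : i ≤ j) (hj : j ≤ n) (z : (B.tens (n + 2)).carrier) :
    (B.eps n i).1 ((B.eps (n + 1) (j + 1)).1 z) = (B.eps n j).1 ((B.eps (n + 1) i).1 z) := by
  induction n generalizing i j with
  | zero =>
    obtain rfl : j = 0 := by omega
    obtain rfl : i = 0 := by omega
    induction z using B.tens_induct with
    | hc u x => rw [eps_succ_cons, eps_zero_cons, eps_zero_cons, LMap.diag_s]
    | h0 => simp
    | ha x y hx hy => simp only [map_add, hx, hy]
  | succ n ih =>
    induction z using B.tens_induct with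
    | hc u x =>
      rw [eps_succ_cons]
      obtain _ | i := i
      · rw [eps_zero_cons, eps_zero_cons, LMap.diag_s]
      · obtain _ | j := j
        · omega
        · rw [eps_succ_cons, eps_succ_cons, eps_succ_cons, ih i j (by omega) (by omega)]
    | h0 => simp
    | ha x y hx hy => simp only [map_add, hx, hy]

/-- The only case with content is i = j = 0, which is coassociativity. -/
theorem dl_dl (n i j : ℕ) (h : i ≤ j) (hj : j ≤ n) (z : (B.tens (n + 1)).carrier) :
    (B.dl (n + 1) i).1 ((B.dl n j).1 z) = (B.dl (n + 1) (j + 1)).1 ((B.dl n i).1 z) := by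
  induction n generalizing i j with
  | zero =>
    obtain rfl : j = 0 := by omega
    obtain rfl : i = 0 := by omega
    induction z using B.tens_induct with
    | hc u x =>
      simp only [dl_zero_cons, map_bsum, dl_succ_cons]
      exact IsBal3.coassoc (F := fun p q r => B.cons 2 p (B.cons 1 q (B.cons 0 r x)))
        (by constructor <;> simp [AeRing.cons_bal, AeRing.act_cons]) u
    | h0 => simp
    | ha x y hx hy => simp only [map_add, hx, hy]
  | succ n ih =>
    induction z using B.tens_induct with
    | hc u x =>
      obtain _ | i := i
      · obtain _ | j := j
        · simp only [dl_zero_cons, map_bsum, dl_succ_cons]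
          exact IsBal3.coassoc
            (F := fun p q r => B.cons (n + 3) p (B.cons (n + 2) q (B.cons (n + 1) r x)))
            (by constructor <;> simp [AeRing.cons_bal, AeRing.act_cons]) u
        · simp only [dl_zero_cons, map_bsum, dl_succ_cons]
      · obtain _ | j := j
        · omega
        · rw [dl_succ_cons, dl_succ_cons, dl_succ_cons, dl_succ_cons, ih i j (by omega) (by omega)]
    | h0 => simp
    | ha x y hx hy => simp only [map_add, hx, hy]

theorem dl_eps (n i j : ℕ) (h : i ≤ j) (hj : j ≤ n) (z : (B.tens (n + 2)).carrier) :
    (B.eps (n + 2) i).1 ((B.dl (n + 1) (j + 1)).1 z) = (B.dl n j).1 ((B.eps (n + 1) i).1 z) := by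
  induction n generalizing i j with
  | zero =>
    obtain rfl : j = 0 := by omega
    obtain rfl : i = 0 := by omega
    induction z using B.tens_induct with
    | hc u x => rw [dl_succ_cons, eps_zero_cons, eps_zero_cons, LMap.diag_s]
    | h0 => simp
    | ha x y hx hy => simp only [map_add, hx, hy]
  | succ n ih =>
    induction z using B.tens_induct with
    | hc u x =>
      rw [dl_succ_cons]
      obtain _ | i := i
      · rw [eps_zero_cons, eps_zero_cons, LMap.diag_s]
      · obtain _ | j := j
        · omega
        · rw [eps_succ_cons, eps_succ_cons, dl_succ_cons, ih i j (by omega) (by omega)]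
    | h0 => simp
    | ha x y hx hy => simp only [map_add, hx, hy]

/-- At index zero this is the left counit law; its companion `eps_dl_succ` is the right one, with
ε(q) moved back to the preceding entry by balancing. -/
theorem eps_dl_self (n i : ℕ) (hi : i ≤ n) (z : (B.tens (n + 1)).carrier) :
    (B.eps (n + 1) i).1 ((B.dl n i).1 z) = z := by
  induction n generalizing i with
  | zero =>
    obtain rfl : i = 0 := by omega
    induction z using B.tens_induct with
    | hc u x =>
      simp only [dl_zero_cons, map_bsum, eps_zero_cons, diag_s, AeRing.act_cons]
      conv_rhs => rw [← B.sw_counit_left u]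
      exact (map_bsum ((B.cons 0).flip x) _ _).symm
    | h0 => simp
    | ha x y hx hy => simp only [map_add, hx, hy]
  | succ n ih =>
    induction z using B.tens_induct with
    | hc u x =>
      obtain _ | i := i
      · simp only [dl_zero_cons, map_bsum, eps_zero_cons, diag_s, AeRing.act_cons]
        conv_rhs => rw [← B.sw_counit_left u]
        exact (map_bsum ((B.cons (n + 1)).flip x) _ _).symm
      · rw [dl_succ_cons, eps_succ_cons, ih i (by omega)]
    | h0 => simp
    | ha x y hx hy => simp only [map_add, hx, hy]

theorem eps_dl_succ (n i : ℕ) (hi : i ≤ n) (z : (B.tens (n + 1)).carrier) :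
    (B.eps (n + 1) (i + 1)).1 ((B.dl n i).1 z) = z := by
  induction n generalizing i with
  | zero =>
    obtain rfl : i = 0 := by omega
    induction z using B.tens_induct with
    | hc u x =>
      simp only [dl_zero_cons, map_bsum, eps_succ_cons, eps_zero_cons, diag_s, ← AeRing.cons_bal]
      conv_rhs => rw [← B.sw_counit_right u]
      exact (map_bsum ((B.cons 0).flip x) _ _).symm
    | h0 => simp
    | ha x y hx hy => simp only [map_add, hx, hy]
  | succ n ih =>
    induction z using B.tens_induct with
    | hc u x =>
      obtain _ | i := i
      · simp only [dl_zero_cons, map_bsum, eps_succ_cons, eps_zero_cons, diag_s,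
          ← AeRing.cons_bal]
        conv_rhs => rw [← B.sw_counit_right u]
        exact (map_bsum ((B.cons (n + 1)).flip x) _ _).symm
      · rw [dl_succ_cons, eps_succ_cons, ih i (by omega)]
    | h0 => simp
    | ha x y hx hy => simp only [map_add, hx, hy]

theorem eps_dl_gt (n i j : ℕ) (h : j < i) (hi : i ≤ n + 1) (z : (B.tens (n + 2)).carrier) :
    (B.eps (n + 2) (i + 1)).1 ((B.dl (n + 1) j).1 z) = (B.dl n j).1 ((B.eps (n + 1) i).1 z) := by
  obtain _ | i := i
  · omega
  induction n generalizing i j with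
  | zero =>
    obtain rfl : j = 0 := by omega
    obtain rfl : i = 0 := by omega
    induction z using B.tens_induct with
    | hc u x => simp only [dl_zero_cons, map_bsum, eps_succ_cons]
    | h0 => simp
    | ha x y hx hy => simp only [map_add, hx, hy]
  | succ n ih =>
    induction z using B.tens_induct with
    | hc u x =>
      obtain _ | j := j
      · simp only [dl_zero_cons, map_bsum, eps_succ_cons]
      · obtain _ | i := i
        · omega
        · rw [dl_succ_cons, eps_succ_cons, eps_succ_cons, dl_succ_cons,
            ih _ _ _ (by omega) (by omega)]
    | h0 => simp
    | ha x y hx hy => simp only [map_add, hx, hy]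

/-! ### Compatibility with the last entry -/

theorem eps_snoc (n i : ℕ) (hi : i ≤ n) (z : (B.tens (n + 1)).carrier) (u : U) :
    (B.eps (n + 1) i).1 (B.snoc (n + 1) z u) = B.snoc n ((B.eps n i).1 z) u := by
  induction n generalizing i with
  | zero =>
    obtain rfl : i = 0 := by omega
    induction z using B.tens_induct with
    | hc v x => rw [AeRing.snoc_cons, eps_zero_cons, eps_zero_cons, diag_s, diag_s, AeRing.snoc_act]
    | h0 => simp
    | ha x y hx hy => simp only [map_add, LinearMap.add_apply, hx, hy]
  | succ n ih =>
    induction z using B.tens_induct with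
    | hc v x =>
      rw [AeRing.snoc_cons]
      obtain _ | i := i
      · rw [eps_zero_cons, eps_zero_cons, diag_s, diag_s, AeRing.snoc_act]
      · rw [eps_succ_cons, eps_succ_cons, AeRing.snoc_cons, ih i (by omega)]
    | h0 => simp
    | ha x y hx hy => simp only [map_add, LinearMap.add_apply, hx, hy]

theorem eps_last_snoc (n : ℕ) (x : (B.tens n).carrier) (u : U) :
    (B.eps n n).1 (B.snoc n x u) = B.tensR n (B.ε u) x := by
  induction n with
  | zero =>
    obtain ⟨x, rfl⟩ := B.ofBase.surjective x
    rw [AeRing.snoc_zero, eps_zero_cons, diag_s, AeRing.act_zero, AeRing.tensR_zero, counit_s_mul,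
      mul_one]
  | succ n ih =>
    induction x using B.tens_induct with
    | hc v x => rw [AeRing.snoc_cons, eps_succ_cons, ih, AeRing.tensR_cons]
    | h0 => simp
    | ha x y hx hy => simp only [map_add, LinearMap.add_apply, hx, hy]

theorem dl_snoc (n i : ℕ) (hi : i ≤ n) (z : (B.tens (n + 1)).carrier) (u : U) :
    (B.dl (n + 1) i).1 (B.snoc (n + 1) z u) = B.snoc (n + 2) ((B.dl n i).1 z) u := by
  have key : ∀ m (v : U) (x : (B.tens m).carrier),
      (B.dl (m + 1) 0).1 (B.snoc (m + 1) (B.cons m v x) u) =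
        B.snoc (m + 2) ((B.dl m 0).1 (B.cons m v x)) u := by
    intro m v x
    rw [AeRing.snoc_cons, dl_zero_cons, dl_zero_cons]
    refine Eq.trans ?_ (map_bsum ((B.snoc (m + 2)).flip u) _ _).symm
    simp only [LinearMap.flip_apply, AeRing.snoc_cons]
  induction n generalizing i with
  | zero =>
    obtain rfl : i = 0 := by omega
    induction z using B.tens_induct with
    | hc v x => exact key 0 v x
    | h0 => simp
    | ha x y hx hy => simp only [map_add, LinearMap.add_apply, hx, hy]
  | succ n ih =>
    induction z using B.tens_induct with
    | hc v x =>
      obtain _ | i := i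
      · exact key (n + 1) v x
      · rw [AeRing.snoc_cons, dl_succ_cons, dl_succ_cons, AeRing.snoc_cons, ih i (by omega)]
    | h0 => simp
    | ha x y hx hy => simp only [map_add, LinearMap.add_apply, hx, hy]

theorem dl_last_snoc (n : ℕ) (x : (B.tens n).carrier) (u : U) :
    (B.dl n n).1 (B.snoc n x u) = B.sw u (fun p q => B.snoc (n + 1) (B.snoc n x p) q) := by
  induction n with
  | zero =>
    obtain ⟨x, rfl⟩ := B.ofBase.surjective x
    have hb : IsBal k B.tL B.sL (fun p q => B.cons 1 p (B.cons 0 q (B.ofBase 1))) :=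
      B.isBal_consCons 0 LinearMap.id (B.ofBase 1)
    rw [AeRing.snoc_zero, dl_zero_cons, sw_s_mul hb]
    simp only [AeRing.snoc_zero, AeRing.snoc_cons, map_one, one_mul]
  | succ n ih =>
    induction x using B.tens_induct with
    | hc v x =>
      rw [AeRing.snoc_cons, dl_succ_cons, ih, map_bsum]
      simp only [AeRing.snoc_cons]
    | h0 => simp [bsum]
    | ha x y hx hy => simp only [map_add, LinearMap.add_apply, hx, hy, ← bsum_add_fun]

/-! ### `U`-linearity -/

/-- At the first entry, ε(pv) = ε(p s(ε(v))), so the claim is the left counit law for the element u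
s(ε(v)). U-linearity is what lets these operators act on Hom_U. -/
theorem diag_eps (n i : ℕ) (hi : i ≤ n) (u : U) (z : (B.tens (n + 1)).carrier) :
    B.diag n u ((B.eps n i).1 z) = (B.eps n i).1 (B.diag (n + 1) u z) := by
  have key : ∀ m (u v : U) (x : (B.tens m).carrier),
      B.diag m u ((B.eps m 0).1 (B.cons m v x)) =
        (B.eps m 0).1 (B.diag (m + 1) u (B.cons m v x)) := by
    intro m u v x
    rw [eps_zero_cons, diag_cons, map_bsum, ← diag_mul]
    have h := B.sw_counit_left (u * B.s (B.ε v))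
    rw [sw_mul_s] at h
    · rw [← h, map_bsum]
      have h1 : ∀ m (z : B.UU) (F : U → U → Module.End k (B.tens m).carrier) (x),
          bsum z F x = bsum z (fun p q => F p q x) :=
        fun m z F x => map_bsum (LinearMap.applyₗ (R := k) x) z F
      rw [h1]
      simp only [eps_zero_cons, B.counit_mul_s _ v, diag_mul]
    · constructor <;> intros <;> simp [add_mul, mul_add, counit_t_mul, mul_assoc]
  induction n generalizing i u with
  | zero =>
    obtain rfl : i = 0 := by omega
    induction z using B.tens_induct with
    | hc v x => exact key 0 u v x
    | h0 => simp
    | ha x y hx hy => simp only [map_add, hx, hy]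
  | succ n ih =>
    induction z using B.tens_induct with
    | hc v x =>
      obtain _ | i := i
      · exact key (n + 1) u v x
      · simp only [diag_cons, eps_succ_cons, map_bsum, ih i (by omega)]
    | h0 => simp
    | ha x y hx hy => simp only [map_add, hx, hy]

/-- At the first entry one side splits the second leg of u and the other side splits Δ(pv). They
agree by multiplicativity of Δ and coassociativity of u. -/
theorem diag_dl (n i : ℕ) (hi : i ≤ n) (u : U) (z : (B.tens (n + 1)).carrier) :
    B.diag (n + 2) u ((B.dl n i).1 z) = (B.dl n i).1 (B.diag (n + 1) u z) := by
  have key : ∀ m (u v : U) (x : (B.tens m).carrier),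
      B.diag (m + 2) u ((B.dl m 0).1 (B.cons m v x)) =
        (B.dl m 0).1 (B.diag (m + 1) u (B.cons m v x)) := by
    intro m u v x
    have e1 : ∀ p q : U, (B.dl m 0).1 (B.cons m (p * v) (B.diag m q x)) =
        B.sw p (fun a b => B.sw v (fun a' b' =>
          B.cons (m + 1) (a * a') (B.cons m (b * b') (B.diag m q x)))) := fun p q => by
      rw [dl_zero_cons]
      exact sw_mul (B.isBal_consCons m LinearMap.id _) p v
    have e2 : ∀ p q : U, B.diag (m + 2) u (B.cons (m + 1) p (B.cons m q x)) =
        B.sw u (fun a b => B.sw b (fun c d =>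
          B.cons (m + 1) (a * p) (B.cons m (c * q) (B.diag m d x)))) := fun p q => by
      rw [diag_cons]
      simp only [diag_cons, map_bsum]
    rw [dl_zero_cons, diag_cons, map_bsum, map_bsum]
    simp only [e1, e2]
    have e3 : ∀ p q : U, B.sw u (fun a b => B.sw b (fun c d =>
          B.cons (m + 1) (a * p) (B.cons m (c * q) (B.diag m d x)))) =
        B.sw u (fun a b => B.sw a (fun c d =>
          B.cons (m + 1) (c * p) (B.cons m (d * q) (B.diag m b x)))) := fun p q =>
      ((B.isBal3_diag_cons m LinearMap.id p q x).coassoc u).symm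
    simp only [e3]
    have e4 := bsum_comm (B.Δ v) (B.Δ u) (fun p q a b => B.sw a (fun c d =>
      B.cons (m + 1) (c * p) (B.cons m (d * q) (B.diag m b x))))
    rw [e4]
    congr 1; funext a b
    exact bsum_comm _ _ _
  induction n generalizing i u with
  | zero =>
    obtain rfl : i = 0 := by omega
    induction z using B.tens_induct with
    | hc v x => exact key 0 u v x
    | h0 => simp
    | ha x y hx hy => simp only [map_add, hx, hy]
  | succ n ih =>
    induction z using B.tens_induct with
    | hc v x =>
      obtain _ | i := i
      · exact key (n + 1) u v x
      · simp only [diag_cons, dl_succ_cons, map_bsum, ih i (by omega)]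
    | h0 => simp
    | ha x y hx hy => simp only [map_add, hx, hy]

end LeftBialgebroid
end Cosimplicial

/-! ### Contraaction, translation maps and the aYD condition -/

section Gamma

variable {k : Type v} [CommRing k] {A U : Type u} [Ring A] [Algebra k A] [Ring U] [Algebra k U]
  {B : LeftBialgebroid k A U}
  {M : Type u} [AddCommGroup M] [Module k M] [Module U M] [IsScalarTower k U M]

section Rel

variable {γ : HomRight B.toAeRing M B.tL →ₗ[k] M}

theorem GammaRel.of (f : HomRight B.toAeRing M B.tL) : GammaRel γ (fun u => f.1 u) (γ f) :=
  ⟨f, fun _ => rfl, rfl⟩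

/-- Values determine the element of the Hom space. Identities between values of γ are proved
throughout by exhibiting both sides as γ of the same function. -/
theorem GammaRel.unique {F : U → M} {m m' : M} (h : GammaRel γ F m) (h' : GammaRel γ F m') :
    m = m' := by
  obtain ⟨f, hf, rfl⟩ := h
  obtain ⟨g, hg, rfl⟩ := h'
  exact congrArg γ (Subtype.ext (LinearMap.ext fun u => (hf u).trans (hg u).symm))

theorem GammaRel.congr {F G : U → M} {m : M} (h : GammaRel γ F m) (e : ∀ u, F u = G u) :
    GammaRel γ G m := by
  rwa [← funext e]

theorem GammaRel.add {F G : U → M} {m m' : M} (h : GammaRel γ F m) (h' : GammaRel γ G m') :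
    GammaRel γ (fun u => F u + G u) (m + m') := by
  obtain ⟨f, hf, rfl⟩ := h
  obtain ⟨g, hg, rfl⟩ := h'
  exact ⟨f + g, fun u => by simp only [← hf, ← hg]; rfl, map_add _ _ _⟩

theorem GammaRel.zero : GammaRel γ (fun _ => (0 : M)) 0 :=
  ⟨0, fun _ => rfl, map_zero _⟩

theorem GammaRel.sum {ι : Type*} (s : Finset ι) {F : ι → U → M} {m : ι → M}
    (h : ∀ i, GammaRel γ (F i) (m i)) :
    GammaRel γ (fun u => ∑ i ∈ s, F i u) (∑ i ∈ s, m i) := by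
  classical
  induction s using Finset.induction_on with
  | empty => simpa using GammaRel.zero
  | insert a s ha ih => simpa [Finset.sum_insert ha] using (h a).add ih

theorem GammaRel.bsum {R X Y : Type*} [AddCommGroup X] [Module k X] [AddCommGroup Y] [Module k Y]
    {ρ : R → Module.End k X} {l : R → Module.End k Y} (z : BalTensor ρ l) {F : X → Y → U → M}
    {m : X → Y → M} (h : ∀ x y, GammaRel γ (F x y) (m x y)) :
    GammaRel γ (fun u => bsum z (fun x y => F x y u)) (bsum z m) :=
  GammaRel.sum _ fun _ => h _ _

end Rel

theorem evalL_eq (F : HomRight B.toAeRing M B.tL) (z : B.UUl) :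
    LeftBialgebroid.evalL F z = bsum z (fun x y => x • F.1 y) := lift_eq_bsum _ _ _

theorem evalR_eq (F : HomLeft B.toAeRing M B.sL) (z : B.UUr) :
    LeftBialgebroid.evalR F z = bsum z (fun x y => x • F.1 y) := lift_eq_bsum _ _ _

theorem galoisL_btmul (u v : U) : B.galoisL (btmul B.tR B.tL u v) = B.mulSnd v (B.Δ u) :=
  BalTensor.lift_btmul _ _ _ _

theorem galoisR_btmul (u v : U) : B.galoisR (btmul B.sR B.sL u v) = B.mulFst v (B.Δ u) :=
  BalTensor.lift_btmul _ _ _ _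

theorem LeftBialgebroid.IsLeftHopf.galois_transl (hl : B.IsLeftHopf) (u : U) :
    B.galoisL (hl.transl u) = btmul B.tL B.sL u 1 :=
  (LinearEquiv.ofBijective B.galoisL hl).apply_symm_apply _

theorem LeftBialgebroid.IsRightHopf.galois_transl (hr : B.IsRightHopf) (u : U) :
    B.galoisR (hr.transl u) = btmul B.tL B.sL 1 u :=
  (LinearEquiv.ofBijective B.galoisR hr).apply_symm_apply _

theorem LeftBialgebroid.IsLeftHopf.transl_one (hl : B.IsLeftHopf) : hl.transl 1 = btmul B.tR B.tL 1 1 := by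
  apply hl.1
  rw [hl.galois_transl, galoisL_btmul, B.comul_one, B.mulSnd_btmul, mul_one]

/-- `F(u₊₍₁₎, u₊₍₂₎ u₋) = F(u, 1)`. -/
theorem LeftBialgebroid.IsLeftHopf.bsum_transl (hl : B.IsLeftHopf) {P : Type*} [AddCommGroup P] [Module k P]
    {F : U → U → P} (h : IsBal k B.tL B.sL F) (u : U) :
    bsum (hl.transl u) (fun y z => B.sw y (fun p q => F p (q * z))) = F u 1 := by
  have := congrArg h.lift (hl.galois_transl u)
  rw [h.lift_btmul] at this
  rw [← this]
  conv_rhs => rw [← bsum_btmul_eq (hl.transl u)]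
  simp only [map_bsum, galoisL_btmul, LeftBialgebroid.mulSnd]
  simp only [← h.bsum_eq, h.bsum_map]
  rfl

/-- `F(u₍₊₎₍₁₎ u₍₋₎, u₍₊₎₍₂₎) = F(1, u)`. -/
theorem LeftBialgebroid.IsRightHopf.bsum_transl (hr : B.IsRightHopf) {P : Type*} [AddCommGroup P] [Module k P]
    {F : U → U → P} (h : IsBal k B.tL B.sL F) (u : U) :
    bsum (hr.transl u) (fun y z => B.sw y (fun p q => F (p * z) q)) = F 1 u := by
  have := congrArg h.lift (hr.galois_transl u)
  rw [h.lift_btmul] at this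
  rw [← this]
  conv_rhs => rw [← bsum_btmul_eq (hr.transl u)]
  simp only [map_bsum, galoisR_btmul, LeftBialgebroid.mulFst]
  simp only [← h.bsum_eq, h.bsum_map]
  rfl

variable {hl : B.IsLeftHopf} {c : Contraaction B M}

theorem IsAYD.compat_bsum (hM : IsAYD hl c) (u : U) (f : HomRight B.toAeRing M B.tL) :
    GammaRel c.γ (fun v => B.sw u (fun p q =>
      bsum (hl.transl q) (fun y z => y • f.1 (z * (v * p))))) (u • c.γ f) := by
  obtain ⟨m, p, q, hpq, hs⟩ := bsum_exists (P := M) (B.Δ u)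
  refine (hM.compat u f m p q hpq).congr fun v => ?_
  simp only [LeftBialgebroid.sw, hs, evalL_eq]
  rfl

theorem isBal_smul (f : HomRight B.toAeRing M B.tL) : IsBal k B.tR B.tL (fun y z => y • f.1 z) where
  add_l _ _ _ := add_smul _ _ _
  smul_l _ _ _ := smul_assoc _ _ _
  add_r _ _ _ := by simp
  smul_r _ _ _ := by rw [map_smul, smul_comm]
  bal a y z := by rw [f.2, LinearMap.mulRight_apply, mul_smul]

/-- Contraassociativity: `γ(u ↦ γ(v ↦ G u v)) = γ(u ↦ G u₍₁₎ u₍₂₎)`. -/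
theorem Contraaction.gamma_gamma (c : Contraaction B M) {G : U → U → M} (hG : IsBal k B.tL B.sL G)
    (hG' : ∀ a u v, G u (B.t (MulOpposite.op a) * v) = B.t (MulOpposite.op a) • G u v)
    {H : U → M} {m : M} (h₁ : ∀ u, GammaRel c.γ (G u) (H u)) (h₂ : GammaRel c.γ H m) :
    GammaRel c.γ (fun u => B.sw u G) m := by
  -- The axiom supplies its own inner function `h`; uniqueness identifies it with the given `H`.
  obtain ⟨h, hh, hm⟩ := c.assoc ⟨hG.lift, fun a z => by
    obtain ⟨z, rfl⟩ := (balRel B.tL B.sL).mkQ_surjective z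
    induction z using TensorProduct.induction_on with
    | zero => simp
    | tmul x y =>
      rw [LeftBialgebroid.mkQ_tmul, AeRing.rUU, BalTensor.map_btmul, hG.lift_btmul, hG.lift_btmul]
      exact hG' _ _ _
    | add x y hx hy => simp only [map_add, hx, hy, smul_add]⟩
  have hH : ∀ u, h.1 u = H u := fun u =>
    (hh u).unique ((h₁ u).congr fun v => (hG.lift_btmul u v).symm)
  have : c.γ h = m := by
    obtain ⟨g, hg, rfl⟩ := h₂
    exact congrArg c.γ (Subtype.ext (LinearMap.ext fun u => (hH u).trans (hg u).symm))
  rw [← this]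
  exact hm.congr fun u => (hG.bsum_eq _).symm

/-- The Takeuchi condition replaces s(a) on the second leg by t(a) on the first, after which the
right counit law applies. -/
theorem sw_counit_right_mul_s (a : A) (u : U) :
    B.sw u (fun p q => B.t (MulOpposite.op (B.ε (q * B.s a))) * p) =
      u * B.t (MulOpposite.op a) := by
  have hb : IsBal k B.tL B.sL (fun p q => B.t (MulOpposite.op (B.ε q)) * p) := by
    constructor <;> intros <;>
      simp [add_mul, mul_add, LeftBialgebroid.counit_s_mul, mul_assoc]
  rw [← LeftBialgebroid.sw_takeuchi hb]
  simp only [← mul_assoc]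
  conv_rhs => rw [← B.sw_counit_right u]
  exact (map_bsum (LinearMap.mulRight k (B.t (MulOpposite.op a))) _ _).symm

/-- `γ(f(- t(a))) = γ(s(a) f(-))`. -/
theorem IsAYD.gamma_mul_t (hM : IsAYD hl c) (a : A) (f : HomRight B.toAeRing M B.tL) {m : M}
    (h : GammaRel c.γ (fun u => B.s a • f.1 u) m) :
    GammaRel c.γ (fun u => f.1 (u * B.t (MulOpposite.op a))) m := by
  -- Contraassociativity is applied to G(u, v) = f(u) ε(v s(a)). Its inner γ is the left action of a
  -- on f(u), and the composite with Δ is f(u t(a)) by the preceding counit identity.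
  have hG : IsBal k B.tL B.sL
      (fun u v => B.t (MulOpposite.op (B.ε (v * B.s a))) • f.1 u) := by
    constructor <;> intros
    · simp
    · rw [map_smul, smul_comm]
    · simp [add_mul, add_smul]
    · simp
    · rw [f.2, LinearMap.mulLeft_apply, mul_assoc, LeftBialgebroid.counit_s_mul, MulOpposite.op_mul,
        map_mul B.t, mul_smul]
  refine (c.gamma_gamma hG (fun b u v => ?_) (fun u => hM.left_act a (f.1 u)) h).congr fun u => ?_
  · rw [mul_assoc, LeftBialgebroid.counit_t_mul, MulOpposite.op_mul, map_mul B.t, mul_smul]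
  · rw [← sw_counit_right_mul_s, map_bsum]
    congr 1; funext p q
    exact (f.2 _ _).symm

end Gamma

/-! ### Diagonally U-linear maps and their rotation -/

section Trace

variable {k : Type v} [CommRing k] {A U : Type u} [Ring A] [Algebra k A] [Ring U] [Algebra k U]
  (B : LeftBialgebroid k A U)
  (M : Type u) [AddCommGroup M] [Module k M] [Module U M] [IsScalarTower k U M]

/-- `Hom_U(U^{⊗_A (n+1)}, M)`, for the diagonal action. -/
def DiagHom (n : ℕ) : Submodule k ((B.tens (n + 1)).carrier →ₗ[k] M) where
  carrier := {φ | ∀ u x, φ (B.diag (n + 1) u x) = u • φ x}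
  add_mem' := by
    intro f g hf hg u x
    simp only [LinearMap.add_apply, smul_add]
    rw [hf u x, hg u x]
  zero_mem' := by intro u x; simp
  smul_mem' := by
    intro c f hf u x
    simp only [LinearMap.smul_apply]
    rw [hf u x, smul_comm c]

variable {B M}

theorem DiagHom.map_diag {n : ℕ} (φ : DiagHom B M n) (u : U) (x) :
    φ.1 (B.diag (n + 1) u x) = u • φ.1 x := φ.2 u x

theorem DiagHom.map_act {n : ℕ} (φ : DiagHom B M n) (a : A) (x) :
    φ.1 ((B.tens (n + 1)).act a x) = B.s a • φ.1 x := by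
  rw [← B.diag_s, φ.2]

theorem DiagHom.map_tensR {n : ℕ} (φ : DiagHom B M n) (a : A) (x) :
    φ.1 (B.tensR (n + 1) a x) = B.t (MulOpposite.op a) • φ.1 x := by
  rw [← B.diag_t, φ.2]

/-- `v ↦ φ(x | v u)`. -/
def DiagHom.slice {n : ℕ} (φ : DiagHom B M n) (x : (B.tens n).carrier) (u : U) :
    HomRight B.toAeRing M B.tL :=
  ⟨φ.1 ∘ₗ B.snoc n x ∘ₗ LinearMap.mulRight k u, fun a v => by
    simp only [LinearMap.comp_apply, LinearMap.mulRight_apply, LinearMap.mulLeft_apply, mul_assoc]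
    rw [← AeRing.tensR_snoc, DiagHom.map_tensR φ]⟩

theorem DiagHom.slice_apply {n : ℕ} (φ : DiagHom B M n) (x : (B.tens n).carrier) (u v : U) :
    (DiagHom.slice φ x u).1 v = φ.1 (B.snoc n x (v * u)) := rfl

variable {hl : B.IsLeftHopf} {c : Contraaction B M} (hM : IsAYD hl c)

/-- The balancing relation is where the two left A-actions must agree: φ(ax | vu) = a φ(x | vu), and
under γ the left action of a can be traded for multiplication of v by t(a) on the right
(`IsAYD.gamma_mul_t`). -/
theorem DiagHom.isBal_gamma (hM : IsAYD hl c) {n : ℕ} (φ : DiagHom B M n) :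
    IsBal k B.tL (B.tens n).act (fun u x => c.γ (DiagHom.slice φ x u)) where
  add_l u u' x := by
    rw [← map_add]
    congr 1
    exact Subtype.ext (LinearMap.ext fun v => by simp [DiagHom.slice_apply, mul_add])
  smul_l r u x := by
    rw [← map_smul]
    congr 1
    exact Subtype.ext (LinearMap.ext fun v => by simp [DiagHom.slice_apply])
  add_r u x x' := by
    rw [← map_add]
    congr 1
    exact Subtype.ext (LinearMap.ext fun v => by simp [DiagHom.slice_apply])
  smul_r r u x := by
    rw [← map_smul]
    congr 1
    exact Subtype.ext (LinearMap.ext fun v => by simp [DiagHom.slice_apply])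
  bal a u x := by
    have h1 : GammaRel c.γ (fun v => B.s a • (DiagHom.slice φ x 1).1 (v * u))
        (c.γ (DiagHom.slice φ ((B.tens n).act a x) u)) :=
      (GammaRel.of _).congr fun v => by
        rw [slice_apply, AeRing.snoc_act, DiagHom.map_act, slice_apply, mul_one]
    have h2 : GammaRel c.γ (fun v => B.s a • (DiagHom.slice φ x u).1 v)
        (c.γ (DiagHom.slice φ ((B.tens n).act a x) u)) :=
      h1.congr fun v => by simp [slice_apply]
    refine GammaRel.unique (F := fun v => (DiagHom.slice φ x u).1 (v * B.t (MulOpposite.op a)))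
      ((GammaRel.of _).congr fun v => ?_) (hM.gamma_mul_t a _ h2)
    simp [slice_apply, mul_assoc]

/-- The cyclic operator `(T φ)(u | x) = γ(v ↦ φ(x | v u))`. -/
def DiagHom.rot (hM : IsAYD hl c) (n : ℕ) : DiagHom B M n →ₗ[k] DiagHom B M n where
  toFun φ := ⟨B.tensLift (DiagHom.isBal_gamma hM φ), fun u z => by
    induction z using B.tens_induct with
    | hc w x =>
      rw [B.diag_cons, map_bsum]
      simp only [AeRing.tensLift_cons]
      -- With p ⊗ q = Δu, compatibility produces q₊ φ(x | q₋vpw). U-linearity moves q₊ inside as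
      -- (q₊₍₁₎x | q₊₍₂₎q₋vpw), and the translation identity contracts this to (qx | vpw).
      refine GammaRel.unique (GammaRel.bsum _ fun p q => GammaRel.of _)
        ((hM.compat_bsum u (DiagHom.slice φ x w)).congr fun v => ?_)
      congr 1; funext p q
      simp only [slice_apply]
      have := hl.bsum_transl (B.isBal_snoc n φ.1 x (v * p * w)) q
      rw [one_mul] at this
      rw [← mul_assoc, ← this]
      congr 1; funext y z
      rw [← DiagHom.map_diag φ, B.diag_snoc, map_bsum]
      simp only [mul_assoc]
    | h0 => simp
    | ha x y hx hy => simp only [map_add, hx, hy, smul_add]⟩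
  map_add' φ ψ := Subtype.ext (B.tens_hom_ext fun u x => by
    simp only [AeRing.tensLift_cons, Submodule.coe_add, LinearMap.add_apply]
    rw [← map_add]
    congr 1)
  map_smul' r φ := Subtype.ext (B.tens_hom_ext fun u x => by
    simp only [AeRing.tensLift_cons, Submodule.coe_smul, LinearMap.smul_apply, RingHom.id_apply]
    rw [← map_smul]
    congr 1)

theorem DiagHom.rot_cons {n : ℕ} (φ : DiagHom B M n) (u : U) (x : (B.tens n).carrier) :
    GammaRel c.γ (fun v => φ.1 (B.snoc n x (v * u))) ((DiagHom.rot hM n φ).1 (B.cons n u x)) := by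
  have e : (DiagHom.rot hM n φ).1 (B.cons n u x) = c.γ (DiagHom.slice φ x u) := by
    simp only [rot, LinearMap.coe_mk, AddHom.coe_mk, AeRing.tensLift_cons]
  rw [e]
  exact GammaRel.of (DiagHom.slice φ x u)

end Trace

/-! ### Words of varying length, and the order of the rotation -/

section Words

variable {k : Type v} [CommRing k] {A U : Type u} [Ring A] [Algebra k A] [Ring U] [Algebra k U]
  (B : LeftBialgebroid k A U)
  {M : Type u} [AddCommGroup M] [Module k M] [Module U M] [IsScalarTower k U M]

/-- Elements of the tensor powers of `U`, of any degree. -/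
abbrev Word : Type _ := Σ n, (B.tens n).carrier

variable {B}

/-- `(u | x)` for `x` of any degree. -/
def Word.cons (u : U) (X : Word B) : Word B := ⟨X.1 + 1, B.cons X.1 u X.2⟩

/-- `(x | u)` for `x` of any degree. -/
def Word.snoc (X : Word B) (u : U) : Word B := ⟨X.1 + 1, B.snoc X.1 X.2 u⟩

/-- `(u¹ | ⋯ | uʳ | x)`. -/
def Word.app (l : List U) (X : Word B) : Word B := l.foldr Word.cons X

/-- `(x | u¹ | ⋯ | uʳ)`. -/
def Word.rsn (l : List U) (X : Word B) : Word B := l.foldl Word.snoc X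

/-- The value of a graded family of linear maps. -/
def Word.eval (Φ : ∀ m, (B.tens m).carrier →ₗ[k] M) (X : Word B) : M := Φ X.1 X.2

theorem Word.snoc_cons (u v : U) (X : Word B) :
    Word.snoc (Word.cons u X) v = Word.cons u (Word.snoc X v) := by
  obtain ⟨n, x⟩ := X
  exact congrArg (Sigma.mk (n + 1 + 1)) (AeRing.snoc_cons ..)

theorem Word.rsn_cons (l : List U) (u : U) (X : Word B) :
    Word.rsn l (Word.cons u X) = Word.cons u (Word.rsn l X) := by
  induction l generalizing X with
  | nil => rfl
  | cons a l ih =>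
    change Word.rsn l (Word.snoc (Word.cons u X) a) = Word.cons u (Word.rsn l (Word.snoc X a))
    rw [Word.snoc_cons, ih]

theorem Word.rsn_concat (l : List U) (u : U) (X : Word B) :
    Word.rsn (l ++ [u]) X = Word.snoc (Word.rsn l X) u := by
  simp [Word.rsn]

theorem Word.app_concat (l : List U) (u : U) (X : Word B) :
    Word.app (l ++ [u]) X = Word.app l (Word.cons u X) := by
  simp [Word.app]

theorem Word.rsn_fst (l : List U) (X : Word B) : (Word.rsn l X).1 = X.1 + l.length := by
  induction l generalizing X with
  | nil => rfl
  | cons a l ih =>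
    refine (ih (Word.snoc X a)).trans ?_
    simp only [Word.snoc, List.length_cons]; omega

theorem Word.rsn_one (l : List U) :
    Word.rsn l (⟨0, B.ofBase 1⟩ : Word B) = Word.app l ⟨0, B.ofBase 1⟩ := by
  induction l with
  | nil => rfl
  | cons a l ih =>
    have h : Word.snoc (⟨0, B.ofBase 1⟩ : Word B) a = Word.cons a ⟨0, B.ofBase 1⟩ := by
      simp only [Word.snoc, Word.cons, AeRing.snoc_zero, map_one, one_mul]
    change Word.rsn l (Word.snoc _ a) = Word.cons a _
    rw [h, Word.rsn_cons, ih]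
    rfl

/-- Only linearity in `x` is needed later. Stating it as existence of a linear map avoids any
transport along the equality of degrees. -/
theorem Word.eval_app (l : List U) (j : ℕ) (Φ : ∀ m, (B.tens m).carrier →ₗ[k] M) :
    ∃ L : (B.tens j).carrier →ₗ[k] M, ∀ x, Word.eval Φ (Word.app l ⟨j, x⟩) = L x := by
  induction l generalizing Φ with
  | nil => exact ⟨Φ j, fun x => rfl⟩
  | cons a l ih => exact ih fun m => Φ (m + 1) ∘ₗ B.cons m a

theorem Word.eval_rsn (l : List U) (j : ℕ) (Φ : ∀ m, (B.tens m).carrier →ₗ[k] M) :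
    ∃ L : (B.tens j).carrier →ₗ[k] M, ∀ x, Word.eval Φ (Word.rsn l ⟨j, x⟩) = L x := by
  induction l generalizing j with
  | nil => exact ⟨Φ j, fun x => rfl⟩
  | cons a l ih =>
    obtain ⟨L, hL⟩ := ih (j + 1)
    exact ⟨L ∘ₗ (B.snoc j).flip a, fun x => hL (B.snoc j x a)⟩

theorem Word.app_tensR (l : List U) (j : ℕ) (a : A) (x : (B.tens j).carrier) :
    Word.app l (⟨j, B.tensR j a x⟩ : Word B) =
      ⟨(Word.app l ⟨j, x⟩ : Word B).1, B.tensR _ a (Word.app l ⟨j, x⟩ : Word B).2⟩ := by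
  induction l with
  | nil => rfl
  | cons b l ih =>
    change Word.cons b (Word.app l _) = _
    rw [ih]
    exact congrArg (Sigma.mk _) (AeRing.tensR_cons ..).symm

theorem Word.rsn_act (l : List U) (a : A) (X : Word B) :
    Word.rsn l (⟨X.1, (B.tens X.1).act a X.2⟩ : Word B) =
      ⟨(Word.rsn l X).1, (B.tens _).act a (Word.rsn l X).2⟩ := by
  induction l generalizing X with
  | nil => rfl
  | cons b l ih =>
    refine Eq.trans ?_ (ih (Word.snoc X b))
    exact congrArg (fun z => Word.rsn l ⟨X.1 + 1, z⟩) (AeRing.snoc_act ..)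

/-- The extension by zero of `φ` to all degrees. -/
noncomputable def DiagHom.extend {n : ℕ} (φ : DiagHom B M n) (m : ℕ) :
    (B.tens m).carrier →ₗ[k] M :=
  if h : m = n + 1 then h ▸ φ.1 else 0

theorem DiagHom.extend_self {n : ℕ} (φ : DiagHom B M n) : DiagHom.extend φ (n + 1) = φ.1 := by
  simp [extend]

theorem DiagHom.extend_diag {n : ℕ} (φ : DiagHom B M n) (m : ℕ) (u : U) (x) :
    DiagHom.extend φ m (B.diag m u x) = u • DiagHom.extend φ m x := by
  by_cases h : m = n + 1
  · subst h
    rw [extend_self, map_diag]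
  · simp [extend, h]

variable {hl : B.IsLeftHopf} {c : Contraaction B M}

/-- This says (Tʲφ)(x | l) = γ(v ↦ φ(l | v·x)) for x of length j. Each further rotation moves one
more entry of x to the end behind its own γ, and contraassociativity merges the two contraactions
into one diagonal action. For j = 0 the element x lies in A, and the formula is the agreement of the
two left A-actions. -/
theorem DiagHom.rot_pow_aux (hM : IsAYD hl c) {n : ℕ} (φ : DiagHom B M n) (j : ℕ)
    (l : List U) (h : j + l.length = n + 1) (x : (B.tens j).carrier) :
    GammaRel c.γ
      (fun v => Word.eval (DiagHom.extend φ) (Word.app l ⟨j, B.diag j v x⟩))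
      (Word.eval (DiagHom.extend ((DiagHom.rot hM n ^ j) φ)) (Word.rsn l ⟨j, x⟩)) := by
  induction j generalizing l with
  | zero =>
    obtain ⟨a, rfl⟩ := B.ofBase.surjective x
    have h1 : ∀ v, Word.eval (DiagHom.extend φ) (Word.app l ⟨0, B.diag 0 v (B.ofBase a)⟩) =
        B.t (MulOpposite.op (B.ε (v * B.s a))) •
          Word.eval (DiagHom.extend φ) (Word.app l ⟨0, B.ofBase 1⟩) := by
      intro v
      have e : B.diag 0 v (B.ofBase a) = B.tensR 0 (B.ε (v * B.s a)) (B.ofBase 1) := by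
        rw [B.diag_zero, AeRing.tensR_zero, one_mul]
      rw [e, Word.app_tensR]
      simp only [Word.eval]
      rw [← B.diag_t, extend_diag]
    have h2 : Word.eval (DiagHom.extend φ) (Word.rsn l ⟨0, B.ofBase a⟩) =
        B.s a • Word.eval (DiagHom.extend φ) (Word.app l ⟨0, B.ofBase 1⟩) := by
      have := Word.rsn_act l a (⟨0, B.ofBase 1⟩ : Word B)
      simp only [AeRing.act_zero, mul_one] at this
      rw [this, ← Word.rsn_one]
      simp only [Word.eval]
      rw [← B.diag_s, extend_diag]
    rw [pow_zero, Module.End.one_apply, h2]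
    exact (hM.left_act a _).congr fun v => (h1 v).symm
  | succ j ih =>
    obtain ⟨L, hL⟩ := Word.eval_app l (j + 1) (DiagHom.extend φ)
    obtain ⟨K, hK⟩ := Word.eval_rsn l (j + 1) (DiagHom.extend ((DiagHom.rot hM n ^ (j + 1)) φ))
    rw [hK]
    simp only [hL]
    induction x using B.tens_induct with
    | h0 => simpa using GammaRel.zero
    | ha x y hx hy => simpa using hx.add hy
    | hc u x =>
      have hLR : ∀ a y, L (B.tensR (j + 1) a y) = B.t (MulOpposite.op a) • L y := by
        intro a y
        rw [← hL, ← hL, Word.app_tensR]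
        simp only [Word.eval]
        rw [← B.diag_t, extend_diag]
      have hG := B.diag_isBal' j (F := fun w y => L (B.cons j w y)) u x (B.tens_isBal L)
      -- One rotation is unfolded: the value of Tʲ⁺¹φ at (u | x | l) is γ of w ↦ (Tʲφ)(x | l | wu).
      have hH : GammaRel c.γ
          (fun w => Word.eval (DiagHom.extend ((DiagHom.rot hM n ^ j) φ))
            (Word.rsn (l ++ [w * u]) ⟨j, x⟩)) (K (B.cons j u x)) := by
        rw [← hK]
        have e1 : Word.rsn l ⟨j + 1, B.cons j u x⟩ = Word.cons u (Word.rsn l ⟨j, x⟩) :=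
          Word.rsn_cons l u ⟨j, x⟩
        have e2 : (Word.rsn l (⟨j, x⟩ : Word B)).1 = n := by
          rw [Word.rsn_fst]; simp only; omega
        rw [e1]
        simp only [Word.rsn_concat]
        generalize Word.rsn l (⟨j, x⟩ : Word B) = Z at e2
        obtain ⟨m, z⟩ := Z
        obtain rfl : m = n := e2
        simp only [Word.eval, Word.cons, Word.snoc, extend_self]
        rw [pow_succ', Module.End.mul_apply]
        exact rot_cons hM _ u z
      refine (c.gamma_gamma hG (fun a w v => ?_) (fun w => ?_) hH).congr fun v => ?_
      · rw [B.diag_mul, B.diag_t, ← AeRing.tensR_cons, hLR]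
      · refine (ih (l ++ [w * u]) (by simp; omega) x).congr fun v => ?_
        rw [Word.app_concat, ← hL]
        rfl
      · rw [B.diag_cons, map_bsum]

/-- The cyclic operator has order dividing `n + 1`. -/
theorem DiagHom.rot_pow (hM : IsAYD hl c) (hst : IsStable c) (n : ℕ) :
    (DiagHom.rot hM n : Module.End k (DiagHom B M n)) ^ (n + 1) = 1 := by
  refine LinearMap.ext fun φ => Subtype.ext (LinearMap.ext fun x => ?_)
  -- With nothing left to append, T^{n+1}φ at x is γ(v ↦ φ(v·x)) = γ(v ↦ vφ(x)), which stability
  -- evaluates to φ(x).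
  have h := DiagHom.rot_pow_aux hM φ (n + 1) [] (by simp) x
  simp only [Word.rsn, Word.app, List.foldl_nil, List.foldr_nil, Word.eval, extend_self] at h
  exact h.unique ((hst (φ.1 x)).congr fun v => (map_diag φ v x).symm)

end Words

/-! ### Cocyclic modules and their duals through the inverse cyclic operator -/

section Rotational

variable {k : Type v} [CommRing k]
  {X : ℕ → Type u} [∀ n, AddCommGroup (X n)] [∀ n, Module k (X n)]
  {Y : ℕ → Type u} [∀ n, AddCommGroup (Y n)] [∀ n, Module k (Y n)]

/-- A cocyclic module, presented through the inverse `T` of its cocyclic operator. -/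
structure IsRotational (δ : ∀ n, Fin (n + 2) → X n →ₗ[k] X (n + 1))
    (σ : ∀ n, Fin (n + 1) → X (n + 1) →ₗ[k] X n) (T : ∀ n, X n →ₗ[k] X n) : Prop where
  δ_δ : ∀ n (i j : Fin (n + 2)), i ≤ j →
    δ (n + 1) j.succ ∘ₗ δ n i = δ (n + 1) i.castSucc ∘ₗ δ n j
  σ_σ : ∀ n (i j : Fin (n + 1)), i ≤ j →
    σ n j ∘ₗ σ (n + 1) i.castSucc = σ n i ∘ₗ σ (n + 1) j.succ
  σ_δ_lt : ∀ n (i : Fin (n + 2)) (j : Fin (n + 1)), i ≤ j.castSucc →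
    σ (n + 1) j.succ ∘ₗ δ (n + 1) i.castSucc = δ n i ∘ₗ σ n j
  σ_δ_self : ∀ n (i : Fin (n + 1)), σ n i ∘ₗ δ n i.castSucc = LinearMap.id
  σ_δ_succ : ∀ n (i : Fin (n + 1)), σ n i ∘ₗ δ n i.succ = LinearMap.id
  σ_δ_gt : ∀ n (i : Fin (n + 2)) (j : Fin (n + 1)), j.castSucc < i →
    σ (n + 1) j.castSucc ∘ₗ δ (n + 1) i.succ = δ n i ∘ₗ σ n j
  T_δ : ∀ n (i : Fin (n + 1)), T (n + 1) ∘ₗ δ n i.castSucc = δ n i.succ ∘ₗ T n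
  T_δ_last : ∀ n, T (n + 1) ∘ₗ δ n (Fin.last (n + 1)) = δ n 0
  T_σ : ∀ n (i : Fin n), T n ∘ₗ σ n i.castSucc = σ n i.succ ∘ₗ T (n + 1)
  T_σ_last : ∀ n, T n ∘ₗ σ n (Fin.last n) = σ n 0 ∘ₗ T (n + 1) ∘ₗ T (n + 1)
  T_pow : ∀ n, (T n : Module.End k (X n)) ^ (n + 1) = 1

/-- The inverse of an operator `t` with `t ^ (n + 1) = 1`. -/
def powInv (T : ∀ n, X n →ₗ[k] X n) (n : ℕ) : X n →ₗ[k] X n := (T n : Module.End k (X n)) ^ n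

namespace IsRotational

variable {δ : ∀ n, Fin (n + 2) → X n →ₗ[k] X (n + 1)}
  {σ : ∀ n, Fin (n + 1) → X (n + 1) →ₗ[k] X n} {T : ∀ n, X n →ₗ[k] X n}

theorem T_inv (h : IsRotational δ σ T) (n : ℕ) (x : X n) : T n (powInv T n x) = x := by
  have := LinearMap.congr_fun (h.T_pow n) x
  rwa [pow_succ'] at this

theorem inv_T (h : IsRotational δ σ T) (n : ℕ) (x : X n) : powInv T n (T n x) = x := by
  have := LinearMap.congr_fun (h.T_pow n) x
  rwa [pow_succ] at this

theorem cocyclic (h : IsRotational δ σ T) : IsCocyclicModule δ σ (powInv T) where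
  δ_δ := h.δ_δ
  σ_σ := h.σ_σ
  σ_δ_lt := h.σ_δ_lt
  σ_δ_self := h.σ_δ_self
  σ_δ_succ := h.σ_δ_succ
  σ_δ_gt := h.σ_δ_gt
  τ_δ n i := LinearMap.ext fun x => by
    have := LinearMap.congr_fun (h.T_δ n i) (powInv T n x)
    simp only [LinearMap.comp_apply, h.T_inv] at this ⊢
    rw [← this, h.inv_T]
  τ_δ_zero n := LinearMap.ext fun x => by
    have := LinearMap.congr_fun (h.T_δ_last n) x
    simp only [LinearMap.comp_apply] at this ⊢
    rw [← this, h.inv_T]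
  τ_σ n i := LinearMap.ext fun x => by
    have := LinearMap.congr_fun (h.T_σ n i) (powInv T (n + 1) x)
    simp only [LinearMap.comp_apply, h.T_inv] at this ⊢
    rw [← this, h.inv_T]
  τ_σ_zero n := LinearMap.ext fun x => by
    have := LinearMap.congr_fun (h.T_σ_last n) (powInv T (n + 1) (powInv T (n + 1) x))
    simp only [LinearMap.comp_apply, h.T_inv] at this ⊢
    rw [← this, h.inv_T]
  τ_pow n := by
    change ((T n : Module.End k (X n)) ^ n) ^ (n + 1) = 1
    rw [← pow_mul, mul_comm, pow_mul, h.T_pow, one_pow]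

/-- The faces of the cyclic dual. -/
def _root_.CoextCyclic.dualFace (σ : ∀ n, Fin (n + 1) → X (n + 1) →ₗ[k] X n)
    (τ : ∀ n, X n →ₗ[k] X n) (n : ℕ) (i : Fin (n + 2)) : X (n + 1) →ₗ[k] X n :=
  Fin.cases (motive := fun _ => X (n + 1) →ₗ[k] X n) (σ n (Fin.last n) ∘ₗ τ (n + 1))
    (fun j => σ n j) i

theorem _root_.CoextCyclic.dualFace_zero (σ : ∀ n, Fin (n + 1) → X (n + 1) →ₗ[k] X n)
    (τ : ∀ n, X n →ₗ[k] X n) (n : ℕ) (x : X (n + 1)) :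
    dualFace σ τ n 0 x = σ n (Fin.last n) (τ (n + 1) x) := rfl

theorem _root_.CoextCyclic.dualFace_succ (σ : ∀ n, Fin (n + 1) → X (n + 1) →ₗ[k] X n)
    (τ : ∀ n, X n →ₗ[k] X n) (n : ℕ) (i : Fin (n + 1)) (x : X (n + 1)) :
    dualFace σ τ n i.succ x = σ n i x := rfl

/-- Apart from the zeroth face, the faces are codegeneracies with index shifted by one and the
degeneracies are cofaces without the last, so most identities are read off. Those with the zeroth
face σ_n τ use the commutation of τ with σ and δ; the relations involving t rest on the rules for T.
-/
theorem cyclic (h : IsRotational δ σ T) :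
    IsCyclicModule (dualFace σ (powInv T)) (fun n j => δ n j.castSucc) T := by
  have hc := h.cocyclic
  have cf : ∀ {V W : Type u} [AddCommGroup V] [Module k V] [AddCommGroup W] [Module k W]
      {f g : V →ₗ[k] W}, f = g → ∀ x, f x = g x := fun e x => by rw [e]
  constructor
  · intro n i j hij
    refine LinearMap.ext fun x => ?_
    simp only [LinearMap.comp_apply]
    induction i using Fin.cases with
    | zero =>
      rw [Fin.castSucc_zero]
      induction j using Fin.cases with
      | zero =>
        -- Here d₀d₁ = d₀d₀: both sides become a pair of codegeneracies applied to τ², since τσ₀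
        -- equals the last codegeneracy after τ².
        simp only [dualFace_zero, dualFace_succ]
        have h1 := cf (hc.τ_σ_zero (n + 1)) x
        have h2 := cf (hc.τ_σ (n + 1) (Fin.last n)) (powInv T (n + 2) x)
        have h3 := cf (h.σ_σ n (Fin.last n) (Fin.last n) le_rfl)
          (powInv T (n + 2) (powInv T (n + 2) x))
        simp only [LinearMap.comp_apply, Fin.succ_last] at h1 h2 h3
        rw [h1, h2, ← h3]
      | succ j =>
        simp only [dualFace_zero, dualFace_succ]
        have h2 := cf (hc.τ_σ (n + 1) j) x
        have h3 := cf (h.σ_σ n j (Fin.last n) (Fin.le_last _)) (powInv T (n + 2) x)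
        simp only [LinearMap.comp_apply, Fin.succ_last] at h2 h3
        rw [h2, h3]
    | succ i =>
      induction j using Fin.cases with
      | zero => simp at hij
      | succ j =>
        rw [← Fin.succ_castSucc]
        simp only [dualFace_succ]
        exact (cf (h.σ_σ n i j (by simpa using hij)) x).symm
  · intro n i j hij
    simp only [← Fin.succ_castSucc]
    exact (h.δ_δ n i.castSucc j.castSucc (by simpa using hij)).symm
  · intro n i j hij
    refine LinearMap.ext fun x => ?_
    simp only [LinearMap.comp_apply, ← Fin.succ_castSucc]
    induction i using Fin.cases with
    | zero =>
      rw [Fin.castSucc_zero]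
      simp only [dualFace_zero]
      have h1 := cf (hc.τ_δ (n + 1) j.castSucc) x
      have h2 := cf (h.σ_δ_lt n j.castSucc (Fin.last n)
        (by simpa using Fin.le_last _)) (powInv T (n + 1) x)
      simp only [LinearMap.comp_apply, Fin.succ_last] at h1 h2
      rw [h1, h2]
    | succ i =>
      rw [← Fin.succ_castSucc]
      simp only [dualFace_succ]
      exact cf (h.σ_δ_gt n j.castSucc i (by
        rw [Fin.lt_def]; rw [Fin.le_def] at hij; simp at hij ⊢; omega)) x
  · intro n i
    refine LinearMap.ext fun x => ?_
    simp only [LinearMap.comp_apply]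
    induction i using Fin.cases with
    | zero =>
      have h1 := cf (hc.τ_δ_zero n) x
      simp only [LinearMap.comp_apply] at h1
      rw [Fin.castSucc_zero, dualFace_zero, h1]
      exact cf (h.σ_δ_succ n (Fin.last _)) x
    | succ i =>
      rw [← Fin.succ_castSucc, dualFace_succ]
      exact cf (h.σ_δ_succ n i.castSucc) x
  · intro n i
    exact h.σ_δ_self n i
  · intro n i j hij
    induction i using Fin.cases with
    | zero => simp at hij
    | succ i =>
      refine LinearMap.ext fun x => ?_
      simp only [LinearMap.comp_apply, dualFace_succ]
      exact cf (h.σ_δ_lt n j.castSucc i (by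
        rw [Fin.lt_def] at hij; rw [Fin.le_def]; simp at hij ⊢; omega)) x
  · intro n i
    refine LinearMap.ext fun x => ?_
    simp only [LinearMap.comp_apply, dualFace_succ]
    induction i using Fin.cases with
    | zero =>
      have := cf (h.T_σ_last n) (powInv T (n + 1) x)
      simp only [LinearMap.comp_apply, h.T_inv] at this
      rw [Fin.castSucc_zero, dualFace_zero]
      exact this.symm
    | succ i =>
      rw [← Fin.succ_castSucc, dualFace_succ]
      exact (cf (h.T_σ n i) x).symm
  · intro n
    refine LinearMap.ext fun x => ?_
    simp only [LinearMap.comp_apply, dualFace_zero, h.inv_T]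
    rfl
  · intro n i
    rw [← Fin.succ_castSucc]
    exact (h.T_δ n i.castSucc).symm
  · intro n
    refine LinearMap.ext fun x => ?_
    -- The last degeneracy is the coface δ_n, one below the top. One rotation yields δ_{n+1}T and
    -- the next yields δ₀T.
    have h1 := cf (h.T_δ n (Fin.last n)) x
    have h2 := cf (h.T_δ_last n) (T n x)
    simp only [LinearMap.comp_apply, Fin.succ_last, Fin.castSucc_zero] at h1 h2 ⊢
    rw [h1, h2]
  · exact h.T_pow

end IsRotational

theorem arrowCongr_pow {V W : Type u} [AddCommGroup V] [Module k V] [AddCommGroup W] [Module k W]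
    (e : V ≃ₗ[k] W) (f : V →ₗ[k] V) (n : ℕ) :
    (LinearEquiv.arrowCongr e e f : Module.End k W) ^ n =
      LinearEquiv.arrowCongr e e ((f : Module.End k V) ^ n) := by
  induction n with
  | zero => ext; simp
  | succ n ih =>
    rw [pow_succ, ih, pow_succ]
    exact (LinearEquiv.arrowCongr_comp e e e f (f ^ n)).symm

theorem IsCocyclicModule.transport {δ : ∀ n, Fin (n + 2) → X n →ₗ[k] X (n + 1)}
    {σ : ∀ n, Fin (n + 1) → X (n + 1) →ₗ[k] X n} {τ : ∀ n, X n →ₗ[k] X n}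
    (h : IsCocyclicModule δ σ τ) (e : ∀ n, X n ≃ₗ[k] Y n) :
    IsCocyclicModule (fun n i => LinearEquiv.arrowCongr (e n) (e (n + 1)) (δ n i))
      (fun n i => LinearEquiv.arrowCongr (e (n + 1)) (e n) (σ n i))
      (fun n => LinearEquiv.arrowCongr (e n) (e n) (τ n)) where
  δ_δ n i j hij := by simp only [← LinearEquiv.arrowCongr_comp, h.δ_δ n i j hij]
  σ_σ n i j hij := by simp only [← LinearEquiv.arrowCongr_comp, h.σ_σ n i j hij]
  σ_δ_lt n i j hij := by simp only [← LinearEquiv.arrowCongr_comp, h.σ_δ_lt n i j hij]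
  σ_δ_self n i := by
    simp only [← LinearEquiv.arrowCongr_comp, h.σ_δ_self n i]
    ext; simp
  σ_δ_succ n i := by
    simp only [← LinearEquiv.arrowCongr_comp, h.σ_δ_succ n i]
    ext; simp
  σ_δ_gt n i j hij := by simp only [← LinearEquiv.arrowCongr_comp, h.σ_δ_gt n i j hij]
  τ_δ n i := by simp only [← LinearEquiv.arrowCongr_comp, h.τ_δ n i]
  τ_δ_zero n := by simp only [← LinearEquiv.arrowCongr_comp, h.τ_δ_zero n]
  τ_σ n i := by simp only [← LinearEquiv.arrowCongr_comp, h.τ_σ n i]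
  τ_σ_zero n := by simp only [← LinearEquiv.arrowCongr_comp, h.τ_σ_zero n]
  τ_pow n := by
    rw [arrowCongr_pow, h.τ_pow]
    ext; simp

theorem IsCyclicModule.transport {d : ∀ n, Fin (n + 2) → X (n + 1) →ₗ[k] X n}
    {s : ∀ n, Fin (n + 1) → X n →ₗ[k] X (n + 1)} {t : ∀ n, X n →ₗ[k] X n}
    (h : IsCyclicModule d s t) (e : ∀ n, X n ≃ₗ[k] Y n) :
    IsCyclicModule (fun n i => LinearEquiv.arrowCongr (e (n + 1)) (e n) (d n i))
      (fun n i => LinearEquiv.arrowCongr (e n) (e (n + 1)) (s n i))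
      (fun n => LinearEquiv.arrowCongr (e n) (e n) (t n)) where
  d_d n i j hij := by simp only [← LinearEquiv.arrowCongr_comp, h.d_d n i j hij]
  s_s n i j hij := by simp only [← LinearEquiv.arrowCongr_comp, h.s_s n i j hij]
  d_s_lt n i j hij := by simp only [← LinearEquiv.arrowCongr_comp, h.d_s_lt n i j hij]
  d_s_self n i := by
    simp only [← LinearEquiv.arrowCongr_comp, h.d_s_self n i]
    ext; simp
  d_s_succ n i := by
    simp only [← LinearEquiv.arrowCongr_comp, h.d_s_succ n i]
    ext; simp
  d_s_gt n i j hij := by simp only [← LinearEquiv.arrowCongr_comp, h.d_s_gt n i j hij]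
  d_t n i := by simp only [← LinearEquiv.arrowCongr_comp, h.d_t n i]
  d_t_zero n := by simp only [← LinearEquiv.arrowCongr_comp, h.d_t_zero n]
  s_t n i := by simp only [← LinearEquiv.arrowCongr_comp, h.s_t n i]
  s_t_zero n := by simp only [← LinearEquiv.arrowCongr_comp, h.s_t_zero n]
  t_pow n := by
    rw [arrowCongr_pow, h.t_pow]
    ext; simp

end Rotational

/-! ### The cocyclic structure on diagonally U-linear maps -/

section TraceModule

variable {k : Type v} [CommRing k] {A U : Type u} [Ring A] [Algebra k A] [Ring U] [Algebra k U]
  {B : LeftBialgebroid k A U}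
  {M : Type u} [AddCommGroup M] [Module k M] [Module U M] [IsScalarTower k U M]

namespace DiagHom

/-- `φ ↦ φ(⋯ | ε(uⁱ⁺¹) | ⋯)`. -/
def coface (n : ℕ) (i : Fin (n + 2)) : DiagHom B M n →ₗ[k] DiagHom B M (n + 1) where
  toFun φ := ⟨φ.1 ∘ₗ (B.eps (n + 1) i).1, fun u x => by
    rw [LinearMap.comp_apply, ← B.diag_eps (n + 1) i (by omega), map_diag]; rfl⟩
  map_add' _ _ := rfl
  map_smul' _ _ := rfl

/-- `φ ↦ φ(⋯ | Δ uʲ⁺¹ | ⋯)`. -/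
noncomputable def codegen (n : ℕ) (j : Fin (n + 1)) :
    DiagHom B M (n + 1) →ₗ[k] DiagHom B M n where
  toFun φ := ⟨φ.1 ∘ₗ (B.dl n j).1, fun u x => by
    rw [LinearMap.comp_apply, ← B.diag_dl n j (by omega), map_diag]; rfl⟩
  map_add' _ _ := rfl
  map_smul' _ _ := rfl

theorem coface_apply (n : ℕ) (i : Fin (n + 2)) (φ : DiagHom B M n) (z) :
    (coface n i φ).1 z = φ.1 ((B.eps (n + 1) i).1 z) := rfl

theorem codegen_apply (n : ℕ) (j : Fin (n + 1)) (φ : DiagHom B M (n + 1)) (z) :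
    (codegen n j φ).1 z = φ.1 ((B.dl n j).1 z) := rfl

variable {hl : B.IsLeftHopf} {c : Contraaction B M}

theorem hom_ext_cons {n : ℕ} {φ ψ : DiagHom B M n}
    (h : ∀ u x, φ.1 (B.cons n u x) = ψ.1 (B.cons n u x)) : φ = ψ :=
  Subtype.ext (B.tens_hom_ext h)

/-- The identities without T are precompositions of identities between operators on tensor powers.
Away from the end, T commutes with them up to a shift because operators on early entries ignore the
last entry. The two relations at the end and the power of T are where the contramodule structure
enters. -/
theorem isRotational (hM : IsAYD hl c) (hst : IsStable c) :
    IsRotational (X := fun n => DiagHom B M n) coface codegen (rot hM) where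
  δ_δ n i j hij := LinearMap.ext fun φ => Subtype.ext (LinearMap.ext fun z => by
    simp only [LinearMap.comp_apply, coface_apply]
    exact congrArg φ.1 (B.eps_eps (n + 1) i j hij (by omega) z))
  σ_σ n i j hij := LinearMap.ext fun φ => Subtype.ext (LinearMap.ext fun z => by
    simp only [LinearMap.comp_apply, codegen_apply]
    exact congrArg φ.1 (B.dl_dl n i j hij (by omega) z))
  σ_δ_lt n i j hij := LinearMap.ext fun φ => Subtype.ext (LinearMap.ext fun z => by
    simp only [LinearMap.comp_apply, coface_apply, codegen_apply]
    exact congrArg φ.1 (B.dl_eps n i j hij (by omega) z))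
  σ_δ_self n i := LinearMap.ext fun φ => Subtype.ext (LinearMap.ext fun z =>
    congrArg φ.1 (B.eps_dl_self n i (by omega) z))
  σ_δ_succ n i := LinearMap.ext fun φ => Subtype.ext (LinearMap.ext fun z => by
    simp only [LinearMap.comp_apply, coface_apply, codegen_apply, Fin.val_succ]
    exact congrArg φ.1 (B.eps_dl_succ n i (by omega) z))
  σ_δ_gt n i j hij := LinearMap.ext fun φ => Subtype.ext (LinearMap.ext fun z => by
    simp only [LinearMap.comp_apply, coface_apply, codegen_apply, Fin.val_succ]
    exact congrArg φ.1 (B.eps_dl_gt n i j hij (by omega) z))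
  T_δ n i := LinearMap.ext fun φ => hom_ext_cons fun u z => by
    simp only [LinearMap.comp_apply, coface_apply, Fin.val_succ, B.eps_succ_cons]
    refine ((rot_cons hM (coface n i.castSucc φ) u z).congr fun v => ?_).unique
      (rot_cons hM φ u _)
    rw [coface_apply]
    exact congrArg φ.1 (B.eps_snoc n i (by omega) z _)
  -- The rotated coface is γ(v ↦ φ(z)ε(v s(ε(u)))), which is the left action of ε(u) on φ(z).
  T_δ_last n := LinearMap.ext fun φ => hom_ext_cons fun u z => by
    simp only [LinearMap.comp_apply, coface_apply]
    have h : B.s (B.ε u) • φ.1 z = φ.1 ((B.eps (n + 1) (0 : Fin (n + 2))).1 (B.cons (n + 1) u z)) :=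
      (map_diag φ _ z).symm.trans (congrArg φ.1 (B.eps_zero_cons _ u z).symm)
    rw [← h]
    refine ((rot_cons hM (coface n (Fin.last (n + 1)) φ) u z)).unique
      ((hM.left_act (B.ε u) (φ.1 z)).congr fun v => ?_)
    rw [coface_apply, Fin.val_last, B.eps_last_snoc, map_tensR, B.counit_mul_s v u]
  T_σ n i := by
    obtain _ | n := n
    · exact i.elim0
    refine LinearMap.ext fun φ => hom_ext_cons fun u z => ?_
    simp only [LinearMap.comp_apply, codegen_apply, Fin.val_succ, B.dl_succ_cons]
    refine ((rot_cons hM (codegen (n + 1) i.castSucc φ) u z).congr fun v => ?_).unique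
      (rot_cons hM φ u _)
    rw [codegen_apply]
    exact congrArg φ.1 (B.dl_snoc n i (by omega) z _)
  -- Splitting the last entry vu gives (v₍₁₎u₍₁₎ | v₍₂₎u₍₂₎), so a single γ over Δv is by
  -- contraassociativity a pair of nested contraactions, that is, two rotations of (u₍₁₎ | u₍₂₎ |
  -- x).
  T_σ_last n := LinearMap.ext fun φ => hom_ext_cons fun u x => by
    simp only [LinearMap.comp_apply, codegen_apply]
    have hb : IsBal k B.tL B.sL (fun p q => φ.1 (B.snoc (n + 1) (B.snoc n x p) q)) := by
      constructor <;> intros <;> simp [← AeRing.tensR_snoc, AeRing.snoc_tensR]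
    have hG : ∀ p q, IsBal k B.tL B.sL
        (fun v w => φ.1 (B.snoc (n + 1) (B.snoc n x (v * p)) (w * q))) := by
      intro p q
      constructor <;> intros <;>
        simp [add_mul, mul_assoc, ← AeRing.tensR_snoc, AeRing.snoc_tensR]
    refine (rot_cons hM (codegen n (Fin.last n) φ) u x).unique
      ((c.gamma_gamma (IsBal.bsum hG (B.Δ u)) (fun a v w => ?_) (H := fun v => bsum (B.Δ u)
        fun p q => (rot hM (n + 1) φ).1 (B.cons _ q (B.snoc n x (v * p)))) (fun v => ?_) ?_).congr
        fun v => ?_)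
    · simp only [mul_assoc, ← AeRing.tensR_snoc, map_tensR, bsum_smul_fun]
    · exact GammaRel.bsum _ fun p q => rot_cons hM φ q _
    · rw [Fin.val_zero, B.dl_zero_cons, map_bsum]
      refine GammaRel.bsum _ fun p q => ?_
      refine (rot_cons hM (rot hM (n + 1) φ) p (B.cons n q x)).congr fun v => ?_
      rw [AeRing.snoc_cons]
    · rw [codegen_apply, Fin.val_last, B.dl_last_snoc, map_bsum]
      exact (LeftBialgebroid.sw_mul hb v u).symm
  T_pow n := rot_pow hM hst n

/-- `(τ φ)(x | u) = γ(v ↦ φ(u | v x))`, for the inverse `τ` of the cyclic operator. -/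
theorem powInv_snoc (hM : IsAYD hl c) (hst : IsStable c) {n : ℕ} (φ : DiagHom B M n)
    (x : (B.tens n).carrier) (u : U) :
    GammaRel c.γ (fun v => φ.1 (B.cons n u (B.diag n v x)))
      ((powInv (rot hM) n φ).1 (B.snoc n x u)) := by
  set ψ := powInv (X := fun n => DiagHom B M n) (rot hM) n φ with hψ
  have e : rot hM n ψ = φ := (isRotational hM hst).T_inv n φ
  let H : HomRight B.toAeRing M B.tL :=
    ⟨φ.1 ∘ₗ B.cons n u ∘ₗ (B.diag n).flip x, fun a v => by
      simp only [LinearMap.comp_apply, LinearMap.flip_apply, LinearMap.mulLeft_apply]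
      rw [B.diag_mul, B.diag_t, ← AeRing.tensR_cons, map_tensR]⟩
  -- With ψ = τφ, the function H(v) = φ(u | v·x) equals γ(w ↦ ψ(v·x | wu)). Contraassociativity
  -- turns γ(H) into γ(v ↦ ψ(v·(x | u))), and stability evaluates this to ψ(x | u).
  have h := c.gamma_gamma (B.isBal_snoc n ψ.1 x u) (H := fun v => H.1 v) (m := c.γ H)
    (fun a v w => by rw [mul_assoc, ← AeRing.tensR_snoc, map_tensR])
    (fun v => by
      have := rot_cons hM ψ u (B.diag n v x)
      rwa [e] at this) (GammaRel.of H)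
  have h' := h.unique ((hst (ψ.1 (B.snoc n x u))).congr fun v => by
    rw [← map_diag, B.diag_snoc, map_bsum])
  rw [← h']
  exact GammaRel.of H

end DiagHom
end TraceModule

/-! ### Identities for the two translation maps -/

section Translation

variable {k : Type v} [CommRing k] {A U : Type u} [Ring A] [Algebra k A] [Ring U] [Algebra k U]
  {B : LeftBialgebroid k A U}

namespace LeftBialgebroid

theorem mulLeft_sR (w : U) (a : A) (u : U) :
    LinearMap.mulLeft k w (B.sR a u) = B.sR a (LinearMap.mulLeft k w u) := by
  simp [mul_assoc]

theorem mulLeft_tR (w : U) (a : A) (u : U) :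
    LinearMap.mulLeft k w (B.tR a u) = B.tR a (LinearMap.mulLeft k w u) := by
  simp [mul_assoc]

variable (B) in
/-- `y ⊗ z ↦ w y ⊗ z v` on `U_◀ ⊗_A ▷U`. -/
def bimulR (w v : U) : Module.End k B.UUr :=
  BalTensor.map (ρ' := B.sR) (l' := B.sL) (LinearMap.mulLeft k w) (LinearMap.mulRight k v)
    (B.mulLeft_sR w) (B.mulRight_sL v)

variable (B) in
/-- `y ⊗ z ↦ w y ⊗ z v` on `▶U ⊗_{Aᵒᵖ} U_◁`. -/
def bimulL (w v : U) : Module.End k B.UUl :=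
  BalTensor.map (ρ' := B.tR) (l' := B.tL) (LinearMap.mulLeft k w) (LinearMap.mulRight k v)
    (B.mulLeft_tR w) (B.mulRight_tL v)

variable (B) in
-- Multiplication by Δ(w) from the left respects the tensor product over A only because Δ takes
-- values in the Takeuchi product.
theorem isBal_sw_mul (w : U) :
    IsBal k B.tL B.sL (fun p q => B.sw w (fun a b => btmul B.tL B.sL (a * p) (b * q))) := by
  have h : ∀ p q, IsBal k B.tL B.sL (fun a b => btmul B.tL B.sL (a * p) (b * q)) := by
    intro p q
    constructor <;> intros
    · simp [add_mul]
    · simp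
    · simp [add_mul]
    · simp
    · simp only [LinearMap.mulLeft_apply, mul_assoc]
      exact btmul_bal (ρ := B.tL) (l := B.sL) _ _ _
  constructor <;> intros
  · simp [mul_add, bsum_add_fun]
  · simp [bsum_smul_fun]
  · simp [mul_add, bsum_add_fun]
  · simp [bsum_smul_fun]
  · simp only [LinearMap.mulLeft_apply, ← mul_assoc]
    exact sw_takeuchi (h _ _) _ _

theorem isBal_btmul_mul (v v' : U) :
    IsBal k B.tL B.sL (fun p q => btmul B.tL B.sL (p * v) (q * v')) := by
  constructor <;> intros
  · simp [add_mul]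
  · simp
  · simp [add_mul]
  · simp
  · simp only [LinearMap.mulLeft_apply, mul_assoc]
    exact btmul_bal (ρ := B.tL) (l := B.sL) _ _ _

namespace IsRightHopf

variable (hr : B.IsRightHopf)

theorem transl_add (u v : U) : hr.transl (u + v) = hr.transl u + hr.transl v := by
  simp [transl]

theorem transl_smul (r : k) (u : U) : hr.transl (r • u) = r • hr.transl u := by
  simp [transl]

theorem transl_one : hr.transl 1 = btmul B.sR B.sL 1 1 := by
  apply hr.1
  rw [hr.galois_transl, galoisR_btmul, B.comul_one, B.mulFst_btmul, mul_one]

/-- Multiplicativity of Δ pulls w out of the Galois map, and the defining property of the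
translation map collapses the rest. Identities for the translation map then follow from injectivity
of the Galois map. `galoisL_bimul_transl` is the mirror image. -/
theorem galoisR_bimul_transl (w v u : U) :
    B.galoisR (B.bimulR w v (hr.transl u)) =
      B.sw w (fun p q => btmul B.tL B.sL (p * v) (q * u)) := by
  have h1 : B.galoisR (B.bimulR w v (hr.transl u)) = bsum (hr.transl u) (fun y z =>
      B.sw y (fun p q => B.sw w (fun a b => btmul B.tL B.sL (a * (p * z * v)) (b * q)))) := by
    rw [bimulR, map_eq_bsum, map_bsum]
    simp only [galoisR_btmul, mulFst, map_eq_bsum]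
    congr 1; funext y z
    refine (sw_mul ?_ w y).trans ?_
    · simpa [mul_assoc] using B.isBal_btmul_mul (z * v) 1
    · simp only [LinearMap.mulRight_apply, LinearMap.id_apply, mul_assoc]
      exact bsum_comm _ _ _
  have h2 : IsBal k B.tL B.sL
      (fun p q => B.sw w (fun a b => btmul B.tL B.sL (a * (p * v)) (b * q))) := by
    have h := B.isBal_sw_mul w
    constructor <;> intros
    · rw [add_mul, h.add_l]
    · rw [smul_mul_assoc, h.smul_l]
    · rw [h.add_r]
    · rw [h.smul_r]
    · rw [← h.bal, LinearMap.mulLeft_apply, LinearMap.mulLeft_apply, mul_assoc]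
  rw [h1, hr.bsum_transl h2 u, one_mul]

theorem transl_s_mul (a : A) (u : U) :
    hr.transl (B.s a * u) = B.bimulR 1 (B.t (MulOpposite.op a)) (hr.transl u) := by
  apply hr.1
  rw [galoisR_bimul_transl, hr.galois_transl, sw_one, one_mul, one_mul]
  · have := btmul_bal (ρ := B.tL) (l := B.sL) a 1 u
    simpa using this.symm
  · exact B.isBal_btmul_mul _ _

/-- `(w₍₂₎ u)₍₊₎ ⊗ (w₍₂₎ u)₍₋₎ w₍₁₎ = w u₍₊₎ ⊗ u₍₋₎`. -/
theorem sw_transl (w u : U) :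
    B.sw w (fun p q => B.bimulR 1 p (hr.transl (q * u))) = B.bimulR w 1 (hr.transl u) := by
  apply hr.1
  rw [map_bsum, galoisR_bimul_transl]
  simp only [galoisR_bimul_transl, mul_one]
  congr 1; funext p q
  rw [sw_one, one_mul, one_mul]
  exact B.isBal_btmul_mul _ _

end IsRightHopf

namespace IsLeftHopf

variable (hl : B.IsLeftHopf)

theorem transl_add (u v : U) : hl.transl (u + v) = hl.transl u + hl.transl v := by
  simp [transl]

theorem transl_smul (r : k) (u : U) : hl.transl (r • u) = r • hl.transl u := by
  simp [transl]

theorem galoisL_bimul_transl (w v u : U) :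
    B.galoisL (B.bimulL w v (hl.transl u)) =
      B.sw w (fun p q => btmul B.tL B.sL (p * u) (q * v)) := by
  have h1 : B.galoisL (B.bimulL w v (hl.transl u)) = bsum (hl.transl u) (fun y z =>
      B.sw y (fun p q => B.sw w (fun a b => btmul B.tL B.sL (a * p) (b * (q * z * v))))) := by
    rw [bimulL, map_eq_bsum, map_bsum]
    simp only [galoisL_btmul, mulSnd, map_eq_bsum]
    congr 1; funext y z
    refine (sw_mul ?_ w y).trans ?_
    · simpa [mul_assoc] using B.isBal_btmul_mul 1 (z * v)
    · simp only [LinearMap.mulRight_apply, LinearMap.id_apply, mul_assoc]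
      exact bsum_comm _ _ _
  have h2 : IsBal k B.tL B.sL
      (fun p q => B.sw w (fun a b => btmul B.tL B.sL (a * p) (b * (q * v)))) := by
    have h := B.isBal_sw_mul w
    constructor <;> intros
    · rw [h.add_l]
    · rw [h.smul_l]
    · rw [add_mul, h.add_r]
    · rw [smul_mul_assoc, h.smul_r]
    · rw [h.bal, LinearMap.mulLeft_apply, LinearMap.mulLeft_apply, mul_assoc]
  rw [h1, hl.bsum_transl h2 u, one_mul]

theorem transl_t_mul (a : A) (u : U) :
    hl.transl (B.t (MulOpposite.op a) * u) = B.bimulL 1 (B.s a) (hl.transl u) := by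
  apply hl.1
  rw [galoisL_bimul_transl, hl.galois_transl, sw_one, one_mul, one_mul]
  · have := btmul_bal (ρ := B.tL) (l := B.sL) a u 1
    simpa using this
  · exact B.isBal_btmul_mul _ _

/-- `(w₍₁₎ u)₊ ⊗ (w₍₁₎ u)₋ w₍₂₎ = w u₊ ⊗ u₋`. -/
theorem sw_transl (w u : U) :
    B.sw w (fun p q => B.bimulL 1 q (hl.transl (p * u))) = B.bimulL w 1 (hl.transl u) := by
  apply hl.1
  rw [map_bsum, galoisL_bimul_transl]
  simp only [galoisL_bimul_transl, mul_one]
  congr 1; funext p q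
  rw [sw_one, one_mul, one_mul]
  exact B.isBal_btmul_mul _ _

end IsLeftHopf

end LeftBialgebroid
end Translation

/-! ### The three coordinate systems on diagonally U-linear maps -/

section Models

variable {k : Type v} [CommRing k] {A U : Type u} [Ring A] [Algebra k A] [Ring U] [Algebra k U]
  {B : LeftBialgebroid k A U}
  {M : Type u} [AddCommGroup M] [Module k M] [Module U M] [IsScalarTower k U M]

open LeftBialgebroid

/-! ### The model `Hom_A(U^{⊗_A n}, M)` -/

theorem rightHopfAct_eq (hr : B.IsRightHopf) {n : ℕ} (u : U)
    (f : HomLeft B.toAeRing M (B.tens n).act) (x : (B.tens n).carrier) :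
    rightHopfAct hr u f x = bsum (hr.transl u) (fun y z => y • f.1 (B.diag n z x)) :=
  evalR_eq _ _

theorem isBal_smulR (f : HomLeft B.toAeRing M B.sL) :
    IsBal k B.sR B.sL (fun y z => y • f.1 z) where
  add_l _ _ _ := add_smul _ _ _
  smul_l _ _ _ := smul_assoc _ _ _
  add_r _ _ _ := by simp
  smul_r _ _ _ := by rw [map_smul, smul_comm]
  bal a y z := by rw [f.2, LinearMap.mulRight_apply, mul_smul]

theorem rightHopfAct_one (hr : B.IsRightHopf) {n : ℕ}
    (f : HomLeft B.toAeRing M (B.tens n).act) (x : (B.tens n).carrier) :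
    rightHopfAct hr 1 f x = f.1 x := by
  rw [rightHopfAct_eq, hr.transl_one]
  refine ((isBal_smulR (sliceDiag f x)).bsum_btmul 1 1).trans ?_
  rw [one_smul]
  exact congrArg f.1 (B.diag_one n x)

theorem evalR_bimulR {n : ℕ} (f : HomLeft B.toAeRing M (B.tens n).act) (x : (B.tens n).carrier)
    (w v : U) (Z : B.UUr) :
    evalR (sliceDiag f x) (B.bimulR w v Z) = w • evalR (sliceDiag f (B.diag n v x)) Z := by
  rw [evalR_eq, evalR_eq, bimulR, (isBal_smulR _).bsum_map, ← bsum_smul_fun]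
  congr 1; funext y z
  simp only [LinearMap.mulLeft_apply, mul_smul, sliceDiag, LinearMap.comp_apply,
    LinearMap.flip_apply, LinearMap.mulRight_apply, B.diag_mul]

/-- The right translation map gives (x | u) = u₍₊₎·(u₍₋₎x | 1), so a U-linear map is determined by
its values at (x | 1). -/
theorem DiagHom.map_snoc (hr : B.IsRightHopf) {n : ℕ} (φ : DiagHom B M n)
    (x : (B.tens n).carrier) (u : U) :
    φ.1 (B.snoc n x u) = bsum (hr.transl u) (fun y z => y • φ.1 (B.snoc n (B.diag n z x) 1)) := by
  have := hr.bsum_transl (F := fun p q => φ.1 (B.snoc n (B.diag n p x) q))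
    (by simpa using B.isBal_snoc n φ.1 x 1) u
  rw [B.diag_one] at this
  rw [← this]
  congr 1; funext y z
  rw [← DiagHom.map_diag φ, B.diag_snoc, map_bsum]
  simp only [mul_one, B.diag_mul]

/-- Restriction of `φ` along `x ↦ (x | 1)`. -/
def DiagHom.toCobar (n : ℕ) : DiagHom B M n →ₗ[k] CobarChain B M n where
  toFun φ := ⟨φ.1 ∘ₗ (B.snoc n).flip 1, fun a x => by
    simp only [LinearMap.comp_apply, LinearMap.flip_apply, AeRing.snoc_act, map_act]⟩
  map_add' _ _ := rfl
  map_smul' _ _ := rfl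

/-- The inverse extends f by (x | u) ↦ u₍₊₎ f(u₍₋₎x). This is balanced by `IsRightHopf.transl_s_mul`
and U-linear by `IsRightHopf.sw_transl`. -/
theorem DiagHom.toCobar_bijective (hr : B.IsRightHopf) (n : ℕ) :
    Function.Bijective (DiagHom.toCobar (B := B) (M := M) n) := by
  constructor
  · intro φ ψ h
    have h' : ∀ x, φ.1 (B.snoc n x 1) = ψ.1 (B.snoc n x 1) := fun x =>
      congrArg (fun f : CobarChain B M n => f.1 x) h
    refine Subtype.ext (B.snoc_hom_ext fun x u => ?_)
    rw [map_snoc hr, map_snoc hr]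
    simp only [h']
  · intro f
    let F : (B.tens n).carrier →ₗ[k] U →ₗ[k] M := LinearMap.mk₂ k
      (fun x u => rightHopfAct hr u f x)
      (fun x x' u => by simp [rightHopfAct_eq, bsum_add_fun])
      (fun r x u => by
        simp only [rightHopfAct_eq, map_smul, ← bsum_smul_fun]
        congr 1; funext y z
        rw [smul_comm])
      (fun x u u' => by simp [rightHopfAct, hr.transl_add])
      (fun r x u => by simp [rightHopfAct, hr.transl_smul])
    have hF : ∀ x u, F x u = evalR (sliceDiag f x) (hr.transl u) := fun _ _ => rfl
    obtain ⟨φ, hφ⟩ := B.exists_snoc_lift n F (fun a x u => by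
      rw [hF, hF, hr.transl_s_mul, evalR_bimulR, one_smul, B.diag_t])
    refine ⟨⟨φ, fun u z => ?_⟩, Subtype.ext (LinearMap.ext fun x => ?_)⟩
    · have : φ ∘ₗ B.diag (n + 1) u = Algebra.lsmul k k M u ∘ₗ φ := by
        refine B.snoc_hom_ext fun x w => ?_
        simp only [LinearMap.comp_apply, B.diag_snoc, map_bsum, hφ, hF]
        have := congrArg (evalR (sliceDiag f x)) (hr.sw_transl u w)
        simp only [map_bsum, evalR_bimulR, B.diag_one, one_smul] at this
        simpa using this
      simpa using LinearMap.congr_fun this z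
    · exact (hφ x 1).trans (rightHopfAct_one hr f x)

/-- `Hom_U(U^{⊗_A (n+1)}, M) ≅ Hom_A(U^{⊗_A n}, M)`. -/
noncomputable def cobarEquiv (hr : B.IsRightHopf) (n : ℕ) :
    DiagHom B M n ≃ₗ[k] CobarChain B M n :=
  LinearEquiv.ofBijective (DiagHom.toCobar n) (DiagHom.toCobar_bijective hr n)

theorem cobarEquiv_apply (hr : B.IsRightHopf) {n : ℕ} (φ : DiagHom B M n)
    (x : (B.tens n).carrier) : (cobarEquiv hr n φ).1 x = φ.1 (B.snoc n x 1) := rfl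

/-! ### The model `Hom_{Aᵒᵖ}(U^{⊗_A n}, M)` -/

/-- `y ↦ ψ(y x)`, for the diagonal action. -/
def diagSlice {n : ℕ} (ψ : DChain B M n) (x : (B.tens n).carrier) :
    HomRight B.toAeRing M B.tL :=
  ⟨ψ.1 ∘ₗ (B.diag n).flip x, fun a y => by
    simp only [LinearMap.comp_apply, LinearMap.flip_apply, LinearMap.mulLeft_apply, B.diag_mul,
      B.diag_t]
    exact ψ.2 a _⟩

theorem evalL_bimulL {n : ℕ} (f : DChain B M n) (x : (B.tens n).carrier)
    (w v : U) (Z : B.UUl) :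
    evalL (diagSlice f x) (B.bimulL w v Z) = w • evalL (diagSlice f (B.diag n v x)) Z := by
  rw [evalL_eq, evalL_eq, bimulL, (isBal_smul _).bsum_map, ← bsum_smul_fun]
  congr 1; funext y z
  simp only [LinearMap.mulLeft_apply, mul_smul, diagSlice, LinearMap.comp_apply,
    LinearMap.flip_apply, LinearMap.mulRight_apply, B.diag_mul]

/-- The action of u₊ produces (u₊₍₁₎ | u₊₍₂₎u₋x), and u₊₍₁₎ ⊗ u₊₍₂₎u₋ = u ⊗ 1. -/
theorem cons_transl (hl : B.IsLeftHopf) (n : ℕ) (u : U) (x : (B.tens n).carrier) :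
    bsum (hl.transl u) (fun y z => B.diag (n + 1) y (B.cons n 1 (B.diag n z x))) =
      B.cons n u x := by
  have := hl.bsum_transl (F := fun p q => B.cons n p (B.diag n q x))
    (by simpa using B.diag_isBal n 1 x) u
  rw [B.diag_one] at this
  rw [← this]
  congr 1; funext y z
  rw [B.diag_cons]
  simp only [mul_one, B.diag_mul]

theorem DiagHom.map_cons (hl : B.IsLeftHopf) {n : ℕ} (φ : DiagHom B M n)
    (u : U) (x : (B.tens n).carrier) :
    φ.1 (B.cons n u x) = bsum (hl.transl u) (fun y z => y • φ.1 (B.cons n 1 (B.diag n z x))) := by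
  rw [← cons_transl hl, map_bsum]
  simp only [map_diag]

/-- Restriction of `φ` along `x ↦ (1 | x)`. -/
def DiagHom.toD (n : ℕ) : DiagHom B M n →ₗ[k] DChain B M n where
  toFun φ := ⟨φ.1 ∘ₗ B.cons n 1, fun a x => by
    simp only [LinearMap.comp_apply, ← AeRing.tensR_cons, map_tensR]⟩
  map_add' _ _ := rfl
  map_smul' _ _ := rfl

/-- The inverse extends f by (u | x) ↦ u₊ f(u₋x); balancing and U-linearity come from
`IsLeftHopf.transl_t_mul` and `IsLeftHopf.sw_transl`. -/
theorem DiagHom.toD_bijective (hl : B.IsLeftHopf) (n : ℕ) :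
    Function.Bijective (DiagHom.toD (B := B) (M := M) n) := by
  constructor
  · intro φ ψ h
    have h' : ∀ x, φ.1 (B.cons n 1 x) = ψ.1 (B.cons n 1 x) := fun x =>
      congrArg (fun f : DChain B M n => f.1 x) h
    refine Subtype.ext (B.tens_hom_ext fun u x => ?_)
    rw [map_cons hl, map_cons hl]
    simp only [h']
  · intro f
    have hF : IsBal k B.tL (B.tens n).act (fun u x => evalL (diagSlice f x) (hl.transl u)) :=
      { add_l := fun _ _ _ => by simp [hl.transl_add]
        smul_l := fun _ _ _ => by simp [hl.transl_smul]
        add_r := fun u x x' => by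
          simp [evalL_eq, diagSlice, bsum_add_fun]
        smul_r := fun r u x => by
          simp only [evalL_eq, diagSlice, ← bsum_smul_fun]
          congr 1; funext y z
          simp [smul_comm y]
        bal := fun a u x => by
          rw [LinearMap.mulLeft_apply, hl.transl_t_mul, evalL_bimulL, one_smul, B.diag_s] }
    refine ⟨⟨B.tensLift hF, fun u z => ?_⟩, Subtype.ext (LinearMap.ext fun x => ?_)⟩
    · induction z using B.tens_induct with
      | hc w x =>
        simp only [B.diag_cons, map_bsum, AeRing.tensLift_cons]
        have := congrArg (evalL (diagSlice f x)) (hl.sw_transl u w)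
        simpa only [map_bsum, evalL_bimulL, B.diag_one, one_smul] using this
      | h0 => simp
      | ha x y hx hy => simp only [map_add, hx, hy, smul_add]
    · change B.tensLift hF (B.cons n 1 x) = f.1 x
      rw [AeRing.tensLift_cons, hl.transl_one, evalL_eq, (isBal_smul _).bsum_btmul, one_smul]
      exact congrArg f.1 (B.diag_one n x)

/-- `Hom_U(U^{⊗_A (n+1)}, M) ≅ Hom_{Aᵒᵖ}(U^{⊗_A n}, M)`. -/
noncomputable def dEquiv (hl : B.IsLeftHopf) (n : ℕ) : DiagHom B M n ≃ₗ[k] DChain B M n :=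
  LinearEquiv.ofBijective (DiagHom.toD n) (DiagHom.toD_bijective hl n)

/-! ### The model `Hom_{Aᵒᵖ}(U^{⊗_{Aᵒᵖ} n}, M)` -/

theorem isBal_diag_cons_one {n : ℕ} (f : {f : (B.tensOp n).carrier →ₗ[k] (B.tens n).carrier //
    ∀ a z, f ((B.tensOp n).act a z) = B.tensR n a (f z)}) :
    IsBal k B.tR (B.tensOp n).act (fun u z => B.diag (n + 1) u (B.cons n 1 (f.1 z))) where
  add_l _ _ _ := by simp
  smul_l _ _ _ := by simp
  add_r _ _ _ := by simp
  smul_r _ _ _ := by simp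
  bal a u z := by
    rw [LinearMap.mulRight_apply, B.diag_mul, B.diag_t, AeRing.tensR_cons, f.2]

variable (B) in
/-- The map `U^{⊗_{Aᵒᵖ} n} → U^{⊗_A n}`, `(u, z) ↦ u (1 | z)`, and its right `A`-linearity. -/
noncomputable def thetaAux : (n : ℕ) → {f : (B.tensOp n).carrier →ₗ[k] (B.tens n).carrier //
    ∀ a z, f ((B.tensOp n).act a z) = B.tensR n a (f z)}
  | 0 => ⟨(B.ofBaseOp.symm ≪≫ₗ B.ofBase).toLinearMap, fun _ _ => rfl⟩
  | n + 1 => ⟨B.tensOpLift (isBal_diag_cons_one (thetaAux n)), fun a z => by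
      have : B.tensOpLift (isBal_diag_cons_one (thetaAux n)) ∘ₗ (B.tensOp (n + 1)).act a =
          B.tensR (n + 1) a ∘ₗ B.tensOpLift (isBal_diag_cons_one (thetaAux n)) :=
        B.tensOp_hom_ext fun u z => by
          rw [LinearMap.comp_apply, LinearMap.comp_apply, AeRing.act_consOp,
            AeRing.tensOpLift_consOp, AeRing.tensOpLift_consOp, B.diag_mul, B.diag_t]
      exact LinearMap.congr_fun this z⟩

variable (B) in
/-- The map `U^{⊗_{Aᵒᵖ} n} → U^{⊗_A n}`, `(u, z) ↦ u (1 | z)`. -/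
noncomputable def theta (n : ℕ) : (B.tensOp n).carrier →ₗ[k] (B.tens n).carrier :=
  (thetaAux B n).1

theorem theta_act (n : ℕ) (a : A) (z : (B.tensOp n).carrier) :
    theta B n ((B.tensOp n).act a z) = B.tensR n a (theta B n z) := (thetaAux B n).2 a z

theorem theta_consOp (n : ℕ) (u : U) (z : (B.tensOp n).carrier) :
    theta B (n + 1) (B.consOp n u z) = B.diag (n + 1) u (B.cons n 1 (theta B n z)) := by
  simp only [theta, thetaAux, AeRing.tensOpLift_consOp]

/-- By induction, an inverse is (u | x) ↦ (u₊, θ⁻¹(u₋x)). Injectivity is shown by checking that it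
is a left inverse, surjectivity by using it to write down preimages. -/
theorem theta_bijective (hl : B.IsLeftHopf) (n : ℕ) : Function.Bijective (theta B n) := by
  induction n with
  | zero => exact (B.ofBaseOp.symm ≪≫ₗ B.ofBase).bijective
  | succ n ih =>
    let e := LinearEquiv.ofBijective (theta B n) ih
    have he : ∀ z, theta B n (e.symm z) = z := fun z => e.apply_symm_apply z
    have he' : ∀ z, e.symm (theta B n z) = z := fun z => e.symm_apply_apply z
    have hR : ∀ a x, e.symm (B.tensR n a x) = (B.tensOp n).act a (e.symm x) := fun a x => by
      obtain ⟨z, rfl⟩ := ih.2 x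
      rw [← theta_act, he', he']
    have hb : ∀ x, IsBal k B.tR B.tL
        (fun y z => B.consOp n y (e.symm (B.diag n z x))) := fun x =>
      { add_l := fun _ _ _ => by simp
        smul_l := fun _ _ _ => by simp
        add_r := fun _ _ _ => by simp
        smul_r := fun _ _ _ => by simp
        bal := fun a y z => by
          rw [LinearMap.mulRight_apply, LinearMap.mulLeft_apply, AeRing.consOp_bal, ← hR,
            B.diag_mul, B.diag_t] }
    have hm : ∀ w v x (Z : B.UUl), bsum (B.bimulL w v Z)
        (fun y z => B.consOp n y (e.symm (B.diag n z x))) =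
        bsum Z (fun y z => B.consOp n (w * y) (e.symm (B.diag n z (B.diag n v x)))) := by
      intro w v x Z
      rw [bimulL, (hb x).bsum_map]
      simp only [LinearMap.mulLeft_apply, LinearMap.mulRight_apply, B.diag_mul]
    have hF : IsBal k B.tL (B.tens n).act (fun u x => bsum (hl.transl u)
        (fun y z => B.consOp n y (e.symm (B.diag n z x)))) :=
      { add_l := fun _ _ _ => by rw [hl.transl_add, (hb _).bsum_add]
        smul_l := fun _ _ _ => by rw [hl.transl_smul, (hb _).bsum_smul]
        add_r := fun _ _ _ => by simp [bsum_add_fun]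
        smul_r := fun _ _ _ => by simp [bsum_smul_fun]
        bal := fun a u x => by
          rw [LinearMap.mulLeft_apply, hl.transl_t_mul, hm, ← B.diag_s]
          simp only [one_mul] }
    refine ⟨?_, fun x => ?_⟩
    · have : B.tensLift hF ∘ₗ theta B (n + 1) = LinearMap.id := by
        refine B.tensOp_hom_ext fun u z => ?_
        rw [LinearMap.comp_apply, theta_consOp, B.diag_cons, map_bsum]
        simp only [AeRing.tensLift_cons]
        have := congrArg (hb (theta B n z)).lift (hl.sw_transl u 1)
        rw [map_bsum] at this
        simp only [← (hb _).bsum_eq, hm] at this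
        simp only [one_mul, B.diag_one] at this
        rw [this, hl.transl_one, LinearMap.id_apply]
        refine (IsBal.bsum_btmul (ρ := B.tR) (l := B.tL)
          (F := fun y w => B.consOp n (u * y) (e.symm (B.diag n w (theta B n z))))
          { add_l := fun _ _ _ => by simp [mul_add]
            smul_l := fun _ _ _ => by simp
            add_r := fun _ _ _ => by simp
            smul_r := fun _ _ _ => by simp
            bal := fun a y w => by
              have := (hb (theta B n z)).bal a (u * y) w
              simpa [mul_assoc] using this } 1 1).trans ?_
        rw [mul_one, B.diag_one, he']
      exact Function.LeftInverse.injective fun x => LinearMap.congr_fun this x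
    · induction x using B.tens_induct with
      | hc u x =>
        refine ⟨bsum (hl.transl u) (fun y z => B.consOp n y (e.symm (B.diag n z x))), ?_⟩
        rw [map_bsum]
        simp only [theta_consOp, he]
        exact cons_transl hl n u x
      | h0 => exact ⟨0, map_zero _⟩
      | ha x y hx hy =>
        obtain ⟨x, rfl⟩ := hx
        obtain ⟨y, rfl⟩ := hy
        exact ⟨x + y, map_add _ _ _⟩

variable (M) in
/-- `Hom_{Aᵒᵖ}(U^{⊗_A n}, M) ≅ Hom_{Aᵒᵖ}(U^{⊗_{Aᵒᵖ} n}, M)`. -/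
noncomputable def thetaEquiv (hl : B.IsLeftHopf) (n : ℕ) : DChain B M n ≃ₗ[k] BarCochain B M n where
  toFun f := ⟨f.1 ∘ₗ theta B n, fun a z => by
    rw [LinearMap.comp_apply, theta_act]; exact f.2 a _⟩
  map_add' _ _ := rfl
  map_smul' _ _ := rfl
  invFun g := ⟨g.1 ∘ₗ (LinearEquiv.ofBijective (theta B n) (theta_bijective hl n)).symm,
    fun a x => by
      obtain ⟨z, rfl⟩ := (theta_bijective hl n).2 x
      rw [← theta_act]
      have h : ∀ z, (LinearEquiv.ofBijective (theta B n) (theta_bijective hl n)).symm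
          (theta B n z) = z := fun z => LinearEquiv.symm_apply_apply _ z
      simp only [LinearMap.comp_apply, LinearEquiv.coe_coe, h]
      exact g.2 a z⟩
  left_inv f := Subtype.ext (LinearMap.ext fun x => congrArg f.1
    ((LinearEquiv.ofBijective (theta B n) (theta_bijective hl n)).apply_symm_apply x))
  right_inv g := Subtype.ext (LinearMap.ext fun x => congrArg g.1
    ((LinearEquiv.ofBijective (theta B n) (theta_bijective hl n)).symm_apply_apply x))

/-- `Hom_U(U^{⊗_A (n+1)}, M) ≅ Hom_{Aᵒᵖ}(U^{⊗_{Aᵒᵖ} n}, M)`. -/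
noncomputable def barEquiv (hl : B.IsLeftHopf) (n : ℕ) : DiagHom B M n ≃ₗ[k] BarCochain B M n :=
  dEquiv hl n ≪≫ₗ thetaEquiv M hl n

theorem barEquiv_apply (hl : B.IsLeftHopf) {n : ℕ} (φ : DiagHom B M n)
    (z : (B.tensOp n).carrier) : (barEquiv hl n φ).1 z = φ.1 (B.cons n 1 (theta B n z)) := rfl

end Models

/-! ### Evaluation on pure tensors -/

section Pure

variable {k : Type v} [CommRing k] {A U : Type u} [Ring A] [Algebra k A] [Ring U] [Algebra k U]
  {B : LeftBialgebroid k A U}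
  {M : Type u} [AddCommGroup M] [Module k M] [Module U M] [IsScalarTower k U M]

namespace AeRing

variable (S : AeRing k A U)

theorem pureA_cons (n : ℕ) (u : U) (w : Fin n → U) (a : A) :
    S.pureA (n + 1) (Fin.cons (α := fun _ => U) u w) a = S.cons n u (S.pureA n w a) := rfl

theorem pure_snoc (n : ℕ) (w : Fin n → U) (u : U) :
    S.pure (n + 1) (Fin.snoc (α := fun _ => U) w u) = S.snoc n (S.pure n w) u := by
  induction n with
  | zero =>
    have := S.snoc_zero 1 u
    rw [map_one S.s, one_mul] at this
    exact this.symm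
  | succ n ih =>
    obtain ⟨v, w, rfl⟩ : ∃ v w', Fin.cons (α := fun _ => U) v w' = w :=
      ⟨w 0, Fin.tail w, Fin.cons_self_tail w⟩
    rw [← Fin.cons_snoc_eq_snoc_cons]
    change S.cons (n + 1) v (S.pure (n + 1) (Fin.snoc (α := fun _ => U) w u)) =
      S.snoc (n + 1) (S.cons n v (S.pure n w)) u
    rw [ih, snoc_cons]

end AeRing

namespace LeftBialgebroid

theorem splitAt_zero_cons {n : ℕ} (p q v : U) (w : Fin n → U) :
    splitAt (0 : Fin (n + 1)) p q (Fin.cons (α := fun _ => U) v w) =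
      Fin.cons (α := fun _ => U) p (Fin.cons (α := fun _ => U) q w) := by
  rw [splitAt, Fin.update_cons_zero, Fin.insertNth_succ_cons, Fin.insertNth_zero']

theorem splitAt_succ_cons {n : ℕ} (i : Fin n) (p q v : U) (w : Fin n → U) :
    splitAt i.succ p q (Fin.cons (α := fun _ => U) v w) =
      Fin.cons (α := fun _ => U) v (splitAt i p q w) := by
  rw [splitAt, ← Fin.cons_update, Fin.insertNth_succ_cons]
  rfl

theorem dl_zero_pureA (n : ℕ) (v : U) (w : Fin n → U) (a : A) {m : ℕ} (p q : Fin m → U)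
    (h : ∑ j, btmul B.tL B.sL (p j) (q j) = B.Δ v) :
    (B.dl n 0).1 (B.pureA (n + 1) (Fin.cons (α := fun _ => U) v w) a) =
      ∑ j, B.pureA (n + 2) (splitAt 0 (p j) (q j) (Fin.cons (α := fun _ => U) v w)) a := by
  have hb : IsBal k B.tL B.sL (fun p q => B.cons (n + 1) p (B.cons n q (B.pureA n w a))) :=
    B.isBal_consCons n LinearMap.id _
  have h1 := hb.of_rep Finset.univ p q h
  rw [AeRing.pureA_cons, dl_zero_cons, sw, ← h1]
  refine Finset.sum_congr rfl fun j _ => ?_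
  rw [splitAt_zero_cons, AeRing.pureA_cons, AeRing.pureA_cons]

theorem dl_pureA (n : ℕ) (i : Fin (n + 1)) (w : Fin (n + 1) → U) (a : A) {m : ℕ} (p q : Fin m → U)
    (h : ∑ j, btmul B.tL B.sL (p j) (q j) = B.Δ (w i)) :
    (B.dl n i).1 (B.pureA (n + 1) w a) = ∑ j, B.pureA (n + 2) (splitAt i (p j) (q j) w) a := by
  obtain ⟨v, w, rfl⟩ : ∃ v w', Fin.cons (α := fun _ => U) v w' = w :=
    ⟨w 0, Fin.tail w, Fin.cons_self_tail w⟩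
  induction n generalizing v with
  | zero =>
    obtain rfl : i = 0 := Fin.ext (by omega)
    exact dl_zero_pureA 0 v w a p q h
  | succ n ih =>
    induction i using Fin.cases with
    | zero => exact dl_zero_pureA (n + 1) v w a p q h
    | succ i =>
      obtain ⟨v', w, rfl⟩ : ∃ v w', Fin.cons (α := fun _ => U) v w' = w :=
        ⟨w 0, Fin.tail w, Fin.cons_self_tail w⟩
      have := ih i v' w h
      rw [AeRing.pureA_cons, Fin.val_succ, dl_succ_cons, this, map_sum]
      refine Finset.sum_congr rfl fun j _ => ?_
      rw [splitAt_succ_cons, AeRing.pureA_cons]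

theorem contractNth_zero_cons {n : ℕ} (op : U → U → U) (u v : U) (w : Fin n → U) :
    Fin.contractNth (0 : Fin (n + 2)) op
      (Fin.cons (α := fun _ => U) u (Fin.cons (α := fun _ => U) v w)) =
      Fin.cons (α := fun _ => U) (op u v) w := by
  funext j
  induction j using Fin.cases with
  | zero => rw [Fin.contractNth_apply_of_eq _ _ _ _ rfl]; rfl
  | succ j =>
    rw [Fin.contractNth_apply_of_gt _ _ _ _ (by simp)]
    rfl

theorem contractNth_succ_cons {n : ℕ} (i : Fin (n + 1)) (op : U → U → U) (u : U)
    (w : Fin (n + 1) → U) :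
    Fin.contractNth i.succ op (Fin.cons (α := fun _ => U) u w) =
      Fin.cons (α := fun _ => U) u (Fin.contractNth i op w) := by
  funext j
  induction j using Fin.cases with
  | zero => rw [Fin.contractNth_apply_of_lt _ _ _ _ (by simp)]; rfl
  | succ j =>
    rw [Fin.cons_succ]
    rcases lt_trichotomy (j : ℕ) i with h | h | h
    · rw [Fin.contractNth_apply_of_lt _ _ _ _ (by simpa using h),
        Fin.contractNth_apply_of_lt _ _ _ _ h, ← Fin.succ_castSucc, Fin.cons_succ]
    · rw [Fin.contractNth_apply_of_eq _ _ _ _ (by simpa using h),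
        Fin.contractNth_apply_of_eq _ _ _ _ h, ← Fin.succ_castSucc, Fin.cons_succ, Fin.cons_succ]
    · rw [Fin.contractNth_apply_of_gt _ _ _ _ (by simpa using h),
        Fin.contractNth_apply_of_gt _ _ _ _ h, Fin.cons_succ]

theorem eps_pureA (n : ℕ) (i : Fin n) (w : Fin (n + 1) → U) (a : A) :
    (B.eps n i).1 (B.pureA (n + 1) w a) =
      B.pureA n (Fin.contractNth i.castSucc (fun x y => B.s (B.ε x) * y) w) a := by
  induction n with
  | zero => exact i.elim0
  | succ n ih =>
    obtain ⟨v, w, rfl⟩ : ∃ v w', Fin.cons (α := fun _ => U) v w' = w :=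
      ⟨w 0, Fin.tail w, Fin.cons_self_tail w⟩
    rw [AeRing.pureA_cons]
    induction i using Fin.cases with
    | zero =>
      obtain ⟨v', w, rfl⟩ : ∃ v w', Fin.cons (α := fun _ => U) v w' = w :=
        ⟨w 0, Fin.tail w, Fin.cons_self_tail w⟩
      rw [Fin.val_zero, eps_zero_cons, Fin.castSucc_zero, contractNth_zero_cons, AeRing.pureA_cons,
        AeRing.pureA_cons, diag_s, AeRing.act_cons]
    | succ i =>
      rw [Fin.val_succ, eps_succ_cons, ih, ← Fin.succ_castSucc, contractNth_succ_cons,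
        AeRing.pureA_cons]

theorem eps_last_pure (n : ℕ) (w : Fin (n + 1) → U) :
    (B.eps n n).1 (B.pure (n + 1) w) = B.pureA n (Fin.init w) (B.ε (w (Fin.last n))) := by
  have h : ∀ n (w : Fin n → U) (a : A), B.tensR n a (B.pure n w) = B.pureA n w a := by
    intro n
    induction n with
    | zero => intro w a; exact (B.tensR_zero a 1).trans (by rw [one_mul]; rfl)
    | succ n ih =>
      intro w a
      exact (B.tensR_cons n a (w 0) _).trans (congrArg (B.cons n (w 0)) (ih _ _))
  conv_lhs => rw [← Fin.snoc_init_self w]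
  rw [AeRing.pure_snoc, eps_last_snoc, h]

end LeftBialgebroid

/-! ### The map `theta` on pure tensors -/

theorem theta_pureOpA_succ (n : ℕ) (w : Fin (n + 1) → U) (a : A) :
    theta B (n + 1) (B.pureOpA (n + 1) w a) =
      B.diag (n + 1) (w 0) (B.cons n 1 (theta B n (B.pureOpA n (Fin.tail w) a))) :=
  theta_consOp _ _ _

theorem theta_pureOpA_cons (n : ℕ) (u : U) (w : Fin n → U) (a : A) :
    theta B (n + 1) (B.pureOpA (n + 1) (Fin.cons (α := fun _ => U) u w) a) =
      B.diag (n + 1) u (B.cons n 1 (theta B n (B.pureOpA n w a))) :=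
  theta_consOp _ _ _

theorem eps_zero_one_cons (n : ℕ) (x : (B.tens n).carrier) :
    (B.eps n 0).1 (B.cons n 1 x) = x := by
  rw [B.eps_zero_cons, B.counit_one, map_one, B.diag_one]

/-- Each stage of θ creates an entry 1 and acts on it. Applying ε to such a 1 removes it, and two
successive actions uⁱ·(uⁱ⁺¹·⋯) merge into the action of the product. U-linearity of the operator
allows this below the outer actions. -/
theorem eps_theta (n : ℕ) (i : Fin n) (w : Fin (n + 1) → U) (a : A) :
    (B.eps n i).1 (theta B (n + 1) (B.pureOpA (n + 1) w a)) =
      theta B n (B.pureOpA n (Fin.contractNth i.castSucc (· * ·) w) a) := by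
  induction n with
  | zero => exact i.elim0
  | succ n ih =>
    obtain ⟨v, w, rfl⟩ : ∃ v w', Fin.cons (α := fun _ => U) v w' = w :=
      ⟨w 0, Fin.tail w, Fin.cons_self_tail w⟩
    rw [theta_pureOpA_cons, ← B.diag_eps _ _ (by omega)]
    induction i using Fin.cases with
    | zero =>
      obtain ⟨v', w, rfl⟩ : ∃ v w', Fin.cons (α := fun _ => U) v w' = w :=
        ⟨w 0, Fin.tail w, Fin.cons_self_tail w⟩
      rw [Fin.val_zero, eps_zero_one_cons, Fin.castSucc_zero,
        LeftBialgebroid.contractNth_zero_cons, theta_pureOpA_cons, theta_pureOpA_cons, B.diag_mul]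
    | succ i =>
      rw [Fin.val_succ, B.eps_succ_cons, ih, ← Fin.succ_castSucc,
        LeftBialgebroid.contractNth_succ_cons, theta_pureOpA_cons]

theorem eps_last_theta (n : ℕ) (w : Fin (n + 1) → U) :
    (B.eps n n).1 (theta B (n + 1) (B.pureOp (n + 1) w)) =
      theta B n (B.pureOpA n (Fin.init w) (B.ε (w (Fin.last n)))) := by
  induction n with
  | zero =>
    rw [AeRing.pureOp, theta_pureOpA_succ, ← B.diag_eps _ _ le_rfl, eps_zero_one_cons]
    refine (B.diag_zero (w 0) 1).trans ?_
    rw [map_one, mul_one]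
    rfl
  | succ n ih =>
    have h := ih (Fin.tail w)
    rw [AeRing.pureOp] at h ⊢
    rw [theta_pureOpA_succ, ← B.diag_eps _ _ le_rfl, B.eps_succ_cons, h, theta_pureOpA_succ]
    rfl

theorem dl_one_cons (n : ℕ) (x : (B.tens n).carrier) :
    (B.dl n 0).1 (B.cons n 1 x) = B.cons (n + 1) 1 (B.cons n 1 x) := by
  rw [B.dl_zero_cons]
  exact LeftBialgebroid.sw_one (B.isBal_consCons n LinearMap.id x)

/-- Applying Δ to an entry 1 created by θ gives (1 | 1), which is the stage of θ with 1 inserted in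
the argument. -/
theorem dl_theta (n : ℕ) (j : Fin (n + 1)) (w : Fin n → U) (a : A) :
    (B.dl n j).1 (B.cons n 1 (theta B n (B.pureOpA n w a))) =
      B.cons (n + 1) 1
        (theta B (n + 1) (B.pureOpA (n + 1) (Fin.insertNth (α := fun _ => U) j 1 w) a)) := by
  have key : ∀ n (w : Fin n → U), (B.dl n 0).1 (B.cons n 1 (theta B n (B.pureOpA n w a))) =
      B.cons (n + 1) 1 (theta B (n + 1)
        (B.pureOpA (n + 1) (Fin.insertNth (α := fun _ => U) (0 : Fin (n + 1)) 1 w) a)) := by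
    intro n w
    rw [dl_one_cons, Fin.insertNth_zero', theta_pureOpA_cons, B.diag_one]
  induction n with
  | zero =>
    obtain rfl : j = 0 := Fin.ext (by omega)
    exact key 0 w
  | succ n ih =>
    induction j using Fin.cases with
    | zero => exact key (n + 1) w
    | succ j =>
      obtain ⟨v, w, rfl⟩ : ∃ v w', Fin.cons (α := fun _ => U) v w' = w :=
        ⟨w 0, Fin.tail w, Fin.cons_self_tail w⟩
      rw [Fin.insertNth_succ_cons, theta_pureOpA_cons, theta_pureOpA_cons, Fin.val_succ,
        B.dl_succ_cons, ← B.diag_dl _ _ (by omega), ih]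

/-- `theta(u¹, …, uⁿ⁺¹) = (theta(u¹₍₁₎, …, uⁿ₍₁₎) | u¹₍₂₎ ⋯ uⁿ₍₂₎ uⁿ⁺¹)`. -/
theorem theta_eq_snoc (n : ℕ) (w : Fin (n + 1) → U) (m : ℕ) (p q : Fin n → Fin m → U)
    (h : ∀ i, ∑ j, btmul B.tL B.sL (p i j) (q i j) = B.Δ (w i.castSucc)) :
    theta B (n + 1) (B.pureOp (n + 1) w) = ∑ j : Fin n → Fin m,
      B.snoc n (theta B n (B.pureOp n fun i => p i (j i)))
        ((List.ofFn fun i => q i (j i)).prod * w (Fin.last n)) := by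
  induction n with
  | zero =>
    rw [AeRing.pureOp, theta_pureOpA_succ]
    rw [Finset.univ_unique, Finset.sum_singleton]
    have h0 : theta B 0 (B.pureOp 0 fun i => p i ((default : Fin 0 → Fin m) i)) = B.ofBase 1 := rfl
    rw [h0, B.snoc_zero, B.diag_cons]
    have h2 : ∀ r s : U, B.cons 0 (r * 1) (B.diag 0 s (theta B 0 (B.pureOpA 0 (Fin.tail w) 1))) =
        (B.cons 0).flip (B.ofBase 1) (B.t (MulOpposite.op (B.ε s)) * r) := by
      intro r s
      have : B.diag 0 s (theta B 0 (B.pureOpA 0 (Fin.tail w) 1)) = (B.tens 0).act (B.ε s) (B.ofBase 1) :=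
        (B.diag_zero s 1).trans (by rw [map_one, mul_one, B.act_zero, mul_one])
      rw [this, LinearMap.flip_apply, B.cons_bal, mul_one]
    simp only [h2]
    refine (map_bsum ((B.cons 0).flip (B.ofBase 1)) (B.Δ (w 0))
      (fun p q => B.t (MulOpposite.op (B.ε q)) * p)).symm.trans ?_
    have h3 := B.sw_counit_right (w 0)
    rw [LeftBialgebroid.sw] at h3
    rw [h3]
    simp
  | succ n ih =>
    have e : ∀ (F : (Fin (n + 1) → Fin m) → (B.tens (n + 2)).carrier),
        ∑ j, F j = ∑ j0 : Fin m, ∑ j : Fin n → Fin m,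
          F (Fin.cons (α := fun _ => Fin m) j0 j) := by
      intro F
      rw [← Fintype.sum_prod_type']
      exact ((Fin.consEquiv fun _ => Fin m).sum_comp F).symm
    rw [e, AeRing.pureOp, theta_pureOpA_succ]
    have ih' := ih (Fin.tail w) (fun i => p i.succ) (fun i => q i.succ) (fun i => h i.succ)
    rw [AeRing.pureOp] at ih'
    rw [ih', map_sum, map_sum, Finset.sum_comm]
    refine Finset.sum_congr rfl fun j _ => ?_
    -- Acting by u¹ on (1 | x | v) multiplies the last entry from the left by the second leg of u¹,
    -- which is how the product of second legs accumulates.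
    rw [← B.snoc_cons, B.diag_snoc]
    refine ((B.isBal_snoc (n + 1) LinearMap.id _ _).of_rep Finset.univ (p 0) (q 0) (h 0)).symm.trans ?_
    refine Finset.sum_congr rfl fun j0 _ => ?_
    rw [LinearMap.id_apply, List.ofFn_succ, List.prod_cons, mul_assoc]
    congr 1

/-- `v (u¹ | ⋯ | uⁿ | 1)` as a value of `theta`. -/
theorem diag_pure_snoc_one (hl : B.IsLeftHopf) (n : ℕ) (v : U) (w : Fin n → U) (m : ℕ)
    (p q : Fin n → Fin m → U)
    (h : ∀ i, ∑ j, btmul B.tR B.tL (p i j) (q i j) = hl.transl (w i)) :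
    B.diag (n + 1) v (B.pure (n + 1) (Fin.snoc (α := fun _ => U) w 1)) =
      ∑ j : Fin n → Fin m, theta B (n + 1) (B.pureOp (n + 1) fun i =>
        (Fin.cons (α := fun _ => U) v (fun i => q i (j i)) : Fin (n + 1) → U) i *
          (Fin.snoc (α := fun _ => U) (fun i => p i (j i)) 1 : Fin (n + 1) → U) i) := by
  induction n generalizing v with
  | zero =>
    rw [Finset.univ_unique, Finset.sum_singleton, AeRing.pureOp, theta_pureOpA_succ]
    have hs : ∀ f : Fin 0 → U, (Fin.snoc (α := fun _ => U) f 1 : Fin 1 → U) 0 = 1 := fun f => rfl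
    rw [hs, Fin.cons_zero, mul_one]
    rfl
  | succ n ih =>
    obtain ⟨u, w, rfl⟩ : ∃ v w', Fin.cons (α := fun _ => U) v w' = w :=
      ⟨w 0, Fin.tail w, Fin.cons_self_tail w⟩
    have e : ∀ (F : (Fin (n + 1) → Fin m) → (B.tens (n + 2)).carrier),
        ∑ j, F j = ∑ j0 : Fin m, ∑ j : Fin n → Fin m,
          F (Fin.cons (α := fun _ => Fin m) j0 j) := by
      intro F
      rw [← Fintype.sum_prod_type']
      exact ((Fin.consEquiv fun _ => Fin m).sum_comp F).symm
    rw [e, ← Fin.cons_snoc_eq_snoc_cons, AeRing.pure, AeRing.pureA_cons, ← AeRing.pure,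
      ← cons_transl hl, map_bsum]
    simp only [← B.diag_mul]
    have hb : IsBal k B.tR B.tL (fun y z => B.diag (n + 2) (v * y) (B.cons (n + 1) 1
        (B.diag (n + 1) z (B.pure (n + 1) (Fin.snoc (α := fun _ => U) w 1))))) := by
      constructor <;> intros <;>
        simp [mul_add, ← mul_assoc, B.diag_mul, B.diag_t, AeRing.tensR_cons]
    refine (hb.of_rep Finset.univ (p 0) (q 0) (h 0)).symm.trans ?_
    refine Finset.sum_congr rfl fun j0 _ => ?_
    rw [ih (q 0 j0) w (fun i => p i.succ) (fun i => q i.succ) (fun i => h i.succ), map_sum, map_sum]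
    refine Finset.sum_congr rfl fun j _ => ?_
    rw [← theta_consOp]
    have hF : (fun i => (Fin.cons (α := fun _ => U) v (fun i : Fin (n + 1) =>
          q i (Fin.cons (α := fun _ => Fin m) j0 j i)) : Fin (n + 2) → U) i *
          (Fin.snoc (α := fun _ => U) (fun i : Fin (n + 1) =>
            p i (Fin.cons (α := fun _ => Fin m) j0 j i)) 1 : Fin (n + 2) → U) i) =
        Fin.cons (α := fun _ => U) (v * p 0 j0) (fun i =>
          (Fin.cons (α := fun _ => U) (q 0 j0) (fun i => q i.succ (j i)) : Fin (n + 1) → U) i *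
          (Fin.snoc (α := fun _ => U) (fun i => p i.succ (j i)) 1 : Fin (n + 1) → U) i) := by
      have hp : (fun i : Fin (n + 1) => p i (Fin.cons (α := fun _ => Fin m) j0 j i)) =
          Fin.cons (α := fun _ => U) (p 0 j0) (fun i => p i.succ (j i)) := by
        funext i
        induction i using Fin.cases <;> rfl
      rw [hp, ← Fin.cons_snoc_eq_snoc_cons]
      funext i
      induction i using Fin.cases with
      | zero => rfl
      | succ i =>
        simp only [Fin.cons_succ]
        congr 1
        induction i using Fin.cases <;> rfl
    rw [hF]
    rfl

end Pure

/-! ### Alternating sums of faces -/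

section AltSum

/-- The alternating sum of faces squares to zero. -/
theorem alternating_comp_eq_zero {k : Type*} [CommRing k] {X Y Z : Type*}
    [AddCommGroup X] [Module k X] [AddCommGroup Y] [Module k Y] [AddCommGroup Z] [Module k Z]
    (n : ℕ) (d : Fin (n + 2) → Y →ₗ[k] Z) (d' : Fin (n + 3) → X →ₗ[k] Y)
    (h : ∀ i j : Fin (n + 2), i ≤ j → d i ∘ₗ d' j.succ = d j ∘ₗ d' i.castSucc) :
    (∑ i : Fin (n + 2), (-1 : ℤ) ^ (i : ℕ) • d i) ∘ₗ
      (∑ i : Fin (n + 3), (-1 : ℤ) ^ (i : ℕ) • d' i) = 0 := by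
  refine LinearMap.ext fun x => ?_
  simp only [LinearMap.comp_apply, LinearMap.sum_apply, LinearMap.smul_apply, map_sum, map_zsmul,
    Finset.smul_sum, smul_smul, ← pow_add, LinearMap.zero_apply]
  rw [Finset.sum_comm, ← Finset.sum_product', Finset.univ_product_univ]
  let P := Fin (n + 2) × Fin (n + 3)
  let S : Finset P := {ij : P | (ij.2 : ℕ) ≤ (ij.1 : ℕ)}
  rw [← Finset.sum_add_sum_compl S, ← eq_neg_iff_add_eq_zero, ← Finset.sum_neg_distrib]
  -- The terms with j ≤ i cancel against those with j > i through (i, j) ↦ (j, i + 1), which changes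
  -- the sign.
  let φ : ∀ ij : P, ij ∈ S → P := fun ij hij =>
    (Fin.castLT ij.2 (lt_of_le_of_lt (Finset.mem_filter.mp hij).right (Fin.is_lt ij.1)), ij.1.succ)
  apply Finset.sum_bij φ
  · intro ij hij
    simp only [S, φ, Finset.mem_univ, Finset.compl_filter, Finset.mem_filter, true_and,
      Fin.val_succ, Fin.val_castLT] at hij ⊢
    omega
  · rintro ⟨i, j⟩ hij ⟨i', j'⟩ hij' h
    rw [Prod.mk_inj]
    exact ⟨by simpa [φ] using congr_arg Prod.snd h,
      by simpa [φ, Fin.castSucc_castLT] using congr_arg Fin.castSucc (congr_arg Prod.fst h)⟩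
  · rintro ⟨i', j'⟩ hij'
    simp only [S, Finset.mem_univ, Finset.compl_filter, not_le,
      Finset.mem_filter, true_and] at hij'
    refine ⟨(j'.pred <| ?_, Fin.castSucc i'), ?_, ?_⟩
    · rintro rfl
      simp at hij'
    · simpa [S] using Nat.le_sub_one_of_lt hij'
    · simp [φ]
  · rintro ⟨i, j⟩ hij
    simp only [S, Finset.mem_filter, Finset.mem_univ, true_and] at hij
    have h1 := LinearMap.congr_fun (h (Fin.castLT j (lt_of_le_of_lt hij i.isLt)) i
      (by rw [Fin.le_def]; exact hij)) x
    simp only [LinearMap.comp_apply, Fin.castSucc_castLT] at h1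
    rw [← h1, ← neg_smul]
    simp only [φ, Fin.val_succ, Fin.val_castLT]
    congr 1
    rw [add_right_comm, pow_succ, add_comm (j : ℕ)]
    simp

variable {k : Type v} [CommRing k]
  {X : ℕ → Type u} [∀ n, AddCommGroup (X n)] [∀ n, Module k (X n)]
  {Y : ℕ → Type u} [∀ n, AddCommGroup (Y n)] [∀ n, Module k (Y n)]

theorem altSum_comp_altSum (d : ∀ n, Fin (n + 2) → X (n + 1) →ₗ[k] X n)
    (h : ∀ n (i j : Fin (n + 2)), i ≤ j →
      d n i ∘ₗ d (n + 1) j.succ = d n j ∘ₗ d (n + 1) i.castSucc) (n : ℕ) :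
    altSum d n ∘ₗ altSum d (n + 1) = 0 :=
  alternating_comp_eq_zero n _ _ (h n)

theorem altSum_map (d : ∀ n, Fin (n + 2) → X (n + 1) →ₗ[k] X n)
    (b : ∀ n, Fin (n + 2) → Y (n + 1) →ₗ[k] Y n) (e : ∀ n, X n →ₗ[k] Y n)
    (h : ∀ n i x, e n (d n i x) = b n i (e (n + 1) x)) (n : ℕ) (x : X (n + 1)) :
    e n (altSum d n x) = altSum b n (e (n + 1) x) := by
  simp only [altSum, LinearMap.sum_apply, LinearMap.smul_apply, map_sum, map_zsmul, h]

end AltSum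

theorem AeRing.pure_cons {k : Type v} [CommRing k] {A U : Type u} [Ring A] [Algebra k A] [Ring U]
    [Algebra k U] (S : AeRing k A U) (n : ℕ) (u : U) (w : Fin n → U) :
    S.pure (n + 1) (Fin.cons (α := fun _ => U) u w) = S.cons n u (S.pure n w) := rfl

/-! ### Explicit formulas and the faces on D -/

section StructureMaps

variable {k : Type v} [CommRing k] {A U : Type u} [Ring A] [Algebra k A] [Ring U] [Algebra k U]
  {B : LeftBialgebroid k A U}
  {M : Type u} [AddCommGroup M] [Module k M] [Module U M] [IsScalarTower k U M]
  {hl : B.IsLeftHopf} {c : Contraaction B M}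

open LeftBialgebroid DiagHom

theorem arrowCongr_apply_eq {V W V' W' : Type u} [AddCommGroup V] [Module k V] [AddCommGroup W]
    [Module k W] [AddCommGroup V'] [Module k V'] [AddCommGroup W'] [Module k W']
    (e : V ≃ₗ[k] V') (e' : W ≃ₗ[k] W') (f : V →ₗ[k] W) (x : V) :
    LinearEquiv.arrowCongr e e' f (e x) = e' (f x) := by
  simp

/-- Everything is evaluated on (1 | θ(u¹, …, uⁿ)). The zeroth coface deletes the leading 1, and
U-linearity then releases u¹ as an action on M. For τ, `theta_eq_snoc` exposes the last entry,
`powInv_snoc` gives the contraaction, and the left translation map restores the form with leading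
entry 1. -/
theorem barFormulas (hM : IsAYD hl c) (hst : IsStable c) :
    BarFormulas hl c
      (fun n i => LinearEquiv.arrowCongr (barEquiv (M := M) hl n) (barEquiv hl (n + 1))
        (coface n i))
      (fun n i => LinearEquiv.arrowCongr (barEquiv (M := M) hl (n + 1)) (barEquiv hl n)
        (codegen n i))
      (fun n => LinearEquiv.arrowCongr (barEquiv hl n) (barEquiv hl n)
        (powInv (X := fun n => DiagHom B M n) (rot hM) n)) where
  δ_zero n f w := by
    obtain ⟨φ, rfl⟩ := (barEquiv hl n).surjective f
    rw [arrowCongr_apply_eq, barEquiv_apply, barEquiv_apply, coface_apply, Fin.val_zero,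
      eps_zero_one_cons, AeRing.pureOp, theta_pureOpA_succ, map_diag]
    rfl
  δ_mid n f i w := by
    obtain ⟨φ, rfl⟩ := (barEquiv hl n).surjective f
    rw [arrowCongr_apply_eq, barEquiv_apply, barEquiv_apply, coface_apply, Fin.val_succ,
      B.eps_succ_cons]
    exact congrArg (fun z => φ.1 (B.cons n 1 z)) (eps_theta n i w 1)
  δ_last n f w := by
    obtain ⟨φ, rfl⟩ := (barEquiv hl n).surjective f
    rw [arrowCongr_apply_eq, barEquiv_apply, barEquiv_apply, coface_apply, Fin.val_last,
      B.eps_succ_cons, eps_last_theta]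
  σ_eq n f j w := by
    obtain ⟨φ, rfl⟩ := (barEquiv hl (n + 1)).surjective f
    rw [arrowCongr_apply_eq, barEquiv_apply, barEquiv_apply, codegen_apply]
    exact congrArg φ.1 (dl_theta n j w 1)
  τ_zero := by
    ext; simp [powInv]
  τ_succ n f w m p q h := by
    obtain ⟨φ, rfl⟩ := (barEquiv hl (n + 1)).surjective f
    rw [arrowCongr_apply_eq, barEquiv_apply, theta_eq_snoc n w m p q h, map_sum, map_sum]
    refine GammaRel.sum _ fun j => ?_
    rw [← B.snoc_cons]
    refine (powInv_snoc hM hst φ _ _).congr fun v => ?_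
    rw [DiagHom.map_cons hl, evalL_eq]
    congr 1; funext y z
    change _ = y • φ.1 (B.cons (n + 1) 1 (theta B (n + 1) (B.consOp n (z * v) _)))
    rw [theta_consOp, B.diag_mul]

/-- The change of coordinates evaluates φ at (u¹ | ⋯ | uⁿ | 1). The left translation map rewrites
(u¹ | y) as u¹₊·(1 | u¹₋y), and `diag_pure_snoc_one` expresses u¹₋y through θ. -/
theorem xiFormula (hr : B.IsRightHopf) : XiFormula hl
    (fun n => (barEquiv (M := M) hl n).symm ≪≫ₗ cobarEquiv hr n) where
  ξ_zero g w := by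
    obtain ⟨φ, rfl⟩ := (barEquiv hl 0).surjective g
    rw [LinearEquiv.trans_apply, LinearEquiv.symm_apply_apply, cobarEquiv_apply, barEquiv_apply]
    refine congrArg φ.1 ((B.snoc_zero 1 1).trans ?_)
    rw [map_one B.s, one_mul]
    rfl
  ξ_succ n g w m p q h := by
    obtain ⟨φ, rfl⟩ := (barEquiv hl (n + 1)).surjective g
    rw [LinearEquiv.trans_apply, LinearEquiv.symm_apply_apply, cobarEquiv_apply, ← B.pure_snoc]
    obtain ⟨u, w, rfl⟩ : ∃ v w', Fin.cons (α := fun _ => U) v w' = w :=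
      ⟨w 0, Fin.tail w, Fin.cons_self_tail w⟩
    have e : ∀ (F : (Fin (n + 1) → Fin m) → M),
        ∑ j, F j = ∑ j0 : Fin m, ∑ j : Fin n → Fin m,
          F (Fin.cons (α := fun _ => Fin m) j0 j) := by
      intro F
      rw [← Fintype.sum_prod_type']
      exact ((Fin.consEquiv fun _ => Fin m).sum_comp F).symm
    rw [← Fin.cons_snoc_eq_snoc_cons, AeRing.pure_cons,
      DiagHom.map_cons hl, e]
    have hb : IsBal k B.tR B.tL (fun y z => y • φ.1 (B.cons (n + 1) 1
        (B.diag (n + 1) z (B.pure (n + 1) (Fin.snoc (α := fun _ => U) w 1))))) :=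
      isBal_smul (diagSlice (DiagHom.toD (n + 1) φ)
        (B.pure (n + 1) (Fin.snoc (α := fun _ => U) w 1)))
    refine (hb.of_rep Finset.univ (p 0) (q 0) (h 0)).symm.trans ?_
    refine Finset.sum_congr rfl fun j0 _ => ?_
    rw [diag_pure_snoc_one hl n (q 0 j0) w m (fun i => p i.succ) (fun i => q i.succ)
      (fun i => h i.succ), map_sum, map_sum, Finset.smul_sum]
    refine Finset.sum_congr rfl fun j _ => ?_
    rw [barEquiv_apply]
    congr 5
    funext i
    induction i using Fin.lastCases with
    | last =>
      rw [Fin.snoc_last, Fin.snoc_last, mul_one]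
      obtain _ | n := n
      · rfl
      · rw [← Fin.succ_last]
        rfl
    | cast i =>
      rw [Fin.snoc_castSucc, Fin.snoc_castSucc]
      congr 1
      obtain _ | n := n
      · exact i.elim0
      · induction i using Fin.cases <;> rfl

theorem cobarFormulas (hr : B.IsRightHopf) (hM : IsAYD hl c) (hst : IsStable c) :
    CobarFormulas hr c
      (fun n i => LinearEquiv.arrowCongr (cobarEquiv (M := M) hr (n + 1)) (cobarEquiv hr n)
        (dualFace (X := fun n => DiagHom B M n) codegen
          (powInv (X := fun n => DiagHom B M n) (rot hM)) n i))
      (fun n j => LinearEquiv.arrowCongr (cobarEquiv (M := M) hr n) (cobarEquiv hr (n + 1))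
        (coface n j.castSucc))
      (fun n => LinearEquiv.arrowCongr (cobarEquiv hr n) (cobarEquiv hr n) (rot hM n)) where
  d_zero n f w := by
    obtain ⟨φ, rfl⟩ := (cobarEquiv hr (n + 1)).surjective f
    rw [arrowCongr_apply_eq, cobarEquiv_apply, dualFace_zero, codegen_apply, Fin.val_last,
      B.dl_last_snoc]
    have h1 : B.sw 1 (fun p q => B.snoc (n + 1) (B.snoc n (B.pure n w) p) q) =
        B.snoc (n + 1) (B.snoc n (B.pure n w) 1) 1 := by
      refine sw_one ?_
      constructor <;> intros <;> simp [← AeRing.tensR_snoc, AeRing.snoc_tensR]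
    rw [h1]
    refine (powInv_snoc hM hst φ _ _).congr fun v => ?_
    rw [evalR_eq]
    -- The cyclic operator leaves φ(1 | v·(x | 1)). The stated face has v₍₊₎φ(v₍₋₎ | x | 1), and
    -- moving v₍₊₎ inside gives the same by the right translation identity.
    have h2 := hr.bsum_transl (F := fun p q => φ.1 (B.cons (n + 1) p
      (B.diag (n + 1) q (B.snoc n (B.pure n w) 1)))) (by
        simpa using (B.diag_isBal (n + 1) 1 (B.snoc n (B.pure n w) 1)).comp φ.1) v
    rw [← h2]
    congr 1; funext y z
    change _ = y • φ.1 (B.snoc (n + 1) (B.cons n z (B.pure n w)) 1)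
    rw [B.snoc_cons, ← map_diag φ, B.diag_cons, map_bsum]
  d_mid n f i w m p q h := by
    obtain ⟨φ, rfl⟩ := (cobarEquiv hr (n + 1)).surjective f
    obtain _ | n := n
    · exact i.elim0
    rw [arrowCongr_apply_eq, cobarEquiv_apply, dualFace_succ, codegen_apply]
    simp only [cobarEquiv_apply]
    rw [Fin.val_castSucc, B.dl_snoc _ _ (by omega), AeRing.pure, dl_pureA n i w 1 p q h, map_sum,
      LinearMap.sum_apply, map_sum]
    rfl
  d_last n f w := by
    obtain ⟨φ, rfl⟩ := (cobarEquiv hr (n + 1)).surjective f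
    rw [← Fin.succ_last, arrowCongr_apply_eq, cobarEquiv_apply, dualFace_succ, codegen_apply,
      Fin.val_last, B.dl_last_snoc, cobarEquiv_apply, B.pure_snoc]
    refine congrArg φ.1 (sw_one ?_)
    constructor <;> intros <;> simp [← AeRing.tensR_snoc, AeRing.snoc_tensR]
  s_lt n f j w := by
    obtain ⟨φ, rfl⟩ := (cobarEquiv hr n).surjective f
    rw [arrowCongr_apply_eq, cobarEquiv_apply, coface_apply, Fin.val_castSucc, Fin.val_castSucc,
      B.eps_snoc _ _ (by omega), cobarEquiv_apply]
    exact congrArg (fun z => φ.1 (B.snoc n z 1)) (eps_pureA n j w 1)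
  s_last n f w := by
    obtain ⟨φ, rfl⟩ := (cobarEquiv hr n).surjective f
    rw [arrowCongr_apply_eq, cobarEquiv_apply, coface_apply, Fin.val_castSucc, Fin.val_last,
      B.eps_snoc _ _ le_rfl, cobarEquiv_apply, eps_last_pure]
  t_zero := by
    have h : rot hM 0 = LinearMap.id := (pow_one _).symm.trans ((isRotational hM hst).T_pow 0)
    rw [h]
    ext; simp
  t_succ n f w := by
    obtain ⟨φ, rfl⟩ := (cobarEquiv hr (n + 1)).surjective f
    obtain ⟨u, w, rfl⟩ : ∃ v w', Fin.cons (α := fun _ => U) v w' = w :=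
      ⟨w 0, Fin.tail w, Fin.cons_self_tail w⟩
    rw [arrowCongr_apply_eq, cobarEquiv_apply, ← B.pure_snoc, ← Fin.cons_snoc_eq_snoc_cons,
      AeRing.pure_cons]
    refine (rot_cons hM φ _ _).congr fun v => ?_
    rw [rightHopfAct_eq, DiagHom.map_snoc hr]
    rfl

theorem cyclicDualVia (hr : B.IsRightHopf) (hM : IsAYD hl c) (hst : IsStable c) :
    IsCyclicDualVia (fun n => (barEquiv (M := M) hl n).symm ≪≫ₗ cobarEquiv hr n)
      (fun n i => LinearEquiv.arrowCongr (barEquiv (M := M) hl n) (barEquiv hl (n + 1))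
        (coface n i))
      (fun n i => LinearEquiv.arrowCongr (barEquiv (M := M) hl (n + 1)) (barEquiv hl n)
        (codegen n i))
      (fun n => LinearEquiv.arrowCongr (barEquiv hl n) (barEquiv hl n)
        (powInv (X := fun n => DiagHom B M n) (rot hM) n))
      (fun n i => LinearEquiv.arrowCongr (cobarEquiv (M := M) hr (n + 1)) (cobarEquiv hr n)
        (dualFace (X := fun n => DiagHom B M n) codegen
          (powInv (X := fun n => DiagHom B M n) (rot hM)) n i))
      (fun n j => LinearEquiv.arrowCongr (cobarEquiv (M := M) hr n) (cobarEquiv hr (n + 1))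
        (coface n j.castSucc))
      (fun n => LinearEquiv.arrowCongr (cobarEquiv hr n) (cobarEquiv hr n) (rot hM n)) where
  d_zero n x := by
    obtain ⟨φ, rfl⟩ := (barEquiv hl (n + 1)).surjective x
    simp only [LinearEquiv.trans_apply, arrowCongr_apply_eq, LinearEquiv.symm_apply_apply]
    rfl
  d_succ n i x := by
    obtain ⟨φ, rfl⟩ := (barEquiv hl (n + 1)).surjective x
    simp only [LinearEquiv.trans_apply, arrowCongr_apply_eq, LinearEquiv.symm_apply_apply]
    rfl
  s_eq n j x := by
    obtain ⟨φ, rfl⟩ := (barEquiv hl n).surjective x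
    simp only [LinearEquiv.trans_apply, arrowCongr_apply_eq, LinearEquiv.symm_apply_apply]
  t_eq n x := by
    obtain ⟨φ, rfl⟩ := (barEquiv hl n).surjective x
    have h := (isRotational hM hst).T_inv n φ
    simp only [LinearEquiv.trans_apply, arrowCongr_apply_eq, LinearEquiv.symm_apply_apply, h]
  t_eq' n x := by
    obtain ⟨φ, rfl⟩ := (barEquiv hl n).surjective x
    have h := (isRotational hM hst).inv_T n φ
    simp only [LinearEquiv.trans_apply, arrowCongr_apply_eq, LinearEquiv.symm_apply_apply,
      LinearEquiv.trans_symm, LinearEquiv.symm_symm, h]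

/-- The cyclic operator, as an automorphism. -/
noncomputable def rotEquiv (hM : IsAYD hl c) (hst : IsStable c) (n : ℕ) :
    DiagHom B M n ≃ₗ[k] DiagHom B M n :=
  LinearEquiv.ofLinearMap (rot hM n) (powInv (X := fun n => DiagHom B M n) (rot hM) n)
    (LinearMap.ext fun φ => (isRotational hM hst).T_inv n φ)
    (LinearMap.ext fun φ => (isRotational hM hst).inv_T n φ)

/-- The isomorphism `Hom_U(U^{⊗_A (n+1)}, M) ≅ Hom_{Aᵒᵖ}(U^{⊗_A n}, M)` given by rotation followed
by restriction. -/
noncomputable def rotD (hM : IsAYD hl c) (hst : IsStable c) (n : ℕ) :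
    DiagHom B M n ≃ₗ[k] DChain B M n :=
  rotEquiv hM hst n ≪≫ₗ dEquiv hl n

theorem rotD_apply (hM : IsAYD hl c) (hst : IsStable c) {n : ℕ} (φ : DiagHom B M n) (x) :
    (rotD hM hst n φ).1 x = (rot hM n φ).1 (B.cons n 1 x) := rfl

/-- The faces of `Hom_{Aᵒᵖ}(U^{⊗_A n}, M)`. -/
noncomputable def dFace (hM : IsAYD hl c) (hst : IsStable c) (n : ℕ) (i : Fin (n + 2)) :
    DChain B M (n + 1) →ₗ[k] DChain B M n :=
  LinearEquiv.arrowCongr (rotD hM hst (n + 1)) (rotD hM hst n)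
    (dualFace (X := fun n => DiagHom B M n) codegen
      (powInv (X := fun n => DiagHom B M n) (rot hM)) n i)

/-- D is compared through φ ↦ (Tφ)(1 | x). With this extra rotation, T d₀ = Tσ_nτ = σ₀T, and σ₀
doubles the leading 1, so the zeroth face contains no γ. -/
theorem dFace_zero (hM : IsAYD hl c) (hst : IsStable c) {n : ℕ} (f : DChain B M (n + 1)) (x) :
    (dFace hM hst n 0 f).1 x = f.1 (B.cons n 1 x) := by
  obtain ⟨φ, rfl⟩ := (rotD hM hst (n + 1)).surjective f
  rw [dFace, arrowCongr_apply_eq, rotD_apply, rotD_apply, dualFace_zero]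
  have h := LinearMap.congr_fun ((isRotational hM hst).T_σ_last n)
    (powInv (X := fun n => DiagHom B M n) (rot hM) (n + 1) φ)
  simp only [LinearMap.comp_apply] at h
  rw [h, (isRotational hM hst).T_inv, codegen_apply, Fin.val_zero, dl_one_cons]

theorem dFace_mid (hM : IsAYD hl c) (hst : IsStable c) {n : ℕ} (i : Fin (n + 1))
    (f : DChain B M (n + 2)) (x) :
    (dFace hM hst (n + 1) i.castSucc.succ f).1 x = f.1 ((B.dl n i).1 x) := by
  obtain ⟨φ, rfl⟩ := (rotD hM hst (n + 2)).surjective f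
  rw [dFace, arrowCongr_apply_eq, rotD_apply, rotD_apply, dualFace_succ]
  have h := LinearMap.congr_fun ((isRotational hM hst).T_σ (n + 1) i) φ
  simp only [LinearMap.comp_apply] at h
  rw [h, codegen_apply, Fin.val_succ, B.dl_succ_cons]

/-- Here Tσ_n = σ₀T²: one rotation is absorbed in the comparison with D, and the other appears as γ
in the last entry. -/
theorem dFace_last (hM : IsAYD hl c) (hst : IsStable c) {n : ℕ} (f : DChain B M (n + 1)) (x) :
    GammaRel c.γ (fun v => f.1 (B.snoc n x v)) ((dFace hM hst n (Fin.last (n + 1)) f).1 x) := by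
  obtain ⟨φ, rfl⟩ := (rotD hM hst (n + 1)).surjective f
  rw [dFace, arrowCongr_apply_eq, rotD_apply, ← Fin.succ_last, dualFace_succ]
  have h := LinearMap.congr_fun ((isRotational hM hst).T_σ_last n) φ
  simp only [LinearMap.comp_apply] at h
  rw [h, codegen_apply, Fin.val_zero, dl_one_cons]
  refine (rot_cons hM (rot hM (n + 1) φ) 1 (B.cons n 1 x)).congr fun v => ?_
  rw [mul_one, B.snoc_cons, rotD_apply]

theorem dFormulas (hM : IsAYD hl c) (hst : IsStable c) :
    DFormulas c (dFace (M := M) hM hst) where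
  b_zero n f w := by
    rw [dFace_zero]
    rfl
  b_mid n f i w m p q h := by
    obtain _ | n := n
    · exact i.elim0
    rw [dFace_mid, AeRing.pure, dl_pureA n i w 1 p q h, map_sum]
    rfl
  b_last n f w := by
    simp only [AeRing.pure_snoc]
    exact dFace_last hM hst f _

end StructureMaps

/-! ### Flatness of tensor powers and extension into injective modules -/

section Flat

variable {k : Type v} [CommRing k] {A : Type u} [Ring A] [Algebra k A]

section EndMaps

variable {M : Type*} [AddCommGroup M] [Module k M] {N : Type*} [AddCommGroup N] [Module k N]
  {ρ : A → Module.End k M} {l : A → Module.End k N}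
  {R : Type*} [Ring R] [Algebra k R]

/-- An action on the first factor of a balanced tensor product. -/
def BalTensor.endL (f : R →ₐ[k] Module.End k M) (hf : ∀ r a m, f r (ρ a m) = ρ a (f r m)) :
    R →ₐ[k] Module.End k (BalTensor ρ l) :=
  AlgHom.ofLinearMap
    { toFun := fun r => BalTensor.map (ρ' := ρ) (l' := l) (f r) LinearMap.id (hf r)
        (id_intertwines l)
      map_add' := fun r s => BalTensor.ext fun m n => by simp
      map_smul' := fun c r => BalTensor.ext fun m n => by simp }
    (BalTensor.ext fun m n => by simp) (fun r s => BalTensor.ext fun m n => by simp)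

/-- An action on the second factor of a balanced tensor product. -/
def BalTensor.endR (f : R →ₐ[k] Module.End k N) (hf : ∀ r a n, f r (l a n) = l a (f r n)) :
    R →ₐ[k] Module.End k (BalTensor ρ l) :=
  AlgHom.ofLinearMap
    { toFun := fun r => BalTensor.map (ρ' := ρ) (l' := l) LinearMap.id (f r) (id_intertwines ρ)
        (hf r)
      map_add' := fun r s => BalTensor.ext fun m n => by simp
      map_smul' := fun c r => BalTensor.ext fun m n => by simp }
    (BalTensor.ext fun m n => by simp) (fun r s => BalTensor.ext fun m n => by simp)

@[simp] theorem BalTensor.endL_btmul (f : R →ₐ[k] Module.End k M)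
    (hf : ∀ r a m, f r (ρ a m) = ρ a (f r m)) (r : R) (m : M) (n : N) :
    BalTensor.endL (l := l) f hf r (btmul ρ l m n) = btmul ρ l (f r m) n :=
  BalTensor.map_btmul (f r) LinearMap.id (hf r) (id_intertwines l) m n

@[simp] theorem BalTensor.endR_btmul (f : R →ₐ[k] Module.End k N)
    (hf : ∀ r a n, f r (l a n) = l a (f r n)) (r : R) (m : M) (n : N) :
    BalTensor.endR (ρ := ρ) f hf r (btmul ρ l m n) = btmul ρ l m (f r n) :=
  BalTensor.map_btmul LinearMap.id (f r) (id_intertwines ρ) (hf r) m n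

end EndMaps

/-- `M ⊗_A -` preserves injective maps of left `A`-modules. -/
def IsFlatOps {M : Type u} [AddCommGroup M] [Module k M] (ρ : A → Module.End k M) : Prop :=
  ∀ (X Y : Type u) [AddCommGroup X] [Module k X] [AddCommGroup Y] [Module k Y]
    (lX : A →ₐ[k] Module.End k X) (lY : A →ₐ[k] Module.End k Y) (φ : X →ₗ[k] Y)
    (hφ : ∀ a x, φ (lX a x) = lY a (φ x)), Function.Injective φ →
    Function.Injective (BalTensor.map (ρ := ρ) (l := fun a => lX a) (ρ' := ρ)
      (l' := fun a => lY a) LinearMap.id φ (id_intertwines ρ) hφ)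

/-- The action on the quotient by an invariant submodule. -/
def quotAct {R : Type*} [Ring R] [Algebra k R] {Y : Type*} [AddCommGroup Y] [Module k Y]
    (l : R →ₐ[k] Module.End k Y) (N : Submodule k Y) (hN : ∀ a, N ≤ N.comap (l a)) :
    R →ₐ[k] Module.End k (Y ⧸ N) :=
  AlgHom.ofLinearMap
    { toFun := fun a => N.mapQ N (l a) (hN a)
      map_add' := fun r s => by
        apply Submodule.linearMap_qext
        ext
        simp
      map_smul' := fun c r => by
        apply Submodule.linearMap_qext
        ext
        simp }
    (by
      apply Submodule.linearMap_qext
      ext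
      simp) (fun r s => by
      apply Submodule.linearMap_qext
      ext
      simp)

theorem quotAct_mk {R : Type*} [Ring R] [Algebra k R] {Y : Type*} [AddCommGroup Y] [Module k Y]
    (l : R →ₐ[k] Module.End k Y) (N : Submodule k Y) (hN : ∀ a, N ≤ N.comap (l a)) (a : R) (y : Y) :
    quotAct l N hN a (N.mkQ y) = N.mkQ (l a y) := rfl

/-- A flat module preserves exactness. -/
theorem IsFlatOps.exact {M : Type u} [AddCommGroup M] [Module k M] {ρ : A → Module.End k M}
    (h : IsFlatOps ρ) {X Y Z : Type u} [AddCommGroup X] [Module k X] [AddCommGroup Y] [Module k Y]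
    [AddCommGroup Z] [Module k Z] {lX : A →ₐ[k] Module.End k X} {lY : A →ₐ[k] Module.End k Y}
    {lZ : A →ₐ[k] Module.End k Z} (φ : X →ₗ[k] Y) (ψ : Y →ₗ[k] Z)
    (hφ : ∀ a x, φ (lX a x) = lY a (φ x)) (hψ : ∀ a x, ψ (lY a x) = lZ a (ψ x))
    (hex : Function.Exact φ ψ)
    (w : BalTensor ρ (fun a => lY a))
    (hw : BalTensor.map (ρ' := ρ) (l' := fun a => lZ a) LinearMap.id ψ (id_intertwines ρ) hψ w = 0) :
    ∃ w', BalTensor.map (ρ := ρ) (l := fun a => lX a) (ρ' := ρ) (l' := fun a => lY a)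
      LinearMap.id φ (id_intertwines ρ) hφ w' = w := by
  set N := LinearMap.range φ with hN
  have hNl : ∀ a, N ≤ N.comap (lY a) := by
    rintro a _ ⟨x, rfl⟩
    exact ⟨lX a x, hφ a x⟩
  have hk : N ≤ LinearMap.ker ψ := by
    rintro _ ⟨x, rfl⟩
    exact (hex _).2 ⟨x, rfl⟩
  have hι : ∀ a y, N.liftQ ψ hk (quotAct lY N hNl a y) = lZ a (N.liftQ ψ hk y) := by
    intro a y
    obtain ⟨y, rfl⟩ := N.mkQ_surjective y
    exact hψ a y
  have hinj : Function.Injective (N.liftQ ψ hk) := by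
    rw [injective_iff_map_eq_zero]
    intro y hy
    obtain ⟨y, rfl⟩ := N.mkQ_surjective y
    exact (Submodule.Quotient.mk_eq_zero N).2 ((hex y).1 hy)
  -- `ψ` embeds `Y / im φ` in `Z`. Flatness keeps this injective after tensoring, so `w` already
  -- vanishes in `M ⊗ (Y / im φ)`.
  have h1 := h _ _ (quotAct lY N hNl) lZ (N.liftQ ψ hk) hι hinj
  let π : BalTensor ρ (fun a => lY a) →ₗ[k] BalTensor ρ (fun a => quotAct lY N hNl a) :=
    BalTensor.map LinearMap.id N.mkQ (id_intertwines ρ) (fun a y => rfl)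
  have h2 : π w = 0 := by
    apply h1
    rw [map_zero, ← hw]
    have : BalTensor.map (ρ := ρ) (l := fun a => quotAct lY N hNl a) (ρ' := ρ)
        (l' := fun a => lZ a) LinearMap.id (N.liftQ ψ hk) (id_intertwines ρ) hι ∘ₗ π =
        BalTensor.map (ρ' := ρ) (l' := fun a => lZ a) LinearMap.id ψ (id_intertwines ρ) hψ :=
      BalTensor.ext fun m y => by
        simp only [π, LinearMap.comp_apply, BalTensor.map_btmul, LinearMap.id_apply]
        rfl
    exact LinearMap.congr_fun this w
  let K := LinearMap.range (BalTensor.map (ρ := ρ) (l := fun a => lX a) (ρ' := ρ)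
    (l' := fun a => lY a) LinearMap.id φ (id_intertwines ρ) hφ)
  let f : Y →ₗ[k] M →ₗ[k] (BalTensor ρ (fun a => lY a)) ⧸ K :=
    ((btmul ρ (fun a => lY a)).compr₂ K.mkQ).flip
  have hf : ∀ y m, f y m = K.mkQ (btmul ρ (fun a => lY a) m y) := fun _ _ => rfl
  let g := N.liftQ f (by
    rintro _ ⟨x, rfl⟩
    refine LinearMap.ext fun m => ?_
    rw [hf]
    exact (Submodule.Quotient.mk_eq_zero K).2 ⟨btmul ρ (fun a => lX a) m x, by simp⟩)
  have hg : ∀ y, g (N.mkQ y) = f y := fun _ => rfl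
  -- Right exactness of the tensor product: `M ⊗ (Y / im φ)` maps back to the quotient by `K`, so an
  -- element that vanishes there lies in `K`.
  let L : BalTensor ρ (fun a => quotAct lY N hNl a) →ₗ[k] (BalTensor ρ (fun a => lY a)) ⧸ K :=
    BalTensor.lift g.flip (by
      intro a m n
      obtain ⟨y, rfl⟩ := N.mkQ_surjective n
      rw [LinearMap.flip_apply, LinearMap.flip_apply, quotAct_mk, hg, hg, hf, hf, btmul_bal])
  have h3 : L ∘ₗ π = K.mkQ := BalTensor.ext fun m y => by
    simp only [L, π, LinearMap.comp_apply]
    rfl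
  have h4 : K.mkQ w = 0 := by
    rw [← h3, LinearMap.comp_apply, h2, map_zero]
  exact (Submodule.Quotient.mk_eq_zero K).1 h4

variable {U : Type u} [Ring U] [Algebra k U]

namespace LeftBialgebroid

variable (B : LeftBialgebroid k A U)

/-- The diagonal action, as a map of algebras. -/
def diagHom (n : ℕ) : U →ₐ[k] Module.End k (B.tens n).carrier :=
  AlgHom.ofLinearMap (B.diag n) (LinearMap.ext (B.diag_one n))
    (fun u v => LinearMap.ext (B.diag_mul n u v))

/-- The left `A`-action on `U^{⊗_A n}`, as a map of algebras. -/
def actHom (n : ℕ) : A →ₐ[k] Module.End k (B.tens n).carrier := (B.diagHom n).comp B.s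

/-- The right `A`-action on `U^{⊗_A n}`, as a map of algebras. -/
def tensRHom (n : ℕ) : Aᵐᵒᵖ →ₐ[k] Module.End k (B.tens n).carrier := (B.diagHom n).comp B.t

theorem actHom_apply (n : ℕ) (a : A) (x) : B.actHom n a x = (B.tens n).act a x := B.diag_s n a x

theorem tensRHom_apply (n : ℕ) (a : A) (x) :
    B.tensRHom n (MulOpposite.op a) x = B.tensR n a x := B.diag_t n a x

theorem actHom_tensR (n : ℕ) (r a : A) (x) :
    B.actHom n r (B.tensR n a x) = B.tensR n a (B.actHom n r x) := by
  rw [← B.diag_t, ← B.diag_t]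
  change B.diag n (B.s r) _ = _
  rw [← B.diag_mul, B.comm, B.diag_mul]
  rfl

theorem tensR_act (n : ℕ) (r : Aᵐᵒᵖ) (a : A) (x) :
    B.tensRHom n r ((B.tens n).act a x) = (B.tens n).act a (B.tensRHom n r x) := by
  rw [← B.diag_s, ← B.diag_s]
  change B.diag n (B.t r) _ = _
  rw [← B.diag_mul, ← B.comm, B.diag_mul]
  rfl

variable {B}

/-- Tensoring with A is naturally the identity, through a ⊗ x ↦ ax with inverse x ↦ 1 ⊗ x. -/
theorem isFlatOps_tensR_zero : IsFlatOps (B.tensR 0) := by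
  intro X Y _ _ _ _ lX lY φ hφ hinj
  have key : ∀ {X : Type u} [AddCommGroup X] [Module k X] (lX : A →ₐ[k] Module.End k X),
      ∃ κ : BalTensor (B.tensR 0) (fun a => lX a) →ₗ[k] X,
        (∀ a x, κ (btmul _ _ (B.ofBase a) x) = lX a x) ∧
          ∀ w, btmul (B.tensR 0) (fun a => lX a) (B.ofBase 1) (κ w) = w := by
    intro X _ _ lX
    let κ : BalTensor (B.tensR 0) (fun a => lX a) →ₗ[k] X :=
      BalTensor.lift (lX.toLinearMap ∘ₗ B.ofBase.symm.toLinearMap) (by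
        intro a m n
        obtain ⟨m, rfl⟩ := B.ofBase.surjective m
        rw [AeRing.tensR_zero]
        simp)
    have hκ : ∀ a x, κ (btmul _ _ (B.ofBase a) x) = lX a x := fun a x => by simp [κ]
    refine ⟨κ, hκ, fun w => ?_⟩
    have : btmul (B.tensR 0) (fun a => lX a) (B.ofBase 1) ∘ₗ κ = LinearMap.id :=
      BalTensor.ext fun a x => by
        obtain ⟨a, rfl⟩ := B.ofBase.surjective a
        rw [LinearMap.comp_apply, hκ, ← btmul_bal, AeRing.tensR_zero, one_mul]
        rfl
    exact LinearMap.congr_fun this w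
  obtain ⟨κ, hκ, hκ'⟩ := key lX
  obtain ⟨κ', h', h''⟩ := key lY
  have hn : ∀ w, κ' (BalTensor.map (ρ := B.tensR 0) (l := fun a => lX a) (ρ' := B.tensR 0)
      (l' := fun a => lY a) LinearMap.id φ (id_intertwines _) hφ w) = φ (κ w) := by
    intro w
    have : κ' ∘ₗ (BalTensor.map (ρ := B.tensR 0) (l := fun a => lX a) (ρ' := B.tensR 0)
      (l' := fun a => lY a) LinearMap.id φ (id_intertwines _) hφ) = φ ∘ₗ κ :=
      BalTensor.ext fun a x => by
        obtain ⟨a, rfl⟩ := B.ofBase.surjective a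
        rw [LinearMap.comp_apply, BalTensor.map_btmul, LinearMap.id_apply, h',
          LinearMap.comp_apply, hκ, hφ]
    exact LinearMap.congr_fun this w
  intro w w' hw
  have := congrArg κ' hw
  rw [hn, hn] at this
  rw [← hκ' w, ← hκ' w', hinj this]

/-- The left `A`-action on `U^{⊗_A n} ⊗_A X`. -/
abbrev actTens (n : ℕ) {X : Type u} [AddCommGroup X] [Module k X] (lX : A → Module.End k X) :
    A →ₐ[k] Module.End k (BalTensor (B.tensR n) lX) :=
  BalTensor.endL (B.actHom n) (B.actHom_tensR n)

variable {X : Type u} [AddCommGroup X] [Module k X]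

theorem isBal_tensAssoc (n : ℕ) (lX : A → Module.End k X) :
    IsBal k B.tL (B.tens n).act (fun u y => btmul B.tL (fun a => actTens (B := B) n lX a) u ∘ₗ
        btmul (B.tensR n) lX y) where
  add_l _ _ _ := LinearMap.ext fun x => by
    rw [map_add]
    rfl
  smul_l _ _ _ := LinearMap.ext fun x => by
    rw [map_smul]
    rfl
  add_r _ _ _ := by rw [map_add, LinearMap.comp_add]
  smul_r _ _ _ := by rw [map_smul, LinearMap.comp_smul]
  bal a u y := LinearMap.ext fun x => by
    rw [LinearMap.comp_apply, LinearMap.comp_apply, btmul_bal, BalTensor.endL_btmul, actHom_apply]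

theorem tensAssoc_bal (n : ℕ) (lX : A → Module.End k X) (a : A) (z) (x : X) :
    B.tensLift (isBal_tensAssoc n lX) (B.tensR (n + 1) a z) x =
      B.tensLift (isBal_tensAssoc n lX) z (lX a x) := by
  induction z using B.tens_induct with
  | hc u y =>
    rw [AeRing.tensR_cons, AeRing.tensLift_cons, AeRing.tensLift_cons, LinearMap.comp_apply,
      LinearMap.comp_apply, btmul_bal]
  | h0 => simp only [map_zero, LinearMap.zero_apply]
  | ha x y hx hy => simp only [map_add, LinearMap.add_apply, hx, hy]

/-- `(u | y) ⊗ x ↦ u ⊗ (y ⊗ x)`. -/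
def tensAssoc (n : ℕ) (lX : A → Module.End k X) :
    BalTensor (B.tensR (n + 1)) lX →ₗ[k]
      BalTensor B.tL (fun a => actTens (B := B) n lX a) :=
  BalTensor.lift (B.tensLift (isBal_tensAssoc n lX)) (tensAssoc_bal n lX)

theorem tensAssoc_btmul (n : ℕ) (lX : A → Module.End k X) (u : U) (y : (B.tens n).carrier) (x : X) :
    tensAssoc (B := B) n lX (btmul (B.tensR (n + 1)) lX (B.cons n u y) x) =
      btmul B.tL (fun a => actTens (B := B) n lX a) u (btmul (B.tensR n) lX y x) := by
  rw [tensAssoc, BalTensor.lift_btmul, AeRing.tensLift_cons, LinearMap.comp_apply]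

/-- Reassociating the other way is a left inverse. Injectivity and naturality are all that the
induction for flatness of tensor powers uses. -/
theorem tensAssoc_injective (n : ℕ) (lX : A → Module.End k X) :
    Function.Injective (tensAssoc (B := B) n lX) := by
  let g : U → BalTensor (B.tensR n) lX →ₗ[k] BalTensor (B.tensR (n + 1)) lX := fun u =>
    BalTensor.map (ρ' := B.tensR (n + 1)) (l' := lX) (B.cons n u) LinearMap.id
      (fun a m => (B.tensR_cons n a u m).symm) (id_intertwines lX)
  have hg : ∀ u y x, g u (btmul (B.tensR n) lX y x) =
      btmul (B.tensR (n + 1)) lX (B.cons n u y) x := fun u y x => by simp [g]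
  have hb : IsBal k B.tL (fun a => actTens (B := B) n lX a) (fun u w => g u w) :=
    { add_l := fun u u' w => by
        have : g (u + u') = g u + g u' := BalTensor.ext fun y x => by simp [hg]
        rw [this]
        rfl
      smul_l := fun r u w => by
        have : g (r • u) = r • g u := BalTensor.ext fun y x => by simp [hg]
        rw [this]
        rfl
      add_r := fun u w w' => map_add _ _ _
      smul_r := fun r u w => map_smul _ _ _
      bal := fun a u w => by
        have : g (B.tL a u) = g u ∘ₗ actTens (B := B) n lX a := BalTensor.ext fun y x => by
          rw [LinearMap.comp_apply, BalTensor.endL_btmul, hg, hg, actHom_apply,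
            ← AeRing.cons_bal]
          rfl
        rw [this]
        rfl }
  have h : hb.lift ∘ₗ tensAssoc (B := B) n lX = LinearMap.id := BalTensor.ext fun z x => by
    rw [LinearMap.comp_apply]
    induction z using B.tens_induct with
    | hc u y => rw [tensAssoc_btmul, hb.lift_btmul, hg]; rfl
    | h0 => simp
    | ha z z' hz hz' => simp only [map_add, LinearMap.add_apply, hz, hz']
  exact Function.LeftInverse.injective fun w => LinearMap.congr_fun h w

/-- `U^{⊗_A n}` is flat on the right if `U_◁` is. -/
theorem isFlatOps_tensR (hflat : B.TargetFlat) (n : ℕ) : IsFlatOps (B.tensR n) := by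
  induction n with
  | zero => exact isFlatOps_tensR_zero
  | succ n ih =>
    intro X Y _ _ _ _ lX lY φ hφ hinj
    have h1 := ih X Y lX lY φ hφ hinj
    set Φ := BalTensor.map (ρ := B.tensR n) (l := fun a => lX a) (ρ' := B.tensR n)
      (l' := fun a => lY a) LinearMap.id φ (id_intertwines _) hφ with hΦ
    have hb : ∀ y x, Φ (btmul _ _ y x) = btmul _ _ y (φ x) := fun y x => by
      rw [hΦ, BalTensor.map_btmul, LinearMap.id_apply]
    have ha : ∀ a w, Φ (actTens (B := B) n (fun a => lX a) a w) =
        actTens (B := B) n (fun a => lY a) a (Φ w) := fun a w => by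
      have : Φ ∘ₗ actTens (B := B) n (fun a => lX a) a =
          actTens (B := B) n (fun a => lY a) a ∘ₗ Φ := BalTensor.ext fun y x => by
        rw [LinearMap.comp_apply, LinearMap.comp_apply, BalTensor.endL_btmul, hb, hb,
          BalTensor.endL_btmul]
      exact LinearMap.congr_fun this w
    have h2 := hflat _ _ (actTens (B := B) n fun a => lX a) (actTens (B := B) n fun a => lY a) Φ
      ha h1
    have hn : ∀ w, BalTensor.map (ρ := B.tL) (l := fun a => actTens (B := B) n (fun a => lX a) a)
        (ρ' := B.tL) (l' := fun a => actTens (B := B) n (fun a => lY a) a) LinearMap.id Φ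
        (id_intertwines _) ha (tensAssoc n (fun a => lX a) w) = tensAssoc n (fun a => lY a)
          (BalTensor.map (ρ := B.tensR (n + 1)) (l := fun a => lX a) (ρ' := B.tensR (n + 1))
            (l' := fun a => lY a) LinearMap.id φ (id_intertwines _) hφ w) := by
      intro w
      refine LinearMap.congr_fun (f := BalTensor.map (ρ := B.tL)
        (l := fun a => actTens (B := B) n (fun a => lX a) a)
        (ρ' := B.tL) (l' := fun a => actTens (B := B) n (fun a => lY a) a) LinearMap.id Φ
        (id_intertwines _) ha ∘ₗ tensAssoc n (fun a => lX a)) (g := tensAssoc n (fun a => lY a) ∘ₗ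
          (BalTensor.map (ρ := B.tensR (n + 1)) (l := fun a => lX a) (ρ' := B.tensR (n + 1))
            (l' := fun a => lY a) LinearMap.id φ (id_intertwines _) hφ)) (BalTensor.ext fun z x => ?_) w
      rw [LinearMap.comp_apply, LinearMap.comp_apply, BalTensor.map_btmul]
      induction z using B.tens_induct with
      | hc u y =>
        rw [tensAssoc_btmul, BalTensor.map_btmul, hb, LinearMap.id_apply, LinearMap.id_apply,
          tensAssoc_btmul]
      | h0 => simp only [map_zero, LinearMap.zero_apply]
      | ha z z' hz hz' => simp only [map_add, LinearMap.add_apply, hz, hz']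
    intro w w' hw
    apply tensAssoc_injective
    apply h2
    rw [hn, hn, hw]

end LeftBialgebroid

/-- Extension of maps into an injective right `A`-module. -/
theorem IsRightInjective.exists_extend {S : AeRing k A U} {M : Type u} [AddCommGroup M]
    [Module k M] [Module U M] [IsScalarTower k U M] (hM : IsRightInjective S M)
    {P Q : Type u} [AddCommGroup P] [Module k P] [AddCommGroup Q] [Module k Q]
    (rP : Aᵐᵒᵖ →ₐ[k] Module.End k P) (rQ : Aᵐᵒᵖ →ₐ[k] Module.End k Q) (h : P →ₗ[k] Q)
    (hh : ∀ a p, h (rP a p) = rQ a (h p)) (f : P →ₗ[k] M)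
    (hf : ∀ a p, f (rP a p) = S.t a • f p) (hker : ∀ p, h p = 0 → f p = 0) :
    ∃ g : Q →ₗ[k] M, (∀ a q, g (rQ a q) = S.t a • g q) ∧ ∀ p, g (h p) = f p := by
  let : Module Aᵐᵒᵖ M := Module.compHom M S.t.toRingHom
  let : Module Aᵐᵒᵖ P := Module.compHom P rP.toRingHom
  let : Module Aᵐᵒᵖ Q := Module.compHom Q rQ.toRingHom
  have hM' : Module.Injective Aᵐᵒᵖ M := hM
  let h' : P →ₗ[Aᵐᵒᵖ] Q := { toFun := h, map_add' := map_add h, map_smul' := hh }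
  let f' : P →ₗ[Aᵐᵒᵖ] M := { toFun := f, map_add' := map_add f, map_smul' := hf }
  -- `f` factors through `P / ker h`, which embeds in `Q`, so the extension property applies
  -- although `h` need not be injective.
  obtain ⟨g, hg⟩ := hM'.out ((LinearMap.ker h').liftQ h' le_rfl)
    (by
      rw [← LinearMap.ker_eq_bot]
      exact Submodule.ker_liftQ_eq_bot _ _ _ le_rfl)
    ((LinearMap.ker h').liftQ f' fun p hp => hker p hp)
  refine ⟨{ toFun := g, map_add' := map_add g, map_smul' := fun r q => ?_ },
    fun a q => map_smul g a q, fun p => hg ((LinearMap.ker h').mkQ p)⟩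
  -- Scalars of `k` act through `Aᵐᵒᵖ` on both sides, so an `Aᵐᵒᵖ`-linear map is automatically
  -- `k`-linear.
  have h1 : r • q = (algebraMap k Aᵐᵒᵖ r) • q := by
    change r • q = rQ (algebraMap k Aᵐᵒᵖ r) q
    rw [AlgHom.commutes]
    rfl
  have h2 : ∀ m : M, r • m = (algebraMap k Aᵐᵒᵖ r) • m := by
    intro m
    change r • m = S.t (algebraMap k Aᵐᵒᵖ r) • m
    rw [AlgHom.commutes, algebraMap_smul]
  rw [h1, map_smul, RingHom.id_apply, h2]

end Flat

/-! ### Comparing the two edges of a double complex by zigzags -/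

section Balancing

variable {k : Type v} [CommRing k]

/-- A double complex `E`, with an augmentation `α` of its zeroth column to `D` for which all rows
`⋯ → E 1 q → E 0 q → D q → 0` are exact. -/
structure IsRowExact (E : ℕ → ℕ → Type u) [∀ p q, AddCommGroup (E p q)] [∀ p q, Module k (E p q)]
    (D : ℕ → Type u) [∀ n, AddCommGroup (D n)] [∀ n, Module k (D n)]
    (dh : ∀ p q, E (p + 1) q →ₗ[k] E p q) (dv : ∀ p q, E p (q + 1) →ₗ[k] E p q)
    (α : ∀ q, E 0 q →ₗ[k] D q) (d : ∀ q, D (q + 1) →ₗ[k] D q) : Prop where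
  comm : ∀ p q e, dh p q (dv (p + 1) q e) = dv p q (dh p (q + 1) e)
  dv_dv : ∀ p q e, dv p q (dv p (q + 1) e) = 0
  aug_dv : ∀ q e, α q (dv 0 q e) = d q (α (q + 1) e)
  aug_surjective : ∀ q, Function.Surjective (α q)
  aug_exact : ∀ q e, α q e = 0 ↔ ∃ e', dh 0 q e' = e
  exact : ∀ p q e, dh p q e = 0 → ∃ e', dh (p + 1) q e' = e

namespace IsRowExact

variable {E : ℕ → ℕ → Type u} [∀ p q, AddCommGroup (E p q)] [∀ p q, Module k (E p q)]
  {D : ℕ → Type u} [∀ n, AddCommGroup (D n)] [∀ n, Module k (D n)]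
  {dh : ∀ p q, E (p + 1) q →ₗ[k] E p q} {dv : ∀ p q, E p (q + 1) →ₗ[k] E p q}
  {α : ∀ q, E 0 q →ₗ[k] D q} {d : ∀ q, D (q + 1) →ₗ[k] D q}
  (H : IsRowExact E D dh dv α d)

theorem aug_dh (H : IsRowExact E D dh dv α d) (q : ℕ) (e) : α q (dh 0 q e) = 0 :=
  (H.aug_exact q _).2 ⟨e, rfl⟩

/-- Zigzags of total degree `n`. -/
def zigzags (dh : ∀ p q, E (p + 1) q →ₗ[k] E p q) (dv : ∀ p q, E p (q + 1) →ₗ[k] E p q) (n : ℕ) :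
    Submodule k (∀ p q, E p q) where
  carrier := {e | ∀ p q, p + q + 1 = n → dh p q (e (p + 1) q) = dv p q (e p (q + 1))}
  add_mem' {e e'} he he' p q h := by
    simp only [Pi.add_apply, map_add, he p q h, he' p q h]
  zero_mem' p q _ := by simp only [Pi.zero_apply, map_zero]
  smul_mem' c e he p q h := by simp only [Pi.smul_apply, map_smul, he p q h]

theorem mem_cycles (H : IsRowExact E D dh dv α d) {n : ℕ} {e : ∀ p q, E p q}
    (he : e ∈ zigzags dh dv n) : α n (e 0 n) ∈ cycles d n := by
  cases n with
  | zero => trivial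
  | succ m =>
    change d m _ = 0
    rw [← H.aug_dv, ← he 0 m (by omega), H.aug_dh]

/-- Row exactness continues the staircase: the vertical image of an entry is killed by the next
horizontal map, hence lifts one column further. The cycle condition on x is used only for the step
out of column zero. -/
theorem exists_zigzag (H : IsRowExact E D dh dv α d) {n : ℕ} {x : D n} (hx : x ∈ cycles d n) :
    ∃ e ∈ zigzags dh dv n, α n (e 0 n) = x := by
  suffices h : ∀ m, ∃ e : ∀ p q, E p q, α n (e 0 n) = x ∧ ∀ p q, p + q + 1 = n → p < m →
      dh p q (e (p + 1) q) = dv p q (e p (q + 1)) by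
    obtain ⟨e, h1, h2⟩ := h n
    exact ⟨e, fun p q h => h2 p q h (by omega), h1⟩
  intro m
  induction m with
  | zero =>
    obtain ⟨y, hy⟩ := H.aug_surjective n x
    -- The starting family has a lift of x at position (0, n) and zeros elsewhere; each step
    -- overwrites a single entry.
    exact ⟨Function.update (fun _ _ => 0) 0 (Function.update (fun _ => 0) n y), by simp [hy],
      fun p q _ h => absurd h (by omega)⟩
  | succ m ih =>
    obtain ⟨e, h1, h2⟩ := ih
    by_cases hm : m < n
    · obtain ⟨q, hq⟩ : ∃ q, n = m + q + 1 := ⟨n - m - 1, by omega⟩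
      obtain ⟨y, hy⟩ : ∃ y, dh m q y = dv m q (e m (q + 1)) := by
        cases m with
        | zero =>
          refine (H.aug_exact q _).1 ?_
          rw [H.aug_dv]
          obtain rfl : n = q + 1 := by omega
          rw [h1]
          exact hx
        | succ m =>
          refine H.exact _ _ _ ?_
          rw [H.comm, h2 m (q + 1) (by omega) (by omega), H.dv_dv]
      refine ⟨Function.update e (m + 1) (Function.update (e (m + 1)) q y), ?_, ?_⟩
      · rw [Function.update_of_ne (by omega), h1]
      · intro p q' hq' hp
        rw [Function.update_of_ne (a := p) (by omega)]
        by_cases hpm : p = m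
        · subst hpm
          obtain rfl : q' = q := by omega
          simp [hy]
        · rw [Function.update_of_ne (by omega)]
          exact h2 p q' hq' (by omega)
    · exact ⟨e, h1, fun p q h _ => h2 p q h (by omega)⟩

/-- When the class on the first edge vanishes, every entry on the staircase is a vertical image plus
a horizontal one. The horizontal preimage at one position serves as the vertical preimage at the
next, with a row-exact correction. -/
theorem decompose (H : IsRowExact E D dh dv α d) {n : ℕ} {e : ∀ p q, E p q}
    (he : e ∈ zigzags dh dv n) (hb : α n (e 0 n) ∈ LinearMap.range (d n)) (p : ℕ) :
    ∀ q, p + q = n → ∃ f f', e p q = dv p q f + dh p q f' := by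
  induction p with
  | zero =>
    intro q hq
    obtain rfl : q = n := by omega
    obtain ⟨x, hx⟩ := hb
    obtain ⟨f, rfl⟩ := H.aug_surjective _ x
    rw [← H.aug_dv] at hx
    obtain ⟨f', hf'⟩ := (H.aug_exact q (e 0 q - dv 0 q f)).1 (by rw [map_sub, hx, sub_self])
    exact ⟨f, f', by rw [hf']; abel⟩
  | succ p ih =>
    intro q hq
    obtain ⟨f, f', h⟩ := ih (q + 1) (by omega)
    obtain ⟨f'', h'⟩ := H.exact p q (e (p + 1) q - dv (p + 1) q f') (by
      rw [map_sub, he p q (by omega), h, map_add, H.dv_dv, H.comm, zero_add, sub_self])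
    exact ⟨f', f'', by rw [h']; abel⟩

variable {C : ℕ → Type u} [∀ n, AddCommGroup (C n)] [∀ n, Module k (C n)]
  {β : ∀ p, E p 0 →ₗ[k] C p} {d' : ∀ p, C (p + 1) →ₗ[k] C p}

/-- At the far end of the staircase, β kills the vertical part and carries the horizontal part to a
boundary. -/
theorem boundary (H : IsRowExact E D dh dv α d)
    (H' : IsRowExact (fun p q => E q p) C (fun p q => dv q p) (fun p q => dh q p) β d') {n : ℕ}
    {e : ∀ p q, E p q} (he : e ∈ zigzags dh dv n) (hb : α n (e 0 n) ∈ LinearMap.range (d n)) :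
    β n (e n 0) ∈ LinearMap.range (d' n) := by
  obtain ⟨f, f', h⟩ := H.decompose he hb n 0 (by omega)
  refine ⟨β (n + 1) f', ?_⟩
  rw [h, map_add, H'.aug_dv, H'.aug_dh, zero_add]

/-- The class of the end of a zigzag. -/
def zigzagClass (H : IsRowExact E D dh dv α d) (n : ℕ) : zigzags dh dv n →ₗ[k] Homology d n :=
  Submodule.mkQ _ ∘ₗ
    { toFun := fun e => (⟨α n (e.1 0 n), H.mem_cycles e.2⟩ : cycles d n)
      map_add' := fun _ _ => Subtype.ext (map_add (α n) _ _)
      map_smul' := fun _ _ => Subtype.ext (map_smul (α n) _ _) }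

theorem zigzagClass_surjective (H : IsRowExact E D dh dv α d) (n : ℕ) :
    Function.Surjective (H.zigzagClass n) := by
  intro x
  obtain ⟨⟨x, hx⟩, rfl⟩ := Submodule.mkQ_surjective _ x
  obtain ⟨e, he, rfl⟩ := H.exists_zigzag hx
  exact ⟨⟨e, he⟩, rfl⟩

theorem zigzagClass_eq_zero (H : IsRowExact E D dh dv α d) {n : ℕ} (e : zigzags dh dv n) :
    H.zigzagClass n e = 0 ↔ α n (e.1 0 n) ∈ LinearMap.range (d n) :=
  Submodule.Quotient.mk_eq_zero _

/-- Transposition of zigzags. -/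
def zigzagSwap (dh : ∀ p q, E (p + 1) q →ₗ[k] E p q) (dv : ∀ p q, E p (q + 1) →ₗ[k] E p q) (n : ℕ) :
    zigzags dh dv n ≃ₗ[k]
      zigzags (E := fun p q => E q p) (fun p q => dv q p) (fun p q => dh q p) n where
  toFun e := ⟨fun p q => e.1 q p, fun p q h => (e.2 q p (by omega)).symm⟩
  invFun e := ⟨fun p q => e.1 q p, fun p q h => (e.2 q p (by omega)).symm⟩
  map_add' _ _ := rfl
  map_smul' _ _ := rfl
  left_inv _ := rfl
  right_inv _ := rfl

/-- Both edges of a double complex with exact rows and exact columns have the same homology. -/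
theorem nonempty_homology_equiv (H : IsRowExact E D dh dv α d)
    (H' : IsRowExact (fun p q => E q p) C (fun p q => dv q p) (fun p q => dh q p) β d') (n : ℕ) :
    Nonempty (Homology d n ≃ₗ[k] Homology d' n) := by
  let ψ := H'.zigzagClass n ∘ₗ (zigzagSwap dh dv n).toLinearMap
  have hψ : Function.Surjective ψ :=
    (H'.zigzagClass_surjective n).comp (zigzagSwap dh dv n).surjective
  -- Zigzags surject onto both homologies. The kernels agree because vanishing at one end forces
  -- vanishing at the other, in both directions by symmetry.
  have hker : LinearMap.ker (H.zigzagClass n) = LinearMap.ker ψ := by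
    ext e
    rw [LinearMap.mem_ker, LinearMap.mem_ker, H.zigzagClass_eq_zero]
    refine Iff.trans ⟨H.boundary H' e.2, ?_⟩ (H'.zigzagClass_eq_zero (zigzagSwap dh dv n e)).symm
    exact H'.boundary H (zigzagSwap dh dv n e).2
  exact ⟨((H.zigzagClass n).quotKerEquivOfSurjective (H.zigzagClass_surjective n)).symm ≪≫ₗ
    Submodule.quotEquivOfEq _ _ hker ≪≫ₗ ψ.quotKerEquivOfSurjective hψ⟩

end IsRowExact

end Balancing

/-! ### Free comodules, cokernels and a resolution of the unit comodule -/

section Comodules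

variable {k : Type v} [CommRing k] {A U : Type u} [Ring A] [Algebra k A] [Ring U] [Algebra k U]
  {B : LeftBialgebroid k A U} {N : Type*} [AddCommGroup N] [Module k N]

namespace RComod

section Construct

variable {X : Type u} [AddCommGroup X] [Module k X] (act : Aᵐᵒᵖ →ₐ[k] Module.End k X)

theorem isBal_btmul_comul : IsBal k (fun a : A => act (MulOpposite.op a)) B.sL
    (fun p q => btmul (fun a : A => act (MulOpposite.op a)) B.lUU p (B.Δ q)) where
  add_l _ _ _ := by rw [map_add, LinearMap.add_apply]
  smul_l _ _ _ := by rw [map_smul, LinearMap.smul_apply]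
  add_r _ _ _ := by rw [map_add, map_add]
  smul_r _ _ _ := by rw [map_smul, map_smul]
  bal a p q := by rw [btmul_bal, LinearMap.mulLeft_apply, B.comul_s_mul]

theorem isBal_act_counit : IsBal k (fun a : A => act (MulOpposite.op a)) B.sL
    (fun p q => act (MulOpposite.op (B.ε q)) p) where
  add_l _ _ _ := map_add _ _ _
  smul_l _ _ _ := map_smul _ _ _
  add_r _ _ _ := by rw [map_add, MulOpposite.op_add, map_add, LinearMap.add_apply]
  smul_r _ _ _ := by rw [map_smul, MulOpposite.op_smul, map_smul, LinearMap.smul_apply]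
  bal a p q := by
    rw [LinearMap.mulLeft_apply, B.counit_s_mul, MulOpposite.op_mul, map_mul, Module.End.mul_apply]

/-- `(x ⊗ u) ↦ x ⊗ (u ⊗ v)`. -/
def tmulRight (v : U) : BalTensor (fun a : A => act (MulOpposite.op a)) B.sL →ₗ[k]
    BalTensor (fun a : A => act (MulOpposite.op a)) B.lUU :=
  BalTensor.map (ρ' := fun a : A => act (MulOpposite.op a)) (l' := B.lUU)
        LinearMap.id (B.tmulR v)
        (id_intertwines fun a : A => act (MulOpposite.op a)) (B.tmulR_sL v)

theorem tmulRight_btmul (v : U) (x : X) (u : U) :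
    tmulRight act v (btmul _ B.sL x u) = btmul _ B.lUU x (btmul B.tL B.sL u v) :=
  BalTensor.map_btmul _ _ _ (B.tmulR_sL v) x u

theorem isBal_tmulRight (w : BalTensor (fun a : A => act (MulOpposite.op a)) B.sL) :
    (∀ v v', tmulRight act (v + v') w = tmulRight act v w + tmulRight act v' w) ∧
    (∀ (c : k) v, tmulRight act (c • v) w = c • tmulRight act v w) ∧
    ∀ (a : A) v, tmulRight act v (BalTensor.map (ρ' := fun a : A => act (MulOpposite.op a))
      (l' := B.sL) LinearMap.id (B.tL a)
      (id_intertwines fun a : A => act (MulOpposite.op a)) (B.tL_sL a) w) =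
        tmulRight act (B.s a * v) w := by
  refine ⟨fun v v' => ?_, fun c v => ?_, fun a v => ?_⟩
  · rw [← LinearMap.add_apply]
    refine LinearMap.congr_fun (BalTensor.ext fun x u => ?_) w
    rw [LinearMap.add_apply]
    simp only [tmulRight_btmul, map_add]
  · rw [← LinearMap.smul_apply]
    refine LinearMap.congr_fun (BalTensor.ext fun x u => ?_) w
    rw [LinearMap.smul_apply]
    simp only [tmulRight_btmul, map_smul]
  · rw [← LinearMap.comp_apply]
    refine LinearMap.congr_fun (BalTensor.ext fun x u => ?_) w
    rw [LinearMap.comp_apply, BalTensor.map_btmul, tmulRight_btmul, tmulRight_btmul, btmul_bal]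
    rfl

variable {act} {coact : X →ₗ[k] BalTensor (fun a : A => act (MulOpposite.op a)) B.sL}
  (coact_act : ∀ (a : A) (x : X), coact (act (MulOpposite.op a) x) =
    BalTensor.map (ρ' := fun a : A => act (MulOpposite.op a)) (l' := B.sL) LinearMap.id (B.tL a)
      (id_intertwines fun a : A => act (MulOpposite.op a)) (B.tL_sL a) (coact x))

theorem isBal_tmulRight_coact (coact_act : ∀ (a : A) (x : X), coact (act (MulOpposite.op a) x) =
    BalTensor.map (ρ' := fun a : A => act (MulOpposite.op a)) (l' := B.sL) LinearMap.id (B.tL a)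
      (id_intertwines fun a : A => act (MulOpposite.op a)) (B.tL_sL a) (coact x)) :
    IsBal k (fun a : A => act (MulOpposite.op a)) B.sL
    (fun p q => tmulRight act q (coact p)) where
  add_l _ _ _ := by rw [map_add, map_add]
  smul_l _ _ _ := by rw [map_smul, map_smul]
  add_r p _ _ := (isBal_tmulRight act (coact p)).1 _ _
  smul_r _ p _ := (isBal_tmulRight act (coact p)).2.1 _ _
  bal a p q := by rw [coact_act, (isBal_tmulRight act (coact p)).2.2, LinearMap.mulLeft_apply]

/-- Construction of a comodule, with the axioms expressed for chosen components. -/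
def ofBsum (act : Aᵐᵒᵖ →ₐ[k] Module.End k X)
    (coact : X →ₗ[k] BalTensor (fun a : A => act (MulOpposite.op a)) B.sL)
    (coact_act : ∀ (a : A) (x : X), coact (act (MulOpposite.op a) x) =
      BalTensor.map (ρ' := fun a : A => act (MulOpposite.op a)) (l' := B.sL) LinearMap.id (B.tL a)
        (id_intertwines fun a : A => act (MulOpposite.op a)) (B.tL_sL a) (coact x))
    (coassoc : ∀ x, bsum (coact x) (fun p q => tmulRight act q (coact p)) =
      bsum (coact x) (fun p q => btmul (fun a : A => act (MulOpposite.op a)) B.lUU p (B.Δ q)))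
    (counit : ∀ x, bsum (coact x) (fun p q => act (MulOpposite.op (B.ε q)) p) = x) : RComod B where
  carrier := X
  act := act
  coact := coact
  coact_act := coact_act
  coassoc x _ p q h := ((isBal_tmulRight_coact coact_act).of_rep Finset.univ p q h).trans
    ((coassoc x).trans ((isBal_btmul_comul act).of_rep Finset.univ p q h).symm)
  counit x _ p q h := ((isBal_act_counit act).of_rep Finset.univ p q h).trans (counit x)

end Construct

variable (P : RComod B)

/-- A function of three variables that is balanced on `P ⊗_A ▷U_◁ ⊗_A ▷U`. -/
structure IsBal3 (F : P.carrier → U → U → N) : Prop where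
  left : ∀ z, IsBal k P.r B.sL (fun x y => F x y z)
  right : ∀ x, IsBal k B.tL B.sL (fun y z => F x y z)

variable {P}

theorem IsBal3.isBal_lUU {F : P.carrier → U → U → N} (h : P.IsBal3 F) :
    IsBal k P.r B.lUU (fun x (w : B.UU) => bsum w (fun y z => F x y z)) where
  add_l _ _ _ := by simp only [(h.left _).add_l, bsum_add_fun]
  smul_l _ _ _ := by simp only [(h.left _).smul_l, bsum_smul_fun]
  add_r _ _ _ := (h.right _).bsum_add _ _
  smul_r _ _ _ := (h.right _).bsum_smul _ _
  bal a x w := by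
    simp only [(h.left _).bal]
    rw [AeRing.lUU, (h.right x).bsum_map]
    rfl

theorem sum_coassoc {F : P.carrier → U → U → N} (h : P.IsBal3 F) (x : P.carrier) :
    bsum (P.coact x) (fun p q => bsum (P.coact p) (fun a b => F a b q)) =
      bsum (P.coact x) (fun p q => B.sw q (fun c d => F p c d)) := by
  obtain ⟨m, p, q, hpq, hs⟩ := bsum_exists (P := N) (P.coact x)
  have := congrArg h.isBal_lUU.lift (P.coassoc x m p q hpq)
  rw [map_sum, map_sum] at this
  rw [hs, hs]
  refine Eq.trans ?_ (this.trans ?_)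
  · refine Finset.sum_congr rfl fun j _ => ?_
    rw [← h.isBal_lUU.bsum_eq, h.isBal_lUU.bsum_map]
    simp only [AeRing.tmulR, LinearMap.flip_apply, LinearMap.id_apply]
    simp only [(h.right _).bsum_btmul]
  · refine Finset.sum_congr rfl fun j _ => ?_
    rw [h.isBal_lUU.lift_btmul]

theorem sum_counit (x : P.carrier) : bsum (P.coact x) (fun p q => P.r (B.ε q) p) = x := by
  obtain ⟨m, p, q, hpq, hs⟩ := bsum_exists (P := P.carrier) (P.coact x)
  rw [hs]
  exact P.counit x m p q hpq

theorem sum_coact_r {F : P.carrier → U → N} (h : IsBal k P.r B.sL F) (a : A) (x : P.carrier) :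
    bsum (P.coact (P.r a x)) F =
      bsum (P.coact x) (fun p q => F p (B.t (MulOpposite.op a) * q)) := by
  rw [P.coact_act, h.bsum_map]
  rfl

theorem Hom.sum_coact {Q : RComod B} (φ : Hom P Q) {F : Q.carrier → U → N}
    (h : IsBal k Q.r B.sL F) (x : P.carrier) :
    bsum (Q.coact (φ.map x)) F = bsum (P.coact x) (fun p q => F (φ.map p) q) := by
  rw [φ.map_coact, h.bsum_map]
  rfl

/-- The counit splits the coaction. -/
theorem coact_injective (P : RComod B) : Function.Injective P.coact := by
  intro x y h
  rw [← P.sum_counit x, h, P.sum_counit]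

/-- Composition of comodule maps. -/
def Hom.comp {P Q R : RComod B} (ψ : Hom Q R) (φ : Hom P Q) : Hom P R where
  map := ψ.map ∘ₗ φ.map
  map_act a x := by rw [LinearMap.comp_apply, φ.map_act, ψ.map_act, LinearMap.comp_apply]
  map_coact x := by
    rw [LinearMap.comp_apply, ψ.map_coact, φ.map_coact, ← LinearMap.comp_apply]
    refine LinearMap.congr_fun (BalTensor.ext fun p q => ?_) _
    rw [LinearMap.comp_apply, BalTensor.map_btmul, BalTensor.map_btmul, BalTensor.map_btmul]
    rfl

/-- The identity of a comodule. -/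
def Hom.id (P : RComod B) : Hom P P where
  map := LinearMap.id
  map_act _ _ := rfl
  map_coact x := by
    conv_lhs => rw [LinearMap.id_apply, ← bsum_btmul_eq (P.coact x)]
    rw [map_eq_bsum]
    rfl

section Free

variable {X : Type u} [AddCommGroup X] [Module k X] (rX : Aᵐᵒᵖ →ₐ[k] Module.End k X)

/-- The right `A`-action `x ⊗ u ↦ x ⊗ (u ◁ a)`. -/
def freeAct : Aᵐᵒᵖ →ₐ[k] Module.End k (BalTensor (fun a : A => rX (MulOpposite.op a)) B.sL) :=
  BalTensor.endR ((Algebra.lmul k U).comp B.t) (fun r a u => by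
    change B.t r * (B.s a * u) = B.s a * (B.t r * u)
    rw [← mul_assoc, ← B.comm, mul_assoc])

theorem freeAct_btmul (r : Aᵐᵒᵖ) (x : X) (u : U) :
    freeAct rX r (btmul (fun a : A => rX (MulOpposite.op a)) B.sL x u) =
      btmul _ B.sL x (B.t r * u) := BalTensor.endR_btmul _ _ _ _ _

/-- `(x ⊗ p) ⊗ q` -/
abbrev tmul3 (x : X) (p q : U) :
    BalTensor (fun a : A => freeAct (B := B) rX (MulOpposite.op a)) B.sL :=
  btmul _ B.sL (btmul _ B.sL x p) q

theorem isBal_tmul3 (x : X) : IsBal k B.tL B.sL (fun p q => tmul3 (B := B) rX x p q) where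
  add_l _ _ _ := by simp [tmul3]
  smul_l _ _ _ := by simp [tmul3]
  add_r _ _ _ := by simp [tmul3]
  smul_r _ _ _ := by simp [tmul3]
  bal a p q := by
    rw [tmul3, tmul3, ← btmul_bal, freeAct_btmul]
    rfl

theorem isBal_freeCoact : IsBal k (fun a : A => rX (MulOpposite.op a)) B.sL
    (fun x u => B.sw u (fun p q => tmul3 (B := B) rX x p q)) where
  add_l _ _ _ := by
    rw [← bsum_add_fun]
    simp [tmul3]
  smul_l _ _ _ := by
    rw [← bsum_smul_fun]
    simp [tmul3]
  add_r _ _ _ := LeftBialgebroid.sw_add (isBal_tmul3 rX _) _ _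
  smul_r _ _ _ := LeftBialgebroid.sw_smul (isBal_tmul3 rX _) _ _
  bal a x u := by
    rw [LinearMap.mulLeft_apply, LeftBialgebroid.sw_s_mul (isBal_tmul3 rX _)]
    simp only [tmul3, btmul_bal, LinearMap.mulLeft_apply]

theorem freeCoact_act (a : A) (y) :
    (isBal_freeCoact (B := B) rX).lift (freeAct rX (MulOpposite.op a) y) =
      BalTensor.map (ρ' := fun a : A => freeAct (B := B) rX (MulOpposite.op a)) (l' := B.sL)
        LinearMap.id (B.tL a)
        (id_intertwines fun a : A => freeAct (B := B) rX (MulOpposite.op a)) (B.tL_sL a)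
        ((isBal_freeCoact rX).lift y) := by
  rw [← LinearMap.comp_apply, ← LinearMap.comp_apply]
  refine LinearMap.congr_fun (BalTensor.ext fun x u => ?_) y
  rw [LinearMap.comp_apply, LinearMap.comp_apply, freeAct_btmul, IsBal.lift_btmul,
    IsBal.lift_btmul, LeftBialgebroid.sw_t_mul (isBal_tmul3 rX x), map_bsum]
  simp only [BalTensor.map_btmul, LinearMap.id_apply, LinearMap.mulLeft_apply]

theorem isBal3_free (x : X) : B.IsBal3 (fun p q r =>
    btmul (fun a : A => freeAct (B := B) rX (MulOpposite.op a)) B.lUU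
      (btmul (fun a : A => rX (MulOpposite.op a)) B.sL x p) (btmul B.tL B.sL q r)) where
  add₁ _ _ _ _ := by simp
  smul₁ _ _ _ _ := by simp
  add₂ _ _ _ _ := by simp
  smul₂ _ _ _ _ := by simp
  add₃ _ _ _ _ := by simp
  smul₃ _ _ _ _ := by simp
  bal₁ a p q r := by
    rw [← B.lUU_btmul, ← btmul_bal, freeAct_btmul]
  bal₂ a p q r := by
    have := btmul_bal (ρ := B.tL) (l := B.sL) a q r
    rw [LinearMap.mulLeft_apply, LinearMap.mulLeft_apply] at this
    rw [this]

/-- The free comodule `X ⊗_A U`. -/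
noncomputable def free : RComod B :=
  ofBsum (freeAct rX) (isBal_freeCoact rX).lift (freeCoact_act rX)
    (fun y => by
      rw [(isBal_tmulRight_coact (freeCoact_act rX)).bsum_eq,
        (isBal_btmul_comul (freeAct rX)).bsum_eq, ← LinearMap.comp_apply, ← LinearMap.comp_apply]
      refine LinearMap.congr_fun (BalTensor.ext fun x u => ?_) y
      rw [LinearMap.comp_apply, LinearMap.comp_apply, IsBal.lift_btmul, map_bsum, map_bsum]
      simp only [IsBal.lift_btmul, map_bsum, tmulRight_btmul]
      refine ((isBal3_free rX x).coassoc u).trans ?_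
      simp only [LeftBialgebroid.sw, ← map_bsum, bsum_btmul_eq])
    (fun y => by
      rw [(isBal_act_counit (freeAct rX)).bsum_eq, ← LinearMap.comp_apply]
      refine LinearMap.congr_fun (g := LinearMap.id) (BalTensor.ext fun x u => ?_) y
      rw [LinearMap.comp_apply, IsBal.lift_btmul, map_bsum]
      simp only [IsBal.lift_btmul, freeAct_btmul, ← map_bsum]
      exact congrArg _ (B.sw_counit_right u))

theorem isBal_tmulRight_free : IsBal k (fun a : A => freeAct (B := B) rX (MulOpposite.op a)) B.sL
    (fun p q => tmulRight rX q p) where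
  add_l _ _ _ := map_add _ _ _
  smul_l _ _ _ := map_smul _ _ _
  add_r p _ _ := (isBal_tmulRight rX p).1 _ _
  smul_r _ p _ := (isBal_tmulRight rX p).2.1 _ _
  bal a p q := (isBal_tmulRight rX p).2.2 a q

theorem isFree_free : (free (B := B) rX).IsFree := by
  refine ⟨X, _, _, rX, LinearEquiv.refl k _, fun a y => rfl, fun y m p q h => ?_⟩
  refine ((isBal_tmulRight_free rX).of_rep Finset.univ p q h).trans
    (((isBal_tmulRight_free rX).bsum_eq _).trans ?_)
  refine LinearMap.congr_fun (f := (isBal_tmulRight_free rX).lift ∘ₗ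
    (isBal_freeCoact (B := B) rX).lift) (BalTensor.ext fun x u => ?_) y
  rw [LinearMap.comp_apply, IsBal.lift_btmul, map_bsum]
  simp only [tmul3, IsBal.lift_btmul, tmulRight_btmul, ← map_bsum, bsum_btmul_eq]
  exact (BalTensor.map_btmul LinearMap.id B.Δ
    (id_intertwines fun a : A => rX (MulOpposite.op a)) B.comul_s_mul x u).symm

theorem isInjective_of_isFree {F : RComod B} (h : F.IsFree) : F.IsInjective :=
  ⟨F, h, Hom.id F, Hom.id F, fun _ => rfl⟩

/-- The coaction, as a map into the free comodule. -/
noncomputable def coactHom (P : RComod B) : Hom P (free P.act) where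
  map := P.coact
  map_act := P.coact_act
  map_coact x := by
    have h3 : P.IsBal3 (fun p q r => tmul3 (B := B) P.act p q r) :=
      ⟨fun z =>
        { add_l := fun _ _ _ => by simp [tmul3]
          smul_l := fun _ _ _ => by simp [tmul3]
          add_r := fun _ _ _ => by simp [tmul3]
          smul_r := fun _ _ _ => by simp [tmul3]
          bal := fun a p q => by rw [tmul3, btmul_bal] }, fun x => isBal_tmul3 P.act x⟩
    have h1 : (free (B := B) P.act).coact (P.coact x) =
        bsum (P.coact x) (fun p q => B.sw q (fun c d => tmul3 (B := B) P.act p c d)) :=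
      ((isBal_freeCoact P.act).bsum_eq _).symm
    refine h1.trans ((sum_coassoc h3 x).symm.trans (Eq.trans ?_ (map_eq_bsum _ _ _ _ _).symm))
    refine congrArg (bsum (P.coact x)) (funext fun p => funext fun q => ?_)
    conv_rhs => rw [← bsum_btmul_eq (P.coact p)]
    rw [← LinearMap.flip_apply, map_bsum]
    rfl

end Free

section Quotient

variable {P Q : RComod B} (φ : Hom P Q)

theorem range_le_comap_act (φ : Hom P Q) (a : Aᵐᵒᵖ) :
    LinearMap.range φ.map ≤ (LinearMap.range φ.map).comap (Q.act a) := by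
  rintro _ ⟨x, rfl⟩
  exact ⟨P.act a x, φ.map_act a.unop x⟩

/-- The right action on the cokernel. -/
abbrev cokerAct : Aᵐᵒᵖ →ₐ[k] Module.End k (Q.carrier ⧸ LinearMap.range φ.map) :=
  quotAct Q.act (LinearMap.range φ.map) (range_le_comap_act φ)

theorem mkQ_r (a : A) (x : Q.carrier) : (LinearMap.range φ.map).mkQ (Q.r a x) =
    cokerAct φ (MulOpposite.op a) ((LinearMap.range φ.map).mkQ x) := rfl

/-- `Q ⊗_A U → coker φ ⊗_A U` -/
def mkTens : BalTensor Q.r B.sL →ₗ[k]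
    BalTensor (fun a : A => cokerAct φ (MulOpposite.op a)) B.sL :=
  BalTensor.map (ρ := Q.r) (ρ' := fun a : A => cokerAct φ (MulOpposite.op a))
    (LinearMap.range φ.map).mkQ LinearMap.id (mkQ_r φ) (id_intertwines B.sL)

theorem mkTens_btmul (x : Q.carrier) (u : U) : mkTens φ (btmul Q.r B.sL x u) =
    btmul _ B.sL ((LinearMap.range φ.map).mkQ x) u := BalTensor.map_btmul _ _ _ _ _ _

/-- The coaction on the cokernel. -/
def cokerCoact : Q.carrier ⧸ LinearMap.range φ.map →ₗ[k]
    BalTensor (fun a : A => cokerAct φ (MulOpposite.op a)) B.sL :=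
  -- Colinearity sends the coaction of φ(x) into φ(P) ⊗ U, which dies in the target, so cokernels of
  -- comodules exist without flatness.
  (LinearMap.range φ.map).liftQ (mkTens φ ∘ₗ Q.coact) (by
    rintro _ ⟨x, rfl⟩
    rw [LinearMap.mem_ker, LinearMap.comp_apply, φ.map_coact, map_eq_bsum, map_bsum]
    have : ∀ p, (LinearMap.range φ.map).mkQ (φ.map p) = 0 := fun p =>
      (Submodule.Quotient.mk_eq_zero _).2 ⟨p, rfl⟩
    simp only [mkTens_btmul, this, map_zero, LinearMap.zero_apply]
    exact Finset.sum_const_zero)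

theorem cokerCoact_mk (x : Q.carrier) :
    cokerCoact φ ((LinearMap.range φ.map).mkQ x) = mkTens φ (Q.coact x) := rfl

theorem sum_cokerCoact {F : Q.carrier ⧸ LinearMap.range φ.map → U → N}
    (h : IsBal k (fun a : A => cokerAct φ (MulOpposite.op a)) B.sL F) (x : Q.carrier) :
    bsum (cokerCoact φ ((LinearMap.range φ.map).mkQ x)) F =
      bsum (Q.coact x) (fun p q => F ((LinearMap.range φ.map).mkQ p) q) := by
  rw [cokerCoact_mk, mkTens, h.bsum_map]
  rfl

theorem cokerCoact_act (a : A) (y) :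
    cokerCoact φ (cokerAct φ (MulOpposite.op a) y) =
      BalTensor.map (ρ' := fun a : A => cokerAct φ (MulOpposite.op a)) (l' := B.sL)
        LinearMap.id (B.tL a)
        (id_intertwines fun a : A => cokerAct φ (MulOpposite.op a)) (B.tL_sL a)
        (cokerCoact φ y) := by
  obtain ⟨x, rfl⟩ := Submodule.mkQ_surjective (LinearMap.range φ.map) y
  rw [quotAct_mk, cokerCoact_mk, cokerCoact_mk, Q.coact_act]
  generalize Q.coact x = w
  rw [← LinearMap.comp_apply, ← LinearMap.comp_apply]
  refine LinearMap.congr_fun (BalTensor.ext fun x u => ?_) w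
  rw [LinearMap.comp_apply, LinearMap.comp_apply, BalTensor.map_btmul, mkTens_btmul, mkTens_btmul,
    BalTensor.map_btmul]
  rfl

/-- The cokernel of a comodule map. -/
def coker : RComod B :=
  ofBsum (cokerAct φ) (cokerCoact φ) (cokerCoact_act φ)
    (fun y => by
      obtain ⟨x, rfl⟩ := Submodule.mkQ_surjective (LinearMap.range φ.map) y
      rw [sum_cokerCoact φ (isBal_tmulRight_coact (cokerCoact_act φ)),
        sum_cokerCoact φ (isBal_btmul_comul (cokerAct φ))]
      have h3 : Q.IsBal3 (fun p q r =>
          btmul (fun a : A => cokerAct φ (MulOpposite.op a)) B.lUU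
            ((LinearMap.range φ.map).mkQ p) (btmul B.tL B.sL q r)) :=
        ⟨fun z =>
          { add_l := fun _ _ _ => by simp only [map_add, LinearMap.add_apply]
            smul_l := fun _ _ _ => by simp only [map_smul, LinearMap.smul_apply]
            add_r := fun _ _ _ => by simp only [map_add, LinearMap.add_apply]
            smul_r := fun _ _ _ => by simp only [map_smul, LinearMap.smul_apply]
            bal := fun a p q => by
              rw [LinearMap.mulLeft_apply, ← B.lUU_btmul, ← btmul_bal, quotAct_mk] }, fun x =>
          { add_l := fun _ _ _ => by simp only [map_add, LinearMap.add_apply]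
            smul_l := fun _ _ _ => by simp only [map_smul, LinearMap.smul_apply]
            add_r := fun _ _ _ => by simp only [map_add]
            smul_r := fun _ _ _ => by simp only [map_smul]
            bal := fun a p q => by rw [btmul_bal] }⟩
      simp only [cokerCoact_mk]
      refine Eq.trans (congrArg (bsum (Q.coact x)) (funext fun p => funext fun q => ?_))
        ((sum_coassoc h3 x).trans (congrArg (bsum (Q.coact x)) (funext fun p => funext fun q => ?_)))
      · refine (linear_eq_bsum (tmulRight (cokerAct φ) q ∘ₗ mkTens φ) (Q.coact p)).trans ?_
        simp only [LinearMap.comp_apply, mkTens_btmul, tmulRight_btmul]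
      · rw [LeftBialgebroid.sw, ← map_bsum, bsum_btmul_eq])
    (fun y => by
      obtain ⟨x, rfl⟩ := Submodule.mkQ_surjective (LinearMap.range φ.map) y
      rw [sum_cokerCoact φ (isBal_act_counit (cokerAct φ))]
      simp only [quotAct_mk, ← map_bsum]
      rw [Q.sum_counit])

/-- The projection onto the cokernel. -/
def cokerHom : Hom Q (coker φ) where
  map := (LinearMap.range φ.map).mkQ
  map_act _ _ := rfl
  map_coact _ := rfl

end Quotient

/-- Right multiplication on `A`. -/
def unitAct (k : Type v) [CommRing k] (A : Type u) [Ring A] [Algebra k A] :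
    Aᵐᵒᵖ →ₐ[k] Module.End k A :=
  AlgHom.ofLinearMap ((LinearMap.mul k A).flip ∘ₗ (MulOpposite.opLinearEquiv k).symm.toLinearMap)
    (LinearMap.ext fun a => mul_one a)
    (fun r r' => LinearMap.ext fun a => (mul_assoc a r'.unop r.unop).symm)

/-- The coaction `a ↦ 1 ⊗ t(a)`. -/
def unitCoact (B : LeftBialgebroid k A U) :
    A →ₗ[k] BalTensor (fun a : A => unitAct k A (MulOpposite.op a)) B.sL :=
  btmul _ B.sL 1 ∘ₗ B.t.toLinearMap ∘ₗ (MulOpposite.opLinearEquiv k).toLinearMap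

theorem unitCoact_apply (a : A) :
    unitCoact B a = btmul _ B.sL 1 (B.t (MulOpposite.op a)) := rfl

theorem unitCoact_act (a x : A) : unitCoact B (unitAct k A (MulOpposite.op a) x) =
    BalTensor.map (ρ' := fun a : A => unitAct k A (MulOpposite.op a)) (l' := B.sL)
      LinearMap.id (B.tL a)
      (id_intertwines fun a : A => unitAct k A (MulOpposite.op a)) (B.tL_sL a) (unitCoact B x) := by
  rw [unitCoact_apply, unitCoact_apply, BalTensor.map_btmul, LinearMap.mulLeft_apply, ← map_mul,
    ← MulOpposite.op_mul]
  rfl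

/-- The right comodule `A`, with coaction `a ↦ 1 ⊗ t(a)`. -/
def unit (B : LeftBialgebroid k A U) : RComod B :=
  ofBsum (unitAct k A) (unitCoact B) unitCoact_act
    (fun x => by
      rw [unitCoact_apply, (isBal_tmulRight_coact unitCoact_act).bsum_btmul,
        (isBal_btmul_comul (unitAct k A)).bsum_btmul, unitCoact_apply, MulOpposite.op_one, map_one B.t,
        tmulRight_btmul]
      have h := B.comul_t_mul x 1
      rw [mul_one, B.comul_one] at h
      rw [h, AeRing.rUU, BalTensor.map_btmul, LinearMap.mulLeft_apply, mul_one]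
      rfl)
    (fun x => by
      rw [unitCoact_apply, (isBal_act_counit (unitAct k A)).bsum_btmul, B.counit_t]
      exact one_mul x)

/-- The second map is the projection to the cokernel followed by its coaction. The coaction is
injective, so the kernel is that of the projection. -/
theorem exact_cosyzygy (P : RComod B) : Function.Exact (coactHom P).map
    ((coactHom (coker (coactHom P))).comp (cokerHom (coactHom P))).map := by
  intro y
  constructor
  · intro h
    exact (Submodule.Quotient.mk_eq_zero _).1
      (coact_injective (coker (coactHom P)) (h.trans (map_zero (coker (coactHom P)).coact).symm))
  · intro h
    exact (congrArg (coactHom (coker (coactHom P))).map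
      ((Submodule.Quotient.mk_eq_zero (LinearMap.range (coactHom P).map)).2 h)).trans (map_zero _)

/-- The cosyzygies of `A` in the cobar resolution. -/
noncomputable def cosyzygy (B : LeftBialgebroid k A U) : ℕ → RComod B
  | 0 => unit B
  | n + 1 => coker (coactHom (cosyzygy B n))

end RComod

/-- Every bialgebroid has a resolution of `A` by free comodules. -/
theorem nonempty_injResolution (B : LeftBialgebroid k A U) : Nonempty (InjResolution B) :=
  ⟨{  I := fun n => RComod.free (RComod.cosyzygy B n).act
      d := fun n => (RComod.coactHom (RComod.cosyzygy B (n + 1))).comp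
        (RComod.cokerHom (RComod.coactHom (RComod.cosyzygy B n)))
      aug := (RComod.coactHom (RComod.unit B)).map
      aug_act := fun a b => (RComod.coactHom (RComod.unit B)).map_act b a
      aug_coact := fun a => ((RComod.coactHom (RComod.unit B)).map_coact a).trans
        (BalTensor.map_btmul (RComod.coactHom (RComod.unit B)).map LinearMap.id
          (RComod.coactHom (RComod.unit B)).map_act (id_intertwines B.sL) (1 : A)
          (B.t (MulOpposite.op a)))
      injective := fun n => RComod.isInjective_of_isFree (RComod.isFree_free _)
      aug_injective := RComod.coact_injective (RComod.unit B)
      exact_zero := RComod.exact_cosyzygy (RComod.unit B)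
      exact_succ := fun n y => by
        refine (RComod.exact_cosyzygy (RComod.cosyzygy B (n + 1)) y).trans ?_
        constructor
        · rintro ⟨x, rfl⟩
          obtain ⟨x, rfl⟩ := (LinearMap.range
            (RComod.coactHom (RComod.cosyzygy B n)).map).mkQ_surjective x
          exact ⟨x, rfl⟩
        · rintro ⟨x, rfl⟩
          exact ⟨(RComod.cokerHom (RComod.coactHom (RComod.cosyzygy B n))).map x, rfl⟩ }⟩

end Comodules

/-! ### The complex of maps on P ⊗ U^{⊗ q} and its augmentation to Cohom -/

section CotensorChains

set_option maxSynthPendingDepth 3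

variable {k : Type v} [CommRing k] {A U : Type u} [Ring A] [Algebra k A] [Ring U] [Algebra k U]
  {B : LeftBialgebroid k A U}
  {M : Type u} [AddCommGroup M] [Module k M] [Module U M] [IsScalarTower k U M]
  {hl : B.IsLeftHopf} {c : Contraaction B M} (hM : IsAYD hl c) (hst : IsStable c)

theorem DChain.ext_cons {q : ℕ} {f g : DChain B M (q + 1)}
    (h : ∀ u y, f.1 (B.cons q u y) = g.1 (B.cons q u y)) : f = g :=
  Subtype.ext (AeRing.tens_hom_ext B.toAeRing h)

/-- `f ↦ f(u | -)`. -/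
def DChain.slice (q : ℕ) (u : U) : DChain B M (q + 1) →ₗ[k] DChain B M q where
  toFun f := ⟨f.1 ∘ₗ B.cons q u, fun a y => by
    rw [LinearMap.comp_apply, ← AeRing.tensR_cons, f.2]
    rfl⟩
  map_add' _ _ := rfl
  map_smul' _ _ := rfl

theorem DChain.slice_apply (q : ℕ) (u : U) (f : DChain B M (q + 1)) (y) :
    (DChain.slice q u f).1 y = f.1 (B.cons q u y) := rfl

/-- The faces other than the zeroth one are left `A`-linear. -/
theorem dFace_succ_act {q : ℕ} (i : Fin (q + 1)) {f g : DChain B M (q + 1)} (a : A)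
    (h : ∀ y, g.1 y = f.1 ((B.tens (q + 1)).act a y)) (y) :
    (dFace hM hst q i.succ g).1 y = (dFace hM hst q i.succ f).1 ((B.tens q).act a y) := by
  induction i using Fin.lastCases with
  | last =>
    refine (dFace_last hM hst g y).unique ((dFace_last hM hst f _).congr fun v => ?_)
    rw [h, AeRing.snoc_act]
  | cast i =>
    obtain _ | q := q
    · exact i.elim0
    rw [dFace_mid, dFace_mid, h, (B.dl q i).2]

/-- The faces from the second one on do not affect the first entry. -/
theorem slice_dFace {q : ℕ} (i : Fin (q + 1)) (f : DChain B M (q + 2)) (u : U) :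
    DChain.slice q u (dFace hM hst (q + 1) i.succ.succ f) =
      dFace hM hst q i.succ (DChain.slice (q + 1) u f) := by
  refine Subtype.ext (LinearMap.ext fun y => ?_)
  rw [DChain.slice_apply]
  induction i using Fin.lastCases with
  | last =>
    refine (dFace_last hM hst f _).unique ((dFace_last hM hst _ y).congr fun v => ?_)
    rw [DChain.slice_apply, AeRing.snoc_cons]
  | cast i =>
    obtain _ | q := q
    · exact i.elim0
    rw [dFace_mid hM hst i, ← Fin.castSucc_succ, dFace_mid hM hst i.succ, DChain.slice_apply, Fin.val_succ,
      B.dl_succ_cons]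

theorem dFace_one {q : ℕ} (f : DChain B M (q + 2)) (u : U) (y) :
    (dFace hM hst (q + 1) (Fin.succ 0) f).1 (B.cons q u y) =
      B.sw u (fun p r => f.1 (B.cons (q + 1) p (B.cons q r y))) := by
  rw [← Fin.castSucc_zero, dFace_mid, Fin.val_zero, B.dl_zero_cons, map_bsum]

namespace RComod

variable (P : RComod B) (M)

/-- `Hom_{Aᵒᵖ}(P ⊗_A U^{⊗_A q}, M)`, as a space of maps `P → Hom_{Aᵒᵖ}(U^{⊗_A q}, M)`. -/
def BiHom (q : ℕ) : Submodule k (P.carrier →ₗ[k] DChain B M q) where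
  carrier := {F | ∀ a p y, (F (P.r a p)).1 y = (F p).1 ((B.tens q).act a y)}
  add_mem' {F G} hF hG a p y := by
    rw [LinearMap.add_apply, LinearMap.add_apply]
    exact congrArg₂ (· + ·) (hF a p y) (hG a p y)
  zero_mem' a p y := rfl
  smul_mem' c F hF a p y := by
    rw [LinearMap.smul_apply, LinearMap.smul_apply]
    exact congrArg (c • ·) (hF a p y)

variable {P M}

theorem isBal_slice {q : ℕ} (F : BiHom M P (q + 1)) :
    IsBal k P.r B.sL (fun p u => DChain.slice q u (F.1 p)) where
  add_l _ _ _ := by rw [map_add, map_add]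
  smul_l _ _ _ := by rw [map_smul, map_smul]
  add_r p u u' := Subtype.ext (LinearMap.ext fun y => by
    change (F.1 p).1 (B.cons q (u + u') y) = (F.1 p).1 (B.cons q u y) + (F.1 p).1 (B.cons q u' y)
    rw [map_add, LinearMap.add_apply, map_add])
  smul_r r p u := Subtype.ext (LinearMap.ext fun y => by
    change (F.1 p).1 (B.cons q (r • u) y) = r • (F.1 p).1 (B.cons q u y)
    rw [map_smul, LinearMap.smul_apply, map_smul])
  bal a p u := Subtype.ext (LinearMap.ext fun y => by
    rw [DChain.slice_apply, DChain.slice_apply, F.2, AeRing.act_cons]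
    rfl)

theorem slice_bsum {q : ℕ} {V W R : Type*} [AddCommGroup V] [Module k V] [AddCommGroup W]
    [Module k W] {ρ : R → Module.End k V} {l : R → Module.End k W} (z : BalTensor ρ l)
    (F : V → W → DChain B M q) (y) : (bsum z F).1 y = bsum z (fun p u => (F p u).1 y) := by
  rw [← Submodule.subtype_apply, map_bsum, ← LinearMap.applyₗ_apply_apply (R := k), map_bsum]
  rfl

/-- The zeroth face, `p ⊗ y ↦ f(p₍₀₎ ⊗ (p₍₁₎ | y))`. -/
noncomputable def coactFace (q : ℕ) : BiHom M P (q + 1) →ₗ[k] BiHom M P q where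
  toFun F := ⟨(isBal_slice F).lift ∘ₗ P.coact, fun a p y => by
    rw [LinearMap.comp_apply, LinearMap.comp_apply, ← (isBal_slice F).bsum_eq,
      ← (isBal_slice F).bsum_eq, sum_coact_r (isBal_slice F), slice_bsum, slice_bsum]
    simp only [DChain.slice_apply]
    exact congrArg (bsum (P.coact p)) (funext fun x => funext fun u => congrArg (F.1 x).1
      (B.cons_bal q a u y))⟩
  map_add' F G := Subtype.ext (LinearMap.ext fun p => by
    change (isBal_slice (F + G)).lift (P.coact p) =
      (isBal_slice F).lift (P.coact p) + (isBal_slice G).lift (P.coact p)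
    rw [← IsBal.bsum_eq, ← IsBal.bsum_eq, ← IsBal.bsum_eq, ← bsum_add_fun]
    rfl)
  map_smul' r F := Subtype.ext (LinearMap.ext fun p => by
    change (isBal_slice (r • F)).lift (P.coact p) = r • (isBal_slice F).lift (P.coact p)
    rw [← IsBal.bsum_eq, ← IsBal.bsum_eq, ← bsum_smul_fun]
    rfl)

theorem coactFace_apply {q : ℕ} (F : BiHom M P (q + 1)) (p : P.carrier) :
    (coactFace q F).1 p = bsum (P.coact p) (fun x u => DChain.slice q u (F.1 x)) :=
  ((isBal_slice F).bsum_eq _).symm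

/-- The faces of `Hom_{Aᵒᵖ}(P ⊗_A U^{⊗_A q}, M)`. -/
noncomputable def biFace (q : ℕ) (i : Fin (q + 2)) : BiHom M P (q + 1) →ₗ[k] BiHom M P q :=
  Fin.cases (coactFace q) (fun i =>
    { toFun := fun F => ⟨dFace hM hst q i.succ ∘ₗ F.1, fun a p y =>
        dFace_succ_act hM hst i a (F.2 a p) y⟩
      map_add' := fun F G => Subtype.ext (LinearMap.ext fun p =>
        map_add (dFace hM hst q i.succ) (F.1 p) (G.1 p))
      map_smul' := fun r F => Subtype.ext (LinearMap.ext fun p =>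
        map_smul (dFace hM hst q i.succ) r (F.1 p)) }) i

theorem biFace_zero (q : ℕ) : biFace hM hst q 0 = coactFace (P := P) q := rfl

theorem biFace_succ {q : ℕ} (i : Fin (q + 1)) (F : BiHom M P (q + 1)) (p : P.carrier) :
    (biFace hM hst q i.succ F).1 p = dFace hM hst q i.succ (F.1 p) := rfl

/-- Two coaction faces are governed by coassociativity of P. A coaction face commutes with later
faces because these do not touch the first entry. Faces away from the coaction inherit their
identities from D. -/
theorem biFace_biFace (q : ℕ) (i j : Fin (q + 2)) (h : i ≤ j) :
    biFace (P := P) hM hst q i ∘ₗ biFace hM hst (q + 1) j.succ =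
      biFace hM hst q j ∘ₗ biFace hM hst (q + 1) i.castSucc := by
  refine LinearMap.ext fun F => Subtype.ext (LinearMap.ext fun p => ?_)
  rw [LinearMap.comp_apply, LinearMap.comp_apply]
  induction i using Fin.cases with
  | zero =>
    rw [biFace_zero, Fin.castSucc_zero, biFace_zero, coactFace_apply]
    induction j using Fin.cases with
    | zero =>
      rw [biFace_zero, coactFace_apply]
      simp only [biFace_succ, coactFace_apply]
      refine Subtype.ext (LinearMap.ext fun y => ?_)
      have h3 : P.IsBal3 (fun x u v => (F.1 x).1 (B.cons (q + 1) u (B.cons q v y))) :=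
        ⟨fun v =>
          { add_l := fun _ _ _ => by rw [map_add]; rfl
            smul_l := fun _ _ _ => by rw [map_smul]; rfl
            add_r := fun _ _ _ => by rw [map_add, LinearMap.add_apply, map_add]
            smul_r := fun _ _ _ => by rw [map_smul, LinearMap.smul_apply, map_smul]
            bal := fun a x u => by
              rw [F.2, AeRing.act_cons]
              rfl }, fun x => B.isBal_consCons q (F.1 x).1 y⟩
      rw [slice_bsum, slice_bsum]
      simp only [map_bsum, slice_bsum, DChain.slice_apply, dFace_one]
      exact (sum_coassoc h3 p).symm
    | succ j =>
      rw [biFace_succ, coactFace_apply, map_bsum]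
      simp only [biFace_succ, slice_dFace]
  | succ i =>
    induction j using Fin.cases with
    | zero => exact absurd h (by simp)
    | succ j =>
      rw [← Fin.succ_castSucc, biFace_succ, biFace_succ, biFace_succ, biFace_succ,
        ← LinearMap.comp_apply, ← LinearMap.comp_apply]
      exact LinearMap.congr_fun (((DiagHom.isRotational hM hst).cyclic.transport
        (rotD hM hst)).d_d q i.succ j.succ h) (F.1 p)

variable (P M) in
/-- The differential of `Hom_{Aᵒᵖ}(P ⊗_A U^{⊗_A •}, M)`. -/
noncomputable def biD (q : ℕ) : BiHom M P (q + 1) →ₗ[k] BiHom M P q :=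
  altSum (k := k) (X := fun q => BiHom M P q) (fun q => biFace (P := P) hM hst q) q

theorem biD_biD (q : ℕ) (F : BiHom M P (q + 2)) :
    biD M hM hst P q (biD M hM hst P (q + 1) F) = 0 :=
  LinearMap.congr_fun (altSum_comp_altSum (k := k) (X := fun q => BiHom M P q) (fun q => biFace hM hst q) (biFace_biFace hM hst) q) F

variable (M) in
/-- Precomposition with a comodule map. -/
def biPre {P Q : RComod B} (φ : Hom P Q) (q : ℕ) : BiHom M Q q →ₗ[k] BiHom M P q where
  toFun F := ⟨F.1 ∘ₗ φ.map, fun a p y => by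
    rw [LinearMap.comp_apply, φ.map_act]
    exact F.2 a _ y⟩
  map_add' _ _ := rfl
  map_smul' _ _ := rfl

theorem biPre_apply {P Q : RComod B} (φ : Hom P Q) {q : ℕ} (F : BiHom M Q q) (p : P.carrier) :
    (biPre M φ q F).1 p = F.1 (φ.map p) := rfl

theorem biPre_biFace {P Q : RComod B} (φ : Hom P Q) (q : ℕ) (i : Fin (q + 2))
    (F : BiHom M Q (q + 1)) :
    biPre M φ q (biFace hM hst q i F) = biFace hM hst q i (biPre M φ (q + 1) F) := by
  refine Subtype.ext (LinearMap.ext fun p => ?_)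
  rw [biPre_apply]
  induction i using Fin.cases with
  | zero =>
    rw [biFace_zero, biFace_zero, coactFace_apply, coactFace_apply, φ.sum_coact (isBal_slice F)]
    rfl
  | succ i => rfl

theorem biPre_biD {P Q : RComod B} (φ : Hom P Q) (q : ℕ) (F : BiHom M Q (q + 1)) :
    biPre M φ q (biD M hM hst Q q F) = biD M hM hst P q (biPre M φ (q + 1) F) :=
  altSum_map (k := k) (X := fun q => BiHom M Q q) (Y := fun q => BiHom M P q) _ _
    (fun q => biPre M φ q) (biPre_biFace hM hst φ) q F

/-! ### The augmentation to `Cohom` -/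

variable (P) in
/-- `p ↦ (a ↦ p a)` -/
def orbit : P.carrier →ₗ[k] (B.tens 0).carrier →ₗ[k] P.carrier :=
  (P.act.toLinearMap ∘ₗ (MulOpposite.opLinearEquiv k).toLinearMap ∘ₗ
    B.ofBase.symm.toLinearMap).flip

theorem orbit_apply (p : P.carrier) (a : A) : P.orbit p (B.ofBase a) = P.r a p := by
  change P.r (B.ofBase.symm (B.ofBase a)) p = _
  rw [LinearEquiv.symm_apply_apply]

theorem r_mul (a b : A) (p : P.carrier) : P.r (a * b) p = P.r b (P.r a p) := by
  rw [r, MulOpposite.op_mul, map_mul]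
  rfl

theorem r_one (p : P.carrier) : P.r 1 p = p := by
  rw [r, MulOpposite.op_one, map_one]
  rfl

variable (M P) in
/-- Restriction to `p ⊗ 1`. -/
def biBaseMap : BiHom M P 0 →ₗ[k] HomRight B.toAeRing M P.r where
  toFun F := ⟨LinearMap.applyₗ (B.ofBase 1) ∘ₗ Submodule.subtype _ ∘ₗ F.1, fun a p => by
    change (F.1 (P.r a p)).1 (B.ofBase 1) = _ • (F.1 p).1 (B.ofBase 1)
    rw [F.2, AeRing.act_zero, mul_one, ← (F.1 p).2, AeRing.tensR_zero, one_mul]⟩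
  map_add' _ _ := rfl
  map_smul' _ _ := rfl

theorem biBaseMap_apply (F : BiHom M P 0) (p : P.carrier) :
    (biBaseMap M P F).1 p = (F.1 p).1 (B.ofBase 1) := rfl

/-- Since p ⊗ a = pa ⊗ 1, values at p ⊗ 1 determine everything; the inverse sends f to p ↦ (a ↦
f(pa)). -/
theorem biBaseMap_bijective : Function.Bijective (biBaseMap M P) := by
  constructor
  · intro F G h
    refine Subtype.ext (LinearMap.ext fun p => Subtype.ext (LinearMap.ext fun y => ?_))
    obtain ⟨y, rfl⟩ := B.ofBase.surjective y
    have h1 := LinearMap.congr_fun (congrArg Subtype.val h) (P.r y p)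
    rw [biBaseMap_apply, biBaseMap_apply, F.2, G.2, AeRing.act_zero, mul_one] at h1
    exact h1
  · intro f
    let F : P.carrier → DChain B M 0 := fun p => ⟨f.1 ∘ₗ P.orbit p, fun a y => by
      obtain ⟨y, rfl⟩ := B.ofBase.surjective y
      rw [LinearMap.comp_apply, LinearMap.comp_apply, AeRing.tensR_zero, orbit_apply, orbit_apply,
        r_mul, f.2]⟩
    have hF : ∀ p y, (F p).1 y = f.1 (P.orbit p y) := fun _ _ => rfl
    refine ⟨⟨{ toFun := F, map_add' := fun p p' => Subtype.ext (LinearMap.ext fun y => ?_),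
               map_smul' := fun r p => Subtype.ext (LinearMap.ext fun y => ?_) },
      fun a p y => ?_⟩, Subtype.ext (LinearMap.ext fun p => ?_)⟩
    · change _ = (F p).1 y + (F p').1 y
      rw [hF, hF, hF, map_add, LinearMap.add_apply, map_add]
    · change _ = r • (F p).1 y
      rw [hF, hF, map_smul, LinearMap.smul_apply, map_smul]
    · change (F _).1 y = (F _).1 _
      obtain ⟨y, rfl⟩ := B.ofBase.surjective y
      rw [hF, hF, AeRing.act_zero, orbit_apply, orbit_apply, r_mul]
    · change (F p).1 _ = _
      rw [hF, orbit_apply, r_one]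

variable (M P) in
/-- Restriction to `p ⊗ 1`. -/
noncomputable def biBase : BiHom M P 0 ≃ₗ[k] HomRight B.toAeRing M P.r :=
  LinearEquiv.ofBijective (biBaseMap M P) biBaseMap_bijective

theorem biBase_apply (F : BiHom M P 0) (p : P.carrier) :
    (biBase M P F).1 p = (F.1 p).1 (B.ofBase 1) := rfl

/-- In lowest degree the differential is the coaction face minus the contraaction face, exactly the
shape of the relations defining Cohom. -/
theorem gammaRel_biD_zero (F : BiHom M P 1) (p : P.carrier) :
    GammaRel c.γ (fun v => (F.1 p).1 (B.cons 0 v (B.ofBase 1)))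
      (bsum (P.coact p) (fun x u => (F.1 x).1 (B.cons 0 u (B.ofBase 1))) -
        (biBase M P (biD M hM hst P 0 F)).1 p) := by
  have h1 : (biBase M P (biD M hM hst P 0 F)).1 p =
      bsum (P.coact p) (fun x u => (F.1 x).1 (B.cons 0 u (B.ofBase 1))) -
        (dFace hM hst 0 (Fin.last 1) (F.1 p)).1 (B.ofBase 1) := by
    have h2 : biD M hM hst P 0 F = coactFace 0 F - biFace hM hst 0 (Fin.succ 0) F := by
      rw [biD, altSum, Fin.sum_univ_two, LinearMap.add_apply]
      simp [biFace_zero, sub_eq_add_neg]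
    rw [h2, biBase_apply]
    change ((coactFace 0 F).1 p).1 _ - ((biFace hM hst 0 (Fin.succ 0) F).1 p).1 _ = _
    rw [coactFace_apply, slice_bsum]
    rfl
  rw [h1, sub_sub_cancel]
  refine (dFace_last hM hst (F.1 p) (B.ofBase 1)).congr fun v => ?_
  rw [AeRing.snoc_zero, map_one, one_mul]

/-- Reconstruction of an element of `Hom_{Aᵒᵖ}(P ⊗_A U^{⊗_A 1}, M)` from
`Hom_{Aᵒᵖ}(P ⊗_A U, M)`. -/
theorem exists_biHom_one (g : HomRight B.toAeRing M P.rPU) :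
    ∃ F : BiHom M P 1, ∀ p v, (F.1 p).1 (B.cons 0 v (B.ofBase 1)) = g.1 (btmul P.r B.sL p v) := by
  have hb : ∀ p, IsBal k B.tL (B.tens 0).act (fun v y => g.1 (btmul P.r B.sL p
      (B.t (MulOpposite.op (B.ofBase.symm y)) * v))) := fun p =>
    { add_l := fun _ _ _ => by rw [mul_add, map_add, map_add]
      smul_l := fun _ _ _ => by rw [mul_smul_comm, map_smul, map_smul]
      add_r := fun _ _ _ => by
        rw [map_add, MulOpposite.op_add, map_add, add_mul, map_add, map_add]
      smul_r := fun _ _ _ => by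
        rw [map_smul, MulOpposite.op_smul, map_smul, smul_mul_assoc, map_smul, map_smul]
      bal := fun a v y => by
        obtain ⟨y, rfl⟩ := B.ofBase.surjective y
        rw [AeRing.act_zero, LinearEquiv.symm_apply_apply, LinearEquiv.symm_apply_apply,
          MulOpposite.op_mul, map_mul B.t, mul_assoc]
        rfl }
  have hg : ∀ a p v, g.1 (btmul P.r B.sL p (B.t (MulOpposite.op a) * v)) =
      B.t (MulOpposite.op a) • g.1 (btmul P.r B.sL p v) := fun a p v => by
    rw [← g.2, rPU, BalTensor.map_btmul]
    rfl
  let f : P.carrier → DChain B M 1 := fun p => ⟨B.tensLift (hb p), fun a y => by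
    induction y using B.tens_induct with
    | hc u y =>
      obtain ⟨y, rfl⟩ := B.ofBase.surjective y
      rw [AeRing.tensR_cons, AeRing.tensLift_cons, AeRing.tensLift_cons, AeRing.tensR_zero,
        ← hg, LinearEquiv.symm_apply_apply, LinearEquiv.symm_apply_apply, MulOpposite.op_mul,
        map_mul B.t, mul_assoc]
    | h0 => simp only [map_zero, smul_zero]
    | ha x y hx hy => simp only [map_add, smul_add, hx, hy]⟩
  have hf : ∀ p u y, (f p).1 (B.cons 0 u y) = g.1 (btmul P.r B.sL p
      (B.t (MulOpposite.op (B.ofBase.symm y)) * u)) := fun p u y => AeRing.tensLift_cons _ (hb p) _ _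
  refine ⟨⟨{ toFun := f, map_add' := fun p p' => DChain.ext_cons fun u y => ?_,
             map_smul' := fun r p => DChain.ext_cons fun u y => ?_ }, fun a p y => ?_⟩,
    fun p v => ?_⟩
  · change _ = (f p).1 _ + (f p').1 _
    rw [hf, hf, hf, map_add, LinearMap.add_apply, map_add]
  · change _ = r • (f p).1 _
    rw [hf, hf, map_smul, LinearMap.smul_apply, map_smul]
  · change (f _).1 y = (f p).1 _
    induction y using B.tens_induct with
    | hc u y =>
      rw [AeRing.act_cons, hf, hf, btmul_bal, LinearMap.mulLeft_apply, ← mul_assoc, B.comm,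
        mul_assoc]
    | h0 => simp only [map_zero]
    | ha x y hx hy => simp only [map_add, hx, hy]
  · change (f p).1 _ = _
    rw [hf, LinearEquiv.symm_apply_apply, MulOpposite.op_one, map_one, one_mul]

/-- The generators of the relations are precisely the boundaries from degree one, and boundaries
already form a submodule. Hence the zeroth homology is Cohom. -/
theorem mem_cohomRel_iff (f : BiHom M P 0) :
    biBase M P f ∈ cohomRel c P ↔ ∃ F, biD M hM hst P 0 F = f := by
  constructor
  · intro h
    suffices h' : cohomRel c P ≤
        LinearMap.range ((biBase M P).toLinearMap ∘ₗ biD M hM hst P 0) by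
      obtain ⟨F, hF⟩ := h' h
      exact ⟨F, (biBase M P).injective hF⟩
    refine Submodule.span_le.2 ?_
    rintro h ⟨g, hg⟩
    obtain ⟨F, hF⟩ := exists_biHom_one g
    refine ⟨F, Subtype.ext (LinearMap.ext fun p => ?_)⟩
    have h1 := ((gammaRel_biD_zero hM hst F p).congr fun v => hF p v).unique (hg p)
    simp only [hF] at h1
    rw [← linear_eq_bsum] at h1
    exact sub_right_injective h1
  · rintro ⟨F, rfl⟩
    have hb : IsBal k P.r B.sL (fun x u => (F.1 x).1 (B.cons 0 u (B.ofBase 1))) :=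
      (isBal_slice F).comp (LinearMap.applyₗ (B.ofBase 1) ∘ₗ Submodule.subtype _)
    refine Submodule.subset_span ⟨⟨hb.lift, fun a w => ?_⟩, fun p => ?_⟩
    · obtain ⟨n, x, u, rfl⟩ := w.exists_rep
      simp only [map_sum, Finset.smul_sum, rPU, BalTensor.map_btmul]
      refine Finset.sum_congr rfl fun j _ => ?_
      rw [hb.lift_btmul, hb.lift_btmul, ← (F.1 (x j)).2, AeRing.tensR_cons, AeRing.tensR_zero,
        LinearMap.mulLeft_apply, B.cons_bal, AeRing.act_zero, one_mul, mul_one]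
      rfl
    · rw [← hb.bsum_eq]
      exact (gammaRel_biD_zero hM hst F p).congr fun v => (hb.lift_btmul p v).symm

end RComod

end CotensorChains

/-! ### Retractions of coactions and the contracting homotopy -/

section InjectiveComodules

set_option maxSynthPendingDepth 3

variable {k : Type v} [CommRing k] {A U : Type u} [Ring A] [Algebra k A] [Ring U] [Algebra k U]
  {B : LeftBialgebroid k A U}

theorem map_alternating_sum_eq {V W N : Type*} [AddCommGroup V] [Module k V] [AddCommGroup W]
    [Module k W] [AddCommGroup N] [Module k N] (L : V →ₗ[k] N) (L' : W →ₗ[k] N) {n : ℕ}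
    (f : Fin n → V) (g : Fin n → W) (h : ∀ i, L (f i) = L' (g i)) :
    L (∑ i : Fin n, (-1 : ℤ) ^ (i : ℕ) • f i) = L' (∑ i : Fin n, (-1 : ℤ) ^ (i : ℕ) • g i) := by
  simp only [map_sum, map_zsmul, h]

namespace RComod

/-- A colinear retraction of the coaction. -/
structure Retraction (P : RComod B) where
  map : BalTensor P.r B.sL →ₗ[k] P.carrier
  map_rPU : ∀ a w, map (P.rPU a w) = P.r a (map w)
  coact_map : ∀ p v, P.coact (map (btmul P.r B.sL p v)) =
    B.sw v (fun x y => btmul P.r B.sL (map (btmul P.r B.sL p x)) y)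
  map_coact : ∀ p, map (P.coact p) = p

theorem rPU_btmul (P : RComod B) (a : A) (p : P.carrier) (v : U) :
    P.rPU a (btmul P.r B.sL p v) = btmul P.r B.sL p (B.t (MulOpposite.op a) * v) :=
  BalTensor.map_btmul _ _ _ _ _ _

section FreeModule

variable {X : Type u} [AddCommGroup X] [Module k X] (rX : Aᵐᵒᵖ →ₐ[k] Module.End k X)

/-- `x ⊗ u ↦ x ε(u)` -/
def augX : BalTensor (fun a : A => rX (MulOpposite.op a)) B.sL →ₗ[k] X :=
  (isBal_act_counit (B := B) rX).lift

theorem augX_btmul (x : X) (u : U) :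
    augX (B := B) rX (btmul _ B.sL x u) = rX (MulOpposite.op (B.ε u)) x := IsBal.lift_btmul _ _ _

theorem isBal_counit_mul : IsBal k B.tL B.sL (fun p q => B.s (B.ε p) * q) where
  add_l _ _ _ := by rw [map_add, map_add, add_mul]
  smul_l _ _ _ := by rw [map_smul, map_smul, smul_mul_assoc]
  add_r _ _ _ := mul_add _ _ _
  smul_r _ _ _ := mul_smul_comm _ _ _
  bal a p q := by
    rw [LinearMap.mulLeft_apply, LinearMap.mulLeft_apply, B.counit_t_mul, map_mul, mul_assoc]

theorem counit_mul_lUU (a : A) (w : B.UU) :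
    (isBal_counit_mul (B := B)).lift (B.lUU a w) =
      B.sL a ((isBal_counit_mul (B := B)).lift w) := by
  rw [← LinearMap.comp_apply, ← LinearMap.comp_apply]
  refine LinearMap.congr_fun (BalTensor.ext fun p q => ?_) w
  rw [LinearMap.comp_apply, LinearMap.comp_apply, B.lUU_btmul, IsBal.lift_btmul, IsBal.lift_btmul,
    B.counit_s_mul, map_mul, mul_assoc, LinearMap.mulLeft_apply]

/-- `x ⊗ (u ⊗ v) ↦ x ⊗ s(ε(u)) v` -/
def counitMid : BalTensor (fun a : A => rX (MulOpposite.op a)) B.lUU →ₗ[k]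
    BalTensor (fun a : A => rX (MulOpposite.op a)) B.sL :=
  BalTensor.map LinearMap.id (isBal_counit_mul (B := B)).lift
    (id_intertwines fun a : A => rX (MulOpposite.op a)) counit_mul_lUU

theorem counitMid_btmul (x : X) (w : B.UU) : counitMid rX (btmul _ B.lUU x w) =
    btmul _ B.sL x ((isBal_counit_mul (B := B)).lift w) := BalTensor.map_btmul _ _ _ _ _ _

theorem btmul_augX (w : BalTensor (fun a : A => rX (MulOpposite.op a)) B.sL) (v : U) :
    btmul (fun a : A => rX (MulOpposite.op a)) B.sL (augX rX w) v =
      counitMid rX (tmulRight rX v w) := by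
  rw [← LinearMap.flip_apply, ← LinearMap.comp_apply, ← LinearMap.comp_apply]
  refine LinearMap.congr_fun (BalTensor.ext fun x u => ?_) w
  rw [LinearMap.comp_apply, LinearMap.comp_apply, LinearMap.flip_apply, augX_btmul,
    tmulRight_btmul, counitMid_btmul, IsBal.lift_btmul, btmul_bal]
  rfl

theorem comul_sL (a : A) (u : U) : B.Δ (B.sL a u) = B.lUU a (B.Δ u) := B.comul_s_mul a u

/-- `x ⊗ u ↦ x ⊗ Δ u` -/
def comulMap : BalTensor (fun a : A => rX (MulOpposite.op a)) B.sL →ₗ[k]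
    BalTensor (fun a : A => rX (MulOpposite.op a)) B.lUU :=
  BalTensor.map LinearMap.id B.Δ (id_intertwines fun a : A => rX (MulOpposite.op a)) comul_sL

theorem comulMap_btmul (x : X) (u : U) : comulMap rX (btmul _ B.sL x u) = btmul _ B.lUU x (B.Δ u) :=
  BalTensor.map_btmul _ _ _ _ _ _

end FreeModule

/-- A free comodule has a retraction. -/
theorem IsFree.nonempty_retraction {F : RComod B} (h : F.IsFree) : Nonempty (Retraction F) := by
  obtain ⟨X, _, _, rX, e, he, hco⟩ := h
  have haug : ∀ a y, augX rX (e (F.r a y)) = rX (MulOpposite.op a) (augX (B := B) rX (e y)) := by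
    intro a y
    rw [he]
    generalize e y = w
    rw [← LinearMap.comp_apply, ← LinearMap.comp_apply]
    refine LinearMap.congr_fun (BalTensor.ext fun x u => ?_) w
    rw [LinearMap.comp_apply, LinearMap.comp_apply, BalTensor.map_btmul, augX_btmul, augX_btmul,
      LinearMap.mulLeft_apply, B.counit_t_mul, MulOpposite.op_mul, map_mul]
    rfl
  have hco' : ∀ y, bsum (F.coact y) (fun p q => tmulRight rX q (e p)) = comulMap rX (e y) := by
    intro y
    obtain ⟨m, p, q, hpq, hs⟩ :=
      bsum_exists (P := BalTensor (fun a : A => rX (MulOpposite.op a)) B.lUU) (F.coact y)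
    rw [hs]
    exact hco y m p q hpq
  -- In the coordinates of the free comodule, the retraction is (x ⊗ u) ⊗ v ↦ xε(u) ⊗ v.
  let C : BalTensor F.r B.sL →ₗ[k] BalTensor (fun a : A => rX (MulOpposite.op a)) B.sL :=
    BalTensor.map (ρ := F.r) (l := B.sL) (augX rX ∘ₗ e.toLinearMap) LinearMap.id haug
      (id_intertwines B.sL)
  have hC : ∀ p v, C (btmul F.r B.sL p v) = btmul _ B.sL (augX rX (e p)) v := fun p v =>
    BalTensor.map_btmul _ _ _ _ _ _
  have hb : ∀ x, IsBal k B.tL B.sL (fun u v => btmul F.r B.sL (e.symm (btmul _ B.sL x u)) v) :=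
    fun x =>
    { add_l := fun _ _ _ => by simp only [map_add, LinearMap.add_apply]
      smul_l := fun _ _ _ => by simp only [map_smul, LinearMap.smul_apply]
      add_r := fun _ _ _ => by rw [map_add]
      smul_r := fun _ _ _ => by rw [map_smul]
      bal := fun a u v => by
        rw [← btmul_bal]
        congr 2
        rw [LinearEquiv.symm_apply_eq, he, LinearEquiv.apply_symm_apply, BalTensor.map_btmul]
        rfl }
  have hb' : IsBal k (fun a : A => rX (MulOpposite.op a)) B.lUU (fun x w => (hb x).lift w) :=
    { add_l := fun x x' w => by
        rw [← IsBal.bsum_eq, ← IsBal.bsum_eq, ← IsBal.bsum_eq, ← bsum_add_fun]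
        simp only [map_add, LinearMap.add_apply]
      smul_l := fun r x w => by
        rw [← IsBal.bsum_eq, ← IsBal.bsum_eq, ← bsum_smul_fun]
        simp only [map_smul, LinearMap.smul_apply]
      add_r := fun _ _ _ => map_add _ _ _
      smul_r := fun _ _ _ => map_smul _ _ _
      bal := fun a x w => by
        rw [← IsBal.bsum_eq, ← IsBal.bsum_eq, AeRing.lUU, (hb x).bsum_map]
        simp only [btmul_bal]
        rfl }
  have hlift : ∀ v w, hb'.lift (tmulRight rX v w) = btmul F.r B.sL (e.symm w) v := by
    intro v w
    refine LinearMap.congr_fun (f := hb'.lift ∘ₗ tmulRight rX v)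
      (g := (btmul F.r B.sL).flip v ∘ₗ e.symm.toLinearMap) (BalTensor.ext fun x u => ?_) w
    rw [LinearMap.comp_apply, LinearMap.comp_apply, tmulRight_btmul, hb'.lift_btmul,
      IsBal.lift_btmul]
    rfl
  refine ⟨{ map := e.symm.toLinearMap ∘ₗ C, map_rPU := fun a w => ?_, coact_map := fun p v => ?_,
            map_coact := fun p => ?_ }⟩
  · rw [← LinearMap.comp_apply, ← LinearMap.comp_apply]
    refine LinearMap.congr_fun (BalTensor.ext fun p v => ?_) w
    rw [LinearMap.comp_apply, LinearMap.comp_apply, LinearMap.comp_apply, LinearMap.comp_apply,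
      rPU_btmul, hC, hC, LinearEquiv.coe_coe, LinearEquiv.symm_apply_eq, he,
      LinearEquiv.apply_symm_apply, BalTensor.map_btmul]
    rfl
  · rw [LinearMap.comp_apply, hC, LinearEquiv.coe_coe]
    set x := augX rX (e p)
    -- Applying a functional to the freeness identity computes the coaction of e⁻¹(x ⊗ v) as e⁻¹(x ⊗
    -- v₍₁₎) ⊗ v₍₂₎.
    have h1 := congrArg hb'.lift (hco' (e.symm (btmul _ B.sL x v)))
    rw [map_bsum, LinearEquiv.apply_symm_apply, comulMap_btmul,
      hb'.lift_btmul, ← (hb x).bsum_eq] at h1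
    simp only [hlift, LinearEquiv.symm_apply_apply, bsum_btmul_eq] at h1
    rw [h1]
    refine congrArg (bsum (B.Δ v)) (funext fun u => funext fun w => ?_)
    rw [LinearMap.comp_apply, hC]
    rfl
  · rw [LinearMap.comp_apply, LinearEquiv.coe_coe, LinearEquiv.symm_apply_eq]
    have h1 : C (F.coact p) = counitMid rX (bsum (F.coact p) (fun p q => tmulRight rX q (e p))) := by
      rw [linear_eq_bsum C, map_bsum]
      simp only [hC, btmul_augX]
    rw [h1, hco']
    generalize e p = w
    rw [← LinearMap.comp_apply]
    refine LinearMap.congr_fun (g := LinearMap.id) (BalTensor.ext fun x u => ?_) w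
    rw [LinearMap.comp_apply, comulMap_btmul, counitMid_btmul, ← IsBal.bsum_eq]
    exact congrArg _ (B.sw_counit_left u)

/-- An injective comodule has a retraction. -/
theorem IsInjective.nonempty_retraction {I : RComod B} (h : I.IsInjective) :
    Nonempty (Retraction I) := by
  obtain ⟨F, hF, i, π, hπ⟩ := h
  obtain ⟨κ⟩ := hF.nonempty_retraction
  let T : BalTensor I.r B.sL →ₗ[k] BalTensor F.r B.sL :=
    BalTensor.map (ρ := I.r) (l := B.sL) (ρ' := F.r) (l' := B.sL) i.map LinearMap.id i.map_act
      (id_intertwines B.sL)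
  have hT : ∀ p v, T (btmul I.r B.sL p v) = btmul F.r B.sL (i.map p) v := fun p v =>
    BalTensor.map_btmul _ _ _ _ _ _
  refine ⟨{ map := π.map ∘ₗ κ.map ∘ₗ T, map_rPU := fun a w => ?_, coact_map := fun p v => ?_,
            map_coact := fun p => ?_ }⟩
  · rw [LinearMap.comp_apply, LinearMap.comp_apply, LinearMap.comp_apply, LinearMap.comp_apply,
      ← π.map_act, ← κ.map_rPU]
    congr 2
    rw [← LinearMap.comp_apply, ← LinearMap.comp_apply]
    refine LinearMap.congr_fun (BalTensor.ext fun p v => ?_) w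
    rw [LinearMap.comp_apply, LinearMap.comp_apply, rPU_btmul, hT, hT, rPU_btmul]
  · rw [LinearMap.comp_apply, LinearMap.comp_apply, hT, π.map_coact, κ.coact_map, map_bsum]
    simp only [BalTensor.map_btmul, LinearMap.comp_apply, hT]
    rfl
  · rw [LinearMap.comp_apply, LinearMap.comp_apply, ← i.map_coact, κ.map_coact, hπ]

namespace Retraction

variable {P : RComod B} (κ : Retraction P)

theorem sum_coact_map {N : Type*} [AddCommGroup N] [Module k N] {F : P.carrier → U → N}
    (κ : Retraction P) (h : IsBal k P.r B.sL F) (p : P.carrier) (v : U) :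
    bsum (P.coact (κ.map (btmul P.r B.sL p v))) F =
      B.sw v (fun x y => F (κ.map (btmul P.r B.sL p x)) y) := by
  rw [κ.coact_map, h.bsum_bsum]
  simp only [h.bsum_btmul]

variable {M : Type u} [AddCommGroup M] [Module k M] [Module U M] [IsScalarTower k U M]
  {hl : B.IsLeftHopf} {c : Contraaction B M} (hM : IsAYD hl c) (hst : IsStable c)

theorem isBal_homotopy {q : ℕ} (κ : Retraction P) (F : BiHom M P q) (p : P.carrier) :
    IsBal k B.tL (B.tens q).act (fun v y => (F.1 (κ.map (btmul P.r B.sL p v))).1 y) where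
  add_l _ _ _ := by
    rw [map_add, map_add, map_add]
    rfl
  smul_l _ _ _ := by
    rw [map_smul, map_smul, map_smul]
    rfl
  add_r _ _ _ := map_add _ _ _
  smul_r _ _ _ := map_smul _ _ _
  bal a v y := by
    rw [← F.2, ← κ.map_rPU, rPU_btmul]
    rfl

/-- The contracting homotopy of `Hom_{Aᵒᵖ}(P ⊗_A U^{⊗_A •}, M)`. -/
theorem exists_homotopy (κ : Retraction P) {q : ℕ} (F : BiHom M P q) :
    ∃ G : BiHom M P (q + 1), ∀ p v,
      DChain.slice q v (G.1 p) = F.1 (κ.map (btmul P.r B.sL p v)) := by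
  let g : P.carrier → DChain B M (q + 1) := fun p => ⟨B.tensLift (isBal_homotopy κ F p), fun a y => by
    induction y using B.tens_induct with
    | hc u y =>
      rw [AeRing.tensR_cons, AeRing.tensLift_cons, AeRing.tensLift_cons]
      exact (F.1 _).2 a y
    | h0 => simp only [map_zero, smul_zero]
    | ha x y hx hy => simp only [map_add, smul_add, hx, hy]⟩
  have hg : ∀ p u y, (g p).1 (B.cons q u y) = (F.1 (κ.map (btmul P.r B.sL p u))).1 y :=
    fun p u y => AeRing.tensLift_cons _ (isBal_homotopy κ F p) u y
  refine ⟨⟨{ toFun := g, map_add' := fun p p' => DChain.ext_cons fun u y => ?_,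
             map_smul' := fun r p => DChain.ext_cons fun u y => ?_ }, fun a p y => ?_⟩,
    fun p v => Subtype.ext (LinearMap.ext fun y => hg p v y)⟩
  · change _ = (g p).1 _ + (g p').1 _
    rw [hg, hg, hg, map_add, LinearMap.add_apply, map_add, map_add]
    rfl
  · change _ = r • (g p).1 _
    rw [hg, hg, map_smul, LinearMap.smul_apply, map_smul, map_smul]
    rfl
  · change (g _).1 y = (g p).1 _
    induction y using B.tens_induct with
    | hc u y => rw [AeRing.act_cons, hg, hg, btmul_bal, LinearMap.mulLeft_apply]
    | h0 => simp only [map_zero]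
    | ha x y hx hy => simp only [map_add, hx, hy]

/-- Let G(p)(v | y) = F(κ(p ⊗ v))(y). Its zeroth face is F, because κ retracts the coaction. Its
face i+1 is the same construction applied to face i of F, where colinearity of κ settles i = 0. The
alternating sum is thus F minus the construction applied to the differential of F, which is zero. -/
theorem exact_biD (κ : Retraction P) (q : ℕ) (F : BiHom M P (q + 1)) (hF : biD M hM hst P q F = 0) :
    ∃ G, biD M hM hst P (q + 1) G = F := by
  obtain ⟨G, hG⟩ := κ.exists_homotopy F
  refine ⟨G, ?_⟩
  have h0 : biFace hM hst (q + 1) 0 G = F := Subtype.ext (LinearMap.ext fun p => by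
    rw [biFace_zero, coactFace_apply]
    simp only [hG]
    rw [← map_bsum, ← map_bsum, bsum_btmul_eq, κ.map_coact])
  have hs : ∀ (i : Fin (q + 2)) p v, DChain.slice q v ((biFace hM hst (q + 1) i.succ G).1 p) =
      (biFace hM hst q i F).1 (κ.map (btmul P.r B.sL p v)) := by
    intro i p v
    rw [biFace_succ]
    induction i using Fin.cases with
    | zero =>
      rw [biFace_zero, coactFace_apply, κ.sum_coact_map (isBal_slice F)]
      refine Subtype.ext (LinearMap.ext fun y => ?_)
      rw [DChain.slice_apply, dFace_one, slice_bsum]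
      simp only [← hG]
      rfl
    | succ i => rw [slice_dFace, hG, biFace_succ]
  let L : P.carrier → U → BiHom M P (q + 1) →ₗ[k] DChain B M q := fun p v =>
    DChain.slice q v ∘ₗ LinearMap.applyₗ p ∘ₗ Submodule.subtype _
  let L' : P.carrier → BiHom M P q →ₗ[k] DChain B M q := fun p =>
    LinearMap.applyₗ p ∘ₗ Submodule.subtype _
  have hL : ∀ (i : Fin (q + 2)) p v, L p v (biFace hM hst (q + 1) i.succ G) =
    L' (κ.map (btmul P.r B.sL p v)) (biFace hM hst q i F) := hs
  have h1 : biD M hM hst P (q + 1) G =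
      F - ∑ i : Fin (q + 2), (-1 : ℤ) ^ (i : ℕ) • biFace hM hst (q + 1) i.succ G := by
    rw [biD, altSum, Fin.sum_univ_succ, LinearMap.add_apply, LinearMap.smul_apply, h0,
      LinearMap.sum_apply, sub_eq_add_neg, ← Finset.sum_neg_distrib]
    simp only [Fin.val_zero, pow_zero, one_smul, LinearMap.smul_apply, Fin.val_succ, pow_succ,
      mul_neg, mul_one, neg_smul, LinearMap.neg_apply]
  have h2 : ∀ p v, L p v (∑ i : Fin (q + 2), (-1 : ℤ) ^ (i : ℕ) •
      biFace hM hst (q + 1) i.succ G) = 0 := by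
    intro p v
    refine (map_alternating_sum_eq (L p v) (L' (κ.map (btmul P.r B.sL p v))) _
      (fun i => biFace hM hst q i F) fun i => hL i p v).trans ?_
    have h3 : ∑ i : Fin (q + 2), (-1 : ℤ) ^ (i : ℕ) • biFace hM hst q i F = 0 := by
      rw [← hF, biD, altSum, LinearMap.sum_apply]
      rfl
    exact (congrArg _ h3).trans (map_zero _)
  rw [h1, sub_eq_self]
  refine Subtype.ext (LinearMap.ext fun p => DChain.ext_cons fun v y => ?_)
  exact congrArg (fun f : DChain B M q => f.1 y) (h2 p v)

end Retraction

end RComod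

end InjectiveComodules

/-! ### Exchanging a comodule with a tensor power of U -/

section Columns

set_option maxSynthPendingDepth 3

variable {k : Type v} [CommRing k] {A U : Type u} [Ring A] [Algebra k A] [Ring U] [Algebra k U]
  {B : LeftBialgebroid k A U} {N : Type*} [AddCommGroup N] [Module k N]

namespace LeftBialgebroid

theorem IsLeftHopf.transl_s_mul (hl : B.IsLeftHopf) (a : A) (u : U) :
    hl.transl (B.s a * u) = B.bimulL (B.s a) 1 (hl.transl u) := by
  apply hl.1
  rw [hl.galoisL_bimul_transl, hl.galois_transl]
  have h : B.Δ (B.s a) = btmul B.tL B.sL (B.s a) 1 := by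
    have h1 := B.comul_s_mul a 1
    rw [mul_one, B.comul_one, B.lUU_btmul, mul_one] at h1
    exact h1
  rw [sw, h, (B.isBal_btmul_mul u 1).bsum_btmul, mul_one]

end LeftBialgebroid

namespace RComod

variable {P Q : RComod B}

/-! ### The left `A`-action on a comodule -/

theorem isBal_lact (a : A) : IsBal k P.r B.sL (fun x u => P.r (B.ε (u * B.s a)) x) where
  add_l _ _ _ := map_add _ _ _
  smul_l _ _ _ := map_smul _ _ _
  add_r _ _ _ := by rw [r, add_mul, map_add, MulOpposite.op_add, map_add, LinearMap.add_apply]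
  smul_r _ _ _ := by
    rw [r, smul_mul_assoc, map_smul, MulOpposite.op_smul, map_smul, LinearMap.smul_apply]
  bal b x u := by
    rw [LinearMap.mulLeft_apply, mul_assoc, B.counit_s_mul, r_mul]

/-- Coassociativity of P moves the second coaction onto a coproduct of u, and the factor ε(v s(a))
then becomes right multiplication by t(a). -/
theorem sum_r (a : A) (p : P.carrier) {F : P.carrier → U → N} (h : IsBal k P.r B.sL F) :
    bsum (P.coact (bsum (P.coact p) (fun x u => P.r (B.ε (u * B.s a)) x))) F =
      bsum (P.coact p) (fun x u => F x (u * B.t (MulOpposite.op a))) := by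
  have h3 : P.IsBal3 (fun x u v => F x (B.t (MulOpposite.op (B.ε (v * B.s a))) * u)) :=
    { left := fun v =>
        { add_l := fun _ _ _ => h.add_l _ _ _
          smul_l := fun _ _ _ => h.smul_l _ _ _
          add_r := fun _ _ _ => by rw [mul_add, h.add_r]
          smul_r := fun _ _ _ => by rw [mul_smul_comm, h.smul_r]
          bal := fun b x u => by
            rw [h.bal, LinearMap.mulLeft_apply, LinearMap.mulLeft_apply, ← mul_assoc, B.comm,
              mul_assoc] }
      right := fun x =>
        { add_l := fun _ _ _ => by rw [mul_add, h.add_r]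
          smul_l := fun _ _ _ => by rw [mul_smul_comm, h.smul_r]
          add_r := fun _ _ _ => by
            rw [add_mul, map_add, MulOpposite.op_add, map_add, add_mul, h.add_r]
          smul_r := fun _ _ _ => by
            rw [smul_mul_assoc, map_smul, MulOpposite.op_smul, map_smul, smul_mul_assoc, h.smul_r]
          bal := fun b u v => by
            rw [LinearMap.mulLeft_apply, LinearMap.mulLeft_apply, mul_assoc (B.s b), B.counit_s_mul,
              MulOpposite.op_mul, map_mul B.t, mul_assoc] } }
  rw [map_bsum, h.bsum_bsum]
  simp only [sum_coact_r h]
  rw [sum_coassoc h3]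
  refine congrArg (bsum (P.coact p)) (funext fun x => funext fun u => ?_)
  have h4 : ∀ (z : B.UU) (G : U → U → U), bsum z (fun c d => F x (G c d)) = F x (bsum z G) :=
    fun z G => by
      let L : U →ₗ[k] N :=
        { toFun := F x, map_add' := h.add_r x, map_smul' := fun r u => h.smul_r r x u }
      exact (map_bsum L z G).symm
  rw [LeftBialgebroid.sw, h4]
  exact congrArg (F x) (sw_counit_right_mul_s (B := B) a u)

variable (P) in
/-- The left `A`-action `a p = p₍₀₎ ε(p₍₁₎ ◀ a)`. -/
noncomputable def lact : A →ₐ[k] Module.End k P.carrier :=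
  AlgHom.ofLinearMap
    { toFun := fun a => (isBal_lact a).lift ∘ₗ P.coact
      map_add' := fun a b => LinearMap.ext fun p => by
        change (isBal_lact (a + b)).lift (P.coact p) =
          (isBal_lact a).lift (P.coact p) + (isBal_lact b).lift (P.coact p)
        rw [← IsBal.bsum_eq, ← IsBal.bsum_eq, ← IsBal.bsum_eq, ← bsum_add_fun]
        refine congrArg (bsum (P.coact p)) (funext fun x => funext fun u => ?_)
        rw [map_add, mul_add, map_add, r, MulOpposite.op_add, map_add, LinearMap.add_apply]
      map_smul' := fun c a => LinearMap.ext fun p => by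
        change (isBal_lact (c • a)).lift (P.coact p) = c • (isBal_lact a).lift (P.coact p)
        rw [← IsBal.bsum_eq, ← IsBal.bsum_eq, ← bsum_smul_fun]
        refine congrArg (bsum (P.coact p)) (funext fun x => funext fun u => ?_)
        rw [map_smul, mul_smul_comm, map_smul, r, MulOpposite.op_smul, map_smul,
          LinearMap.smul_apply] }
    (LinearMap.ext fun p => by
      change (isBal_lact 1).lift (P.coact p) = p
      rw [← IsBal.bsum_eq]
      simp only [map_one, mul_one]
      exact P.sum_counit p)
    (fun a b => LinearMap.ext fun p => by
      change (isBal_lact (a * b)).lift (P.coact p) =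
        (isBal_lact a).lift (P.coact ((isBal_lact b).lift (P.coact p)))
      rw [← IsBal.bsum_eq, ← IsBal.bsum_eq, ← IsBal.bsum_eq, sum_r b p (isBal_lact a)]
      refine congrArg (bsum (P.coact p)) (funext fun x => funext fun u => ?_)
      -- The order comes out right because s and t commute and ε(− t(b)) = ε(− s(b)): thus ε(u
      -- t(b)s(a)) = ε(u s(a)s(b)).
      rw [mul_assoc, ← B.comm, ← mul_assoc, B.counit_mul_t_eq, map_mul B.s, mul_assoc])

theorem lact_apply (a : A) (p : P.carrier) :
    P.lact a p = bsum (P.coact p) (fun x u => P.r (B.ε (u * B.s a)) x) :=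
  ((isBal_lact a).bsum_eq _).symm

theorem sum_coact_lact {F : P.carrier → U → N} (h : IsBal k P.r B.sL F) (a : A) (p : P.carrier) :
    bsum (P.coact (P.lact a p)) F =
      bsum (P.coact p) (fun x u => F x (u * B.t (MulOpposite.op a))) := by
  rw [lact_apply, sum_r a p h]

theorem Hom.map_lact (φ : Hom P Q) (a : A) (p : P.carrier) :
    φ.map (P.lact a p) = Q.lact a (φ.map p) := by
  rw [lact_apply, lact_apply, φ.sum_coact (isBal_lact a), map_bsum]
  simp only [φ.map_act]

/-- A colinear retraction carries the left action on P to right multiplication by t(a) on the factor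
U. This is the balancing needed for the inverse of the exchange map. -/
theorem Retraction.lact_map (κ : Retraction P) (a : A) (p : P.carrier) (v : U) :
    P.lact a (κ.map (btmul P.r B.sL p v)) =
      κ.map (btmul P.r B.sL p (v * B.t (MulOpposite.op a))) := by
  rw [lact_apply, κ.sum_coact_map (isBal_lact a), ← sw_counit_right_mul_s (B := B) a v, map_bsum,
    map_bsum]
  simp only [← κ.map_rPU, rPU_btmul]

/-! ### Interchanging the factors -/

variable (q : ℕ)

theorem isBal_diag (x : (B.tens q).carrier) :
    IsBal k P.r B.sL (fun p u => btmul P.r (B.tens q).act p (B.diag q u x)) where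
  add_l _ _ _ := by rw [map_add, LinearMap.add_apply]
  smul_l _ _ _ := by rw [map_smul, LinearMap.smul_apply]
  add_r _ _ _ := by rw [map_add, LinearMap.add_apply, map_add]
  smul_r _ _ _ := by rw [map_smul, LinearMap.smul_apply, map_smul]
  bal a p u := by rw [btmul_bal, LinearMap.mulLeft_apply, B.diag_mul, B.diag_s]

theorem isBal_swap : IsBal k (B.tensR q) (fun a => P.lact a)
    (fun x p => bsum (P.coact p) (fun p u => btmul P.r (B.tens q).act p (B.diag q u x))) where
  add_l _ _ _ := by
    rw [← bsum_add_fun]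
    simp only [map_add]
  smul_l _ _ _ := by
    rw [← bsum_smul_fun]
    simp only [map_smul]
  add_r _ _ _ := by rw [map_add, (isBal_diag q _).bsum_add]
  smul_r _ _ _ := by rw [map_smul, (isBal_diag q _).bsum_smul]
  bal a x p := by
    rw [sum_coact_lact (isBal_diag q x)]
    simp only [B.diag_mul, B.diag_t]

variable (P) in
/-- `x ⊗ p ↦ p₍₀₎ ⊗ p₍₁₎ x`. -/
noncomputable def swap :
    BalTensor (B.tensR q) (fun a => P.lact a) →ₗ[k] BalTensor P.r (B.tens q).act :=
  (isBal_swap q).lift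

theorem swap_btmul (x : (B.tens q).carrier) (p : P.carrier) :
    P.swap q (btmul (B.tensR q) (fun a => P.lact a) x p) =
      bsum (P.coact p) (fun p u => btmul P.r (B.tens q).act p (B.diag q u x)) :=
  (isBal_swap q).lift_btmul x p

/-- `p ⊗ y ↦ φ(p) ⊗ y`. -/
def tensMap (φ : Hom P Q) : BalTensor P.r (B.tens q).act →ₗ[k] BalTensor Q.r (B.tens q).act :=
  BalTensor.map (ρ := P.r) (l := (B.tens q).act) (ρ' := Q.r) (l' := (B.tens q).act) φ.map
    LinearMap.id φ.map_act (id_intertwines _)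

theorem tensMap_btmul (φ : Hom P Q) (p : P.carrier) (y : (B.tens q).carrier) :
    tensMap q φ (btmul P.r (B.tens q).act p y) = btmul Q.r (B.tens q).act (φ.map p) y :=
  BalTensor.map_btmul _ _ _ _ _ _

/-- `x ⊗ p ↦ x ⊗ φ(p)`. -/
noncomputable def tensMap' (φ : Hom P Q) : BalTensor (B.tensR q) (fun a => P.lact a) →ₗ[k]
    BalTensor (B.tensR q) (fun a => Q.lact a) :=
  BalTensor.map (ρ := B.tensR q) (l := fun a => P.lact a) (ρ' := B.tensR q)
    (l' := fun a => Q.lact a) LinearMap.id φ.map (id_intertwines _) φ.map_lact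

theorem tensMap'_btmul (φ : Hom P Q) (x : (B.tens q).carrier) (p : P.carrier) :
    tensMap' q φ (btmul (B.tensR q) (fun a => P.lact a) x p) =
      btmul (B.tensR q) (fun a => Q.lact a) x (φ.map p) :=
  BalTensor.map_btmul _ _ _ _ _ _

theorem swap_tensMap' (φ : Hom P Q) (w) :
    Q.swap q (tensMap' q φ w) = tensMap q φ (P.swap q w) := by
  refine LinearMap.congr_fun (f := Q.swap q ∘ₗ tensMap' q φ) (g := tensMap q φ ∘ₗ P.swap q)
    (BalTensor.ext fun x p => ?_) w
  rw [LinearMap.comp_apply, LinearMap.comp_apply, tensMap'_btmul, swap_btmul, swap_btmul,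
    φ.sum_coact (isBal_diag q x), map_bsum]
  simp only [tensMap_btmul]

namespace Retraction

variable (κ : Retraction P)

theorem isBal_unswap_inner (κ : Retraction P) (x : (B.tens q).carrier) (p : P.carrier) :
    IsBal k B.tR B.tL (fun y z => btmul (B.tensR q) (fun a => P.lact a) (B.diag q z x)
      (κ.map (btmul P.r B.sL p y))) where
  add_l _ _ _ := by rw [map_add, map_add, map_add]
  smul_l _ _ _ := by rw [map_smul, map_smul, map_smul]
  add_r _ _ _ := by rw [map_add, LinearMap.add_apply, map_add, LinearMap.add_apply]
  smul_r _ _ _ := by rw [map_smul, LinearMap.smul_apply, map_smul, LinearMap.smul_apply]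
  bal a y z := by
    rw [LinearMap.mulLeft_apply, B.diag_mul, B.diag_t, btmul_bal, lact_map]
    rfl

theorem isBal_unswap_mid (κ : Retraction P) (hl : B.IsLeftHopf) (x : (B.tens q).carrier) :
    IsBal k P.r B.sL (fun p u => bsum (hl.transl u) (fun y z =>
      btmul (B.tensR q) (fun a => P.lact a) (B.diag q z x) (κ.map (btmul P.r B.sL p y)))) where
  add_l _ _ _ := by
    rw [← bsum_add_fun]
    simp only [map_add, LinearMap.add_apply]
  smul_l _ _ _ := by
    rw [← bsum_smul_fun]
    simp only [map_smul, LinearMap.smul_apply]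
  add_r p u u' := by rw [hl.transl_add, (κ.isBal_unswap_inner q x p).bsum_add]
  smul_r c p u := by rw [hl.transl_smul, (κ.isBal_unswap_inner q x p).bsum_smul]
  bal a p u := by
    rw [LinearMap.mulLeft_apply, hl.transl_s_mul, LeftBialgebroid.bimulL,
      (κ.isBal_unswap_inner q x p).bsum_map]
    simp only [btmul_bal, LinearMap.mulLeft_apply, LinearMap.mulRight_apply, mul_one]

theorem isBal_unswap (κ : Retraction P) (hl : B.IsLeftHopf) :
    IsBal k P.r (B.tens q).act (fun p x => bsum (P.coact p) (fun p u => bsum (hl.transl u)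
      (fun y z => btmul (B.tensR q) (fun a => P.lact a) (B.diag q z x)
        (κ.map (btmul P.r B.sL p y))))) where
  add_l _ _ x := by rw [map_add, (κ.isBal_unswap_mid q hl x).bsum_add]
  smul_l _ _ x := by rw [map_smul, (κ.isBal_unswap_mid q hl x).bsum_smul]
  add_r _ _ _ := by
    simp only [map_add, LinearMap.add_apply, bsum_add_fun]
  smul_r _ _ _ := by
    simp only [map_smul, LinearMap.smul_apply, bsum_smul_fun]
  bal a p x := by
    rw [sum_coact_r (κ.isBal_unswap_mid q hl x)]
    refine congrArg (bsum (P.coact p)) (funext fun p => funext fun u => ?_)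
    rw [hl.transl_t_mul, LeftBialgebroid.bimulL, (κ.isBal_unswap_inner q x p).bsum_map]
    simp only [LinearMap.mulLeft_apply, LinearMap.mulRight_apply, one_mul, B.diag_mul, B.diag_s]

/-- `p ⊗ x ↦ p₍₁₎₋ x ⊗ κ(p₍₀₎ ⊗ p₍₁₎₊)`. -/
noncomputable def unswap (κ : Retraction P) (hl : B.IsLeftHopf) :
    BalTensor P.r (B.tens q).act →ₗ[k] BalTensor (B.tensR q) (fun a => P.lact a) :=
  (κ.isBal_unswap q hl).lift

theorem unswap_btmul (hl : B.IsLeftHopf) (p : P.carrier) (x : (B.tens q).carrier) :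
    κ.unswap q hl (btmul P.r (B.tens q).act p x) = bsum (P.coact p) (fun p u =>
      bsum (hl.transl u) (fun y z => btmul (B.tensR q) (fun a => P.lact a) (B.diag q z x)
        (κ.map (btmul P.r B.sL p y)))) :=
  (κ.isBal_unswap q hl).lift_btmul p x

theorem sum_map {L : P.carrier →ₗ[k] N} (κ : Retraction P) (p : P.carrier) :
    bsum (P.coact p) (fun x u => L (κ.map (btmul P.r B.sL x u))) = L p := by
  rw [← map_bsum, ← map_bsum, bsum_btmul_eq, κ.map_coact]

/-- Colinearity of κ turns the coaction into a coproduct of p₍₁₎₊; the left translation identity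
cancels it against p₍₁₎₋, leaving κ(p₍₀₎ ⊗ p₍₁₎) ⊗ x = p ⊗ x. -/
theorem swap_unswap (hl : B.IsLeftHopf) (w) : P.swap q (κ.unswap q hl w) = w := by
  refine LinearMap.congr_fun (f := P.swap q ∘ₗ κ.unswap q hl) (g := LinearMap.id)
    (BalTensor.ext fun p x => ?_) w
  rw [LinearMap.comp_apply, unswap_btmul, map_bsum, LinearMap.id_apply]
  simp only [map_bsum, swap_btmul]
  refine Eq.trans ?_ (κ.sum_map (L := (btmul P.r (B.tens q).act).flip x) p)
  refine congrArg (bsum (P.coact p)) (funext fun p => funext fun u => ?_)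
  have hb : IsBal k B.tL B.sL (fun c d => btmul P.r (B.tens q).act
      (κ.map (btmul P.r B.sL p c)) (B.diag q d x)) :=
    { add_l := fun _ _ _ => by rw [map_add, map_add, map_add, LinearMap.add_apply]
      smul_l := fun _ _ _ => by rw [map_smul, map_smul, map_smul, LinearMap.smul_apply]
      add_r := fun _ _ _ => by rw [map_add, LinearMap.add_apply, map_add]
      smul_r := fun _ _ _ => by rw [map_smul, LinearMap.smul_apply, map_smul]
      bal := fun a c d => by
        rw [LinearMap.mulLeft_apply, LinearMap.mulLeft_apply, B.diag_mul, B.diag_s, ← btmul_bal,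
          ← κ.map_rPU, rPU_btmul] }
  have h1 := hl.bsum_transl hb u
  rw [B.diag_one] at h1
  refine Eq.trans ?_ h1
  refine congrArg (bsum (hl.transl u)) (funext fun y => funext fun z => ?_)
  simp only [B.diag_mul]
  exact κ.sum_coact_map (isBal_diag q (B.diag q z x)) p y

/-- After coassociativity the inner sum contains u₍₁₎₊ ⊗ u₍₁₎₋u₍₂₎, which is u ⊗ 1, and κ again
retracts the coaction. -/
theorem unswap_swap (hl : B.IsLeftHopf) (w) : κ.unswap q hl (P.swap q w) = w := by
  refine LinearMap.congr_fun (f := κ.unswap q hl ∘ₗ P.swap q) (g := LinearMap.id)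
    (BalTensor.ext fun x p => ?_) w
  rw [LinearMap.comp_apply, swap_btmul, map_bsum, LinearMap.id_apply]
  simp only [unswap_btmul, ← B.diag_mul]
  have h3 : P.IsBal3 (fun p u v => bsum (hl.transl u) (fun y z =>
      btmul (B.tensR q) (fun a => P.lact a) (B.diag q (z * v) x)
        (κ.map (btmul P.r B.sL p y)))) :=
    { left := fun v => by
        simpa only [B.diag_mul] using κ.isBal_unswap_mid q hl (B.diag q v x)
      right := fun p =>
        { add_l := fun u u' v => by
            simp only [B.diag_mul]
            rw [hl.transl_add, (κ.isBal_unswap_inner q _ p).bsum_add]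
          smul_l := fun c u v => by
            simp only [B.diag_mul]
            rw [hl.transl_smul, (κ.isBal_unswap_inner q _ p).bsum_smul]
          add_r := fun u v v' => by
            simp only [mul_add, map_add, LinearMap.add_apply, bsum_add_fun]
          smul_r := fun c u v => by
            simp only [mul_smul_comm, map_smul, LinearMap.smul_apply, bsum_smul_fun]
          bal := fun a u v => by
            simp only [B.diag_mul]
            rw [LinearMap.mulLeft_apply, LinearMap.mulLeft_apply, hl.transl_t_mul,
              LeftBialgebroid.bimulL, (κ.isBal_unswap_inner q _ p).bsum_map]
            simp only [LinearMap.mulLeft_apply, LinearMap.mulRight_apply, one_mul, B.diag_mul] } }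
  rw [sum_coassoc h3]
  refine Eq.trans ?_ (κ.sum_map (L := btmul (B.tensR q) (fun a => P.lact a) x) p)
  refine congrArg (bsum (P.coact p)) (funext fun p => funext fun u => ?_)
  have h4 : B.bimulL u 1 (hl.transl 1) = btmul B.tR B.tL u 1 := by
    rw [hl.transl_one, LeftBialgebroid.bimulL, BalTensor.map_btmul, LinearMap.mulLeft_apply,
      LinearMap.mulRight_apply, mul_one, mul_one]
  have h5 := congrArg (fun Z => bsum Z (fun y z => btmul (B.tensR q) (fun a => P.lact a)
    (B.diag q z x) (κ.map (btmul P.r B.sL p y)))) ((hl.sw_transl u 1).trans h4)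
  rw [(κ.isBal_unswap_inner q x p).bsum_bsum, (κ.isBal_unswap_inner q x p).bsum_btmul,
    B.diag_one] at h5
  simp only [LeftBialgebroid.bimulL, (κ.isBal_unswap_inner q x p).bsum_map, mul_one,
    LinearMap.mulLeft_apply, LinearMap.mulRight_apply, one_mul] at h5
  exact h5

end Retraction

end RComod

end Columns

/-! ### The double complex of an injective resolution -/

section Balancing

set_option maxSynthPendingDepth 3

variable {k : Type v} [CommRing k] {A U : Type u} [Ring A] [Algebra k A] [Ring U] [Algebra k U]
  {B : LeftBialgebroid k A U}
  {M : Type u} [AddCommGroup M] [Module k M] [Module U M] [IsScalarTower k U M]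

namespace RComod

variable {P Q R : RComod B} (q : ℕ)

/-- `- ⊗_A U^{⊗_A q}` is exact on injective comodules. -/
theorem exact_tensMap (hflat : B.TargetFlat) (hl : B.IsLeftHopf) (φ : Hom P Q) (ψ : Hom Q R)
    (hex : Function.Exact φ.map ψ.map) (hQ : Q.IsInjective) (hR : R.IsInjective)
    (w : BalTensor Q.r (B.tens q).act) (hw : tensMap q ψ w = 0) : ∃ w', tensMap q φ w' = w := by
  obtain ⟨κ⟩ := hQ.nonempty_retraction
  obtain ⟨κ'⟩ := hR.nonempty_retraction
  -- The element is carried to U^{⊗ q} ⊗_A Q, where flatness of the tensor power applies; the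
  -- exchange maps are natural for comodule morphisms.
  have h1 : tensMap' q ψ (κ.unswap q hl w) = 0 := by
    rw [← κ'.unswap_swap q hl (tensMap' q ψ _), swap_tensMap', κ.swap_unswap, hw, map_zero]
  obtain ⟨w', hw'⟩ := (LeftBialgebroid.isFlatOps_tensR hflat q).exact φ.map ψ.map φ.map_lact
    ψ.map_lact hex _ h1
  refine ⟨P.swap q w', ?_⟩
  rw [← swap_tensMap', ← κ.swap_unswap q hl w]
  exact congrArg _ hw'

variable (P) in
/-- The right `A`-action on `P ⊗_A U^{⊗_A q}`. -/
def tensAct : Aᵐᵒᵖ →ₐ[k] Module.End k (BalTensor P.r (B.tens q).act) :=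
  BalTensor.endR (B.tensRHom q) (B.tensR_act q)

theorem tensAct_btmul (a : A) (p : P.carrier) (y : (B.tens q).carrier) :
    P.tensAct q (MulOpposite.op a) (btmul P.r (B.tens q).act p y) =
      btmul P.r (B.tens q).act p (B.tensR q a y) :=
  (BalTensor.endR_btmul _ _ _ _ _).trans (congrArg _ (B.tensRHom_apply q a y))

theorem tensMap_tensAct (φ : Hom P Q) (a : Aᵐᵒᵖ) (w) :
    tensMap q φ (P.tensAct q a w) = Q.tensAct q a (tensMap q φ w) := by
  induction a using MulOpposite.rec' with | _ a
  refine LinearMap.congr_fun (f := tensMap q φ ∘ₗ P.tensAct q (MulOpposite.op a))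
    (g := Q.tensAct q (MulOpposite.op a) ∘ₗ tensMap q φ) (BalTensor.ext fun p y => ?_) w
  rw [LinearMap.comp_apply, LinearMap.comp_apply, tensAct_btmul, tensMap_btmul, tensMap_btmul,
    tensAct_btmul]

variable {q}

theorem exists_biHom (g : BalTensor P.r (B.tens q).act →ₗ[k] M)
    (hg : ∀ a w, g (P.tensAct q a w) = B.t a • g w) :
    ∃ F : BiHom M P q, ∀ p y, (F.1 p).1 y = g (btmul P.r (B.tens q).act p y) := by
  let f : P.carrier → DChain B M q := fun p => ⟨g ∘ₗ btmul P.r (B.tens q).act p, fun a y => by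
    rw [LinearMap.comp_apply, LinearMap.comp_apply, ← tensAct_btmul, hg]⟩
  have hf : ∀ p y, (f p).1 y = g (btmul P.r (B.tens q).act p y) := fun _ _ => rfl
  refine ⟨⟨{ toFun := f, map_add' := fun p p' => Subtype.ext (LinearMap.ext fun y => ?_),
             map_smul' := fun r p => Subtype.ext (LinearMap.ext fun y => ?_) }, fun a p y => ?_⟩,
    fun _ _ => rfl⟩
  · change _ = (f p).1 _ + (f p').1 _
    rw [hf, hf, hf, map_add, LinearMap.add_apply, map_add]
  · change _ = r • (f p).1 _
    rw [hf, hf, map_smul, LinearMap.smul_apply, map_smul]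
  · change (f _).1 y = (f p).1 _
    rw [hf, hf, btmul_bal]

theorem exists_linear_of_biHom (F : BiHom M P q) :
    ∃ g : BalTensor P.r (B.tens q).act →ₗ[k] M, (∀ a w, g (P.tensAct q a w) = B.t a • g w) ∧
      ∀ p y, g (btmul P.r (B.tens q).act p y) = (F.1 p).1 y := by
  have hb : IsBal k P.r (B.tens q).act (fun p y => (F.1 p).1 y) :=
    { add_l := fun _ _ _ => by
        rw [map_add]
        rfl
      smul_l := fun _ _ _ => by
        rw [map_smul]
        rfl
      add_r := fun _ _ _ => map_add _ _ _
      smul_r := fun _ _ _ => map_smul _ _ _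
      bal := F.2 }
  refine ⟨hb.lift, fun a w => ?_, fun p y => hb.lift_btmul p y⟩
  induction a using MulOpposite.rec' with | _ a
  obtain ⟨n, p, y, rfl⟩ := w.exists_rep
  simp only [map_sum, Finset.smul_sum, tensAct_btmul, hb.lift_btmul]
  exact Finset.sum_congr rfl fun j _ => (F.1 (p j)).2 a (y j)

/-- `Hom_{Aᵒᵖ}(- ⊗_A U^{⊗_A q}, M)` is exact on injective comodules. -/
theorem exact_biPre (hflat : B.TargetFlat) (hinj : IsRightInjective B.toAeRing M)
    (hl : B.IsLeftHopf) (φ : Hom P Q) (ψ : Hom Q R) (hex : Function.Exact φ.map ψ.map)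
    (hQ : Q.IsInjective) (hR : R.IsInjective) (F : BiHom M Q q) (hF : biPre M φ q F = 0) :
    ∃ G, biPre M ψ q G = F := by
  obtain ⟨f, hf, hf'⟩ := exists_linear_of_biHom F
  -- F, viewed as a functional on Q ⊗ U^{⊗ q}, kills the image of φ ⊗ 1, which is the kernel of ψ ⊗
  -- 1. It therefore extends along ψ ⊗ 1.
  obtain ⟨g, hg, hg'⟩ := hinj.exists_extend (Q.tensAct q) (R.tensAct q) (tensMap q ψ)
    (tensMap_tensAct q ψ) f hf (fun w hw => by
      obtain ⟨w', rfl⟩ := exact_tensMap q hflat hl φ ψ hex hQ hR w hw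
      refine LinearMap.congr_fun (f := f ∘ₗ tensMap q φ) (g := 0)
        (BalTensor.ext fun p y => ?_) w'
      rw [LinearMap.comp_apply, tensMap_btmul, hf', ← biPre_apply, hF]
      rfl)
  obtain ⟨G, hG⟩ := exists_biHom g hg
  refine ⟨G, Subtype.ext (LinearMap.ext fun p => Subtype.ext (LinearMap.ext fun y => ?_))⟩
  rw [biPre_apply, hG, ← tensMap_btmul, hg', hf']

end RComod

namespace InjResolution

open RComod

variable (R : InjResolution B) (q : ℕ)

/-- The coaction on the image of b is aug(1) ⊗ t(b), and ε(t(b)s(a)) = ab. Hence the augmentation is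
left A-linear and can be tensored with U^{⊗ q} on the left. -/
theorem aug_lact (a b : A) : R.aug (a * b) = (R.I 0).lact a (R.aug b) := by
  rw [lact_apply, R.aug_coact, (isBal_lact a).bsum_btmul, B.counit_t_mul, B.counit_s, ← R.aug_act,
    one_mul]

/-- `x ⊗ a ↦ x ⊗ aug(a)`. -/
noncomputable def augTens : BalTensor (B.tensR q) (fun a => Algebra.lmul k A a) →ₗ[k]
    BalTensor (B.tensR q) (fun a => (R.I 0).lact a) :=
  BalTensor.map (ρ := B.tensR q) (l := fun a => Algebra.lmul k A a) (ρ' := B.tensR q)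
    (l' := fun a => (R.I 0).lact a) LinearMap.id R.aug (id_intertwines _) R.aug_lact

theorem swap_augTens (x : (B.tens q).carrier) :
    (R.I 0).swap q (R.augTens q (btmul (B.tensR q) (fun a => Algebra.lmul k A a) x 1)) =
      btmul (R.I 0).r (B.tens q).act (R.aug 1) x := by
  have h : R.augTens q (btmul (B.tensR q) (fun a => Algebra.lmul k A a) x 1) =
    btmul (B.tensR q) (fun a => (R.I 0).lact a) x (R.aug 1) := BalTensor.map_btmul _ _ _ _ _ _
  rw [h, swap_btmul, R.aug_coact, (isBal_diag q x).bsum_btmul, B.diag_t,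
    ← B.diag_t, MulOpposite.op_one, map_one B.t, B.diag_one]

theorem exists_btmul_one (w : BalTensor (B.tensR q) (fun a => Algebra.lmul k A a)) :
    ∃ x, w = btmul (B.tensR q) (fun a => Algebra.lmul k A a) x 1 := by
  obtain ⟨n, x, a, rfl⟩ := w.exists_rep
  refine ⟨∑ j, B.tensR q (a j) (x j), ?_⟩
  rw [map_sum, LinearMap.sum_apply]
  refine Finset.sum_congr rfl fun j _ => ?_
  rw [btmul_bal]
  exact congrArg _ (mul_one _).symm

theorem btmul_one_injective : Function.Injective fun x : (B.tens q).carrier =>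
    btmul (B.tensR q) (fun a => Algebra.lmul k A a) x 1 := by
  intro x x' h
  have hb : IsBal k (B.tensR q) (fun a => Algebra.lmul k A a) 
      (fun x a => B.tensRHom q (MulOpposite.op a) x) :=
    { add_l := fun _ _ _ => map_add _ _ _
      smul_l := fun _ _ _ => map_smul _ _ _
      add_r := fun _ _ _ => by rw [MulOpposite.op_add, map_add, LinearMap.add_apply]
      smul_r := fun _ _ _ => by rw [MulOpposite.op_smul, map_smul, LinearMap.smul_apply]
      bal := fun a x b => by
        change _ = B.tensRHom q (MulOpposite.op (a * b)) x
        rw [MulOpposite.op_mul, map_mul, Module.End.mul_apply, B.tensRHom_apply q a] }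
  have h1 := congrArg hb.lift h
  simpa only [hb.lift_btmul, MulOpposite.op_one, map_one, Module.End.one_apply] using h1

/-- Under the exchange map this becomes U^{⊗ q} ⊗_A A → U^{⊗ q} ⊗_A I⁰, injective by flatness.
`exists_btmul_aug` is the corresponding exactness at I⁰. -/
theorem btmul_aug_injective (hflat : B.TargetFlat) (hl : B.IsLeftHopf) :
    Function.Injective (btmul (R.I 0).r (B.tens q).act (R.aug 1)) := by
  obtain ⟨κ⟩ := (R.injective 0).nonempty_retraction
  intro x x' h
  rw [← swap_augTens, ← swap_augTens] at h
  refine btmul_one_injective q (LeftBialgebroid.isFlatOps_tensR hflat q _ _ (Algebra.lmul k A)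
    (R.I 0).lact R.aug R.aug_lact R.aug_injective ?_)
  have h1 := congrArg (κ.unswap q hl) h
  rwa [κ.unswap_swap, κ.unswap_swap] at h1

theorem exists_btmul_aug (hflat : B.TargetFlat) (hl : B.IsLeftHopf)
    (w : BalTensor (R.I 0).r (B.tens q).act) (hw : tensMap q (R.d 0) w = 0) :
    ∃ x, btmul (R.I 0).r (B.tens q).act (R.aug 1) x = w := by
  obtain ⟨κ⟩ := (R.injective 0).nonempty_retraction
  obtain ⟨κ'⟩ := (R.injective 1).nonempty_retraction
  have h1 : tensMap' q (R.d 0) (κ.unswap q hl w) = 0 := by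
    rw [← κ'.unswap_swap q hl (tensMap' q (R.d 0) _), swap_tensMap', κ.swap_unswap, hw, map_zero]
  obtain ⟨w', hw'⟩ := (LeftBialgebroid.isFlatOps_tensR hflat q).exact (lX := Algebra.lmul k A)
    R.aug (R.d 0).map R.aug_lact (R.d 0).map_lact R.exact_zero _ h1
  obtain ⟨x, rfl⟩ := exists_btmul_one q w'
  refine ⟨x, ?_⟩
  rw [← swap_augTens, ← κ.swap_unswap q hl w]
  exact congrArg _ hw'

variable (M) in
/-- Restriction along `y ↦ aug(1) ⊗ y`. -/
noncomputable def restrict : BiHom M (R.I 0) q →ₗ[k] DChain B M q :=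
  LinearMap.applyₗ (R.aug 1) ∘ₗ Submodule.subtype _

theorem restrict_apply (F : BiHom M (R.I 0) q) : R.restrict M q F = F.1 (R.aug 1) := rfl

variable {q}

theorem btmul_aug_tensR (a : Aᵐᵒᵖ) (y : (B.tens q).carrier) :
    btmul (R.I 0).r (B.tens q).act (R.aug 1) (B.tensRHom q a y) =
      (R.I 0).tensAct q a (btmul (R.I 0).r (B.tens q).act (R.aug 1) y) :=
  (BalTensor.endR_btmul _ _ _ _ _).symm

theorem restrict_surjective (hflat : B.TargetFlat) (hinj : IsRightInjective B.toAeRing M)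
    (hl : B.IsLeftHopf) : Function.Surjective (R.restrict M q) := by
  intro f
  obtain ⟨g, hg, hg'⟩ := hinj.exists_extend (B.tensRHom q) ((R.I 0).tensAct q)
    (btmul (R.I 0).r (B.tens q).act (R.aug 1)) R.btmul_aug_tensR f.1 (fun a y => by
      induction a using MulOpposite.rec' with | _ a
      rw [B.tensRHom_apply]
      exact f.2 a y) (fun y hy => by
      rw [R.btmul_aug_injective q hflat hl (hy.trans (map_zero _).symm), map_zero])
  obtain ⟨G, hG⟩ := exists_biHom g hg
  refine ⟨G, Subtype.ext (LinearMap.ext fun y => ?_)⟩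
  rw [restrict_apply, hG, hg']

theorem restrict_eq_zero_iff (hflat : B.TargetFlat) (hinj : IsRightInjective B.toAeRing M)
    (hl : B.IsLeftHopf) (F : BiHom M (R.I 0) q) :
    R.restrict M q F = 0 ↔ ∃ G, biPre M (R.d 0) q G = F := by
  constructor
  · intro hF
    obtain ⟨f, hf, hf'⟩ := exists_linear_of_biHom F
    obtain ⟨g, hg, hg'⟩ := hinj.exists_extend ((R.I 0).tensAct q) ((R.I 1).tensAct q)
      (tensMap q (R.d 0)) (tensMap_tensAct q (R.d 0)) f hf (fun w hw => by
        obtain ⟨y, rfl⟩ := R.exists_btmul_aug q hflat hl w hw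
        rw [hf', ← restrict_apply, hF]
        rfl)
    obtain ⟨G, hG⟩ := exists_biHom g hg
    refine ⟨G, Subtype.ext (LinearMap.ext fun p => Subtype.ext (LinearMap.ext fun y => ?_))⟩
    rw [biPre_apply, hG, ← tensMap_btmul, hg', hf']
  · rintro ⟨G, rfl⟩
    rw [restrict_apply, biPre_apply, (R.exact_zero _).2 ⟨1, rfl⟩, map_zero]

variable {hl : B.IsLeftHopf} {c : Contraaction B M} (hM : IsAYD hl c) (hst : IsStable c)

/-- Since aug(1) coacts as aug(1) ⊗ 1, the coaction face restricts to insertion of 1, the zeroth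
face of D; the other faces do not see the comodule. -/
theorem restrict_biFace (i : Fin (q + 2)) (F : BiHom M (R.I 0) (q + 1)) :
    R.restrict M q (biFace hM hst q i F) = dFace hM hst q i (R.restrict M (q + 1) F) := by
  induction i using Fin.cases with
  | zero =>
    rw [biFace_zero, restrict_apply, coactFace_apply, R.aug_coact, (isBal_slice F).bsum_btmul,
      MulOpposite.op_one, map_one B.t]
    refine Subtype.ext (LinearMap.ext fun y => ?_)
    rw [DChain.slice_apply, dFace_zero]
    rfl
  | succ i => rfl

theorem restrict_biD (F : BiHom M (R.I 0) (q + 1)) :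
    R.restrict M q (biD M hM hst (R.I 0) q F) =
      altSum (dFace hM hst) q (R.restrict M (q + 1) F) :=
  altSum_map (k := k) (X := fun q => BiHom M (R.I 0) q) (Y := fun q => DChain B M q) _ _
    (fun q => R.restrict M q) (fun _ i F => R.restrict_biFace hM hst i F) q F

/-- For fixed q the contravariant Hom reverses the resolution into a chain complex ending in D_q.
Flatness and injectivity of M enter only here. -/
theorem isRowExact (hflat : B.TargetFlat) (hinj : IsRightInjective B.toAeRing M) :
    IsRowExact (k := k) (fun p q => BiHom M (R.I p) q) (fun q => DChain B M q)
      (fun p q => biPre M (R.d p) q) (fun p q => biD M hM hst (R.I p) q) (fun q => R.restrict M q)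
      (fun q => altSum (dFace hM hst) q) where
  comm p q _ := biPre_biD hM hst (R.d p) q _
  dv_dv _ q F := biD_biD hM hst q F
  aug_dv _ F := R.restrict_biD hM hst F
  aug_surjective _ := R.restrict_surjective hflat hinj hl
  aug_exact _ F := R.restrict_eq_zero_iff hflat hinj hl F
  exact p _ F hF := exact_biPre hflat hinj hl (R.d p) (R.d (p + 1)) (R.exact_succ p)
    (R.injective _) (R.injective _) F hF

variable (c) in
/-- The projection onto `Cohom`. -/
noncomputable def toCohom (p : ℕ) : BiHom M (R.I p) 0 →ₗ[k] Cohom c (R.I p) :=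
  (cohomRel c (R.I p)).mkQ ∘ₗ (biBase M (R.I p)).toLinearMap

theorem map_map_eq_zero (p : ℕ) (x : (R.I p).carrier) : (R.d (p + 1)).map ((R.d p).map x) = 0 :=
  (R.exact_succ p _).2 ⟨x, rfl⟩

/-- The transposed statement, with p fixed and augmentation to Cohom. It needs only the retractions
of the coactions. -/
theorem isRowExact_swap : IsRowExact (k := k) (fun q p => BiHom M (R.I p) q)
    (fun p => Cohom c (R.I p)) (fun q p => biD M hM hst (R.I p) q)
    (fun q p => biPre M (R.d p) q) (fun p => R.toCohom c p)
    (fun p => cohomMap c (R.d p)) where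
  comm q p F := (biPre_biD hM hst (R.d p) q F).symm
  dv_dv _ p F := Subtype.ext (LinearMap.ext fun x => by
    rw [biPre_apply, biPre_apply, map_map_eq_zero, map_zero]
    rfl)
  aug_dv _ _ := rfl
  aug_surjective p := (Submodule.mkQ_surjective (cohomRel c (R.I p))).comp
    (biBase M (R.I p)).surjective
  aug_exact p F :=
    (Submodule.Quotient.mk_eq_zero (cohomRel c (R.I p))).trans (mem_cohomRel_iff hM hst F)
  exact q p F hF := by
    obtain ⟨κ⟩ := (R.injective p).nonempty_retraction
    exact κ.exact_biD hM hst q F hF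

/-- `D_•(U, M)` computes `Coext`. -/
theorem nonempty_homology_equiv (hflat : B.TargetFlat) (hinj : IsRightInjective B.toAeRing M)
    (n : ℕ) : Nonempty (Homology (k := k) (X := fun q => DChain B M q)
      (fun q => altSum (dFace hM hst) q) n ≃ₗ[k] R.Coext c n) :=
  (R.isRowExact hM hst hflat hinj).nonempty_homology_equiv (R.isRowExact_swap hM hst) n

end InjResolution

end Balancing

end CoextCyclic

theorem theorem4p3 {k : Type v} [CommRing k] {A U M : Type u} [Ring A] [Algebra k A]
    [Ring U] [Algebra k U] (B : LeftBialgebroid k A U)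
    (hl : B.IsLeftHopf) (hr : B.IsRightHopf)
    [AddCommGroup M] [Module k M] [Module U M] [IsScalarTower k U M]
    (c : Contraaction B M) (hM : IsAYD hl c) (hst : IsStable c) :
    ∃ (δ : ∀ n, Fin (n + 2) → BarCochain B M n →ₗ[k] BarCochain B M (n + 1))
      (σ : ∀ n, Fin (n + 1) → BarCochain B M (n + 1) →ₗ[k] BarCochain B M n)
      (τ : ∀ n, BarCochain B M n →ₗ[k] BarCochain B M n)
      (ξ : ∀ n, BarCochain B M n ≃ₗ[k] CobarChain B M n)
      (d : ∀ n, Fin (n + 2) → CobarChain B M (n + 1) →ₗ[k] CobarChain B M n)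
      (s : ∀ n, Fin (n + 1) → CobarChain B M n →ₗ[k] CobarChain B M (n + 1))
      (t : ∀ n, CobarChain B M n →ₗ[k] CobarChain B M n)
      (b : ∀ n, Fin (n + 2) → DChain B M (n + 1) →ₗ[k] DChain B M n),
      BarFormulas hl c δ σ τ ∧ IsCocyclicModule δ σ τ ∧
      XiFormula hl ξ ∧
      CobarFormulas hr c d s t ∧
      IsCyclicDualVia ξ δ σ τ d s t ∧
      IsCyclicModule d s t ∧
      DFormulas c b ∧
      (∀ n, altSum b n ∘ₗ altSum b (n + 1) = 0) ∧
      (∃ η : ∀ n, CobarChain B M n ≃ₗ[k] DChain B M n,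
        ∀ n f, η n (altSum d n f) = altSum b n (η (n + 1) f)) ∧
      (B.TargetFlat → IsRightInjective B.toAeRing M →
        Nonempty (InjResolution B) ∧
        ∀ (R : InjResolution B) (n : ℕ),
          Nonempty (Homology (altSum b) n ≃ₗ[k] R.Coext c n)) := by
  refine ⟨_, _, _, _, _, _, _, dFace hM hst, barFormulas hM hst,
    (DiagHom.isRotational hM hst).cocyclic.transport (barEquiv hl), xiFormula hr,
    cobarFormulas hr hM hst, cyclicDualVia hr hM hst,
    (DiagHom.isRotational hM hst).cyclic.transport (cobarEquiv hr), dFormulas hM hst,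
    -- The faces on D are conjugates of the faces of the homogeneous model, so their simplicial
    -- identities are transported.
    altSum_comp_altSum _
      ((DiagHom.isRotational hM hst).cyclic.transport (rotD hM hst)).d_d,
    ⟨fun n => (cobarEquiv hr n).symm ≪≫ₗ rotD hM hst n, fun n f =>
      altSum_map _ _ (fun n => ((cobarEquiv hr n).symm ≪≫ₗ rotD hM hst n).toLinearMap)
        (fun n i x => ?_) n f⟩, ?_⟩
  -- Both complexes are transports of the same faces, so the change of coordinates commutes with
  -- each face separately.
  · obtain ⟨φ, rfl⟩ := (cobarEquiv hr (n + 1)).surjective x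
    simp only [LinearEquiv.coe_coe, LinearEquiv.trans_apply, arrowCongr_apply_eq,
      LinearEquiv.symm_apply_apply, dFace]
  · exact fun hflat hinj => ⟨nonempty_injResolution B, fun R n =>
      R.nonempty_homology_equiv hM hst hflat hinj n⟩
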